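/- **Setting.** Let $M$ be a quasi-projective scheme over $\mathbb C$ (a locally closed subscheme of a projective space), and let $D(M)$ be the bounded derived category of coherent sheaves on $M$. For a bounded complex of vector bundles (locally free sheaves of finite rank) $P^\bullet$ let $(P^\bullet)^\vee[2]$ be the complex with terms $\big((P^\bullet)^\vee[2]\big)^n=(P^{-n-2})^*$ and the transposed differentials. For an object of $D(M)$ that has a bounded resolution by vector bundles, and for morphisms between such objects, $(\ \cdot\ )^\vee[2]$ is computed with such resolutions. Let $\mathbb E\in D(M)$ be perfect of amplitude contained in $[-2,0]$, i.e. locally on $M$ quasi-isomorphic to a complex of vector bundles in degrees $-2,-1,0$, and let $\theta\colon\mathbb E\xrightarrow{\ \sim\ }\mathbb E^\vee[2]$ be an isomorphism in $D(M)$ with $\theta=\theta^\vee[2]$. (The motivating example: $X$ is a smooth projective fourfold with trivialised canonical bundle, $M$ is the projective moduli space of stable sheaves on $X$ with fixed Chern character for which every Gieseker semistable sheaf is stable, $\mathcal E$ is a twisted universal sheaf, $\pi\colon X\times M\to M$ is the projection, $\mathbb E=\tau^{[-2,0]}\big(R\pi_*R\mathcal Hom(\mathcal E,\mathcal E)[3]\big)$,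 $\theta$ is relative Serre duality, and the obstruction theory $\mathrm{At}\colon\mathbb E\to\mathbb L_M$ below is the truncated Atiyah class.) A *self-dual complex* on $M$ is given by vector bundles $T$, $E$, a symmetric isomorphism $q\colon E\to E^*$ (so $(E,q)$ is an orthogonal bundle) and a map $a\colon T\to E$ such that $a^*\circ a=0$, where $a^*\colon E\xrightarrow{\,q\,}E^*\to T^*$ is $q$ followed by the transpose of $a$. It is the complex $$E^\bullet=\{T\xrightarrow{\ a\ }E\xrightarrow{\ a^*\ }T^*\}$$ in degrees $-2,-1,0$. Its *obvious duality* is the isomorphism of complexes $\delta\colon E^\bullet\to(E^\bullet)^\vee[2]$ given by the canonical map $T\to T^{**}$ in degree $-2$, by $q$ in degree $-1$ and by the identity of $T^*$ in degree $0$. **Theorem.** 0. $\mathbb E$ has a bounded resolution by vector bundles (so that $\mathbb E^\vee[2]$ makes sense as above). 1. There are a self-dual complex $E^\bullet$ and an isomorphism $\alpha\colon E^\bullet\to\mathbb E$ in $D(M)$ such that $\alpha^\vee[2]\circ\theta\circ\alpha=\delta$ in $D(M)$. 2. Let $i\colon M\hookrightarrow A$ be a closed embedding over $\mathbb C$ in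 a smooth $\mathbb C$-scheme, with ideal sheaf $I$, and represent the truncated cotangent complex $\mathbb L_M$ by the complex of coherent sheaves $\{I/I^2\xrightarrow{\,d\,}\Omega_A|_M\}$ in degrees $-1,0$. Let $\mathrm{At}\colon\mathbb E\to\mathbb L_M$ be an obstruction theory, i.e. a morphism in $D(M)$ such that $h^0(\mathrm{At})$ is an isomorphism and $h^{-1}(\mathrm{At})$ is surjective. Then $E^\bullet$ and $\alpha$ in (1) can be chosen such that moreover $\mathrm{At}\circ\alpha$ is represented by a genuine map of complexes $E^\bullet\to\{I/I^2\to\Omega_A|_M\}$ that is surjective in each degree. -/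

import Mathlib

universe u

noncomputable section

namespace DT4

open CategoryTheory Limits AlgebraicGeometry TopologicalSpace Opposite

variable {X : Scheme.{u}}

/-- A family of `O_X(V)`-linear maps `F(V) ⟶ O_X(V)`, for all open `V ⊆ U`. -/
def DualFamily (F : X.Modules) (U : X.Opens) : Type u :=
  ∀ V : {V : X.Opens // V ≤ U}, Γ(F, V.1) →ₗ[Γ(X, V.1)] Γ(X, V.1)

def DualFamily.app {F : X.Modules} {U : X.Opens} (φ : DualFamily F U) (V : X.Opens) (h : V ≤ U) :
    Γ(F, V) →ₗ[Γ(X, V)] Γ(X, V) := φ ⟨V, h⟩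

instance (F : X.Modules) (U : X.Opens) : AddCommGroup (DualFamily F U) :=
  inferInstanceAs (AddCommGroup (∀ V : {V : X.Opens // V ≤ U}, Γ(F, V.1) →ₗ[Γ(X, V.1)] Γ(X, V.1)))

instance (F : X.Modules) (U : X.Opens) : Module Γ(X, U) (DualFamily F U) :=
  letI (V : {V : X.Opens // V ≤ U}) : Module Γ(X, U) (Γ(F, V.1) →ₗ[Γ(X, V.1)] Γ(X, V.1)) :=
    Module.compHom _ (X.presheaf.map (homOfLE V.2).op).hom
  inferInstanceAs (Module Γ(X, U)
    (∀ V : {V : X.Opens // V ≤ U}, Γ(F, V.1) →ₗ[Γ(X, V.1)] Γ(X, V.1)))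

namespace DualFamily
variable {F : X.Modules} {U : X.Opens}

@[simp] lemma add_app (φ ψ : DualFamily F U) (V : X.Opens) (h : V ≤ U) (s : Γ(F, V)) :
    (φ + ψ).app V h s = φ.app V h s + ψ.app V h s := rfl
@[simp] lemma zero_app (V : X.Opens) (h : V ≤ U) (s : Γ(F, V)) :
    (0 : DualFamily F U).app V h s = 0 := rfl
@[simp] lemma smul_app (r : Γ(X, U)) (φ : DualFamily F U) (V : X.Opens) (h : V ≤ U) (s : Γ(F, V)) :
    (r • φ).app V h s = X.presheaf.map (homOfLE h).op r * φ.app V h s := rfl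
end DualFamily

lemma res_res {U V W : X.Opens} (i : U ⟶ V) (j : V ⟶ W) (k : U ⟶ W) (r : Γ(X, W)) :
    X.presheaf.map i.op (X.presheaf.map j.op r) = X.presheaf.map k.op r := by
  rw [← CommRingCat.comp_apply, ← X.presheaf.map_comp]; rfl

/-- The sections over `U` of `F^* = Hom(F, O_X)`: families of linear maps `F(V) ⟶ O_X(V)`, for all
open `V ⊆ U`, that are compatible with restriction, i.e. morphisms `F|_U ⟶ O_U`. -/
def dualSections (F : X.Modules) (U : X.Opens) : Submodule Γ(X, U) (DualFamily F U) where
  carrier := {φ | ∀ (V W : X.Opens) (hV : V ≤ U) (h : W ≤ V) (s : Γ(F, V)),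
    φ.app W (h.trans hV) (F.presheaf.map (homOfLE h).op s) =
      X.presheaf.map (homOfLE h).op (φ.app V hV s)}
  add_mem' := by
    intro φ ψ hφ hψ V W hV h s
    simp [hφ V W hV h s, hψ V W hV h s]
  zero_mem' := by
    intro V W hV h s
    simp
  smul_mem' := by
    intro r φ hφ V W hV h s
    simp only [DualFamily.smul_app, map_mul, hφ V W hV h s]
    rw [res_res]

@[ext] lemma dualSections_ext {F : X.Modules} {U : X.Opens} {φ ψ : dualSections F U}
    (h : ∀ V hV s, φ.1.app V hV s = ψ.1.app V hV s) : φ = ψ :=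
  Subtype.ext (funext fun V ↦ LinearMap.ext fun s ↦ h V.1 V.2 s)

def dualRestrict (F : X.Modules) {U U' : X.Opens} (h : U' ≤ U) (φ : dualSections F U) :
    dualSections F U' :=
  ⟨fun V ↦ φ.1.app V.1 (V.2.trans h), fun V W hV hW s ↦ φ.2 V W (hV.trans h) hW s⟩

@[simp] lemma dualRestrict_app {F : X.Modules} {U U' : X.Opens} (h : U' ≤ U) (φ : dualSections F U)
   (V hV s) : (dualRestrict F h φ).1.app V hV s = φ.1.app V (hV.trans h) s := rfl

instance (F : X.Modules) (U : X.Opensᵒᵖ) :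
    Module (X.ringCatSheaf.obj.obj U) (dualSections F U.unop) :=
  inferInstanceAs (Module Γ(X, U.unop) (dualSections F U.unop))

def dualAb (F : X.Modules) : X.Opensᵒᵖ ⥤ Ab.{u} where
  obj U := AddCommGrpCat.of (dualSections F U.unop)
  map i := AddCommGrpCat.ofHom
    { toFun := dualRestrict F (leOfHom i.unop)
      map_zero' := rfl
      map_add' := fun _ _ ↦ rfl }

instance (F : X.Modules) (U : X.Opensᵒᵖ) :
    Module (X.ringCatSheaf.obj.obj U) ((dualAb F).obj U) :=
  inferInstanceAs (Module Γ(X, U.unop) (dualSections F U.unop))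

def dualPresheaf (F : X.Modules) : X.PresheafOfModules :=
  PresheafOfModules.ofPresheaf (dualAb F) (by
    intro U V i (r : Γ(X, U.unop)) (φ : dualSections F U.unop)
    apply dualSections_ext
    intro W hW s
    change X.presheaf.map _ r * _ = X.presheaf.map _ (X.presheaf.map i r) * _
    rw [← CommRingCat.comp_apply, ← X.presheaf.map_comp]; rfl)

lemma ab_res_res (F : X.Modules) {U V W : X.Opens} (i : U ⟶ V) (j : V ⟶ W) (k : U ⟶ W) (r : Γ(F, W)) :
    F.presheaf.map i.op (F.presheaf.map j.op r) = F.presheaf.map k.op r := by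
  rw [← AddCommGrpCat.comp_apply, ← F.presheaf.map_comp]; rfl

/-- Gluing of compatible sections of the structure sheaf. -/
lemma exists_glue {ι : Type*} (U : ι → X.Opens) (V : X.Opens) (hV : V ≤ iSup U)
    (f : ∀ i, Γ(X, V ⊓ U i))
    (hf : ∀ i j, X.presheaf.map (homOfLE (by
        exact le_inf (inf_le_left) (inf_le_right.trans inf_le_left) :
          V ⊓ (U i ⊓ U j) ≤ V ⊓ U i)).op (f i) =
      X.presheaf.map (homOfLE (by
        exact le_inf (inf_le_left) (inf_le_right.trans inf_le_right) :
          V ⊓ (U i ⊓ U j) ≤ V ⊓ U j)).op (f j)) :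
    ∃! s : Γ(X, V), ∀ i, X.presheaf.map (homOfLE inf_le_left).op s = f i := by
  have := (TopCat.Sheaf.existsUnique_gluing' X.sheaf (fun i ↦ V ⊓ U i) V
    (fun i ↦ homOfLE inf_le_left) (by rw [← inf_iSup_eq]; exact le_inf le_rfl hV) f (by
      intro i j
      have h := congrArg (X.presheaf.map (homOfLE (le_inf (inf_le_left.trans inf_le_left)
        (le_inf (inf_le_left.trans inf_le_right) (inf_le_right.trans inf_le_right)) :
        (V ⊓ U i) ⊓ (V ⊓ U j) ≤ V ⊓ (U i ⊓ U j))).op) (hf i j)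
      rw [← CommRingCat.comp_apply, ← X.presheaf.map_comp, ← CommRingCat.comp_apply,
        ← X.presheaf.map_comp] at h
      exact h))
  exact this

set_option maxHeartbeats 800000 in
lemma dualAb_isSheaf (F : X.Modules) : TopCat.Presheaf.IsSheaf (X := X.toTopCat) (dualAb F) := by
  refine (TopCat.Presheaf.isSheaf_iff_isSheafUniqueGluing (dualAb F)).mpr ?_
  intro ι U (φ : ∀ i, dualSections F (U i)) hφ
  have hc : ∀ i j W (hi : W ≤ U i) (hj : W ≤ U j) (s : Γ(F, W)),
      (φ i).1.app W hi s = (φ j).1.app W hj s := by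
    intro i j W hi hj s
    have := congrArg (fun ψ : dualSections F (U i ⊓ U j) ↦ ψ.1.app W (le_inf hi hj) s) (hφ i j)
    exact this
  have key : ∀ (V : X.Opens) (hV : V ≤ iSup U) (s : Γ(F, V)),
      ∃! t : Γ(X, V), ∀ i, X.presheaf.map (homOfLE inf_le_left).op t =
        (φ i).1.app (V ⊓ U i) inf_le_right (F.presheaf.map (homOfLE inf_le_left).op s) := by
    intro V hV s
    refine exists_glue U V hV _ ?_
    intro i j
    rw [← (φ i).2, ← (φ j).2, ab_res_res F _ _ (homOfLE inf_le_left),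
      ab_res_res F _ _ (homOfLE inf_le_left)]
    exact hc ..
  choose g hg hu using fun V hV s ↦ (key V hV s)
  have huniq : ∀ V hV s t, (∀ i, X.presheaf.map (homOfLE inf_le_left).op t =
        (φ i).1.app (V ⊓ U i) inf_le_right (F.presheaf.map (homOfLE inf_le_left).op s)) →
        g V hV s = t := fun V hV s t ht ↦ (hu V hV s t ht).symm
  let G : DualFamily F (iSup U) := fun V ↦
    { toFun := g V.1 V.2
      map_add' := fun s t ↦ huniq _ _ _ _ (fun i ↦ by
        have h1 := hg V.1 V.2 s i
        have h2 := hg V.1 V.2 t i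
        beta_reduce at h1 h2
        rw [map_add, map_add, map_add, h1, h2])
      map_smul' := fun r s ↦ huniq _ _ _ _ (fun i ↦ by
        have h1 := hg V.1 V.2 s i
        beta_reduce at h1
        rw [RingHom.id_apply, smul_eq_mul, map_mul, h1, Scheme.Modules.map_smul, map_smul,
          smul_eq_mul]) }
  refine ⟨⟨G, ?_⟩, ?_, ?_⟩
  · intro V W hV h s
    refine huniq _ _ _ _ (fun i ↦ ?_)
    have h1 := hg V hV s i
    beta_reduce at h1
    change X.presheaf.map _ (X.presheaf.map _ (g V hV s)) = _
    rw [res_res _ _ (homOfLE (inf_le_left.trans h)), ab_res_res F _ _ (homOfLE (inf_le_left.trans h))]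
    have h2 := congrArg (X.presheaf.map (homOfLE (inf_le_inf_right (U i) h)).op) h1
    rw [res_res _ _ (homOfLE (inf_le_left.trans h)), ← (φ i).2,
      ab_res_res F _ _ (homOfLE (inf_le_left.trans h))] at h2
    exact h2
  · intro i
    apply dualSections_ext
    intro V hV s
    change g V _ s = _
    refine huniq _ _ _ _ (fun j ↦ ?_)
    rw [← (φ i).2]
    exact hc ..
  · intro (ψ : dualSections F (iSup U)) hψ
    apply dualSections_ext
    intro V hV s
    change _ = g V hV s
    refine (huniq _ _ _ _ (fun j ↦ ?_)).symm
    rw [← ψ.2 V (V ⊓ U j) hV inf_le_left]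
    have := congrArg (fun χ : dualSections F (U j) ↦ χ.1.app (V ⊓ U j) inf_le_right
      (F.presheaf.map (homOfLE inf_le_left).op s)) (hψ j)
    exact this

/-- The dual sheaf `F^* = Hom(F, O_X)`. -/
def dual (F : X.Modules) : X.Modules where
  val := dualPresheaf F
  isSheaf := dualAb_isSheaf F

/-- Precomposition of a section of `G^*` with `f : F ⟶ G`. -/
def dualMapSection {F G : X.Modules} (f : F ⟶ G) (U : X.Opens) (φ : dualSections G U) :
    dualSections F U :=
  ⟨fun V ↦
    { toFun := fun s ↦ φ.1.app V.1 V.2 (f.app V.1 s)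
      map_add' := fun s t ↦ by rw [map_add, map_add]
      map_smul' := fun r s ↦ by rw [Scheme.Modules.Hom.app_smul, map_smul]; rfl }, by
    intro V W hV h s
    have hn : f.app W (F.presheaf.map (homOfLE h).op s) =
        G.presheaf.map (homOfLE h).op (f.app V s) :=
      CategoryTheory.congr_fun (f.mapPresheaf.naturality (homOfLE h).op) s
    change φ.1.app W _ (f.app W _) = X.presheaf.map _ (φ.1.app V _ (f.app V s))
    rw [hn, φ.2]⟩

/-- The transpose `f^* : G^* ⟶ F^*` of a morphism `f : F ⟶ G`. -/
def dualMap {F G : X.Modules} (f : F ⟶ G) : dual G ⟶ dual F where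
  val :=
    { app := fun U ↦ ModuleCat.ofHom (X := dualSections G U.unop) (Y := dualSections F U.unop)
        { toFun := dualMapSection f U.unop
          map_add' := fun _ _ ↦ rfl
          map_smul' := fun _ _ ↦ rfl }
      naturality := fun _ ↦ rfl }

lemma dualMap_app {F G : X.Modules} (f : F ⟶ G) (U : X.Opens) (φ : dualSections G U)
    (V : X.Opens) (hV : V ≤ U) (s : Γ(F, V)) :
    (show dualSections F U from (dualMap f).app U φ).1.app V hV s = φ.1.app V hV (f.app V s) := rfl

lemma hom_dual_ext {F G : X.Modules} {f g : G ⟶ dual F}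
    (h : ∀ U (t : Γ(G, U)) V (hV : V ≤ U) s, (show dualSections F U from f.app U t).1.app V hV s =
      (show dualSections F U from g.app U t).1.app V hV s) : f = g := by
  apply Scheme.Modules.hom_ext
  intro U
  ext t
  exact dualSections_ext (h U t)

lemma dualMap_comp {F G H : X.Modules} (f : F ⟶ G) (g : G ⟶ H) :
    dualMap (f ≫ g) = dualMap g ≫ dualMap f := rfl

lemma dualMap_id (F : X.Modules) : dualMap (𝟙 F) = 𝟙 (dual F) := rfl

lemma dualMap_zero (F G : X.Modules) : dualMap (0 : F ⟶ G) = 0 := by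
  refine hom_dual_ext fun U φ V hV s ↦ ?_
  exact map_zero (LinearMap.toAddMonoidHom (DualFamily.app (Subtype.val (p := fun φ ↦ φ ∈ dualSections G U) φ) V hV))

/-- Evaluation at a section `s` of `F`, as a section of `F^**`. -/
def evSection (F : X.Modules) (U : X.Opens) (s : Γ(F, U)) : dualSections (dual F) U :=
  ⟨fun V ↦
    { toFun := fun (φ : dualSections F V.1) ↦
        φ.1.app V.1 le_rfl (F.presheaf.map (homOfLE V.2).op s)
      map_add' := fun _ _ ↦ rfl
      map_smul' := fun r (φ : dualSections F V.1) ↦ by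
        change X.presheaf.map _ r * _ = _
        have : X.presheaf.map (homOfLE (le_refl V.1)).op = 𝟙 _ := X.presheaf.map_id _
        rw [this]
        rfl }, by
    intro V W hV h (φ : dualSections F V)
    change φ.1.app W _ (F.presheaf.map _ s) = X.presheaf.map _ (φ.1.app V _ (F.presheaf.map _ s))
    rw [← φ.2, ab_res_res]⟩

/-- The canonical map `F ⟶ F^**`. -/
def evalDual (F : X.Modules) : F ⟶ dual (dual F) where
  val :=
    { app := fun U ↦ ModuleCat.ofHom (X := F.val.obj U) (Y := dualSections (dual F) U.unop)
        { toFun := evSection F U.unop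
          map_add' := fun s t ↦ by
            apply dualSections_ext
            intro V hV (φ : dualSections F V)
            change φ.1.app V _ (F.presheaf.map _ (_ + _)) = _
            erw [map_add, map_add]
            rfl
          map_smul' := fun (r : Γ(X, U.unop)) (s : Γ(F, U.unop)) ↦ by
            apply dualSections_ext
            intro V hV (φ : dualSections F V)
            change φ.1.app V _ (F.presheaf.map _ (r • s)) = _
            erw [Scheme.Modules.map_smul, map_smul]
            rfl }
      naturality := fun {U V} i ↦ by
        ext s
        apply dualSections_ext
        intro W hW (φ : dualSections F W)
        change φ.1.app W _ (F.presheaf.map _ (F.presheaf.map i s)) =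
          φ.1.app W _ (F.presheaf.map _ s)
        congr 1
        exact ab_res_res F (homOfLE hW) i.unop _ s }

lemma evalDual_naturality {F G : X.Modules} (f : F ⟶ G) :
    evalDual F ≫ dualMap (dualMap f) = f ≫ evalDual G := by
  refine hom_dual_ext fun U s V hV (φ : dualSections G V) ↦ ?_
  change φ.1.app V _ (f.app V (F.presheaf.map _ s)) = φ.1.app V _ (G.presheaf.map _ (f.app U s))
  congr 1
  exact CategoryTheory.congr_fun (f.mapPresheaf.naturality (homOfLE hV).op) s

/-- The sections `e` of `F` over `U` trivialize `F|_U`: their restrictions form a basis of `F(V)`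
for all open `V ⊆ U`. -/
def IsFrame (F : X.Modules) (U : X.Opens) {n : ℕ} (e : Fin n → Γ(F, U)) : Prop :=
  ∀ (V : X.Opens) (h : V ≤ U),
    LinearIndependent Γ(X, V) (fun i ↦ F.presheaf.map (homOfLE h).op (e i)) ∧
    ⊤ ≤ Submodule.span Γ(X, V) (Set.range fun i ↦ F.presheaf.map (homOfLE h).op (e i))

/-- Vector bundles, i.e. locally free sheaves of finite rank. -/
def IsVectorBundle (F : X.Modules) : Prop :=
  ∀ x : X, ∃ U : X.Opens, x ∈ U ∧ ∃ (n : ℕ) (e : Fin n → Γ(F, U)), IsFrame F U e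

def IsFrame.basis {F : X.Modules} {U : X.Opens} {n : ℕ} {e : Fin n → Γ(F, U)}
    (he : IsFrame F U e) (V : X.Opens) (h : V ≤ U) : Module.Basis (Fin n) Γ(X, V) Γ(F, V) :=
  Module.Basis.mk (he V h).1 (he V h).2

lemma IsFrame.basis_apply {F : X.Modules} {U : X.Opens} {n : ℕ} {e : Fin n → Γ(F, U)}
    (he : IsFrame F U e) (V : X.Opens) (h : V ≤ U) (i) :
    he.basis V h i = F.presheaf.map (homOfLE h).op (e i) := by simp [basis]

lemma IsFrame.repr_map {F : X.Modules} {U : X.Opens} {n : ℕ} {e : Fin n → Γ(F, U)}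
    (he : IsFrame F U e) {V W : X.Opens} (hV : V ≤ U) (h : W ≤ V) (s : Γ(F, V)) (i) :
    (he.basis W (h.trans hV)).repr (F.presheaf.map (homOfLE h).op s) i =
      X.presheaf.map (homOfLE h).op ((he.basis V hV).repr s i) := by
  conv_lhs => rw [← (he.basis V hV).sum_repr s, map_sum, map_sum]
  simp only [Scheme.Modules.map_smul, basis_apply, ab_res_res F _ _ (homOfLE (h.trans hV))]
  simp only [← he.basis_apply W (h.trans hV), map_smul]
  simp [Finsupp.single_apply]

def IsFrame.coordSection {F : X.Modules} {U : X.Opens} {n : ℕ} {e : Fin n → Γ(F, U)}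
    (he : IsFrame F U e) (i : Fin n) : dualSections F U :=
  ⟨fun V ↦ (he.basis V.1 V.2).coord i, fun _ _ hV h s ↦ he.repr_map hV h s i⟩

lemma dualSections_sum_app {F : X.Modules} {U V : X.Opens} (hV : V ≤ U) {ι : Type*}
    (t : Finset ι) (φ : ι → dualSections F U) (s : Γ(F, V)) :
    (∑ i ∈ t, φ i).1.app V hV s = ∑ i ∈ t, (φ i).1.app V hV s := by
  let L : dualSections F U →+ Γ(X, V) :=
    { toFun := fun φ ↦ φ.1.app V hV s, map_zero' := rfl, map_add' := fun _ _ ↦ rfl }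
  exact map_sum L φ t

lemma IsFrame.dual {F : X.Modules} {U : X.Opens} {n : ℕ} {e : Fin n → Γ(F, U)}
    (he : IsFrame F U e) :
    IsFrame (dual F) U (n := n) (fun i ↦ show dualSections F U from he.coordSection i) := by
  intro V h
  have hc : ∀ (i j : Fin n) (W : X.Opens) (hW : W ≤ V),
      (dualRestrict F h (he.coordSection i)).1.app W hW
        (F.presheaf.map (homOfLE (hW.trans h)).op (e j)) = if j = i then 1 else 0 := by
    intro i j W hW
    change (he.basis W _).coord i _ = _
    rw [← he.basis_apply, Module.Basis.coord_apply, Module.Basis.repr_self,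
      Finsupp.single_apply]
  constructor
  · rw [Fintype.linearIndependent_iff]
    intro g (hg : ∑ i, g i • dualRestrict F h (he.coordSection i) = 0) i
    have h1 := congrArg (fun φ : dualSections F V ↦ φ.1.app V le_rfl
      (F.presheaf.map (homOfLE h).op (e i))) hg
    beta_reduce at h1
    rw [dualSections_sum_app] at h1
    have h2 : ∀ j, (g j • dualRestrict F h (he.coordSection j)).1.app V le_rfl
      (F.presheaf.map (homOfLE h).op (e i)) = g j * if i = j then 1 else 0 := by
      intro j
      rw [← hc]
      change X.presheaf.map (𝟙 _) (g j) * _ = _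
      rw [X.presheaf.map_id]; rfl
    rw [Finset.sum_congr rfl (fun j _ ↦ h2 j)] at h1
    simp at h1
    exact h1
  · intro (φ : dualSections F V) _
    have : φ = ∑ i, φ.1.app V le_rfl (F.presheaf.map (homOfLE h).op (e i)) •
        dualRestrict F h (he.coordSection i) := by
      apply dualSections_ext
      intro W hW s
      rw [dualSections_sum_app]
      conv_lhs => rw [← (he.basis W (hW.trans h)).sum_repr s, map_sum]
      refine Finset.sum_congr rfl fun i _ ↦ ?_
      rw [map_smul, he.basis_apply, smul_eq_mul, mul_comm,
        ← ab_res_res F (homOfLE hW) (homOfLE h) _ (e i), φ.2 V W le_rfl hW]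
      rfl
    change φ ∈ Submodule.span Γ(X, V) (Set.range fun i ↦ dualRestrict F h (he.coordSection i))
    rw [this]
    exact Submodule.sum_mem _ fun i _ ↦ Submodule.smul_mem _ _ (Submodule.subset_span ⟨i, rfl⟩)

lemma IsVectorBundle.dual {F : X.Modules} (hF : IsVectorBundle F) : IsVectorBundle (dual F) := by
  intro x
  obtain ⟨U, hx, n, e, he⟩ := hF x
  exact ⟨U, hx, n, _, he.dual⟩

/-- Coherent sheaves; on a locally noetherian scheme these are the sheaves of modules of finite
presentation. -/
def IsCoherent (F : X.Modules) : Prop :=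
  SheafOfModules.IsFinitePresentation (R := X.ringCatSheaf) F

lemma isIso_freeHomEquiv_symm {C : Type*} [Category C] {J : GrothendieckTopology C}
    {R : Sheaf J RingCat.{u}} [HasWeakSheafify J AddCommGrpCat.{u}]
    [J.WEqualsLocallyBijective AddCommGrpCat.{u}] (F : SheafOfModules.{u} R) {I : Type u} [Fintype I]
    (e : I → F.sections)
    (he : ∀ V, LinearIndependent (R.obj.obj V) (fun i ↦ (e i).eval V) ∧
      ⊤ ≤ Submodule.span (R.obj.obj V) (Set.range fun i ↦ (e i).eval V)) :
    IsIso (F.freeHomEquiv.symm e) := by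
  let b (V) : Module.Basis I (R.obj.obj V) (F.val.obj V) := Module.Basis.mk (he V).1 (he V).2
  have hb : ∀ V i, b V i = (e i).eval V := fun V i ↦ by simp [b]
  have hmap : ∀ {V W} (f : V ⟶ W) (s : F.val.obj V) i, (b W).repr (F.val.restrictₛₗ f s) i =
      (R.obj.map f).hom ((b V).repr s i) := by
    intro V W f s i
    have h1 : ∀ i, F.val.restrictₛₗ f (b V i) = b W i := fun i ↦ by
      rw [hb, hb]; exact PresheafOfModules.sections_property (e i) f
    conv_lhs => rw [← (b V).sum_repr s, map_sum, map_sum]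
    simp only [map_smulₛₗ, h1]
    simp only [Module.Basis.repr_self]
    classical
    rw [Finset.sum_apply' i]
    simp [Finsupp.single_apply]
  let G : SheafOfModules.{u} R := SheafOfModules.free I
  let f (i : I) : G.sections := SheafOfModules.freeSection i
  let fe (V) (i : I) : G.val.obj V := (f i).eval V
  let c (V) : F.val.obj V →ₗ[R.obj.obj V] G.val.obj V := (b V).constr ℕ (fe V)
  have hc : ∀ V i, c V (b V i) = fe V i := fun V i ↦ Module.Basis.constr_basis ..
  have hc' : ∀ V s, c V s = ∑ i, (b V).repr s i • fe V i := fun V s ↦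
    Module.Basis.constr_apply_fintype ..
  let g : F ⟶ G :=
    { val :=
      { app := fun V ↦ ModuleCat.ofHom (c V)
        naturality := fun {V W} φ ↦ by
          ext s
          change c W (F.val.restrictₛₗ φ s) = G.val.restrictₛₗ φ (c V s)
          rw [hc', hc', map_sum]
          refine Finset.sum_congr rfl fun i _ ↦ ?_
          rw [map_smulₛₗ, hmap]
          congr 1
          exact (PresheafOfModules.sections_property (f i) φ).symm } }
  refine ⟨g, ?_, ?_⟩
  · apply G.freeHomEquiv.injective
    funext i
    rw [SheafOfModules.freeHomEquiv_comp_apply, Equiv.apply_symm_apply]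
    apply PresheafOfModules.sections_ext
    intro V
    change c V ((e i).eval V) = _
    rw [← hb, hc]
  · apply SheafOfModules.hom_ext
    apply PresheafOfModules.hom_ext
    intro V
    ext s
    change (F.freeHomEquiv.symm e).val.app V (c V s) = s
    rw [hc', map_sum]
    conv_rhs => rw [← (b V).sum_repr s]
    refine Finset.sum_congr rfl fun i _ ↦ ?_
    rw [map_smul, hb]
    congr 1
    have := SheafOfModules.sectionsMap_freeHomEquiv_symm_freeSection e i
    exact congrArg (fun t : F.sections ↦ t.eval V) this

set_option maxHeartbeats 800000 in
lemma IsVectorBundle.isCoherent {F : X.Modules} (hF : IsVectorBundle F) : IsCoherent F := by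
  choose U hx n e he using hF
  let F' : SheafOfModules.{u} X.ringCatSheaf := F
  let s (x : X) (i : ULift.{u} (Fin (n x))) : (F'.over (U x)).sections :=
    PresheafOfModules.sectionsMk
      (fun V ↦ F.presheaf.map V.unop.hom.op (e x i.down)) (by
        intro V W f
        have := ab_res_res F f.unop.left V.unop.hom W.unop.hom (e x i.down)
        exact this)
  have hs (x : X) : IsIso ((F'.over (U x)).freeHomEquiv.symm (s x)) := by
    refine isIso_freeHomEquiv_symm (F'.over (U x)) (s x) fun V ↦ ?_
    have h := he x V.unop.left (leOfHom V.unop.hom)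
    constructor
    · exact h.1.comp (fun i : ULift.{u} (Fin (n x)) ↦ i.down) ULift.down_injective
    · refine h.2.trans (Submodule.span_mono ?_)
      rintro _ ⟨i, rfl⟩
      exact ⟨⟨i⟩, rfl⟩
  have hU : (Opens.grothendieckTopology X).CoversTop U := by
    intro V x hxV
    exact ⟨V ⊓ U x, homOfLE inf_le_left, ⟨x, ⟨homOfLE inf_le_right⟩⟩, ⟨hxV, hx x⟩⟩
  let p (x : X) : (F'.over (U x)).Presentation :=
    { generators :=
        { I := ULift.{u} (Fin (n x))
          s := s x
          epi := have := hs x; inferInstance }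
      relations :=
        { I := ULift.{u} Empty
          s := fun j ↦ j.down.elim
          epi := by
            have := hs x
            exact IsZero.epi (IsZero.of_iso (isZero_zero _) (Limits.kernel.ofMono _)) _ } }
  let q : SheafOfModules.QuasicoherentData.{u} (R := X.ringCatSheaf) F' :=
    SheafOfModules.QuasicoherentData.mk (C := X.Opens) (J := Opens.grothendieckTopology X)
      (R := X.ringCatSheaf) (M := F') X U hU p
  have hp (x : X) : (p x).IsFinite := SheafOfModules.Presentation.IsFinite.mk
    (isFiniteType_generators := ⟨inferInstanceAs (Finite (ULift.{u} (Fin (n x))))⟩)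
    (isFiniteType_relations := ⟨inferInstanceAs (Finite (ULift.{u} Empty))⟩)
  exact SheafOfModules.IsFinitePresentation.mk (C := X.Opens) (J := Opens.grothendieckTopology X)
    (R := X.ringCatSheaf) (exists_quasicoherentData := ⟨q,
      SheafOfModules.QuasicoherentData.IsFinitePresentation.mk (C := X.Opens)
        (J := Opens.grothendieckTopology X) (R := X.ringCatSheaf) (M := F') (q := q) hp⟩)

/-- Bounded complexes. -/
def IsBounded (K : CochainComplex X.Modules ℤ) : Prop :=
  ∃ a b : ℤ, ∀ n, (n < a ∨ b < n) → IsZero (K.X n)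

/-- Bounded complexes of coherent sheaves. -/
def boundedCoherent (X : Scheme.{u}) : ObjectProperty (CochainComplex X.Modules ℤ) :=
  fun K ↦ IsBounded K ∧ ∀ n, IsCoherent (K.X n)

/-- Bounded complexes of vector bundles. -/
def boundedBundle (X : Scheme.{u}) : ObjectProperty (CochainComplex X.Modules ℤ) :=
  fun K ↦ IsBounded K ∧ ∀ n, IsVectorBundle (K.X n)

lemma boundedBundle_le : boundedBundle X ≤ boundedCoherent X :=
  fun _ h ↦ ⟨h.1, fun n ↦ (h.2 n).isCoherent⟩

/-- The category of bounded complexes of coherent sheaves. -/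
abbrev CohComplex (X : Scheme.{u}) := (boundedCoherent X).FullSubcategory

/-- The category of bounded complexes of vector bundles. -/
abbrev BundleComplex (X : Scheme.{u}) := (boundedBundle X).FullSubcategory

/-- Quasi-isomorphisms between bounded complexes of coherent sheaves. -/
def cohQuasiIso (X : Scheme.{u}) : MorphismProperty (CohComplex X) :=
  (HomologicalComplex.quasiIso X.Modules (ComplexShape.up ℤ)).inverseImage (boundedCoherent X).ι

/-- The bounded derived category `D(X)` of coherent sheaves: bounded complexes of coherent
sheaves localized at the quasi-isomorphisms. -/
abbrev DCoh (X : Scheme.{u}) := (cohQuasiIso X).Localization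

/-- The localization functor from complexes to the derived category. -/
def Q (X : Scheme.{u}) : CohComplex X ⥤ DCoh X := (cohQuasiIso X).Q

instance : (Q X).IsLocalization (cohQuasiIso X) :=
  inferInstanceAs ((cohQuasiIso X).Q.IsLocalization _)

/-- The cohomology sheaf functors `h^n`. -/
def cohomology (X : Scheme.{u}) (n : ℤ) : DCoh X ⥤ X.Modules :=
  Localization.lift (W := cohQuasiIso X)
    ((boundedCoherent X).ι ⋙ HomologicalComplex.homologyFunctor _ _ n)
    (fun _ _ f hf ↦ HomologicalComplex.homologyFunctor_inverts_quasiIso X.Modules _ n f.hom hf) (Q X)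

/-- A complex of vector bundles as an object of the derived category. -/
def QB (X : Scheme.{u}) : BundleComplex X ⥤ DCoh X :=
  ObjectProperty.ιOfLE boundedBundle_le ⋙ Q X

lemma isZero_dual {F : X.Modules} (h : IsZero F) : IsZero (dual F) := by
  rw [IsZero.iff_id_eq_zero] at h ⊢
  rw [← dualMap_id, h, dualMap_zero]

/-- `K^∨[2]`, with terms `(K^∨[2])^n = (K^{-n-2})^*` and transposed differentials. -/
def dualComplex (K : CochainComplex X.Modules ℤ) : CochainComplex X.Modules ℤ where
  X n := dual (K.X (-n - 2))
  d i j := dualMap (K.d (-j - 2) (-i - 2))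
  shape i j h := by
    rw [K.shape, dualMap_zero]
    simp only [ComplexShape.up_Rel] at h ⊢
    omega
  d_comp_d' i j k _ _ := by
    rw [← dualMap_comp, K.d_comp_d, dualMap_zero]

/-- `f^∨[2]` for a map of complexes `f`. -/
def dualComplexMap {K L : CochainComplex X.Modules ℤ} (f : K ⟶ L) :
    dualComplex L ⟶ dualComplex K where
  f n := dualMap (f.f (-n - 2))
  comm' i j _ := by
    change dualMap _ ≫ dualMap _ = dualMap _ ≫ dualMap _
    rw [← dualMap_comp, ← dualMap_comp, f.comm]

/-- The canonical map `K ⟶ (K^∨[2])^∨[2]`, given by `K^n ⟶ (K^n)^**`. -/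
def evalComplex (K : CochainComplex X.Modules ℤ) : K ⟶ dualComplex (dualComplex K) where
  f n := (K.XIsoOfEq (by ring : n = -(-n - 2) - 2)).hom ≫ evalDual _
  comm' i j _ := by
    change (_ ≫ evalDual _) ≫ dualMap (dualMap _) = _
    rw [Category.assoc, evalDual_naturality, ← Category.assoc, K.XIsoOfEq_hom_comp_d,
      ← K.d_comp_XIsoOfEq_hom (by ring : j = -(-j - 2) - 2), Category.assoc]
    rfl

namespace BundleComplex

/-- `P^∨[2]` for a complex of vector bundles `P`. -/
def dualTwo (P : BundleComplex X) : BundleComplex X :=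
  ⟨dualComplex P.obj, by
    obtain ⟨⟨a, b, h⟩, hP⟩ := P.property
    refine ⟨⟨-b - 2, -a - 2, fun n hn ↦ isZero_dual (h _ ?_)⟩, fun n ↦ (hP _).dual⟩
    omega⟩

/-- `f^∨[2]` for a morphism `f` of complexes of vector bundles. -/
def dualTwoMap {P P' : BundleComplex X} (f : P ⟶ P') : dualTwo P' ⟶ dualTwo P :=
  ObjectProperty.homMk (dualComplexMap f.hom)

/-- The canonical map `P ⟶ (P^∨[2])^∨[2]`. -/
def eval (P : BundleComplex X) : P ⟶ dualTwo (dualTwo P) :=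
  ObjectProperty.homMk (evalComplex P.obj)

end BundleComplex

open BundleComplex

/-- `f' = f^∨[2]` for morphisms `f : A ⟶ B` and `f' : B^∨[2] ⟶ A^∨[2]` of the derived category,
where `A` and `B` are complexes of vector bundles: `f` is represented by a roof `A ⟵ C ⟶ B` of
complexes of vector bundles, and `f'` by the dual roof `A^∨[2] ⟶ C^∨[2] ⟵ B^∨[2]`. -/
def IsDualTwo {A B : BundleComplex X} (f : (QB X).obj A ⟶ (QB X).obj B)
    (f' : (QB X).obj (dualTwo B) ⟶ (QB X).obj (dualTwo A)) : Prop :=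
  ∃ (C : BundleComplex X) (s : C ⟶ A) (t : C ⟶ B), QuasiIso s.hom ∧
    (QB X).map s ≫ f = (QB X).map t ∧
    f' ≫ (QB X).map (dualTwoMap s) = (QB X).map (dualTwoMap t)

/-- A bounded resolution of `𝔼` by vector bundles. -/
structure BundleResolution (𝔼 : DCoh X) where
  P : BundleComplex X
  iso : (QB X).obj P ≅ 𝔼

/-- The object `𝔼^∨[2]` of the derived category, computed with a resolution by vector bundles. -/
def BundleResolution.dualTwo {𝔼 : DCoh X} (R : BundleResolution 𝔼) : DCoh X :=
  (QB X).obj R.P.dualTwo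

/-- `θ = θ^∨[2]` for a morphism `θ : 𝔼 ⟶ 𝔼^∨[2]`, where `(𝔼^∨[2])^∨[2] = 𝔼`. -/
def BundleResolution.IsSymmetric {𝔼 : DCoh X} (R : BundleResolution 𝔼) (θ : 𝔼 ⟶ R.dualTwo) :
    Prop :=
  ∃ θ' : (QB X).obj R.P.dualTwo.dualTwo ⟶ (QB X).obj R.P.dualTwo,
    IsDualTwo (A := R.P) (B := R.P.dualTwo) (R.iso.hom ≫ θ) θ' ∧
      (QB X).map R.P.eval ≫ θ' = R.iso.hom ≫ θ

/-- `𝔼` is perfect of amplitude contained in `[-2, 0]`: it is locally quasi-isomorphic to a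
complex of vector bundles in degrees `-2`, `-1` and `0`. -/
def IsPerfectOfAmplitude (𝔼 : DCoh X) : Prop :=
  ∃ K : CohComplex X, Nonempty ((Q X).obj K ≅ 𝔼) ∧
    ∀ x : X, ∃ U : X.Opens, x ∈ U ∧ ∃ P : CochainComplex U.toScheme.Modules ℤ,
      (∀ n, IsVectorBundle (P.X n)) ∧ (∀ n, n < -2 ∨ 0 < n → IsZero (P.X n)) ∧
      ∃ φ : P ⟶ ((Scheme.Modules.restrictFunctor U.ι).mapHomologicalComplex _).obj K.obj,
        QuasiIso φ

open scoped ZeroObject in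
/-- The complex `A ⟶ B ⟶ C` in degrees `-2`, `-1` and `0`. -/
def threeTerm {A B C : X.Modules} (f : A ⟶ B) (g : B ⟶ C) (w : f ≫ g = 0) :
    CochainComplex X.Modules ℤ where
  X
    | .negSucc 1 => A
    | .negSucc 0 => B
    | .ofNat 0 => C
    | _ => 0
  d
    | .negSucc 1, .negSucc 0 => f
    | .negSucc 0, .ofNat 0 => g
    | _, _ => 0
  shape i j h := by
    split
    · exact absurd rfl h
    · exact absurd rfl h
    · rfl
  d_comp_d' i j k hij hjk := by
    obtain rfl : i + 1 = j := hij
    obtain rfl : i + 1 + 1 = k := hjk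
    match i with
    | .negSucc 1 => exact w
    | .negSucc 0 => exact comp_zero
    | .negSucc (_ + 2) => exact zero_comp
    | .ofNat _ => exact zero_comp

/-- The data `T`, `(E, q)`, `a : T ⟶ E` of a self-dual complex `T ⟶ E ⟶ T^*`: vector bundles
`T` and `E`, a nondegenerate quadratic form on `E`, seen as a symmetric isomorphism
`q : E ⟶ E^*`, and a map `a : T ⟶ E` with isotropic image. -/
structure SelfDualData (X : Scheme.{u}) where
  T : X.Modules
  E : X.Modules
  isVectorBundle_T : IsVectorBundle T
  isVectorBundle_E : IsVectorBundle E
  q : E ⟶ dual E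
  isIso_q : IsIso q
  symm : evalDual E ≫ dualMap q = q
  a : T ⟶ E
  isotropic : a ≫ q ≫ dualMap a = 0

namespace SelfDualData
variable (S : SelfDualData X)

/-- `a^* : E ⟶ T^*`, the transpose of `a` composed with `q : E ≅ E^*`. -/
def aStar : S.E ⟶ dual S.T := S.q ≫ dualMap S.a

/-- The complex `T ⟶ E ⟶ T^*` with differentials `a` and `a^*`, in degrees `-2`, `-1` and `0`. -/
def complex : CochainComplex X.Modules ℤ := threeTerm S.a S.aStar S.isotropic

lemma isVectorBundle_zero {F : X.Modules} (hF : IsZero F) : IsVectorBundle F := by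
  have h0 : ∀ (U : X.Opens) (s : Γ(F, U)), s = 0 := fun U s ↦ by
    have h := congrArg (fun f : F ⟶ F ↦ f.app U s) ((IsZero.iff_id_eq_zero F).mp hF)
    exact h
  intro x
  refine ⟨⊤, trivial, 0, Fin.elim0, fun V h ↦ ⟨linearIndependent_empty_type, fun s _ ↦ ?_⟩⟩
  rw [h0 V s]
  exact zero_mem _

lemma isZero_threeTerm {A B C : X.Modules} (f : A ⟶ B) (g : B ⟶ C) (w : f ≫ g = 0) (n : ℤ)
    (hn : n < -2 ∨ 0 < n) : IsZero ((threeTerm f g w).X n) := by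
  match n with
  | .negSucc 1 => omega
  | .negSucc 0 => omega
  | .ofNat 0 => exact absurd hn (by decide)
  | .negSucc (_ + 2) => exact isZero_zero _
  | .ofNat (_ + 1) => exact isZero_zero _

/-- The self-dual complex `T ⟶ E ⟶ T^*` as a bounded complex of vector bundles. -/
def cx : BundleComplex X :=
  ⟨S.complex, ⟨-2, 0, isZero_threeTerm _ _ _⟩, fun n ↦ by
    match n with
    | .negSucc 1 => exact S.isVectorBundle_T
    | .negSucc 0 => exact S.isVectorBundle_E
    | .ofNat 0 => exact S.isVectorBundle_T.dual
    | .negSucc (_ + 2) => exact isVectorBundle_zero (isZero_zero _)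
    | .ofNat (_ + 1) => exact isVectorBundle_zero (isZero_zero _)⟩

/-- The obvious duality from `T ⟶ E ⟶ T^*` to the dual complex `T^** ⟶ E^* ⟶ T^*`: it is
`T ⟶ T^**` in degree `-2`, `q` in degree `-1` and the identity in degree `0`. -/
def dualityMap : S.complex ⟶ dualComplex S.complex where
  f
    | .negSucc 1 => evalDual S.T
    | .negSucc 0 => S.q
    | .ofNat 0 => 𝟙 (dual S.T)
    | _ => 0
  comm' i j hij := by
    obtain rfl : i + 1 = j := hij
    match i with
    | .negSucc 1 =>
      change evalDual S.T ≫ dualMap (S.q ≫ dualMap S.a) = S.a ≫ S.q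
      rw [dualMap_comp, ← Category.assoc, evalDual_naturality, Category.assoc, S.symm]
    | .negSucc 0 =>
      change S.q ≫ dualMap S.a = (S.q ≫ dualMap S.a) ≫ 𝟙 (dual S.T)
      rw [Category.comp_id]
    | .negSucc (_ + 2) => exact zero_comp.trans zero_comp.symm
    | .ofNat 0 =>
      change 𝟙 (dual S.T) ≫ dualMap 0 = 0 ≫ 0
      rw [dualMap_zero, comp_zero, comp_zero]
    | .ofNat (_ + 1) => exact zero_comp.trans zero_comp.symm

/-- The obvious duality as a morphism of complexes of vector bundles. -/
def duality : S.cx ⟶ S.cx.dualTwo := ObjectProperty.homMk S.dualityMap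

end SelfDualData

/-- The constants `ℂ ⟶ O_A` of a complex scheme `g : A ⟶ Spec ℂ`. -/
def constants {A : Scheme.{0}} (g : A ⟶ Spec (.of ℂ)) :
    (Functor.const A.Opensᵒᵖ).obj (CommRingCat.of ℂ) ⟶ A.presheaf where
  app U := (Scheme.ΓSpecIso (.of ℂ)).inv ≫ g.appTop ≫ A.presheaf.map (homOfLE le_top).op
  naturality U V i := by
    simp only [Functor.const_obj_map, Category.assoc, ← Functor.map_comp]
    rfl

/-- The presheaf `U ↦ Ω_{O_A(U)/ℂ}`. -/
def cotangentPresheaf {A : Scheme.{0}} (g : A ⟶ Spec (.of ℂ)) : A.PresheafOfModules :=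
  PresheafOfModules.DifferentialsConstruction.relativeDifferentials' (constants g)

/-- The sheaf of Kähler differentials `Ω_A` of a complex scheme `A`. -/
def cotangentSheaf {A : Scheme.{0}} (g : A ⟶ Spec (.of ℂ)) : A.Modules :=
  (PresheafOfModules.sheafification (𝟙 A.ringCatSheaf.obj)).obj (cotangentPresheaf g)

/-- The sheafification map. -/
def toCotangentSheaf {A : Scheme.{0}} (g : A ⟶ Spec (.of ℂ)) :
    cotangentPresheaf g ⟶ (cotangentSheaf g).val :=
  (PresheafOfModules.sheafificationAdjunction (𝟙 A.ringCatSheaf.obj)).unit.app _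

/-- The structure sheaf as a module over itself. -/
def structureSheaf (A : Scheme.{0}) : A.Modules := SheafOfModules.unit A.ringCatSheaf

/-- `i^# : O_A ⟶ i_* O_M`. -/
def sharp {M A : Scheme.{0}} (i : M ⟶ A) :
    structureSheaf A ⟶ (Scheme.Modules.pushforward i).obj (structureSheaf M) :=
  SheafOfModules.unitToPushforwardObjUnit i.toRingCatSheafHom

/-- The ideal sheaf of a closed subscheme `i : M ⟶ A`. -/
def idealSheaf {M A : Scheme.{0}} (i : M ⟶ A) : A.Modules := kernel (sharp i)

section
variable {M A : Scheme.{0}} (g : A ⟶ Spec (.of ℂ)) (i : M ⟶ A)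

/-- `Ω_A|_M = i^* Ω_A`. -/
def restrictedCotangent : M.Modules := (Scheme.Modules.pullback i).obj (cotangentSheaf g)

/-- The natural map from `U ↦ Ω_{O_A(U)/ℂ}` to `i_* i^* Ω_A`. -/
def cotangentUnit :
    cotangentPresheaf g ⟶ ((Scheme.Modules.pushforward i).obj (restrictedCotangent g i)).val :=
  toCotangentSheaf g ≫
    ((Scheme.Modules.pullbackPushforwardAdjunction i).unit.app (cotangentSheaf g)).val

/-- The composite `O_A ⟶ Ω_A ⟶ i_* i^* Ω_A` on sections. -/
def universalD (U : A.Opens) :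
    Γ(A, U) →+ Γ((Scheme.Modules.pushforward i).obj (restrictedCotangent g i), U) :=
  AddMonoidHom.comp ((cotangentUnit g i).app (.op U)).hom.toAddMonoidHom
    ((PresheafOfModules.DifferentialsConstruction.derivation' (constants g)).d (X := .op U))

lemma universalD_mul (U : A.Opens) (r s : Γ(A, U)) :
    universalD g i U (r * s) = r • universalD g i U s + s • universalD g i U r := by
  have := (PresheafOfModules.DifferentialsConstruction.derivation' (constants g)).d_mul
    (X := .op U) r s
  let L : (cotangentPresheaf g).obj (.op U) →ₗ[A.ringCatSheaf.obj.obj (.op U)]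
      ((Scheme.Modules.pushforward i).obj (restrictedCotangent g i)).val.obj (.op U) :=
    ((cotangentUnit g i).app (.op U)).hom
  have h := congrArg L this
  exact h.trans ((L.map_add _ _).trans (congrArg₂ _ (L.map_smul _ _) (L.map_smul _ _)))

lemma universalD_map {U V : A.Opens} (h : V ⟶ U) (s : Γ(A, U)) :
    universalD g i V (A.presheaf.map h.op s) =
      ((Scheme.Modules.pushforward i).obj (restrictedCotangent g i)).presheaf.map h.op
        (universalD g i U s) := by
  have := (PresheafOfModules.DifferentialsConstruction.derivation' (constants g)).d_map h.op s
  change ((cotangentUnit g i).app (.op V)).hom _ = _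
  erw [this]
  exact PresheafOfModules.naturality_apply (cotangentUnit g i) h.op _

/-- The inclusion `I ⟶ O_A` on sections. -/
def idealInclusion (U : A.Opens) : Γ(idealSheaf i, U) →+ Γ(A, U) :=
  ((kernel.ι (sharp i)).app U).hom

lemma app_idealInclusion (U : A.Opens) (s : Γ(idealSheaf i, U)) :
    i.app U (idealInclusion i U s) = 0 := by
  have h : (kernel.ι (sharp i) ≫ sharp i).app U s = 0 := by
    rw [kernel.condition]; rfl
  exact h

lemma smul_eq_zero_of_app (N : M.Modules) (U : A.Opens) (r : Γ(A, U)) (hr : i.app U r = 0)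
    (t : Γ((Scheme.Modules.pushforward i).obj N, U)) : r • t = 0 := by
  change (show Γ(M, i ⁻¹ᵁ U) from i.app U r) • (show Γ(N, i ⁻¹ᵁ U) from t) = 0
  rw [hr, zero_smul]

/-- The `O_A`-linear map `I ⟶ i_* i^* Ω_A`, `s ↦ ds`. -/
def conormalD : idealSheaf i ⟶ (Scheme.Modules.pushforward i).obj (restrictedCotangent g i) where
  val :=
    { app := fun U ↦ ModuleCat.ofHom (X := (idealSheaf i).val.obj U)
          (Y := ((Scheme.Modules.pushforward i).obj (restrictedCotangent g i)).val.obj U)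
        { toFun := fun s ↦ universalD g i U.unop (idealInclusion i U.unop s)
          map_add' := fun s t ↦ by
            erw [map_add, map_add]
            rfl
          map_smul' := fun (r : Γ(A, U.unop)) (s : Γ(idealSheaf i, U.unop)) ↦ by
            have h : idealInclusion i U.unop (r • s) = r * idealInclusion i U.unop s :=
              Scheme.Modules.Hom.app_smul (kernel.ι (sharp i)) r s
            erw [h, universalD_mul, smul_eq_zero_of_app i _ _ _ (app_idealInclusion i _ s),
              add_zero]
            rfl }
      naturality := fun {U V} f ↦ by
        ext s
        have h : idealInclusion i V.unop ((idealSheaf i).presheaf.map f s) =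
            A.presheaf.map f (idealInclusion i U.unop s) :=
          CategoryTheory.congr_fun ((kernel.ι (sharp i)).mapPresheaf.naturality f) s
        change universalD g i V.unop (idealInclusion i V.unop ((idealSheaf i).presheaf.map f s)) = _
        rw [h]
        exact universalD_map g i f.unop _ }

/-- The differential `I/I² = i^* I ⟶ Ω_A|_M`, `[s] ↦ ds`. -/
def conormalMap : (Scheme.Modules.pullback i).obj (idealSheaf i) ⟶ restrictedCotangent g i :=
  ((Scheme.Modules.pullbackPushforwardAdjunction i).homEquiv _ _).symm (conormalD g i)

/-- The truncated cotangent complex `{I/I² ⟶ Ω_A|_M}`, in degrees `-1` and `0`. -/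
def truncatedCotangent : CochainComplex M.Modules ℤ :=
  HomologicalComplex.double (conormalMap g i) (c := ComplexShape.up ℤ) (i₀ := -1) (i₁ := 0) (by simp)

end

/-- `α : S ≅ 𝔼` intertwines `θ` with the obvious duality of `S`: the latter is the composite
`S ⟶ 𝔼 ⟶ 𝔼^∨[2] ⟶ S^∨[2]` of `α`, `θ` and `α^∨[2]`. -/
def Intertwines {𝔼 : DCoh X} (R : BundleResolution 𝔼) (θ : 𝔼 ⟶ R.dualTwo) (S : SelfDualData X)
    (α : (QB X).obj S.cx ≅ 𝔼) : Prop :=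
  ∃ α' : R.dualTwo ⟶ (QB X).obj S.cx.dualTwo,
    IsDualTwo (A := S.cx) (B := R.P) (α.hom ≫ R.iso.inv) α' ∧
      α.hom ≫ θ ≫ α' = (QB X).map S.duality

/-- `At : 𝔼 ⟶ L` is an obstruction theory: `h^0(At)` is an isomorphism and `h^{-1}(At)` is
surjective. -/
def IsObstructionTheory {𝔼 L : DCoh X} (At : 𝔼 ⟶ L) : Prop :=
  IsIso ((cohomology X 0).map At) ∧ Epi ((cohomology X (-1)).map At)

/-- The morphism of the derived category represented by a genuine map of complexes from a complex
of vector bundles to a complex of coherent sheaves. -/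
def ofMap {P : BundleComplex X} {L : CohComplex X} (u : P.obj ⟶ L.obj) :
    (QB X).obj P ⟶ (Q X).obj L :=
  (Q X).map (X := (ObjectProperty.ιOfLE boundedBundle_le).obj P) (Y := L) (ObjectProperty.homMk u)

attribute [local instance] MvPolynomial.gradedAlgebra in
/-- `f : M ⟶ Spec ℂ` is quasi-projective: `M` is a locally closed subscheme of a projective
space over `ℂ`. -/
def IsQuasiProjective {M : Scheme.{0}} (f : M ⟶ Spec (.of ℂ)) : Prop :=
  ∃ (n : ℕ) (j : M ⟶ Proj (MvPolynomial.homogeneousSubmodule (Fin (n + 1)) ℂ)),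
    IsImmersion j ∧
      j ≫ Proj.toSpecZero _ ≫ Spec.map (CommRingCat.ofHom (algebraMap ℂ
        (MvPolynomial.homogeneousSubmodule (Fin (n + 1)) ℂ 0))) = f

end DT4

end

open CategoryTheory AlgebraicGeometry DT4

/-!
# Self-dual complexes representing symmetric perfect objects

The theorem rests on three facts: a quasi-projective scheme has enough vector bundles, a symmetric
isomorphism in the derived category is represented by a symmetric map of complexes, and a symmetric
quasi-isomorphism `C ⟶ C^∨[2]` collapses `C` to three terms.

*Enough vector bundles.* On a quasi-projective scheme, finitely many homogeneous polynomials of a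
common degree have nonvanishing loci that form an affine cover. This is recorded as `AmpleData`
(`nonempty_ampleData`), and a section of a coherent sheaf over one of these loci becomes global after
a twist, so that finite sums of line bundles `O(-N)` map onto every coherent sheaf
(`AmpleData.hasEnoughBundles`). Replacing the terms of a bounded coherent complex by vector bundles,
one after the other from the right, gives a resolution `C`. If the complex is perfect, the
process may be truncated: the last kernel is locally a direct summand of a vector bundle, since over
small affine open subsets its sections are the lowest term of a complex quasi-isomorphic to a complex
of projective modules (`projective_lowest_term`, `exists_bundle_resolution`). The same supply of
bundles shows that every morphism out of a complex of vector bundles in the derived category is a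
fraction `Q(s)⁻¹ Q(t)` with a quasi-isomorphism `s` of complexes of vector bundles (`exists_roof`),
and duality preserves such quasi-isomorphisms (`quasiIso_dualComplexMap`).

*Symmetric representatives.* A fraction for `θ` yields `φ : C ⟶ C^∨[2]` that represents `θ` along a
quasi-isomorphism from `C`. By symmetry of `θ`, the transpose of `φ` represents it as well, and so
does the average of the two, because `2` is invertible (`Q_map_average`, `exists_isSymmRep`). Such
representatives can be pulled back along quasi-isomorphisms. Hence `C` may be assumed to vanish in
positive degrees (`exists_trim`) and to carry a map of complexes `t` to `{I/I² ⟶ Ω_A|_M}` that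
represents the obstruction theory. After adding a contractible complex `B ⟶ B` in degrees `-1` and
`0`, the map `t` is surjective in degree `-1`, and then, by surjectivity of `h^0(At)`, in degree `0`
(`exists_good_isSymmRep`).

*Reduction to three terms.* Let `A ⟶ B ⟶ D` be the terms of `C` in degrees `-2, -1, 0` and
`φ : C ⟶ C^∨[2]` symmetric. The middle part of its mapping cone is
`A ⟶ B ⊞ D^* ⟶ D ⊞ B^* ⟶ A^*`. The middle map, composed with the canonical isomorphism of `D ⊞ B^*`
with the dual of `B ⊞ D^*`, is a symmetric form on `B ⊞ D^*`, whose radical is the image of `A`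
because the cone is acyclic. The form therefore descends to a nondegenerate symmetric form on the
quotient `E`, which is a vector bundle because it is also the sheaf of cocycles of a bounded above
acyclic complex of vector bundles. The summand `D^*` is isotropic, which gives the self-dual complex
`D^* ⟶ E ⟶ D^**` (`SymmetricTriple`, `SymmetricTriple.IsNondegenerate.selfDual`). The map `φ` in
degree `-2`, the inclusion of `B` in degree `-1` and the biduality map in degree `0` form a
quasi-isomorphism from `C` to it (`quasiIso_toSelfDual`) that carries the obvious duality to `φ`
(`toSelfDual_duality`). A map `t` from `C` to a complex in degrees `-1` and `0` factors through it:
its component in degree `-1`, extended by zero to `D^*`, vanishes on the image of `A`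
(`exists_toSelfDual_comp`). Since `t` is surjective in each degree, so is the induced map. These
steps are combined in `exists_selfDual_representative`.

*Coherence of the truncated cotangent complex.* Ideal sheaves on locally noetherian schemes, sheaves
of Kähler differentials of schemes locally of finite type, and pullbacks of coherent sheaves are
coherent (`isCoherent_idealSheaf`, `isCoherent_cotangentSheaf`, `IsCoherent.pullback`).

Coherence, exactness and surjectivity are handled throughout in terms of sections: `LocSurj` and
`LocExact` are the local lifting properties that characterize epimorphisms and exact sequences, and
`IsQC` says that sections over a principal open subset of an affine open subset are obtained by
inverting a function.
-/

noncomputable section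

namespace DT4

open CategoryTheory Limits AlgebraicGeometry TopologicalSpace Opposite

/-! ### Sections and local surjectivity -/

section Sections
variable {X : Scheme.{u}} {F G H : X.Modules}

/-- Restriction of sections of a sheaf of modules. -/
def rs (F : X.Modules) {U V : X.Opens} (h : V ≤ U) : Γ(F, U) →+ Γ(F, V) :=
  (F.presheaf.map (homOfLE h).op).hom

/-- Restriction of functions. -/
def rO {X : Scheme.{u}} {U V : X.Opens} (h : V ≤ U) : Γ(X, U) →+* Γ(X, V) :=
  (X.presheaf.map (homOfLE h).op).hom

@[simp] lemma rs_rs {U V W : X.Opens} (h : V ≤ U) (h' : W ≤ V) (s : Γ(F, U)) :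
    rs F h' (rs F h s) = rs F (h'.trans h) s :=
  ab_res_res F (homOfLE h') (homOfLE h) (homOfLE (h'.trans h)) s

@[simp] lemma rs_self {U : X.Opens} (h : U ≤ U) (s : Γ(F, U)) : rs F h s = s := by
  change (F.presheaf.map (𝟙 _)) s = s
  rw [F.presheaf.map_id]; rfl

@[simp] lemma rO_rO {U V W : X.Opens} (h : V ≤ U) (h' : W ≤ V) (s : Γ(X, U)) :
    rO h' (rO h s) = rO (h'.trans h) s :=
  res_res (homOfLE h') (homOfLE h) (homOfLE (h'.trans h)) s

@[simp] lemma rO_self {U : X.Opens} (h : U ≤ U) (s : Γ(X, U)) : rO h s = s := by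
  change (X.presheaf.map (𝟙 _)) s = s
  rw [X.presheaf.map_id]; rfl

@[simp] lemma rs_smul {U V : X.Opens} (h : V ≤ U) (r : Γ(X, U)) (s : Γ(F, U)) :
    rs F h (r • s) = rO h r • rs F h s := Scheme.Modules.map_smul _ _ _ _

lemma app_rs (f : F ⟶ G) {U V : X.Opens} (h : V ≤ U) (s : Γ(F, U)) :
    f.app V (rs F h s) = rs G h (f.app U s) :=
  CategoryTheory.congr_fun (f.mapPresheaf.naturality (homOfLE h).op) s

lemma app_smul (f : F ⟶ G) {U : X.Opens} (r : Γ(X, U)) (s : Γ(F, U)) :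
    f.app U (r • s) = r • f.app U s := Scheme.Modules.Hom.app_smul _ _ _

@[simp] lemma comp_app_apply (f : F ⟶ G) (g : G ⟶ H) {U : X.Opens} (s : Γ(F, U)) :
    (f ≫ g).app U s = g.app U (f.app U s) := rfl

@[simp] lemma zero_app_apply {U : X.Opens} (s : Γ(F, U)) : (0 : F ⟶ G).app U s = 0 := rfl

@[simp] lemma id_app_apply {U : X.Opens} (s : Γ(F, U)) : (𝟙 F : F ⟶ F).app U s = s := rfl

@[simp] lemma add_app_apply (f g : F ⟶ G) {U : X.Opens} (s : Γ(F, U)) :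
    (f + g).app U s = f.app U s + g.app U s := rfl

@[simp] lemma neg_app_apply (f : F ⟶ G) {U : X.Opens} (s : Γ(F, U)) :
    (-f).app U s = -f.app U s := rfl

lemma hom_ext_app {f g : F ⟶ G} (h : ∀ U (s : Γ(F, U)), f.app U s = g.app U s) : f = g := by
  apply Scheme.Modules.hom_ext
  intro U
  ext s
  exact h U s

lemma section_ext_of_local {U : X.Opens} (s t : Γ(F, U))
    (h : ∀ x ∈ U, ∃ (V : X.Opens) (hV : V ≤ U), x ∈ V ∧ rs F hV s = rs F hV t) : s = t := by
  choose V hV hx he using fun x : U ↦ h x.1 x.2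
  refine TopCat.Sheaf.eq_of_locally_eq' ⟨F.presheaf, F.isSheaf⟩ V U (fun x ↦ homOfLE (hV x))
    (fun x hxU ↦ ?_) s t (fun x ↦ he x)
  exact Opens.mem_iSup.mpr ⟨⟨x, hxU⟩, hx _⟩

lemma function_ext_of_local {U : X.Opens} (s t : Γ(X, U))
    (h : ∀ x ∈ U, ∃ (V : X.Opens) (hV : V ≤ U), x ∈ V ∧ rO hV s = rO hV t) : s = t := by
  choose V hV hx he using fun x : U ↦ h x.1 x.2
  refine TopCat.Sheaf.eq_of_locally_eq' X.sheaf V U (fun x ↦ homOfLE (hV x))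
    (fun x hxU ↦ ?_) s t (fun x ↦ he x)
  exact Opens.mem_iSup.mpr ⟨⟨x, hxU⟩, hx _⟩

/-- Gluing of sections given on an indexed cover. -/
lemma exists_glue_sections (F : X.Modules) {ι : Type*} (V : ι → X.Opens) (U : X.Opens)
    (hV : ∀ i, V i ≤ U) (hU : U ≤ iSup V) (s : ∀ i, Γ(F, V i))
    (hs : ∀ i j (W : X.Opens) (hi : W ≤ V i) (hj : W ≤ V j), rs F hi (s i) = rs F hj (s j)) :
    ∃ t : Γ(F, U), ∀ i, rs F (hV i) t = s i := by
  obtain ⟨t, ht, -⟩ := TopCat.Sheaf.existsUnique_gluing' ⟨F.presheaf, F.isSheaf⟩ V U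
    (fun i ↦ homOfLE (hV i)) hU s (fun i j ↦ hs i j _ _ _)
  exact ⟨t, ht⟩

lemma exists_glue_functions {ι : Type*} (V : ι → X.Opens) (U : X.Opens)
    (hV : ∀ i, V i ≤ U) (hU : U ≤ iSup V) (s : ∀ i, Γ(X, V i))
    (hs : ∀ i j (W : X.Opens) (hi : W ≤ V i) (hj : W ≤ V j), rO hi (s i) = rO hj (s j)) :
    ∃ t : Γ(X, U), ∀ i, rO (hV i) t = s i := by
  obtain ⟨t, ht, -⟩ := TopCat.Sheaf.existsUnique_gluing' X.sheaf V U
    (fun i ↦ homOfLE (hV i)) hU s (fun i j ↦ hs i j _ _ _)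
  exact ⟨t, ht⟩

/-- Construction of a morphism of sheaves of modules from linear maps on sections. -/
def homOfSections (φ : ∀ U : X.Opens, Γ(F, U) →ₗ[Γ(X, U)] Γ(G, U))
    (hφ : ∀ (U V : X.Opens) (h : V ≤ U) (s : Γ(F, U)), φ V (rs F h s) = rs G h (φ U s)) :
    F ⟶ G where
  val :=
    { app := fun U ↦ ModuleCat.ofHom (X := F.val.obj U) (Y := G.val.obj U) (φ U.unop)
      naturality := fun {U V} i ↦ by
        ext s
        exact hφ U.unop V.unop (leOfHom i.unop) s }

/-- The subsheaf of modules given by a family of submodules that is determined locally. -/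
def subsheaf (G : X.Modules) (N : ∀ U : X.Opens, Submodule Γ(X, U) Γ(G, U))
    (hN : ∀ (U V : X.Opens) (h : V ≤ U) (s : Γ(G, U)), s ∈ N U → rs G h s ∈ N V)
    (hloc : ∀ (U : X.Opens) (s : Γ(G, U)),
      (∀ x ∈ U, ∃ (V : X.Opens) (h : V ≤ U), x ∈ V ∧ rs G h s ∈ N V) → s ∈ N U) : X.Modules where
  val := PresheafOfModules.Submodule.toPresheafOfModules (M := G.val)
    { obj := fun U ↦ N U.unop
      map := fun {U V} i s hs ↦ hN U.unop V.unop (leOfHom i.unop) s hs }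
  isSheaf := by
    refine (TopCat.Presheaf.isSheaf_iff_isSheafUniqueGluing
      (PresheafOfModules.presheaf (PresheafOfModules.Submodule.toPresheafOfModules (M := G.val)
    { obj := fun U ↦ N U.unop
      map := fun {U V} i s hs ↦ hN U.unop V.unop (leOfHom i.unop) s hs }))).mpr ?_
    intro ι U (s : ∀ i, N (U i)) hs
    obtain ⟨t, ht⟩ := exists_glue_sections G U (iSup U) (fun i ↦ le_iSup U i) le_rfl
      (fun i ↦ (s i).1) (by
        intro i j W hi hj
        have := congrArg (fun z : N (U i ⊓ U j) ↦ rs G (le_inf hi hj) z.1) (hs i j)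
        have h1 : rs G (le_inf hi hj) (rs G inf_le_left (s i).1) =
          rs G (le_inf hi hj) (rs G inf_le_right (s j).1) := this
        simpa using h1)
    refine ⟨(⟨t, hloc _ _ ?_⟩ : N (iSup U)), ?_, ?_⟩
    · intro x hx
      obtain ⟨i, hi⟩ := Opens.mem_iSup.mp hx
      exact ⟨U i, le_iSup U i, hi, by rw [ht]; exact (s i).2⟩
    · intro i
      exact Subtype.ext (ht i)
    · intro (t' : N (iSup U)) ht'
      refine Subtype.ext (section_ext_of_local _ _ fun x hx ↦ ?_)
      obtain ⟨i, hi⟩ := Opens.mem_iSup.mp hx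
      refine ⟨U i, le_iSup U i, hi, ?_⟩
      rw [ht]
      exact congrArg Subtype.val (ht' i)

section
variable (G : X.Modules) (N : ∀ U : X.Opens, Submodule Γ(X, U) Γ(G, U))
    (hN : ∀ (U V : X.Opens) (h : V ≤ U) (s : Γ(G, U)), s ∈ N U → rs G h s ∈ N V)
    (hloc : ∀ (U : X.Opens) (s : Γ(G, U)),
      (∀ x ∈ U, ∃ (V : X.Opens) (h : V ≤ U), x ∈ V ∧ rs G h s ∈ N V) → s ∈ N U)

/-- The inclusion of a subsheaf. -/
def subsheafι : subsheaf G N hN hloc ⟶ G :=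
  homOfSections (F := subsheaf G N hN hloc) (fun U ↦ (N U).subtype) (fun _ _ _ _ ↦ rfl)

end

/-- The images of sections of `F` generate `G` near every point of their domain. -/
def LocSurj (f : F ⟶ G) : Prop :=
  ∀ (U : X.Opens) (s : Γ(G, U)), ∀ x ∈ U, ∃ (V : X.Opens) (h : V ≤ U), x ∈ V ∧
    ∃ t : Γ(F, V), f.app V t = rs G h s

lemma mono_of_injective (f : F ⟶ G) (h : ∀ U, Function.Injective (f.app U)) : Mono f where
  right_cancellation a b hab := hom_ext_app fun U s ↦ h U (by
    simpa using congrArg (fun g : _ ⟶ G ↦ g.app U s) hab)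

lemma app_injective (f : F ⟶ G) [Mono f] (U : X.Opens) : Function.Injective (f.app U) := by
  have h1 : Mono ((Scheme.Modules.toPresheaf X).map f) := inferInstance
  have h2 : Mono (((Scheme.Modules.toPresheaf X).map f).app (op U)) := inferInstance
  exact (AddCommGrpCat.mono_iff_injective _).mp h2

lemma isIso_of_bijective (f : F ⟶ G) (h : ∀ U, Function.Bijective (f.app U)) : IsIso f := by
  rw [Scheme.Modules.Hom.isIso_iff_isIso_app]
  intro U
  exact (ConcreteCategory.isIso_iff_bijective _).mpr (h U)

lemma app_bijective (f : F ⟶ G) [IsIso f] (U : X.Opens) : Function.Bijective (f.app U) :=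
  (ConcreteCategory.isIso_iff_bijective _).mp inferInstance

lemma LocSurj.epi {f : F ⟶ G} (hf : LocSurj f) : Epi f where
  left_cancellation a b hab := hom_ext_app fun U s ↦ section_ext_of_local _ _ fun x hx ↦ by
    obtain ⟨V, h, hxV, t, ht⟩ := hf U s x hx
    refine ⟨V, h, hxV, ?_⟩
    rw [← app_rs, ← app_rs, ← ht]
    exact congrArg (fun g : F ⟶ _ ↦ g.app V t) hab

/-- The local image of `f`, as a family of submodules. -/
def locImage (f : F ⟶ G) (U : X.Opens) : Submodule Γ(X, U) Γ(G, U) where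
  carrier := {s | ∀ x ∈ U, ∃ (V : X.Opens) (h : V ≤ U), x ∈ V ∧ ∃ t, f.app V t = rs G h s}
  zero_mem' := fun x hx ↦ ⟨U, le_rfl, hx, 0, by simp⟩
  add_mem' := by
    intro s s' hs hs' x hx
    obtain ⟨V, h, hxV, t, ht⟩ := hs x hx
    obtain ⟨V', h', hxV', t', ht'⟩ := hs' x hx
    refine ⟨V ⊓ V', inf_le_left.trans h, ⟨hxV, hxV'⟩,
      rs F inf_le_left t + rs F inf_le_right t', ?_⟩
    rw [map_add, map_add, app_rs, app_rs, ht, ht', rs_rs, rs_rs]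
  smul_mem' := by
    intro r s hs x hx
    obtain ⟨V, h, hxV, t, ht⟩ := hs x hx
    exact ⟨V, h, hxV, rO h r • t, by rw [app_smul, ht, rs_smul]⟩

lemma epi_iff_locSurj (f : F ⟶ G) : Epi f ↔ LocSurj f := by
  refine ⟨fun hf ↦ ?_, LocSurj.epi⟩
  have h1 : ∀ (U V : X.Opens) (h : V ≤ U) (s : Γ(G, U)), s ∈ locImage f U →
      rs G h s ∈ locImage f V := by
    intro U V h s hs x hx
    obtain ⟨W, hW, hxW, t, ht⟩ := hs x (h hx)
    refine ⟨V ⊓ W, inf_le_left, ⟨hx, hxW⟩, rs F inf_le_right t, ?_⟩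
    rw [app_rs, ht, rs_rs, rs_rs]
  have h2 : ∀ (U : X.Opens) (s : Γ(G, U)),
      (∀ x ∈ U, ∃ (V : X.Opens) (h : V ≤ U), x ∈ V ∧ rs G h s ∈ locImage f V) →
      s ∈ locImage f U := by
    intro U s hs x hx
    obtain ⟨V, hV, hxV, hV'⟩ := hs x hx
    obtain ⟨W, hW, hxW, t, ht⟩ := hV' x hxV
    exact ⟨W, hW.trans hV, hxW, t, by rw [ht, rs_rs]⟩
  let I := subsheaf G (locImage f) h1 h2
  let i : I ⟶ G := subsheafι G (locImage f) h1 h2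
  have hmem : ∀ U (s : Γ(F, U)), f.app U s ∈ locImage f U :=
    fun U s x hx ↦ ⟨U, le_rfl, hx, s, by simp⟩
  let p : F ⟶ I := homOfSections (G := I)
    (fun U ↦
      { toFun := fun s ↦ (⟨f.app U s, hmem U s⟩ : locImage f U)
        map_add' := fun s t ↦ Subtype.ext (map_add _ _ _)
        map_smul' := fun r s ↦ Subtype.ext (app_smul f r s) })
    (fun U V h s ↦ Subtype.ext (app_rs f h s))
  have hpi : p ≫ i = f := hom_ext_app fun U s ↦ rfl
  have : Mono i := mono_of_injective _ fun U ↦ Subtype.val_injective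
  have : Epi i := epi_of_epi_fac hpi
  have : IsIso i := isIso_of_mono_of_epi i
  intro U s
  obtain ⟨t, rfl⟩ := (app_bijective i U).2 s
  exact t.2

/-- A section killed by `f` comes from a section of the kernel. -/
lemma exists_kernel_section (f : F ⟶ G) (U : X.Opens) (s : Γ(F, U)) (hs : f.app U s = 0) :
    ∃ t : Γ(kernel f, U), (kernel.ι f).app U t = s := by
  let N (U : X.Opens) : Submodule Γ(X, U) Γ(F, U) :=
    { carrier := {s | f.app U s = 0}
      zero_mem' := map_zero _
      add_mem' := fun {s t} (hs : f.app U s = 0) (ht : f.app U t = 0) ↦ by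
        change f.app U _ = 0
        rw [map_add, hs, ht, add_zero]
      smul_mem' := fun r s (hs : f.app U s = 0) ↦ by
        change f.app U _ = 0
        rw [app_smul, hs, smul_zero] }
  have h1 : ∀ (U V : X.Opens) (h : V ≤ U) (s : Γ(F, U)), s ∈ N U → rs F h s ∈ N V := by
    intro U V h s (hs : f.app U s = 0)
    change f.app V _ = 0
    rw [app_rs, hs, map_zero]
  have h2 : ∀ (U : X.Opens) (s : Γ(F, U)),
      (∀ x ∈ U, ∃ (V : X.Opens) (h : V ≤ U), x ∈ V ∧ rs F h s ∈ N V) → s ∈ N U := by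
    intro U s hs
    refine section_ext_of_local _ _ fun x hx ↦ ?_
    obtain ⟨V, h, hxV, (hs : f.app V _ = 0)⟩ := hs x hx
    refine ⟨V, h, hxV, ?_⟩
    rw [← app_rs, hs, map_zero]
  let i := subsheafι F N h1 h2
  have hi : i ≫ f = 0 := hom_ext_app fun U (s : N U) ↦ s.2
  refine ⟨(kernel.lift f i hi).app U (⟨s, hs⟩ : N U), ?_⟩
  exact congrArg (fun g : _ ⟶ F ↦ g.app U (⟨s, hs⟩ : N U)) (kernel.lift_ι f i hi)

lemma kernel_section_condition (f : F ⟶ G) (U : X.Opens) (t : Γ(kernel f, U)) :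
    f.app U ((kernel.ι f).app U t) = 0 :=
  congrArg (fun g : _ ⟶ G ↦ g.app U t) (kernel.condition f)

/-- Local exactness of `F ⟶ G ⟶ H` on sections. -/
def LocExact (f : F ⟶ G) (g : G ⟶ H) : Prop :=
  ∀ (U : X.Opens) (s : Γ(G, U)), g.app U s = 0 → ∀ x ∈ U, ∃ (V : X.Opens) (h : V ≤ U), x ∈ V ∧
    ∃ t : Γ(F, V), f.app V t = rs G h s

lemma exact_iff_locExact (f : F ⟶ G) (g : G ⟶ H) (w : f ≫ g = 0) :
    (ShortComplex.mk f g w).Exact ↔ LocExact f g := by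
  rw [ShortComplex.exact_iff_epi_kernel_lift, epi_iff_locSurj]
  constructor
  · intro h U s hs x hx
    obtain ⟨t, rfl⟩ := exists_kernel_section g U s hs
    obtain ⟨V, hV, hxV, r, hr⟩ := h U t x hx
    refine ⟨V, hV, hxV, r, ?_⟩
    rw [← app_rs, ← hr]
    exact (congrArg (fun q : _ ⟶ G ↦ q.app V r) (kernel.lift_ι g f w)).symm
  · intro h U s x hx
    obtain ⟨V, hV, hxV, r, hr⟩ := h U ((kernel.ι g).app U s) (kernel_section_condition g U s) x hx
    refine ⟨V, hV, hxV, r, app_injective (kernel.ι g) V ?_⟩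
    rw [app_rs]
    exact (congrArg (fun q : _ ⟶ G ↦ q.app V r) (kernel.lift_ι g f w)).trans hr

end Sections

/-! ### Quasi-isomorphisms and sections -/

section ConeExact
variable {C : Type*} [Category* C] [Abelian C] {K L : CochainComplex C ℤ}

/-- The differential of the mapping cone of `f` from `K^j ⊞ L^i`, without signs. -/
def coneFrom (f : K ⟶ L) (i j k : ℤ) : K.X j ⊞ L.X i ⟶ K.X k ⊞ L.X j :=
  biprod.desc (biprod.lift (K.d j k) (f.f j)) (biprod.lift 0 (L.d i j))

/-- The differential of the mapping cone of `f` from `K^k ⊞ L^j`, with the sign that makes its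
composite with `coneFrom` vanish. -/
def coneTo (f : K ⟶ L) (j k l : ℤ) : K.X k ⊞ L.X j ⟶ K.X l ⊞ L.X k :=
  biprod.desc (biprod.lift (K.d k l) (f.f k)) (biprod.lift 0 (-L.d j k))

lemma coneFrom_coneTo (f : K ⟶ L) (i j k l : ℤ) : coneFrom f i j k ≫ coneTo f j k l = 0 := by
  unfold coneFrom coneTo
  ext <;> simp

lemma lift_coneTo_eq_zero_iff (f : K ⟶ L) (j k l : ℤ) {A : C} (z : A ⟶ K.X k ⊞ L.X j) :
    z ≫ coneTo f j k l = 0 ↔ (z ≫ biprod.fst) ≫ K.d k l = 0 ∧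
      (z ≫ biprod.fst) ≫ f.f k = (z ≫ biprod.snd) ≫ L.d j k := by
  have h1 : coneTo f j k l ≫ biprod.fst = biprod.fst ≫ K.d k l := by
    unfold coneTo; ext <;> simp
  have h2 : coneTo f j k l ≫ biprod.snd = biprod.fst ≫ f.f k - biprod.snd ≫ L.d j k := by
    unfold coneTo; ext <;> simp
  constructor
  · intro h
    constructor
    · rw [Category.assoc, ← h1, reassoc_of% h, zero_comp]
    · rw [← sub_eq_zero, Category.assoc, Category.assoc, ← Preadditive.comp_sub, ← h2,
        reassoc_of% h, zero_comp]
  · rintro ⟨h3, h4⟩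
    apply biprod.hom_ext
    · rw [Category.assoc, h1, zero_comp, ← Category.assoc, h3]
    · rw [Category.assoc, h2, zero_comp, Preadditive.comp_sub, ← Category.assoc, ← Category.assoc,
        h4, sub_self]

lemma eq_comp_coneFrom_iff (f : K ⟶ L) (i j k : ℤ) {A : C} (z : A ⟶ K.X k ⊞ L.X j)
    (w : A ⟶ K.X j ⊞ L.X i) :
    z = w ≫ coneFrom f i j k ↔ z ≫ biprod.fst = (w ≫ biprod.fst) ≫ K.d j k ∧
      z ≫ biprod.snd = (w ≫ biprod.fst) ≫ f.f j + (w ≫ biprod.snd) ≫ L.d i j := by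
  have h1 : coneFrom f i j k ≫ biprod.fst = biprod.fst ≫ K.d j k := by
    unfold coneFrom; ext <;> simp
  have h2 : coneFrom f i j k ≫ biprod.snd = biprod.fst ≫ f.f j + biprod.snd ≫ L.d i j := by
    unfold coneFrom; ext <;> simp
  constructor
  · rintro rfl
    constructor
    · rw [Category.assoc, h1, Category.assoc]
    · rw [Category.assoc, h2, Preadditive.comp_add, Category.assoc, Category.assoc]
  · rintro ⟨h3, h4⟩
    apply biprod.hom_ext
    · rw [h3, Category.assoc, Category.assoc, h1]
    · rw [h4, Category.assoc w (coneFrom f i j k), h2, Preadditive.comp_add, Category.assoc,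
        Category.assoc]

lemma quasiIso_iff_cone_exact (f : K ⟶ L) :
    QuasiIso f ↔ ∀ i j k l : ℤ, i + 1 = j → j + 1 = k → k + 1 = l →
      (ShortComplex.mk _ _ (coneFrom_coneTo f i j k l)).Exact := by
  have prv : ∀ i j : ℤ, i + 1 = j → (ComplexShape.up ℤ).prev j = i := by
    intro i j h; rw [CochainComplex.prev]; omega
  have nxt : ∀ i j : ℤ, i + 1 = j → (ComplexShape.up ℤ).next i = j := by
    intro i j h; rw [CochainComplex.next]; omega
  have hR : ∀ i j k l : ℤ, (ShortComplex.mk _ _ (coneFrom_coneTo f i j k l)).Exact ↔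
      ∀ ⦃A : C⦄ (x : A ⟶ K.X k) (y : A ⟶ L.X j), x ≫ K.d k l = 0 → x ≫ f.f k = y ≫ L.d j k →
        ∃ (A' : C) (π : A' ⟶ A) (_ : Epi π) (x' : A' ⟶ K.X j) (y' : A' ⟶ L.X i),
          π ≫ x = x' ≫ K.d j k ∧ π ≫ y = x' ≫ f.f j + y' ≫ L.d i j := by
    intro i j k l
    rw [ShortComplex.exact_iff_exact_up_to_refinements]
    constructor
    · intro h A x y hx hxy
      obtain ⟨A', π, hπ, z, hz⟩ := h (biprod.lift x y : A ⟶ K.X k ⊞ L.X j)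
        ((lift_coneTo_eq_zero_iff f j k l _).mpr (by simp [hx, hxy]))
      obtain ⟨h1, h2⟩ := (eq_comp_coneFrom_iff f i j k _ _).mp hz
      exact ⟨A', π, hπ, z ≫ biprod.fst, z ≫ biprod.snd, by simpa using h1, by simpa using h2⟩
    · intro h A z hz
      obtain ⟨h1, h2⟩ := (lift_coneTo_eq_zero_iff f j k l z).mp hz
      obtain ⟨A', π, hπ, x', y', h1, h2⟩ := h _ _ h1 h2
      exact ⟨A', π, hπ, biprod.lift x' y', (eq_comp_coneFrom_iff f i j k _ _).mpr
        ⟨by simpa using h1, by simpa using h2⟩⟩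
  constructor
  · intro hf i j k l hij hjk hkl
    have hm : Mono (HomologicalComplex.homologyMap f k) := inferInstance
    have he : Epi (HomologicalComplex.homologyMap f j) := inferInstance
    rw [HomologicalComplex.mono_homologyMap_iff_up_to_refinements f j k l (prv _ _ hjk)
      (nxt _ _ hkl)] at hm
    rw [HomologicalComplex.epi_homologyMap_iff_up_to_refinements f i j k (prv _ _ hij)
      (nxt _ _ hjk)] at he
    rw [hR]
    intro A x y hx hxy
    obtain ⟨A₁, π₁, hπ₁, x₁, h₁⟩ := hm x hx y hxy
    obtain ⟨A₂, π₂, hπ₂, x₂, h₂, y₂, h₃⟩ := he (π₁ ≫ y - x₁ ≫ f.f j) (by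
      rw [Preadditive.sub_comp, Category.assoc, ← hxy, Category.assoc, f.comm, ← Category.assoc, h₁,
        Category.assoc, sub_self])
    refine ⟨A₂, π₂ ≫ π₁, inferInstance, π₂ ≫ x₁ + x₂, y₂, ?_, ?_⟩
    · rw [Preadditive.add_comp, h₂, add_zero, Category.assoc, h₁, Category.assoc]
    · rw [Preadditive.add_comp, add_assoc, ← h₃, Preadditive.comp_sub]
      simp
  · intro h
    rw [quasiIso_iff]
    intro j
    rw [quasiIsoAt_iff_isIso_homologyMap]
    have hm : Mono (HomologicalComplex.homologyMap f j) := by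
      rw [HomologicalComplex.mono_homologyMap_iff_up_to_refinements f (j - 1) j (j + 1)
        (prv _ _ (by omega)) (nxt _ _ rfl)]
      intro A x hx y hxy
      obtain ⟨A', π, hπ, x', y', h1, h2⟩ := (hR (j - 1 - 1) (j - 1) j (j + 1)).mp
        (h _ _ _ _ (by omega) (by omega) (by omega)) x y hx hxy
      exact ⟨A', π, hπ, x', h1⟩
    have he : Epi (HomologicalComplex.homologyMap f j) := by
      rw [HomologicalComplex.epi_homologyMap_iff_up_to_refinements f (j - 1) j (j + 1)
        (prv _ _ (by omega)) (nxt _ _ rfl)]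
      intro A y hy
      obtain ⟨A', π, hπ, x', y', h1, h2⟩ := (hR (j - 1) j (j + 1) (j + 1 + 1)).mp
        (h _ _ _ _ (by omega) (by omega) (by omega)) 0 y (by simp) (by simp [hy])
      exact ⟨A', π, hπ, x', by rw [← h1, comp_zero], y', h2⟩
    exact isIso_of_mono_of_epi _

end ConeExact

section
variable {X : Scheme.{u}} {F G H : X.Modules}

lemma biprod_app_ext {U : X.Opens} {s t : Γ(F ⊞ G, U)}
    (h1 : (biprod.fst : F ⊞ G ⟶ F).app U s = (biprod.fst : F ⊞ G ⟶ F).app U t)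
    (h2 : (biprod.snd : F ⊞ G ⟶ G).app U s = (biprod.snd : F ⊞ G ⟶ G).app U t) : s = t := by
  have key : ∀ s : Γ(F ⊞ G, U), (biprod.inl : F ⟶ F ⊞ G).app U ((biprod.fst : F ⊞ G ⟶ F).app U s) +
      (biprod.inr : G ⟶ F ⊞ G).app U ((biprod.snd : F ⊞ G ⟶ G).app U s) = s := fun s ↦
    congrArg (fun f : F ⊞ G ⟶ F ⊞ G ↦ f.app U s) (biprod.total (X := F) (Y := G))
  rw [← key s, ← key t, h1, h2]

/-- The section of `F ⊞ G` with the given components. -/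
def bpair {U : X.Opens} (s : Γ(F, U)) (t : Γ(G, U)) : Γ(F ⊞ G, U) :=
  (biprod.inl : F ⟶ F ⊞ G).app U s + (biprod.inr : G ⟶ F ⊞ G).app U t

@[simp] lemma fst_bpair {U : X.Opens} (s : Γ(F, U)) (t : Γ(G, U)) :
    (biprod.fst : F ⊞ G ⟶ F).app U (bpair s t) = s := by
  rw [bpair, map_add, ← comp_app_apply, ← comp_app_apply]; simp

@[simp] lemma snd_bpair {U : X.Opens} (s : Γ(F, U)) (t : Γ(G, U)) :
    (biprod.snd : F ⊞ G ⟶ G).app U (bpair s t) = t := by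
  rw [bpair, map_add, ← comp_app_apply, ← comp_app_apply]; simp

@[simp] lemma desc_bpair {U : X.Opens} (s : Γ(F, U)) (t : Γ(G, U)) (a : F ⟶ H) (b : G ⟶ H) :
    (biprod.desc a b).app U (bpair s t) = a.app U s + b.app U t := by
  rw [bpair, map_add, ← comp_app_apply, ← comp_app_apply]; simp

@[simp] lemma fst_lift_app {U : X.Opens} (s : Γ(H, U)) (a : H ⟶ F) (b : H ⟶ G) :
    (biprod.fst : F ⊞ G ⟶ F).app U ((biprod.lift a b).app U s) = a.app U s := by
  rw [← comp_app_apply]; simp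

@[simp] lemma snd_lift_app {U : X.Opens} (s : Γ(H, U)) (a : H ⟶ F) (b : H ⟶ G) :
    (biprod.snd : F ⊞ G ⟶ G).app U ((biprod.lift a b).app U s) = b.app U s := by
  rw [← comp_app_apply]; simp

lemma desc_app_eq {U : X.Opens} (s : Γ(F ⊞ G, U)) (a : F ⟶ H) (b : G ⟶ H) :
    (biprod.desc a b).app U s = a.app U ((biprod.fst : F ⊞ G ⟶ F).app U s) +
      b.app U ((biprod.snd : F ⊞ G ⟶ G).app U s) := by
  rw [biprod.desc_eq]; rfl

lemma lift_app_eq {U : X.Opens} (s : Γ(H, U)) (a : H ⟶ F) (b : H ⟶ G) :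
    (biprod.lift a b).app U s = bpair (a.app U s) (b.app U s) := by
  apply biprod_app_ext <;> simp

lemma bpair_ext_iff {U : X.Opens} {s : Γ(F ⊞ G, U)} {a : Γ(F, U)} {b : Γ(G, U)} :
    s = bpair a b ↔ (biprod.fst : F ⊞ G ⟶ F).app U s = a ∧ (biprod.snd : F ⊞ G ⟶ G).app U s = b :=
  ⟨fun h ↦ by simp [h], fun h ↦ biprod_app_ext (by simp [h.1]) (by simp [h.2])⟩

lemma rs_bpair {U V : X.Opens} (h : V ≤ U) (s : Γ(F, U)) (t : Γ(G, U)) :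
    rs (F ⊞ G) h (bpair s t) = bpair (rs F h s) (rs G h t) := by
  rw [bpair_ext_iff, app_rs, app_rs]; simp

variable {K L : CochainComplex X.Modules ℤ}

lemma exactAt_iff_locExact (i j k : ℤ) (hij : i + 1 = j) (hjk : j + 1 = k) :
    K.ExactAt j ↔ LocExact (K.d i j) (K.d j k) := by
  rw [K.exactAt_iff' i j k (by rw [CochainComplex.prev]; omega)
    (by rw [CochainComplex.next]; omega)]
  exact exact_iff_locExact _ _ _

/-- The exactness of the mapping cone of `f` at `K^k ⊕ L^j`, in terms of local sections. -/
def LocCone (f : K ⟶ L) (i j k l : ℤ) : Prop :=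
  ∀ (U : X.Opens) (x : Γ(K.X k, U)) (y : Γ(L.X j, U)), (K.d k l).app U x = 0 →
    (f.f k).app U x = (L.d j k).app U y → ∀ p ∈ U, ∃ (V : X.Opens) (h : V ≤ U), p ∈ V ∧
      ∃ (x' : Γ(K.X j, V)) (y' : Γ(L.X i, V)), (K.d j k).app V x' = rs _ h x ∧
        (f.f j).app V x' + (L.d i j).app V y' = rs _ h y

lemma quasiIso_iff_locCone (f : K ⟶ L) :
    QuasiIso f ↔ ∀ i j k l : ℤ, i + 1 = j → j + 1 = k → k + 1 = l → LocCone f i j k l := by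
  rw [quasiIso_iff_cone_exact]
  refine forall₄_congr fun i j k l ↦ forall₃_congr fun _ _ _ ↦ ?_
  refine (exact_iff_locExact _ _ (coneFrom_coneTo f i j k l)).trans ?_
  unfold coneFrom coneTo
  constructor
  · intro h U x y hx hxy p hp
    obtain ⟨V, hV, hpV, z, hz⟩ := h U (bpair x y) (by
      rw [desc_bpair, lift_app_eq, lift_app_eq, hx, hxy]
      apply biprod_app_ext <;> simp) p hp
    rw [rs_bpair, bpair_ext_iff, desc_app_eq, lift_app_eq, lift_app_eq] at hz
    exact ⟨V, hV, hpV, (biprod.fst : K.X j ⊞ L.X i ⟶ _).app V z,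
      (biprod.snd : K.X j ⊞ L.X i ⟶ _).app V z, by simpa using hz.1, by simpa using hz.2⟩
  · intro h U z hz p hp
    rw [desc_app_eq, lift_app_eq, lift_app_eq] at hz
    have h1 := congrArg ((biprod.fst : K.X l ⊞ L.X k ⟶ _).app U) hz
    have h2 := congrArg ((biprod.snd : K.X l ⊞ L.X k ⟶ _).app U) hz
    simp only [map_add, fst_bpair, snd_bpair, map_zero, zero_app_apply, add_zero,
      neg_app_apply] at h1 h2
    obtain ⟨V, hV, hpV, x', y', e1, e2⟩ := h U _ _ h1 (eq_of_sub_eq_zero (by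
      rw [sub_eq_add_neg]; exact h2)) p hp
    refine ⟨V, hV, hpV, bpair x' y', ?_⟩
    rw [desc_bpair, lift_app_eq, lift_app_eq]
    apply biprod_app_ext
    · rw [app_rs, ← e1]; simp
    · rw [app_rs, ← e2]; simp

end

/-! ### Sheaves locally generated by sections -/

section Generation
variable {X : Scheme.{u}}

/-- A morphism of sheaves of modules on sections, as a linear map. -/
def appLin {F G : X.Modules} (f : F ⟶ G) (U : X.Opens) : Γ(F, U) →ₗ[Γ(X, U)] Γ(G, U) where
  toFun := f.app U
  map_add' := map_add _
  map_smul' := app_smul f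

/-- A section in the span of `e` remains so after restriction. -/
lemma rs_mem_span {F : X.Modules} {I : Type*} {U₀ U V : X.Opens} (e : I → Γ(F, U₀)) (h₀ : U ≤ U₀)
    (h : V ≤ U) {s : Γ(F, U)}
    (hs : s ∈ Submodule.span Γ(X, U) (Set.range fun i ↦ rs F h₀ (e i))) :
    rs F h s ∈ Submodule.span Γ(X, V) (Set.range fun i ↦ rs F (h.trans h₀) (e i)) := by
  induction hs using Submodule.span_induction with
  | mem x hx =>
    obtain ⟨i, rfl⟩ := hx
    exact Submodule.subset_span ⟨i, by simp⟩
  | zero => rw [map_zero]; exact zero_mem _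
  | add x y _ _ hx hy => rw [map_add]; exact add_mem hx hy
  | smul r x _ hx => rw [rs_smul]; exact Submodule.smul_mem _ _ hx

/-- The sections `e` generate `F` over `U₀`: locally on `U₀` every section is a linear combination
of the sections `e`. -/
def LocGen (F : X.Modules) {I : Type*} {U₀ : X.Opens} (e : I → Γ(F, U₀)) : Prop :=
  ∀ (U : X.Opens) (s : Γ(F, U)) (h₀ : U ≤ U₀), ∀ x ∈ U, ∃ (V : X.Opens) (h : V ≤ U), x ∈ V ∧
    rs F h s ∈ Submodule.span Γ(X, V) (Set.range fun i ↦ rs F (h.trans h₀) (e i))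

/-- The free sheaf of modules on `I`. -/
def freeMod (X : Scheme.{u}) (I : Type u) : X.Modules :=
  SheafOfModules.free (R := X.ringCatSheaf) I

/-- A section over `X`, as a global section of the underlying presheaf. -/
def globalSection (N : X.Modules) (s : Γ(N, ⊤)) : SheafOfModules.sections (R := X.ringCatSheaf) N :=
  PresheafOfModules.sectionsMk (fun V ↦ rs N (U := ⊤) (V := V.unop) le_top s) (by
    intro V W f
    exact rs_rs (F := N) le_top (leOfHom f.unop) s)

lemma globalSection_eval (N : X.Modules) (σ : SheafOfModules.sections (R := X.ringCatSheaf) N) :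
    globalSection N (σ.eval (op ⊤)) = σ := by
  apply PresheafOfModules.sections_ext
  intro V
  exact PresheafOfModules.sections_property σ (homOfLE le_top).op

/-- The morphism from the free sheaf of modules with prescribed values on the standard basis. -/
def freeDesc {N : X.Modules} {I : Type u} (e : I → Γ(N, ⊤)) : freeMod X I ⟶ N :=
  (SheafOfModules.freeHomEquiv (R := X.ringCatSheaf) N).symm (fun i ↦ globalSection N (e i))

/-- The standard basis of the free sheaf of modules. -/
def freeBasis (X : Scheme.{u}) (I : Type u) (i : I) : Γ(freeMod X I, ⊤) :=
  (SheafOfModules.freeSection (R := X.ringCatSheaf) i).eval (op ⊤)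

lemma freeDesc_basis {N : X.Modules} {I : Type u} (e : I → Γ(N, ⊤)) (i : I) :
    (freeDesc e).app ⊤ (freeBasis X I i) = e i := by
  have h := SheafOfModules.sectionsMap_freeHomEquiv_symm_freeSection
    (R := X.ringCatSheaf) (fun i ↦ globalSection N (e i)) i
  exact (congrArg (fun t : SheafOfModules.sections (R := X.ringCatSheaf) N ↦ t.eval (op ⊤)) h).trans
    (rs_self _ _)

lemma free_hom_ext {N : X.Modules} {I : Type u} {f g : freeMod X I ⟶ N}
    (h : ∀ i, f.app ⊤ (freeBasis X I i) = g.app ⊤ (freeBasis X I i)) : f = g := by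
  apply (SheafOfModules.freeHomEquiv (R := X.ringCatSheaf) N).injective
  funext i
  rw [← globalSection_eval N (SheafOfModules.freeHomEquiv (R := X.ringCatSheaf) N f i),
    ← globalSection_eval N (SheafOfModules.freeHomEquiv (R := X.ringCatSheaf) N g i)]
  exact congrArg (globalSection N) (h i)

/-- The sections of `F` that are locally linear combinations of the global sections `e`. -/
def locSpan (F : X.Modules) {I : Type*} (e : I → Γ(F, ⊤)) (U : X.Opens) :
    Submodule Γ(X, U) Γ(F, U) where
  carrier := {s | ∀ x ∈ U, ∃ (V : X.Opens) (h : V ≤ U), x ∈ V ∧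
    rs F h s ∈ Submodule.span Γ(X, V) (Set.range fun i ↦ rs F le_top (e i))}
  zero_mem' := fun x hx ↦ ⟨U, le_rfl, hx, by rw [map_zero]; exact zero_mem _⟩
  add_mem' := by
    intro s t hs ht x hx
    obtain ⟨V, h, hxV, hV⟩ := hs x hx
    obtain ⟨W, h', hxW, hW⟩ := ht x hx
    refine ⟨V ⊓ W, inf_le_left.trans h, ⟨hxV, hxW⟩, ?_⟩
    rw [map_add, ← rs_rs h inf_le_left, ← rs_rs h' inf_le_right]
    exact add_mem (rs_mem_span e _ _ hV) (rs_mem_span e _ _ hW)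
  smul_mem' := by
    intro r s hs x hx
    obtain ⟨V, h, hxV, hV⟩ := hs x hx
    exact ⟨V, h, hxV, by rw [rs_smul]; exact Submodule.smul_mem _ _ hV⟩

lemma rs_mem_locSpan (F : X.Modules) {I : Type*} (e : I → Γ(F, ⊤)) (U V : X.Opens) (h : V ≤ U)
    (s : Γ(F, U)) (hs : s ∈ locSpan F e U) : rs F h s ∈ locSpan F e V := by
  intro x hx
  obtain ⟨W, hW, hxW, hsW⟩ := hs x (h hx)
  refine ⟨V ⊓ W, inf_le_left, ⟨hx, hxW⟩, ?_⟩
  have := rs_mem_span e le_top (inf_le_right : V ⊓ W ≤ W) hsW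
  rwa [rs_rs] at this ⊢

lemma mem_locSpan_of_local (F : X.Modules) {I : Type*} (e : I → Γ(F, ⊤)) (U : X.Opens)
    (s : Γ(F, U)) (hs : ∀ x ∈ U, ∃ (V : X.Opens) (h : V ≤ U), x ∈ V ∧ rs F h s ∈ locSpan F e V) :
    s ∈ locSpan F e U := by
  intro x hx
  obtain ⟨V, h, hxV, hV⟩ := hs x hx
  obtain ⟨W, hW, hxW, hsW⟩ := hV x hxV
  exact ⟨W, hW.trans h, hxW, by rwa [rs_rs] at hsW⟩

/-- Global sections generate a sheaf of modules if and only if the associated morphism from the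
free sheaf is an epimorphism. -/
lemma epi_freeDesc_iff {N : X.Modules} {I : Type u} (e : I → Γ(N, ⊤)) :
    Epi (freeDesc e) ↔ LocGen N e := by
  constructor
  · intro he
    let S := subsheaf N (locSpan N e) (rs_mem_locSpan N e) (mem_locSpan_of_local N e)
    let ι : S ⟶ N := subsheafι N (locSpan N e) (rs_mem_locSpan N e) (mem_locSpan_of_local N e)
    let e' (i : I) : Γ(S, ⊤) := (⟨e i, fun x hx ↦ ⟨⊤, le_rfl, hx, by
      rw [rs_self]; exact Submodule.subset_span ⟨i, rs_self _ _⟩⟩⟩ : locSpan N e ⊤)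
    have hι : freeDesc e' ≫ ι = freeDesc e := free_hom_ext fun i ↦ by
      rw [comp_app_apply, freeDesc_basis, freeDesc_basis]
      rfl
    have : Mono ι := mono_of_injective _ fun U ↦ Subtype.val_injective
    have : Epi ι := epi_of_epi_fac hι
    have : IsIso ι := isIso_of_mono_of_epi ι
    intro U s h₀
    obtain ⟨t, rfl⟩ := (app_bijective ι U).2 s
    exact t.2
  · intro he
    refine LocSurj.epi fun U s x hx ↦ ?_
    obtain ⟨V, h, hxV, hV⟩ := he U s le_top x hx
    refine ⟨V, h, hxV, ?_⟩
    change rs N h s ∈ LinearMap.range (appLin (freeDesc e) V)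
    refine Submodule.span_le.mpr ?_ hV
    rintro _ ⟨i, rfl⟩
    exact ⟨rs (freeMod X I) le_top (freeBasis X I i),
      (app_rs (freeDesc e) le_top (freeBasis X I i)).trans (by rw [freeDesc_basis])⟩

lemma locGen_freeBasis (I : Type u) : LocGen (freeMod X I) (freeBasis X I) := by
  rw [← epi_freeDesc_iff]
  have : freeDesc (freeBasis X I) = 𝟙 (freeMod X I) := free_hom_ext fun i ↦ freeDesc_basis _ _
  rw [this]
  infer_instance

lemma mem_span_range_iff {R M I : Type*} [CommRing R] [AddCommGroup M] [Module R M] [Fintype I]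
    (e : I → M) (s : M) : s ∈ Submodule.span R (Set.range e) ↔ ∃ a : I → R, ∑ i, a i • e i = s :=
  Submodule.mem_span_range_iff_exists_fun R

/-- A finite presentation of `F` over `U₀` in terms of sections: generators `e` and relations `r`
that generate all relations locally. -/
structure IsConcretePresentation (F : X.Modules) {I J : Type*} [Fintype I] {U₀ : X.Opens}
    (e : I → Γ(F, U₀)) (r : J → I → Γ(X, U₀)) : Prop where
  gen : LocGen F e
  rel : ∀ j, ∑ i, r j i • e i = 0
  exact : ∀ (U : X.Opens) (h : U ≤ U₀) (a : I → Γ(X, U)), ∑ i, a i • rs F h (e i) = 0 →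
    ∀ x ∈ U, ∃ (V : X.Opens) (h' : V ≤ U), x ∈ V ∧
      (fun i ↦ rO h' (a i)) ∈
        Submodule.span Γ(X, V) (Set.range fun j i ↦ rO (h'.trans h) (r j i))

lemma freeDesc_sum {N : X.Modules} {I : Type u} [Fintype I] (e : I → Γ(N, ⊤)) {U : X.Opens}
    (a : I → Γ(X, U)) : (freeDesc e).app U (∑ i, a i • rs _ le_top (freeBasis X I i)) =
      ∑ i, a i • rs _ le_top (e i) := by
  rw [map_sum]
  refine Finset.sum_congr rfl fun i _ ↦ ?_
  rw [app_smul, app_rs, freeDesc_basis]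

/-- A presentation by global sections in terms of sections is a presentation. -/
lemma IsConcretePresentation.exists_presentation {N : X.Modules} {I J : Type u} [Fintype I]
    [Finite J] {e : I → Γ(N, ⊤)} {r : J → I → Γ(X, ⊤)} (h : IsConcretePresentation N e r) :
    ∃ p : SheafOfModules.Presentation (R := X.ringCatSheaf) N, p.IsFinite := by
  have he : Epi (freeDesc e) := (epi_freeDesc_iff e).mpr h.gen
  have hk (j : J) : ∃ t : Γ(kernel (freeDesc e), ⊤), (kernel.ι (freeDesc e)).app ⊤ t =
      ∑ i, r j i • freeBasis X I i := by
    apply exists_kernel_section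
    have := freeDesc_sum e (r j)
    simp only [rs_self] at this
    rw [this, h.rel]
  choose k hk using hk
  have hkg : LocGen (kernel (freeDesc e)) k := by
    intro U s _ x hx
    obtain ⟨V, hV, hxV, hsV⟩ := locGen_freeBasis I U ((kernel.ι (freeDesc e)).app U s) le_top x hx
    obtain ⟨a, ha⟩ := (mem_span_range_iff _ _).mp hsV
    have h0 : ∑ i, a i • rs N (le_top : V ≤ ⊤) (e i) = 0 := by
      rw [← freeDesc_sum, ha, app_rs, kernel_section_condition, map_zero]
    obtain ⟨W, hW, hxW, hWa⟩ := h.exact V le_top a h0 x hxV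
    refine ⟨W, hW.trans hV, hxW, ?_⟩
    have hfin := Fintype.ofFinite J
    obtain ⟨b, hb⟩ := (mem_span_range_iff _ _).mp hWa
    refine (mem_span_range_iff _ _).mpr ⟨b, app_injective (kernel.ι (freeDesc e)) W ?_⟩
    rw [map_sum, app_rs, ← rs_rs hV hW, ← ha, map_sum]
    have hb' : ∀ i, rO hW (a i) = ∑ j, b j * rO le_top (r j i) := fun i ↦ by
      rw [← congrFun hb i]
      simp
    simp only [app_smul, app_rs, hk, map_sum, rs_smul, rs_rs, hb', Finset.smul_sum,
      Finset.sum_smul, smul_smul]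
    exact Finset.sum_comm
  have hke : Epi (freeDesc k) := (epi_freeDesc_iff k).mpr hkg
  let p : SheafOfModules.Presentation (R := X.ringCatSheaf) N :=
    { generators := { I := I, s := fun i ↦ globalSection N (e i), epi := he }
      relations := { I := J, s := fun j ↦ globalSection _ (k j), epi := hke } }
  exact ⟨p, SheafOfModules.Presentation.IsFinite.mk
    (isFiniteType_generators := ⟨inferInstanceAs (Finite I)⟩)
    (isFiniteType_relations := ⟨inferInstanceAs (Finite J)⟩)⟩

/-- A finite presentation of `F|_U` gives a finite presentation of the sheaf of modules on the slice
site over `U`. -/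
lemma exists_presentation_over (F : X.Modules) (U : X.Opens)
    (p : SheafOfModules.Presentation (R := U.toScheme.ringCatSheaf) (F.restrict U.ι))
    (hp : p.IsFinite) :
    ∃ q : SheafOfModules.Presentation (SheafOfModules.over (R := X.ringCatSheaf) F U),
      q.IsFinite := by
  let E : SheafOfModules.{u} (X.ringCatSheaf.over U) ≌ SheafOfModules.{u} U.toScheme.ringCatSheaf :=
    Scheme.Modules.overEquiv U
  let η : SheafOfModules.unit (X.ringCatSheaf.over U) ≅
      E.inverse.obj (SheafOfModules.unit U.toScheme.ringCatSheaf) :=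
    E.unitIso.app _ ≪≫ E.inverse.mapIso (by
      exact (Scheme.Modules.overFunctorEquiv U).app (SheafOfModules.unit X.ringCatSheaf) ≪≫
        Scheme.Modules.restrictUnitIso U.ι)
  have : PreservesColimitsOfSize.{u, u} E.inverse :=
    E.symm.toAdjunction.leftAdjoint_preservesColimits
  let iso : E.inverse.obj (F.restrict U.ι) ≅ SheafOfModules.over (R := X.ringCatSheaf) F U :=
    E.inverse.mapIso ((Scheme.Modules.overFunctorEquiv U).app F).symm ≪≫ (E.unitIso.app _).symm
  let q0 := SheafOfModules.Presentation.map.{u, u, u} p E.inverse η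
  have h0 : q0.IsFinite := SheafOfModules.Presentation.IsFinite.mk
    (isFiniteType_generators := ⟨hp.isFiniteType_generators.finite⟩)
    (isFiniteType_relations := ⟨hp.isFiniteType_relations.finite⟩)
  exact ⟨SheafOfModules.Presentation.ofIsIso.{u, u, u} iso.hom q0, inferInstance⟩

/-- A finite presentation of the sheaf of modules on the slice site over `U` gives a finite
presentation of `F|_U`. -/
lemma exists_presentation_restrict (F : X.Modules) (U : X.Opens)
    (p : SheafOfModules.Presentation (SheafOfModules.over (R := X.ringCatSheaf) F U))
    (hp : p.IsFinite) :
    ∃ q : SheafOfModules.Presentation (R := U.toScheme.ringCatSheaf) (F.restrict U.ι),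
      q.IsFinite := by
  let E : SheafOfModules.{u} (X.ringCatSheaf.over U) ≌ SheafOfModules.{u} U.toScheme.ringCatSheaf :=
    Scheme.Modules.overEquiv U
  have : PreservesColimitsOfSize.{u, u} E.functor :=
    E.toAdjunction.leftAdjoint_preservesColimits
  let η : SheafOfModules.unit U.toScheme.ringCatSheaf ≅
      E.functor.obj (SheafOfModules.unit (X.ringCatSheaf.over U)) := by
    exact ((Scheme.Modules.overFunctorEquiv U).app (SheafOfModules.unit X.ringCatSheaf) ≪≫
        Scheme.Modules.restrictUnitIso U.ι).symm
  let q0 := SheafOfModules.Presentation.map.{u, u, u} p E.functor η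
  have h0 : q0.IsFinite := SheafOfModules.Presentation.IsFinite.mk
    (isFiniteType_generators := ⟨hp.isFiniteType_generators.finite⟩)
    (isFiniteType_relations := ⟨hp.isFiniteType_relations.finite⟩)
  let iso : Iso (C := SheafOfModules.{u} U.toScheme.ringCatSheaf)
      (E.functor.obj (SheafOfModules.over (R := X.ringCatSheaf) F U)) (F.restrict U.ι) :=
    (Scheme.Modules.overFunctorEquiv U).app F
  have hiso : @IsIso (SheafOfModules.{u} U.toScheme.ringCatSheaf) _ _ _ iso.hom := iso.isIso_hom
  exact ⟨@SheafOfModules.Presentation.ofIsIso.{u, u, u} _ _ _ _ _ _ _ _ iso.hom hiso q0,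
    SheafOfModules.Presentation.IsFinite.mk
    (isFiniteType_generators := ⟨hp.isFiniteType_generators.finite⟩)
    (isFiniteType_relations := ⟨hp.isFiniteType_relations.finite⟩)⟩

/-- A sheaf of modules with local finite presentations is coherent. -/
lemma isCoherent_of_presentations (F : X.Modules)
    (h : ∀ x : X, ∃ (U : X.Opens), x ∈ U ∧
      ∃ p : SheafOfModules.Presentation (R := U.toScheme.ringCatSheaf) (F.restrict U.ι),
        p.IsFinite) : IsCoherent F := by
  choose U hx p hp using h
  choose q hq using fun x ↦ exists_presentation_over F (U x) (p x) (hp x)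
  have hU : (Opens.grothendieckTopology X).CoversTop U := by
    intro V x hxV
    exact ⟨V ⊓ U x, homOfLE inf_le_left, ⟨x, ⟨homOfLE inf_le_right⟩⟩, ⟨hxV, hx x⟩⟩
  let Q : SheafOfModules.QuasicoherentData.{u} (R := X.ringCatSheaf) F :=
    SheafOfModules.QuasicoherentData.mk (C := X.Opens) (J := Opens.grothendieckTopology X)
      (R := X.ringCatSheaf) (M := F) X U hU q
  exact SheafOfModules.IsFinitePresentation.mk (C := X.Opens) (J := Opens.grothendieckTopology X)
    (R := X.ringCatSheaf) (exists_quasicoherentData := ⟨Q,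
      SheafOfModules.QuasicoherentData.IsFinitePresentation.mk (C := X.Opens)
        (J := Opens.grothendieckTopology X) (R := X.ringCatSheaf) (M := F) (q := Q) hq⟩)

/-- Coherent sheaves have finite presentations over the members of an open cover. -/
lemma IsCoherent.exists_presentation {F : X.Modules} (hF : IsCoherent F) (x : X) :
    ∃ U : X.Opens, x ∈ U ∧
      ∃ p : SheafOfModules.Presentation (R := U.toScheme.ringCatSheaf) (F.restrict U.ι),
        p.IsFinite := by
  obtain ⟨⟨I, W, cov, pres⟩, hfin⟩ :=
    SheafOfModules.IsFinitePresentation.exists_quasicoherentData (self := hF)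
  have hcov := (Opens.coversTop_iff X W).mp cov
  obtain ⟨i, hi⟩ : ∃ i, x ∈ W i := by
    have : x ∈ (⊤ : X.Opens) := trivial
    rw [← hcov] at this
    exact Opens.mem_iSup.mp this
  have hfi : (pres i).IsFinite := hfin.isFinite_presentation i
  refine ⟨W i, hi, ?_⟩
  exact exists_presentation_restrict F (W i) (pres i) hfi

lemma restrict_smul (F : X.Modules) (U : X.Opens) (V : U.toScheme.Opens)
    (r : Γ(X, U.ι ''ᵁ V)) (s : Γ(F, U.ι ''ᵁ V)) :
    (HSMul.hSMul (α := Γ(U.toScheme, V)) (β := Γ(F.restrict U.ι, V)) r s : Γ(F.restrict U.ι, V)) =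
    r • s := by
  have : (U.ι.appIso V).inv r = r := by rw [Scheme.Opens.ι_appIso]; rfl
  exact congrArg (fun t : Γ(X, U.ι ''ᵁ V) ↦ t • s) this

lemma image_preimage_of_le {U W : X.Opens} (h : W ≤ U) : U.ι ''ᵁ (U.ι ⁻¹ᵁ W) = W := by
  rw [Scheme.Hom.image_preimage_eq_opensRange_inf, Scheme.Opens.opensRange_ι, inf_eq_right.mpr h]

lemma image_ι_le {U : X.Opens} (V : U.toScheme.Opens) : U.ι ''ᵁ V ≤ U := by
  have := U.ι.image_le_opensRange V
  rwa [Scheme.Opens.opensRange_ι] at this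

lemma mem_span_restrict_iff {F : X.Modules} {U : X.Opens} {I : Type*} [Fintype I]
    {V : U.toScheme.Opens} (e : I → Γ(F.restrict U.ι, V)) (s : Γ(F.restrict U.ι, V)) :
    s ∈ Submodule.span Γ(U.toScheme, V) (Set.range e) ↔
      Membership.mem (Submodule.span (M := Γ(F, U.ι ''ᵁ V)) Γ(X, U.ι ''ᵁ V) (Set.range e)) s := by
  rw [mem_span_range_iff]
  refine Iff.trans ?_ (mem_span_range_iff (M := Γ(F, U.ι ''ᵁ V)) e s).symm
  refine exists_congr fun a ↦ Eq.congr_left ?_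
  exact Finset.sum_congr rfl fun i _ ↦ restrict_smul F U V (a i) (e i)

lemma LocGen.of_restrict {F : X.Modules} {U : X.Opens} {I : Type*} [Fintype I]
    {e : I → Γ(F.restrict U.ι, ⊤)} (h : LocGen (F.restrict U.ι) e) :
    LocGen F (U₀ := U.ι ''ᵁ ⊤) (fun i ↦ (e i : Γ(F, U.ι ''ᵁ ⊤))) := by
  intro W s hW x hx
  have hWU : W ≤ U := hW.trans (image_ι_le _)
  have hWe := image_preimage_of_le hWU
  obtain ⟨V, hV, hxV, hs⟩ := h (U.ι ⁻¹ᵁ W) (rs F hWe.le s) le_top ⟨x, hWU hx⟩ hx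
  have hVW : U.ι ''ᵁ V ≤ W := (U.ι.image_mono hV).trans hWe.le
  refine ⟨U.ι ''ᵁ V, hVW, ⟨⟨x, hWU hx⟩, hxV, rfl⟩, ?_⟩
  have h2 := (mem_span_restrict_iff (F := F) (V := V)
    (fun i ↦ rs F (U.ι.image_mono le_top) (e i)) (rs F (U.ι.image_mono hV) (rs F hWe.le s))).mp hs
  rw [rs_rs] at h2
  exact h2

lemma LocGen.restrict {F : X.Modules} {U : X.Opens} {I : Type*} [Fintype I]
    {e : I → Γ(F, U)} (h : LocGen F e) :
    LocGen (F.restrict U.ι) (U₀ := ⊤)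
      (fun i ↦ (rs F (image_ι_le ⊤) (e i) : Γ(F, U.ι ''ᵁ ⊤))) := by
  intro W (s : Γ(F, U.ι ''ᵁ W)) hW x hx
  obtain ⟨V, hV, hxV, hs⟩ := h (U.ι ''ᵁ W) s (image_ι_le _) x.1 ⟨x, hx, rfl⟩
  have hVU := hV.trans (image_ι_le _)
  have hVe := image_preimage_of_le hVU
  have hVW : U.ι ⁻¹ᵁ V ≤ W := by
    intro y hy
    obtain ⟨z, hz, hzy⟩ := hV hy
    rwa [← U.ι.isOpenEmbedding.injective hzy]
  refine ⟨U.ι ⁻¹ᵁ V, hVW, hxV, ?_⟩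
  have h2 := rs_mem_span e hVU hVe.le hs
  rw [rs_rs] at h2
  refine (mem_span_restrict_iff (F := F) (V := U.ι ⁻¹ᵁ V) _ _).mpr ?_
  have heq : (fun i ↦ rs F (U.ι.image_mono le_top) (rs F (image_ι_le ⊤) (e i))) =
      fun i ↦ rs F (hVe.le.trans hVU) (e i) := funext fun i ↦ rs_rs _ _ _
  exact (congrArg (fun t : I → Γ(F, U.ι ''ᵁ U.ι ⁻¹ᵁ V) ↦ rs F (hVe.le.trans hV) s ∈
    Submodule.span Γ(X, U.ι ''ᵁ U.ι ⁻¹ᵁ V) (Set.range t)) heq).mpr h2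

lemma IsConcretePresentation.restrict {F : X.Modules} {I J : Type*} [Fintype I] [Fintype J]
    {U : X.Opens} {e : I → Γ(F, U)} {r : J → I → Γ(X, U)} (h : IsConcretePresentation F e r) :
    IsConcretePresentation (F.restrict U.ι) (U₀ := ⊤)
      (fun i ↦ (rs F (image_ι_le ⊤) (e i) : Γ(F, U.ι ''ᵁ ⊤)))
      (fun j i ↦ (rO (image_ι_le ⊤) (r j i) : Γ(X, U.ι ''ᵁ ⊤))) where
  gen := h.gen.restrict
  rel j := by
    have h1 := congrArg (rs F (image_ι_le (⊤ : U.toScheme.Opens))) (h.rel j)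
    rw [map_sum, map_zero] at h1
    refine Eq.trans (Finset.sum_congr rfl fun i _ ↦ ?_) h1
    rw [rs_smul]
    exact restrict_smul F U ⊤ _ _
  exact := by
    intro W _ (a' : I → Γ(X, U.ι ''ᵁ W)) ha x hx
    have ha' : ∑ i, a' i • rs F (image_ι_le W) (e i) = 0 := by
      refine Eq.trans (Finset.sum_congr rfl fun i _ ↦ ?_) ha
      refine Eq.trans ?_ (restrict_smul F U W _ _).symm
      congr 1
      exact (rs_rs (F := F) (image_ι_le ⊤) (U.ι.image_mono le_top) (e i)).symm
    obtain ⟨V, hV, hxV, hs⟩ := h.exact (U.ι ''ᵁ W) (image_ι_le _) a' ha' x.1 ⟨x, hx, rfl⟩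
    have hVU := hV.trans (image_ι_le _)
    have hVe := image_preimage_of_le hVU
    have hVW : U.ι ⁻¹ᵁ V ≤ W := by
      intro y hy
      obtain ⟨z, hz, hzy⟩ := hV hy
      rwa [← U.ι.isOpenEmbedding.injective hzy]
    refine ⟨U.ι ⁻¹ᵁ V, hVW, hxV, ?_⟩
    obtain ⟨b, hb⟩ := (mem_span_range_iff _ _).mp hs
    refine (mem_span_range_iff _ _).mpr ⟨fun j ↦ (rO hVe.le (b j) : Γ(X, U.ι ''ᵁ U.ι ⁻¹ᵁ V)), ?_⟩
    funext i
    have h0 : ∑ j, b j * rO hVU (r j i) = rO hV (a' i) := by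
      rw [← congrFun hb i, Finset.sum_apply]
      rfl
    have h1 := congrArg (rO hVe.le) h0
    rw [map_sum, rO_rO] at h1
    rw [Finset.sum_apply]
    refine Eq.trans (Finset.sum_congr rfl fun j _ ↦ ?_) h1
    rw [map_mul, rO_rO]
    exact congrArg (fun t ↦ rO hVe.le (b j) * t)
      (rO_rO (X := X) (image_ι_le ⊤) (U.ι.image_mono le_top) (r j i))

/-- A sheaf of modules with concrete finite presentations near every point is coherent. -/
lemma isCoherent_of_isConcretePresentation (F : X.Modules)
    (h : ∀ x : X, ∃ (U : X.Opens), x ∈ U ∧ ∃ (m n : ℕ) (e : Fin n → Γ(F, U))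
      (r : Fin m → Fin n → Γ(X, U)), IsConcretePresentation F e r) : IsCoherent F := by
  refine isCoherent_of_presentations F fun x ↦ ?_
  obtain ⟨U, hx, m, n, e, r, h⟩ := h x
  refine ⟨U, hx, ?_⟩
  have h1 : IsConcretePresentation F (I := ULift.{u} (Fin n)) (J := ULift.{u} (Fin m))
      (fun i ↦ e i.down) (fun j i ↦ r j.down i.down) := by
    have hs : ∀ {V : X.Opens} {G : X.Modules} (a : Fin n → Γ(G, V)),
        ∑ i : ULift.{u} (Fin n), a i.down = ∑ i, a i := fun a ↦
      Fintype.sum_equiv Equiv.ulift _ _ fun _ ↦ rfl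
    refine ⟨?_, ?_, ?_⟩
    · intro W s hW x hx
      obtain ⟨V, hV, hxV, hsV⟩ := h.gen W s hW x hx
      refine ⟨V, hV, hxV, Submodule.span_mono ?_ hsV⟩
      rintro _ ⟨i, rfl⟩
      exact ⟨⟨i⟩, rfl⟩
    · intro j
      rw [hs (fun i ↦ r j.down i • e i)]
      exact h.rel j.down
    · intro W hW a ha x hx
      rw [← Fintype.sum_equiv Equiv.ulift.symm (fun i ↦ a ⟨i⟩ • rs F hW (e i)) _ fun _ ↦ rfl] at ha
      obtain ⟨V, hV, hxV, hsV⟩ := h.exact W hW (fun i ↦ a ⟨i⟩) ha x hx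
      obtain ⟨b, hb⟩ := (mem_span_range_iff _ _).mp hsV
      refine ⟨V, hV, hxV, (mem_span_range_iff _ _).mpr ⟨fun j ↦ b j.down, ?_⟩⟩
      funext i
      have := congrFun hb i.down
      rw [Finset.sum_apply] at this ⊢
      rw [← this]
      exact Fintype.sum_equiv Equiv.ulift _ _ fun _ ↦ rfl
  exact h1.restrict.exists_presentation

/-- Coherent sheaves are locally generated by finitely many sections. -/
lemma IsCoherent.exists_locGen {F : X.Modules} (hF : IsCoherent F) (x : X) :
    ∃ (U : X.Opens), x ∈ U ∧ ∃ (n : ℕ) (e : Fin n → Γ(F, U)), LocGen F e := by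
  obtain ⟨U, hx, p, hp⟩ := hF.exists_presentation x
  have hfin : Finite p.generators.I := hp.isFiniteType_generators.finite
  have hfin' := Fintype.ofFinite p.generators.I
  let e (i : p.generators.I) : Γ(F.restrict U.ι, ⊤) := (p.generators.s i).eval (op ⊤)
  have hg : LocGen (F.restrict U.ι) e := by
    rw [← epi_freeDesc_iff]
    have : freeDesc e = p.generators.π := by
      refine congrArg (SheafOfModules.freeHomEquiv (R := U.toScheme.ringCatSheaf) _).symm ?_
      funext i
      exact globalSection_eval (F.restrict U.ι) (p.generators.s i)
    rw [this]
    exact p.generators.epi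
  have h2 := hg.of_restrict
  obtain ⟨n, ⟨φ⟩⟩ := Finite.exists_equiv_fin p.generators.I
  refine ⟨U.ι ''ᵁ ⊤, ⟨⟨x, hx⟩, trivial, rfl⟩, n, fun i ↦ e (φ.symm i), fun W s hW x hx ↦ ?_⟩
  obtain ⟨V, hV, hxV, hsV⟩ := h2 W s hW x hx
  refine ⟨V, hV, hxV, Submodule.span_mono ?_ hsV⟩
  rintro _ ⟨i, rfl⟩
  exact ⟨φ i, by simp⟩

end Generation

/-! ### Coherent sheaves on affine open subsets -/

section Coherent
variable {X : Scheme.{u}} {F G H : X.Modules}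

/-- Quasi-coherence in terms of sections: for `U` affine, the sections over `D(f) ⊆ U` are the
localization of the sections over `U`. -/
structure IsQC (F : X.Modules) : Prop where
  exists_extend : ∀ (U : X.Opens), IsAffineOpen U → ∀ (f : Γ(X, U)) (s : Γ(F, X.basicOpen f)),
    ∃ (n : ℕ) (t : Γ(F, U)), rs F (X.basicOpen_le f) t = rO (X.basicOpen_le f) f ^ n • s
  exists_pow_smul : ∀ (U : X.Opens), IsAffineOpen U → ∀ (f : Γ(X, U)) (t : Γ(F, U)),
    rs F (X.basicOpen_le f) t = 0 → ∃ n : ℕ, f ^ n • t = 0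

lemma fromSpec_appIso_inv {U : X.Opens} (hU : IsAffineOpen U) (V : (Spec Γ(X, U)).Opens)
    (h : hU.fromSpec ''ᵁ V ≤ U) (r : Γ(X, U)) :
    (hU.fromSpec.appIso V).inv
      ((Spec Γ(X, U)).presheaf.map (homOfLE le_top).op ((Scheme.ΓSpecIso Γ(X, U)).inv r)) =
      rO h r := by
  have key : (Scheme.ΓSpecIso Γ(X, U)).inv ≫ (Spec Γ(X, U)).presheaf.map (homOfLE le_top).op =
      X.presheaf.map (homOfLE h).op ≫ (hU.fromSpec.appIso V).hom := by
    rw [Scheme.Hom.appIso_hom', Scheme.Hom.map_appLE, Scheme.Hom.appLE, hU.fromSpec_app_self,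
      Category.assoc, ← Functor.map_comp]
    rfl
  have h1 := congrArg (fun φ ↦ (φ ≫ (hU.fromSpec.appIso V).inv) r) key
  simp only [Category.assoc, Iso.hom_inv_id, Category.comp_id] at h1
  exact h1

lemma fromSpec_smul {U : X.Opens} (hU : IsAffineOpen U) (F : X.Modules)
    (V : (Spec Γ(X, U)).Opens) (h : hU.fromSpec ''ᵁ V ≤ U) (r : Γ(X, U))
    (s : Γ(F, hU.fromSpec ''ᵁ V)) :
    (HSMul.hSMul (α := Γ(X, U)) (β := Γ(F.restrict hU.fromSpec, V)) r s :
      Γ(F.restrict hU.fromSpec, V)) = rO h r • s :=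
  congrArg (fun t : Γ(X, hU.fromSpec ''ᵁ V) ↦ t • s) (fromSpec_appIso_inv hU V h r)

lemma IsCoherent.isQuasicoherent (hF : IsCoherent F) :
    SheafOfModules.IsQuasicoherent (R := X.ringCatSheaf) F := by
  obtain ⟨q, -⟩ := SheafOfModules.IsFinitePresentation.exists_quasicoherentData (self := hF)
  exact SheafOfModules.IsQuasicoherent.mk (C := X.Opens) (J := Opens.grothendieckTopology X)
    (R := X.ringCatSheaf) (M := F) (nonempty_quasicoherentData := ⟨q⟩)

lemma IsCoherent.isQC (hF : IsCoherent F) : IsQC F := by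
  have hq : F.IsQuasicoherent := hF.isQuasicoherent
  have h (U : X.Opens) (hU : IsAffineOpen U) :=
    (isIso_fromTildeΓ_iff_isLocalizing (F.restrict hU.fromSpec)).mp inferInstance
  have h1 (U : X.Opens) (hU : IsAffineOpen U) : hU.fromSpec ''ᵁ ⊤ = U := by simp
  constructor
  · intro U hU f s
    have h2 := hU.fromSpec_image_basicOpen f
    obtain ⟨⟨t, c, n, rfl⟩, ht⟩ := (h U hU f).surj (rs F h2.le s)
    have h4 : hU.fromSpec ''ᵁ PrimeSpectrum.basicOpen f ≤ U := h2.le.trans (X.basicOpen_le f)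
    have h3 := (fromSpec_smul hU F (PrimeSpectrum.basicOpen f) h4 (f ^ n)
      (rs F h2.le s)).symm.trans ht
    obtain ⟨t', rfl⟩ : ∃ t' : Γ(F, hU.fromSpec ''ᵁ ⊤), t' = t := ⟨t, rfl⟩
    replace h3 : rO h4 (f ^ n) • rs F h2.le s = rs F (hU.fromSpec.image_mono le_top) t' := h3
    refine ⟨n, rs F (h1 U hU).ge t', ?_⟩
    have h5 := congrArg (rs F h2.ge) h3
    rw [rs_rs, rs_smul, rs_rs, rs_self, rO_rO, map_pow] at h5
    rw [h5]
    exact rs_rs _ _ _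
  · intro U hU f t ht
    have h2 := hU.fromSpec_image_basicOpen f
    have h4 : hU.fromSpec ''ᵁ PrimeSpectrum.basicOpen f ≤ U := h2.le.trans (X.basicOpen_le f)
    obtain ⟨⟨c, n, rfl⟩, hc⟩ := (h U hU f).exists_of_eq (x₁ := rs F (h1 U hU).le t) (x₂ := 0) (by
      rw [map_zero]
      refine (rs_rs (F := F) (h1 U hU).le (hU.fromSpec.image_mono le_top) t).trans ?_
      rw [← rs_rs (F := F) (X.basicOpen_le f) h2.le t, ht]
      exact map_zero _)
    refine ⟨n, ?_⟩
    rw [smul_zero] at hc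
    have h3 := (fromSpec_smul hU F ⊤ (h1 U hU).le (f ^ n) (rs F (h1 U hU).le t)).symm.trans hc
    rw [← rs_smul] at h3
    have h5 := (congrArg (rs F (h1 U hU).ge) h3).trans (map_zero (rs F (h1 U hU).ge))
    rwa [rs_rs, rs_self] at h5

/-- An ideal of functions on an affine open subset is the unit ideal if it contains, for every
point, a function that does not vanish there. -/
lemma ideal_eq_top {U : X.Opens} (hU : IsAffineOpen U) (I : Ideal Γ(X, U))
    (h : ∀ x ∈ U, ∃ f ∈ I, x ∈ X.basicOpen f) : I = ⊤ := by
  rw [← Ideal.span_eq I]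
  refine hU.self_le_iSup_basicOpen_iff.mp fun x hx ↦ ?_
  obtain ⟨f, hf, hxf⟩ := h x hx
  exact Opens.mem_iSup.mpr ⟨⟨f, hf⟩, hxf⟩

lemma exists_affine_le {V : X.Opens} {x : X} (hx : x ∈ V) :
    ∃ U : X.Opens, IsAffineOpen U ∧ x ∈ U ∧ U ≤ V := by
  obtain ⟨U, hU, hxU, hUV⟩ := X.isBasis_affineOpens.exists_subset_of_mem_open hx V.isOpen
  obtain ⟨U', h, rfl⟩ := hU
  exact ⟨U', h, hxU, hUV⟩

lemma exists_basicOpen_le {U V : X.Opens} (hU : IsAffineOpen U) {x : X} (hxU : x ∈ U)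
    (hxV : x ∈ V) : ∃ f : Γ(X, U), X.basicOpen f ≤ V ∧ x ∈ X.basicOpen f :=
  hU.exists_basicOpen_le ⟨x, hxV⟩ hxU

lemma isUnit_rO_basicOpen {U : X.Opens} (f : Γ(X, U)) {V : X.Opens} (hV : V ≤ X.basicOpen f) :
    IsUnit (rO (hV.trans (X.basicOpen_le f)) f) := by
  have h := (RingedSpace.isUnit_res_basicOpen X.toRingedSpace f)
  have h2 : IsUnit (rO (X.basicOpen_le f) f) := h
  have := h2.map (rO hV)
  rwa [rO_rO] at this

lemma IsQC.exists_extend_family (hF : IsQC F) {U : X.Opens} (hU : IsAffineOpen U) (f : Γ(X, U))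
    {ι : Type*} [Fintype ι] (s : ι → Γ(F, X.basicOpen f)) :
    ∃ (n : ℕ) (t : ι → Γ(F, U)), ∀ i, rs F (X.basicOpen_le f) (t i) =
      rO (X.basicOpen_le f) f ^ n • s i := by
  choose n t ht using fun i ↦ hF.exists_extend U hU f (s i)
  refine ⟨∑ i, n i, fun i ↦ f ^ (∑ j, n j - n i) • t i, fun i ↦ ?_⟩
  rw [rs_smul, ht, smul_smul, map_pow, ← pow_add, Nat.sub_add_cancel]
  exact Finset.single_le_sum (f := n) (fun _ _ ↦ Nat.zero_le _) (Finset.mem_univ i)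

lemma exists_extend_functions {U : X.Opens} (hU : IsAffineOpen U) (f : Γ(X, U))
    {ι : Type*} [Fintype ι] (s : ι → Γ(X, X.basicOpen f)) :
    ∃ (n : ℕ) (t : ι → Γ(X, U)), ∀ i, rO (X.basicOpen_le f) (t i) =
      rO (X.basicOpen_le f) f ^ n * s i := by
  have hloc := hU.isLocalization_basicOpen f
  choose n t ht using fun i ↦ IsLocalization.Away.surj f (s i)
  have ht' : ∀ i, rO (X.basicOpen_le f) (t i) = rO (X.basicOpen_le f) f ^ n i * s i :=
    fun i ↦ (ht i).symm.trans (mul_comm _ _)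
  refine ⟨∑ i, n i, fun i ↦ f ^ (∑ j, n j - n i) * t i, fun i ↦ ?_⟩
  rw [map_mul, ht', ← mul_assoc, map_pow, ← pow_add, Nat.sub_add_cancel]
  exact Finset.single_le_sum (f := n) (fun _ _ ↦ Nat.zero_le _) (Finset.mem_univ i)

lemma mem_basicOpen_pow {U : X.Opens} {f : Γ(X, U)} {x : X} (hx : x ∈ X.basicOpen f) (n : ℕ) :
    x ∈ X.basicOpen (f ^ n) := by
  have h1 : x ∈ X.basicOpen (f ^ (n + 1)) := by rwa [X.basicOpen_pow _ (by omega)]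
  rw [pow_succ, Scheme.basicOpen_mul] at h1
  exact h1.1

/-- Epimorphisms of quasi-coherent sheaves are surjective on affine open subsets. -/
lemma IsQC.surjective_app (hF : IsQC F) (hG : IsQC G) (φ : F ⟶ G) [Epi φ] {U : X.Opens}
    (hU : IsAffineOpen U) : Function.Surjective (φ.app U) := by
  intro s
  let I : Ideal Γ(X, U) := (LinearMap.range (appLin φ U)).comap (LinearMap.toSpanSingleton _ _ s)
  have hI : I = ⊤ := by
    refine ideal_eq_top hU I fun x hx ↦ ?_
    obtain ⟨V, hV, hxV, t, ht⟩ := (epi_iff_locSurj φ).mp inferInstance U s x hx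
    obtain ⟨f, hfV, hxf⟩ := exists_basicOpen_le hU hx hxV
    obtain ⟨n, t', ht'⟩ := hF.exists_extend U hU f (rs F hfV t)
    obtain ⟨m, hm⟩ := hG.exists_pow_smul U hU f (φ.app U t' - f ^ n • s) (by
      rw [map_sub, ← app_rs, ht', app_smul, app_rs, ht, rs_smul, rs_rs, map_pow, sub_self])
    refine ⟨f ^ (m + n + 1), ⟨(f * f ^ m) • t', ?_⟩, ?_⟩
    · change φ.app U _ = f ^ (m + n + 1) • s
      rw [app_smul, mul_smul, sub_eq_zero.mp (by rw [← smul_sub]; exact hm :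
        f ^ m • φ.app U t' - f ^ m • f ^ n • s = 0),
        smul_smul, smul_smul]
      congr 1
      ring
    · rw [X.basicOpen_pow _ (by omega)]
      exact hxf
  obtain ⟨t, ht⟩ : (1 : Γ(X, U)) ∈ I := by rw [hI]; trivial
  exact ⟨t, ht.trans (one_smul _ s)⟩

/-- Quasi-coherence is inherited by kernels. -/
lemma IsQC.kernel (hF : IsQC F) (hG : IsQC G) (φ : F ⟶ G) : IsQC (kernel φ) := by
  constructor
  · intro U hU f s
    obtain ⟨n, t, ht⟩ := hF.exists_extend U hU f ((kernel.ι φ).app _ s)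
    obtain ⟨m, hm⟩ := hG.exists_pow_smul U hU f (φ.app U t) (by
      rw [← app_rs, ht, app_smul, kernel_section_condition, smul_zero])
    obtain ⟨t', ht'⟩ := exists_kernel_section φ U (f ^ m • t) (by rw [app_smul, hm])
    refine ⟨m + n, t', app_injective (kernel.ι φ) _ ?_⟩
    rw [app_rs, ht', rs_smul, ht, app_smul, map_pow, smul_smul, pow_add]
  · intro U hU f t ht
    obtain ⟨n, hn⟩ := hF.exists_pow_smul U hU f ((kernel.ι φ).app _ t) (by
      rw [← app_rs, ht, map_zero])
    exact ⟨n, app_injective (kernel.ι φ) _ (by rw [app_smul, hn, map_zero])⟩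

/-- Over an affine open subset the sections of a coherent sheaf form a finite module. -/
lemma IsCoherent.finite (hF : IsCoherent F) {U : X.Opens} (hU : IsAffineOpen U) :
    Module.Finite Γ(X, U) Γ(F, U) := by
  let S : Set Γ(X, U) := {f | ∃ N : Submodule Γ(X, U) Γ(F, U), N.FG ∧
    ∀ s : Γ(F, U), ∀ x ∈ X.basicOpen f, ∃ g : Γ(X, U), x ∈ X.basicOpen g ∧ g • s ∈ N}
  have hS : Ideal.span S = ⊤ := by
    refine ideal_eq_top hU _ fun x hx ↦ ?_
    obtain ⟨V, hxV, n, e, he⟩ := hF.exists_locGen x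
    obtain ⟨f, hfV, hxf⟩ := exists_basicOpen_le hU hx hxV
    refine ⟨f, Ideal.subset_span ?_, hxf⟩
    obtain ⟨k, t, ht⟩ := hF.isQC.exists_extend_family hU f (fun i ↦ rs F hfV (e i))
    refine ⟨Submodule.span _ (Set.range t), Submodule.fg_span (Set.finite_range t), ?_⟩
    intro s y hy
    obtain ⟨W, hW, hyW, hs⟩ := he (X.basicOpen f) (rs F (X.basicOpen_le f) s) hfV y hy
    obtain ⟨a, ha⟩ := (mem_span_range_iff _ _).mp hs
    obtain ⟨g, hgW, hyg⟩ := exists_basicOpen_le hU (X.basicOpen_le f hy) hyW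
    obtain ⟨m, b, hb⟩ := exists_extend_functions hU g (fun i ↦ rO hgW (a i))
    have hgf : X.basicOpen g ≤ X.basicOpen f := hgW.trans hW
    obtain ⟨l, hl⟩ := hF.isQC.exists_pow_smul U hU g (g ^ m • f ^ k • s - ∑ i, b i • t i) (by
      have h1 := congrArg (rs F hgW) ha
      simp only [map_sum, rs_smul, rs_rs] at h1
      simp only [map_sub, map_sum, rs_smul, hb, map_pow]
      simp only [← h1, ← rs_rs (X.basicOpen_le f) hgf, ht, rs_smul, map_pow, rO_rO, rs_rs,
        Finset.smul_sum, smul_smul]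
      rw [sub_eq_zero]
      refine Finset.sum_congr rfl fun i _ ↦ ?_
      congr 1
      ring)
    refine ⟨g ^ l * (g ^ m * f ^ k), ?_, ?_⟩
    · rw [Scheme.basicOpen_mul, Scheme.basicOpen_mul]
      exact ⟨mem_basicOpen_pow hyg _, mem_basicOpen_pow hyg _, mem_basicOpen_pow hy _⟩
    · rw [mul_smul, mul_smul, sub_eq_zero.mp (by rw [← smul_sub]; exact hl :
        g ^ l • g ^ m • f ^ k • s - g ^ l • ∑ i, b i • t i = 0)]
      exact Submodule.smul_mem _ _ (Submodule.sum_mem _ fun i _ ↦ Submodule.smul_mem _ _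
        (Submodule.subset_span ⟨i, rfl⟩))
  -- finitely many members of `S` generate the unit ideal; the sum of the submodules that belong to
  -- them is everything
  obtain ⟨S', hS'S, hS'⟩ := (Ideal.span_eq_top_iff_finite S).mp hS
  choose N hN hN' using fun f : S' ↦ hS'S f.2
  have htop : (⨆ f : S', N f) = ⊤ := by
    refine eq_top_iff.mpr fun s _ ↦ ?_
    let I : Ideal Γ(X, U) := (⨆ f : S', N f).comap (LinearMap.toSpanSingleton _ _ s)
    have hI : I = ⊤ := by
      refine ideal_eq_top hU I fun x hx ↦ ?_
      obtain ⟨f, hxf⟩ := Opens.mem_iSup.mp (hU.self_le_iSup_basicOpen_iff.mpr hS' hx)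
      obtain ⟨g, hxg, hg⟩ := hN' f s x hxf
      exact ⟨g, (le_iSup N f) hg, hxg⟩
    have h1 : (1 : Γ(X, U)) ∈ I := by rw [hI]; trivial
    have h2 : (1 : Γ(X, U)) • s ∈ ⨆ f : S', N f := h1
    rwa [one_smul] at h2
  exact ⟨htop ▸ Submodule.fg_iSup N hN⟩

/-- On a locally noetherian scheme a quasi-coherent sheaf is coherent if its sections over affine
open subsets form finite modules. -/
lemma IsQC.isCoherent [IsLocallyNoetherian X] (hF : IsQC F)
    (hfin : ∀ U : X.Opens, IsAffineOpen U → Module.Finite Γ(X, U) Γ(F, U)) : IsCoherent F := by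
  refine isCoherent_of_isConcretePresentation F fun x ↦ ?_
  obtain ⟨U, hU, hxU, -⟩ := exists_affine_le (show x ∈ (⊤ : X.Opens) from trivial)
  have hR : IsNoetherianRing Γ(X, U) := IsLocallyNoetherian.component_noetherian ⟨U, hU⟩
  have hfinU := hfin U hU
  obtain ⟨n, e, he⟩ := Module.Finite.exists_fin (R := Γ(X, U)) (M := Γ(F, U))
  let p : (Fin n → Γ(X, U)) →ₗ[Γ(X, U)] Γ(F, U) := Fintype.linearCombination Γ(X, U) e
  obtain ⟨m, r, hr⟩ := Submodule.fg_iff_exists_fin_generating_family.mp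
    (IsNoetherian.noetherian (LinearMap.ker p))
  refine ⟨U, hxU, m, n, e, r, ⟨?_, ?_, ?_⟩⟩
  · intro V s hVU x hx
    obtain ⟨f, hfV, hxf⟩ := exists_basicOpen_le hU (hVU hx) hx
    refine ⟨X.basicOpen f, hfV, hxf, ?_⟩
    obtain ⟨k, t, ht⟩ := hF.exists_extend U hU f (rs F hfV s)
    have h1 : t ∈ Submodule.span Γ(X, U) (Set.range fun i ↦ rs F le_rfl (e i)) := by
      simp only [rs_self]
      rw [he]; trivial
    have h2 := rs_mem_span e le_rfl (X.basicOpen_le f) h1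
    rw [ht] at h2
    have hu : IsUnit (rO (X.basicOpen_le f) f ^ k) := (isUnit_rO_basicOpen f le_rfl).pow k
    exact (Submodule.smul_mem_iff_of_isUnit _ hu).mp h2
  · intro j
    have : r j ∈ LinearMap.ker p := hr ▸ Submodule.subset_span ⟨j, rfl⟩
    simpa [p, Fintype.linearCombination_apply] using this
  · intro V hVU a ha x hx
    obtain ⟨f, hfV, hxf⟩ := exists_basicOpen_le hU (hVU hx) hx
    refine ⟨X.basicOpen f, hfV, hxf, ?_⟩
    obtain ⟨k, b, hb⟩ := exists_extend_functions hU f (fun i ↦ rO hfV (a i))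
    obtain ⟨l, hl⟩ := hF.exists_pow_smul U hU f (∑ i, b i • e i) (by
      have h1 := congrArg (rs F hfV) ha
      simp only [map_sum, rs_smul, rs_rs, map_zero] at h1
      simp only [map_sum, rs_smul, hb, mul_smul, ← Finset.smul_sum, h1, smul_zero])
    -- after multiplication by `f ^ (l + k)`, the relation `a` comes from a relation over `U`
    have hk : (fun i ↦ f ^ l * b i) ∈ LinearMap.ker p := by
      simpa [p, Fintype.linearCombination_apply, Finset.smul_sum, mul_smul] using hl
    rw [← hr] at hk
    obtain ⟨c, hc⟩ := (mem_span_range_iff _ _).mp hk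
    have hu : IsUnit (rO (X.basicOpen_le f) f ^ (l + k)) := (isUnit_rO_basicOpen f le_rfl).pow _
    refine (Submodule.smul_mem_iff_of_isUnit _ hu).mp ((mem_span_range_iff _ _).mpr
      ⟨fun j ↦ rO (X.basicOpen_le f) (c j), ?_⟩)
    funext i
    have h1 := congrArg (rO (X.basicOpen_le f)) (congrFun hc i)
    simp only [Finset.sum_apply, Pi.smul_apply, smul_eq_mul, map_sum, map_mul, hb, map_pow] at h1 ⊢
    rw [h1, pow_add, mul_assoc]

lemma IsCoherent.of_iso (hF : IsCoherent F) (e : F ≅ G) : IsCoherent G :=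
  (SheafOfModules.isFinitePresentation X.ringCatSheaf).prop_of_iso (X := F) (Y := G) e hF

lemma IsCoherent.kernel [IsLocallyNoetherian X] (hF : IsCoherent F) (hG : IsCoherent G)
    (φ : F ⟶ G) : IsCoherent (kernel φ) := by
  refine (hF.isQC.kernel hG.isQC φ).isCoherent fun U hU ↦ ?_
  have hR : IsNoetherianRing Γ(X, U) := IsLocallyNoetherian.component_noetherian ⟨U, hU⟩
  have := hF.finite hU
  exact Module.Finite.of_injective (appLin (kernel.ι φ) U) (app_injective _ U)

lemma IsQC.biprod (hF : IsQC F) (hG : IsQC G) : IsQC (F ⊞ G) := by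
  constructor
  · intro U hU f s
    obtain ⟨n, t, ht⟩ := hF.exists_extend U hU f ((biprod.fst : F ⊞ G ⟶ F).app _ s)
    obtain ⟨m, t', ht'⟩ := hG.exists_extend U hU f ((biprod.snd : F ⊞ G ⟶ G).app _ s)
    refine ⟨n + m, bpair (f ^ m • t) (f ^ n • t'), biprod_app_ext ?_ ?_⟩
    · rw [app_rs, fst_bpair, rs_smul, ht, app_smul, smul_smul, map_pow, ← pow_add, add_comm]
    · rw [app_rs, snd_bpair, rs_smul, ht', app_smul, smul_smul, map_pow, ← pow_add]
  · intro U hU f t ht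
    obtain ⟨n, hn⟩ := hF.exists_pow_smul U hU f ((biprod.fst : F ⊞ G ⟶ F).app _ t) (by
      rw [← app_rs, ht, map_zero])
    obtain ⟨m, hm⟩ := hG.exists_pow_smul U hU f ((biprod.snd : F ⊞ G ⟶ G).app _ t) (by
      rw [← app_rs, ht, map_zero])
    refine ⟨n + m, biprod_app_ext ?_ ?_⟩
    · rw [app_smul, add_comm, pow_add, mul_smul, hn, smul_zero, map_zero]
    · rw [app_smul, pow_add, mul_smul, hm, smul_zero, map_zero]

/-- The sections of a biproduct. -/
def biprodEquiv (F G : X.Modules) (U : X.Opens) :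
    (Γ(F, U) × Γ(G, U)) ≃ₗ[Γ(X, U)] Γ(F ⊞ G, U) where
  toFun s := bpair s.1 s.2
  map_add' s t := by apply biprod_app_ext <;> simp
  map_smul' r s := by apply biprod_app_ext <;> simp
  invFun s := ((biprod.fst : F ⊞ G ⟶ F).app _ s, (biprod.snd : F ⊞ G ⟶ G).app _ s)
  left_inv s := by simp
  right_inv s := by apply biprod_app_ext <;> simp

lemma IsCoherent.biprod [IsLocallyNoetherian X] (hF : IsCoherent F) (hG : IsCoherent G) :
    IsCoherent (F ⊞ G) := by
  refine (hF.isQC.biprod hG.isQC).isCoherent fun U hU ↦ ?_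
  have := hF.finite hU
  have := hG.finite hU
  exact Module.Finite.equiv (biprodEquiv F G U)

/-- A sequence of quasi-coherent sheaves that is exact is exact on sections over affine open
subsets. -/
lemma LocExact.exists_preimage (hF : IsQC F) (hG : IsQC G) (hH : IsQC H) {f : F ⟶ G} {g : G ⟶ H}
    (w : f ≫ g = 0) (h : LocExact f g) {U : X.Opens} (hU : IsAffineOpen U) (s : Γ(G, U))
    (hs : g.app U s = 0) : ∃ t, f.app U t = s := by
  have he : Epi (kernel.lift g f w) := by
    have := (exact_iff_locExact f g w).mpr h
    exact (ShortComplex.exact_iff_epi_kernel_lift _).mp this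
  obtain ⟨s', rfl⟩ := exists_kernel_section g U s hs
  obtain ⟨t, rfl⟩ := hF.surjective_app (hG.kernel hH g) (kernel.lift g f w) hU s'
  refine ⟨t, ?_⟩
  rw [← comp_app_apply, kernel.lift_ι]

end Coherent

/-! ### Vector bundles -/

section Algebra

lemma exists_common_pow_mul {R : Type*} [CommMonoidWithZero R] {ι : Type*} [Fintype ι] (r : R)
    (a : ι → R) (h : ∀ i, ∃ k : ℕ, r ^ k * a i = 0) : ∃ k : ℕ, ∀ i, r ^ k * a i = 0 := by
  choose k hk using h
  refine ⟨∑ i, k i, fun i ↦ ?_⟩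
  rw [← Nat.sub_add_cancel (Finset.single_le_sum (f := k) (fun _ _ ↦ Nat.zero_le _)
    (Finset.mem_univ i)), pow_add, mul_assoc, hk, mul_zero]

/-- A finite projective module has a basis after inverting an element outside a given prime
ideal. -/
lemma exists_basis_away {R M : Type*} [CommRing R] [AddCommGroup M] [Module R M]
    [Module.Finite R M] [Module.Projective R M] (p : Ideal R) [hp : p.IsPrime] :
    ∃ r ∉ p, ∃ (n : ℕ) (m : Fin n → M),
      (∀ a : Fin n → R, ∑ i, a i • m i = 0 → ∃ k : ℕ, ∀ i, r ^ k * a i = 0) ∧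
      ∀ s : M, ∃ k : ℕ, r ^ k • s ∈ Submodule.span R (Set.range m) := by
  have : Module.FinitePresentation R M := Module.finitePresentation_of_projective R M
  have hfree : Module.Free (Localization.AtPrime p) (LocalizedModule p.primeCompl M) :=
    Module.free_of_flat_of_isLocalRing
  let I := Module.Free.ChooseBasisIndex (Localization.AtPrime p) (LocalizedModule p.primeCompl M)
  have hI : Module.Finite (Localization.AtPrime p) (LocalizedModule p.primeCompl M) :=
    Module.Finite.of_isLocalizedModule p.primeCompl (Rₚ := Localization.AtPrime p)
      (LocalizedModule.mkLinearMap p.primeCompl M)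
  let b := (Module.Free.chooseBasis (Localization.AtPrime p)
    (LocalizedModule p.primeCompl M)).reindex (Fintype.equivFin I)
  obtain ⟨r, hr, b', -⟩ := Module.FinitePresentation.exists_basis_localizedModule_powers
    p.primeCompl (LocalizedModule.mkLinearMap p.primeCompl M) (Localization.AtPrime p) b
  let g := LocalizedModule.mkLinearMap (Submonoid.powers r) M
  have hb : ∀ i, ∃ (m : M) (k : ℕ), r ^ k • b' i = g m := fun i ↦ by
    obtain ⟨⟨m, ⟨_, k, rfl⟩⟩, h⟩ := IsLocalizedModule.surj (Submonoid.powers r) g (b' i)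
    exact ⟨m, k, h⟩
  choose m k hm using hb
  refine ⟨r, hr, _, m, fun a ha ↦ ?_, fun s ↦ ?_⟩
  · have h1 : ∑ i, (algebraMap R (Localization (Submonoid.powers r)) (a i * r ^ k i)) • b' i =
        0 := by
      rw [← map_zero g, ← ha, map_sum]
      refine Finset.sum_congr rfl fun i _ ↦ ?_
      rw [algebraMap_smul, mul_smul, hm, map_smul]
    have h2 := Fintype.linearIndependent_iff.mp b'.linearIndependent _ h1
    refine exists_common_pow_mul r a fun i ↦ ?_
    obtain ⟨⟨_, l, rfl⟩, hl⟩ := (IsLocalization.map_eq_zero_iff (Submonoid.powers r) _ _).mp (h2 i)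
    refine ⟨l + k i, ?_⟩
    rw [pow_add, mul_assoc, mul_comm (r ^ k i)]
    exact hl
  · have hc : ∀ i, ∃ (l : ℕ) (d : R), r ^ l • b'.repr (g s) i = algebraMap R _ d := fun i ↦ by
      obtain ⟨l, d, h⟩ := IsLocalization.Away.surj r (b'.repr (g s) i)
      refine ⟨l, d, ?_⟩
      rw [← h, Algebra.smul_def, map_pow, mul_comm]
    choose l d hd using hc
    let N := ∑ i, l i + ∑ i, k i
    have hN : ∀ i, ∃ j, N = j + k i + l i := fun i ↦ by
      have h1 := Finset.single_le_sum (f := l) (fun _ _ ↦ Nat.zero_le _) (Finset.mem_univ i)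
      have h2 := Finset.single_le_sum (f := k) (fun _ _ ↦ Nat.zero_le _) (Finset.mem_univ i)
      exact ⟨N - k i - l i, by omega⟩
    choose j hj using hN
    have h1 : g (r ^ N • s) = g (∑ i, (r ^ j i * d i) • m i) := by
      rw [map_smul, ← b'.sum_repr (g s), Finset.smul_sum, map_sum]
      refine Finset.sum_congr rfl fun i _ ↦ ?_
      rw [map_smul, ← hm, smul_smul, hj i, pow_add, mul_smul, ← smul_assoc (r ^ l i), hd,
        algebraMap_smul, smul_smul]
      congr 1
      ring
    obtain ⟨⟨_, q, rfl⟩, hq⟩ := IsLocalizedModule.exists_of_eq (S := Submonoid.powers r) h1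
    refine ⟨q + N, ?_⟩
    rw [pow_add, mul_smul]
    have : r ^ q • r ^ N • s = r ^ q • ∑ i, (r ^ j i * d i) • m i := hq
    rw [this]
    exact Submodule.smul_mem _ _ (Submodule.sum_mem _ fun i _ ↦ Submodule.smul_mem _ _
      (Submodule.subset_span ⟨i, rfl⟩))

end Algebra

section Bundles
variable {X : Scheme.{u}} {F G H : X.Modules}

lemma isFrame_iff {U : X.Opens} {n : ℕ} (e : Fin n → Γ(F, U)) : IsFrame F U e ↔
    ∀ (V : X.Opens) (h : V ≤ U),
      (∀ a : Fin n → Γ(X, V), ∑ i, a i • rs F h (e i) = 0 → a = 0) ∧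
      ∀ s : Γ(F, V), ∃ a : Fin n → Γ(X, V), ∑ i, a i • rs F h (e i) = s := by
  refine forall₂_congr fun V h ↦ and_congr ?_ ?_
  · rw [Fintype.linearIndependent_iff]
    exact forall₂_congr fun a _ ↦ funext_iff.symm
  · refine ⟨fun h s ↦ (mem_span_range_iff _ _).mp (h trivial),
      fun h s _ ↦ (mem_span_range_iff _ _).mpr (h s)⟩

lemma IsFrame.mono {U V : X.Opens} {n : ℕ} {e : Fin n → Γ(F, U)} (he : IsFrame F U e)
    (h : V ≤ U) : IsFrame F V (fun i ↦ rs F h (e i)) := by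
  rw [isFrame_iff] at he ⊢
  intro W hW
  simpa using he W (hW.trans h)

/-- Sections that are linearly independent over all open subsets and generate locally form a
frame. -/
lemma isFrame_of_locGen {U : X.Opens} {n : ℕ} {e : Fin n → Γ(F, U)}
    (hi : ∀ (V : X.Opens) (h : V ≤ U) (a : Fin n → Γ(X, V)), ∑ i, a i • rs F h (e i) = 0 → a = 0)
    (hg : LocGen F e) : IsFrame F U e := by
  refine (isFrame_iff e).mpr fun V h ↦ ⟨hi V h, fun s ↦ ?_⟩
  choose W hWV hxW hsW using fun x : V ↦ hg V s h x.1 x.2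
  choose a ha using fun x ↦ (mem_span_range_iff _ _).mp (hsW x)
  have hcov : V ≤ iSup W := fun x hx ↦ Opens.mem_iSup.mpr ⟨⟨x, hx⟩, hxW ⟨x, hx⟩⟩
  choose b hb using fun i ↦ exists_glue_functions W V hWV hcov (fun x ↦ a x i) (by
    intro x y W' hx hy
    have : (fun i ↦ rO hx (a x i) - rO hy (a y i)) = 0 := by
      refine hi W' (hx.trans ((hWV x).trans h)) _ ?_
      have h1 := congrArg (rs F hx) (ha x)
      have h2 := congrArg (rs F hy) (ha y)
      simp only [map_sum, rs_smul, rs_rs] at h1 h2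
      simp only [sub_smul, Finset.sum_sub_distrib, h1, h2, sub_self]
    exact sub_eq_zero.mp (congrFun this i))
  refine ⟨b, section_ext_of_local _ _ fun x hx ↦ ⟨W ⟨x, hx⟩, hWV _, hxW _, ?_⟩⟩
  rw [← ha]
  simp only [map_sum, rs_smul, rs_rs, hb]

lemma isFrame_basicOpen (hF : IsQC F) {U : X.Opens} (hU : IsAffineOpen U) (r : Γ(X, U)) {n : ℕ}
    (m : Fin n → Γ(F, U))
    (h1 : ∀ a : Fin n → Γ(X, U), ∑ i, a i • m i = 0 → ∃ k : ℕ, ∀ i, r ^ k * a i = 0)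
    (h2 : ∀ s : Γ(F, U), ∃ k : ℕ, r ^ k • s ∈ Submodule.span Γ(X, U) (Set.range m)) :
    IsFrame F (X.basicOpen r) (fun i ↦ rs F (X.basicOpen_le r) (m i)) := by
  have hD := X.basicOpen_le r
  refine isFrame_of_locGen ?_ ?_
  · intro V h a ha
    funext i
    refine function_ext_of_local _ _ fun x hx ↦ ?_
    obtain ⟨f, hfV, hxf⟩ := exists_basicOpen_le hU (hD (h hx)) hx
    refine ⟨X.basicOpen f, hfV, hxf, ?_⟩
    obtain ⟨k, b, hb⟩ := exists_extend_functions hU f (fun i ↦ rO hfV (a i))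
    obtain ⟨l, hl⟩ := hF.exists_pow_smul U hU f (∑ i, b i • m i) (by
      have h1 := congrArg (rs F hfV) ha
      simp only [map_sum, rs_smul, rs_rs, map_zero] at h1
      simp only [map_sum, rs_smul, hb, mul_smul, ← Finset.smul_sum, h1, smul_zero])
    obtain ⟨q, hq⟩ := h1 (fun i ↦ f ^ l * b i) (by simpa [Finset.smul_sum, mul_smul] using hl)
    have h3 := congrArg (rO (X.basicOpen_le f)) (hq i)
    rw [map_mul, map_mul, hb, map_pow, map_pow, map_zero] at h3
    have hu1 : IsUnit (rO (X.basicOpen_le f) f) := isUnit_rO_basicOpen f le_rfl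
    have hu2 : IsUnit (rO (X.basicOpen_le f) r) := by
      have := (isUnit_rO_basicOpen r le_rfl).map (rO (hfV.trans h))
      rwa [rO_rO] at this
    rw [(hu2.pow q).mul_right_eq_zero, (hu1.pow l).mul_right_eq_zero,
      (hu1.pow k).mul_right_eq_zero] at h3
    rw [h3, Pi.zero_apply, map_zero]
  · intro V s hV x hx
    obtain ⟨f, hfV, hxf⟩ := exists_basicOpen_le hU (hD (hV hx)) hx
    refine ⟨X.basicOpen f, hfV, hxf, ?_⟩
    obtain ⟨k, t, ht⟩ := hF.exists_extend U hU f (rs F hfV s)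
    obtain ⟨l, hl⟩ := h2 t
    have h3 : r ^ l • t ∈ Submodule.span Γ(X, U) (Set.range fun i ↦ rs F le_rfl (m i)) := by
      simpa only [rs_self] using hl
    have h4 := rs_mem_span m le_rfl (X.basicOpen_le f) h3
    have hu1 : IsUnit (rO (X.basicOpen_le f) f) := isUnit_rO_basicOpen f le_rfl
    have hu2 : IsUnit (rO (X.basicOpen_le f) r) := by
      have := (isUnit_rO_basicOpen r le_rfl).map (rO (hfV.trans hV))
      rwa [rO_rO] at this
    rw [rs_smul, ht, map_pow] at h4
    have h5 := (Submodule.smul_mem_iff_of_isUnit _ (hu1.pow k)).mp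
      ((Submodule.smul_mem_iff_of_isUnit _ (hu2.pow l)).mp h4)
    simpa only [rs_rs] using h5

/-- `F` has a frame on a neighbourhood of `x`. -/
def HasFrameNear (F : X.Modules) (x : X) : Prop :=
  ∃ U : X.Opens, x ∈ U ∧ ∃ (n : ℕ) (e : Fin n → Γ(F, U)), IsFrame F U e

/-- A coherent sheaf is a vector bundle near the points of an affine open subset over which its
sections form a projective module. -/
lemma hasFrameNear_of_projective (hF : IsCoherent F) {U : X.Opens} (hU : IsAffineOpen U)
    (hp : Module.Projective Γ(X, U) Γ(F, U)) {x : X} (hx : x ∈ U) : HasFrameNear F x := by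
  have := hF.finite hU
  obtain ⟨r, hr, n, m, h1, h2⟩ := exists_basis_away (M := Γ(F, U)) (hU.primeIdealOf ⟨x, hx⟩).asIdeal
  refine ⟨X.basicOpen r, ?_, n, _, isFrame_basicOpen hF.isQC hU r m h1 h2⟩
  rw [← hU.fromSpec_image_basicOpen r]
  exact ⟨hU.primeIdealOf ⟨x, hx⟩, hr, hU.fromSpec_primeIdealOf ⟨x, hx⟩⟩

lemma HasFrameNear.of_iso {x : X} (h : HasFrameNear F x) (φ : F ≅ G) : HasFrameNear G x := by
  obtain ⟨U, hx, n, e, he⟩ := h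
  refine ⟨U, hx, n, fun i ↦ φ.hom.app U (e i), (isFrame_iff _).mpr fun V hV ↦ ?_⟩
  obtain ⟨h1, h2⟩ := (isFrame_iff e).mp he V hV
  have hinj : Function.Injective (φ.hom.app V) := (app_bijective φ.hom V).1
  have h3 : ∀ a : Fin n → Γ(X, V), ∑ i, a i • rs G hV (φ.hom.app U (e i)) =
      φ.hom.app V (∑ i, a i • rs F hV (e i)) := fun a ↦ by
    simp only [map_sum, app_smul, app_rs]
  simp only [h3]
  refine ⟨fun a ha ↦ h1 a (hinj (by rw [ha, map_zero])), fun s ↦ ?_⟩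
  obtain ⟨s, rfl⟩ := (app_bijective φ.hom V).2 s
  obtain ⟨a, rfl⟩ := h2 s
  exact ⟨a, rfl⟩

lemma IsVectorBundle.of_iso (h : IsVectorBundle F) (φ : F ≅ G) : IsVectorBundle G :=
  fun x ↦ HasFrameNear.of_iso (h x) φ

/-- A frame of `F` over an affine open neighbourhood contained in a given one. -/
lemma IsVectorBundle.exists_affine (h : IsVectorBundle F) {x : X} {V : X.Opens} (hx : x ∈ V) :
    ∃ U : X.Opens, IsAffineOpen U ∧ x ∈ U ∧ U ≤ V ∧ ∃ (n : ℕ) (e : Fin n → Γ(F, U)),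
      IsFrame F U e := by
  obtain ⟨W, hxW, n, e, he⟩ := h x
  obtain ⟨U, hU, hxU, hUV⟩ := exists_affine_le (show x ∈ V ⊓ W from ⟨hx, hxW⟩)
  exact ⟨U, hU, hxU, hUV.trans inf_le_left, n, _, he.mono (hUV.trans inf_le_right)⟩

lemma IsFrame.free {U : X.Opens} {n : ℕ} {e : Fin n → Γ(F, U)} (he : IsFrame F U e) :
    Module.Free Γ(X, U) Γ(F, U) := Module.Free.of_basis (he.basis U le_rfl)

variable [IsLocallyNoetherian X]

lemma IsVectorBundle.biprod (hF : IsVectorBundle F) (hG : IsVectorBundle G) :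
    IsVectorBundle (F ⊞ G) := by
  intro x
  obtain ⟨V, hV, hxV, -, n, e, he⟩ := hF.exists_affine (show x ∈ (⊤ : X.Opens) from trivial)
  obtain ⟨U, hU, hxU, hUV, m, e', he'⟩ := hG.exists_affine hxV
  have h1 := (he.mono hUV).free
  have h2 := he'.free
  exact hasFrameNear_of_projective (hF.isCoherent.biprod hG.isCoherent) hU
    (Module.Projective.of_equiv (biprodEquiv F G U)) hxU

/-- The kernel of an epimorphism of vector bundles is a vector bundle. -/
lemma IsVectorBundle.kernel (hF : IsVectorBundle F) (hG : IsVectorBundle G) (φ : F ⟶ G) [Epi φ] :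
    IsVectorBundle (kernel φ) := by
  intro x
  obtain ⟨V, hV, hxV, -, n, e, he⟩ := hF.exists_affine (show x ∈ (⊤ : X.Opens) from trivial)
  obtain ⟨U, hU, hxU, hUV, m, e', he'⟩ := hG.exists_affine hxV
  have h1 := (he.mono hUV).free
  have h2 := he'.free
  refine hasFrameNear_of_projective (hF.isCoherent.kernel hG.isCoherent φ) hU ?_ hxU
  have hsurj := hF.isCoherent.isQC.surjective_app hG.isCoherent.isQC φ hU
  obtain ⟨σ, hσ⟩ := Module.projective_lifting_property (appLin φ U) LinearMap.id hsurj
  let p : Γ(F, U) →ₗ[Γ(X, U)] Γ(F, U) := LinearMap.id - σ ∘ₗ appLin φ U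
  have hp : ∀ s, φ.app U (p s) = 0 := fun s ↦ by
    have := LinearMap.congr_fun hσ (φ.app U s)
    change φ.app U (s - σ (φ.app U s)) = 0
    rw [map_sub, sub_eq_zero]
    exact this.symm
  choose t ht using fun s ↦ exists_kernel_section φ U (p s) (hp s)
  have hinj := app_injective (kernel.ι φ) U
  let q : Γ(F, U) →ₗ[Γ(X, U)] Γ(Limits.kernel φ, U) :=
    { toFun := t
      map_add' := fun s s' ↦ hinj (by rw [map_add, ht, ht, ht, map_add])
      map_smul' := fun r s ↦ hinj (by rw [RingHom.id_apply, app_smul, ht, ht, map_smul]) }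
  refine Module.Projective.of_split (appLin (kernel.ι φ) U) q (LinearMap.ext fun s ↦ hinj ?_)
  change (kernel.ι φ).app U (t ((kernel.ι φ).app U s)) = (kernel.ι φ).app U s
  rw [ht]
  change _ - σ (φ.app U _) = _
  rw [kernel_section_condition, map_zero, sub_zero]
  rfl

end Bundles

/-! ### Restriction to open subschemes -/

section Restriction
variable {X : Scheme.{u}} {F G H : X.Modules} {U : X.Opens}

lemma image_ι_basicOpen (V : U.toScheme.Opens) (f : Γ(X, U.ι ''ᵁ V)) :
    U.ι ''ᵁ (U.toScheme.basicOpen (U := V) f) = X.basicOpen f := by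
  have h : (U.ι.appIso V).inv f = f := by rw [Scheme.Opens.ι_appIso]; rfl
  exact (Scheme.image_basicOpen U.ι (U := V) f).trans (congrArg X.basicOpen h)

lemma IsQC.restrict (hF : IsQC F) : IsQC (F.restrict U.ι) := by
  have hpow : ∀ {W : U.toScheme.Opens} (r : Γ(X, U.ι ''ᵁ W)) (s : Γ(F, U.ι ''ᵁ W)),
    (HSMul.hSMul (α := Γ(U.toScheme, W)) (β := Γ(F.restrict U.ι, W)) r s : Γ(F.restrict U.ι, W)) =
      r • s := fun r s ↦ restrict_smul F U _ r s
  constructor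
  · intro V hV (f : Γ(X, U.ι ''ᵁ V)) (s : Γ(F, U.ι ''ᵁ (U.toScheme.basicOpen (U := V) f)))
    have hV' := hV.image_of_isOpenImmersion U.ι
    have hD := image_ι_basicOpen V f
    obtain ⟨n, t, ht⟩ := hF.exists_extend _ hV' f (rs F hD.ge s)
    refine ⟨n, t, ?_⟩
    have h1 := congrArg (rs F hD.le) ht
    rw [rs_rs, rs_smul, rs_rs, rs_self, map_pow, rO_rO] at h1
    exact h1.trans (hpow _ _).symm
  · intro V hV (f : Γ(X, U.ι ''ᵁ V)) (t : Γ(F, U.ι ''ᵁ V)) ht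
    have hV' := hV.image_of_isOpenImmersion U.ι
    have hD := image_ι_basicOpen V f
    obtain ⟨n, hn⟩ := hF.exists_pow_smul _ hV' f t (by
      have h1 : rs F (U.ι.image_mono (Scheme.basicOpen_le _ _)) t =
          (0 : Γ(F, U.ι ''ᵁ (U.toScheme.basicOpen (U := V) f))) := ht
      have h2 := congrArg (rs F hD.ge) h1
      rwa [rs_rs, map_zero] at h2)
    exact ⟨n, (hpow _ _).trans hn⟩

lemma IsCoherent.restrict [IsLocallyNoetherian X] (hF : IsCoherent F) :
    IsCoherent (F.restrict U.ι) := by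
  refine hF.isQC.restrict.isCoherent fun V hV ↦ ?_
  have hV' := hV.image_of_isOpenImmersion U.ι
  have := hF.finite hV'
  obtain ⟨n, e, he⟩ := Module.Finite.exists_fin (R := Γ(X, U.ι ''ᵁ V)) (M := Γ(F, U.ι ''ᵁ V))
  refine ⟨Submodule.fg_iff_exists_fin_generating_family.mpr ⟨n, e, eq_top_iff.mpr fun s _ ↦ ?_⟩⟩
  refine (mem_span_restrict_iff (F := F) (V := V) e s).mpr ?_
  rw [he]; trivial

lemma sum_restrict {V : U.toScheme.Opens} {n : ℕ} (a : Fin n → Γ(X, U.ι ''ᵁ V))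
    (e : Fin n → Γ(F, U.ι ''ᵁ V)) :
    (Finset.sum (M := Γ(F.restrict U.ι, V)) Finset.univ
      fun i ↦ HSMul.hSMul (α := Γ(U.toScheme, V)) (β := Γ(F.restrict U.ι, V)) (a i) (e i)) =
      ∑ i, a i • e i :=
  Finset.sum_congr rfl fun i _ ↦ restrict_smul F U V (a i) (e i)

lemma HasFrameNear.restrict {x : U} (h : HasFrameNear F x.1) :
    HasFrameNear (F.restrict U.ι) x := by
  obtain ⟨W, hxW, n, e, he⟩ := h
  have he' := he.mono (show U ⊓ W ≤ W from inf_le_right)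
  have hle : U.ι ''ᵁ (U.ι ⁻¹ᵁ W) ≤ W := U.ι.image_preimage_le W
  refine ⟨U.ι ⁻¹ᵁ W, hxW, n, fun i ↦ (rs F hle (e i) : Γ(F, U.ι ''ᵁ (U.ι ⁻¹ᵁ W))), ?_⟩
  refine (isFrame_iff _).mpr fun V hV ↦ ?_
  obtain ⟨h1, h2⟩ := (isFrame_iff e).mp he (U.ι ''ᵁ V) ((U.ι.image_mono hV).trans hle)
  have h3 : ∀ a : Fin n → Γ(X, U.ι ''ᵁ V), (Finset.sum (M := Γ(F.restrict U.ι, V)) Finset.univ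
      fun i ↦ HSMul.hSMul (α := Γ(U.toScheme, V)) (β := Γ(F.restrict U.ι, V)) (a i)
        (rs (F.restrict U.ι) hV (rs F hle (e i) : Γ(F, U.ι ''ᵁ (U.ι ⁻¹ᵁ W))))) =
      ∑ i, a i • rs F ((U.ι.image_mono hV).trans hle) (e i) := fun a ↦ by
    refine (sum_restrict a _).trans (Finset.sum_congr rfl fun i _ ↦ ?_)
    exact congrArg (a i • ·) (rs_rs (F := F) hle (U.ι.image_mono hV) (e i))
  exact ⟨fun a ha ↦ h1 a ((h3 a).symm.trans ha), fun s ↦ (h2 s).imp fun a ha ↦ (h3 a).trans ha⟩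

lemma HasFrameNear.of_restrict {x : U} (h : HasFrameNear (F.restrict U.ι) x) :
    HasFrameNear F x.1 := by
  obtain ⟨W, hxW, n, e, he⟩ := h
  obtain ⟨e, rfl⟩ : ∃ e' : Fin n → Γ(F, U.ι ''ᵁ W), e' = e := ⟨e, rfl⟩
  refine ⟨U.ι ''ᵁ W, ⟨x, hxW, rfl⟩, n, e, (isFrame_iff _).mpr fun V hV ↦ ?_⟩
  obtain ⟨V', rfl⟩ : ∃ V' : U.toScheme.Opens, U.ι ''ᵁ V' = V :=
    ⟨U.ι ⁻¹ᵁ V, image_preimage_of_le (hV.trans (image_ι_le W))⟩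
  have hVW : V' ≤ W := fun y hy ↦ by
    obtain ⟨z, hz, hzy⟩ := hV ⟨y, hy, rfl⟩
    rwa [← U.ι.isOpenEmbedding.injective hzy]
  obtain ⟨h1, h2⟩ := (isFrame_iff _).mp he V' hVW
  have h3 : ∀ a : Fin n → Γ(X, U.ι ''ᵁ V'), (Finset.sum (M := Γ(F.restrict U.ι, V')) Finset.univ
      fun i ↦ HSMul.hSMul (α := Γ(U.toScheme, V')) (β := Γ(F.restrict U.ι, V')) (a i)
        (rs (F.restrict U.ι) hVW (e i))) = ∑ i, a i • rs F hV (e i) := fun a ↦ sum_restrict a _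
  exact ⟨fun a ha ↦ h1 a ((h3 a).trans ha), fun s ↦ (h2 s).imp fun a ha ↦ (h3 a).symm.trans ha⟩

lemma IsVectorBundle.restrict (hF : IsVectorBundle F) : IsVectorBundle (F.restrict U.ι) :=
  fun x ↦ HasFrameNear.restrict (hF x.1)

/-- The restriction of a complex to an open subscheme. -/
abbrev restrictComplex (K : CochainComplex X.Modules ℤ) (U : X.Opens) :
    CochainComplex U.toScheme.Modules ℤ :=
  ((Scheme.Modules.restrictFunctor U.ι).mapHomologicalComplex _).obj K

/-- The restriction of a morphism of complexes to an open subscheme. -/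
abbrev restrictComplexMap {K L : CochainComplex X.Modules ℤ} (f : K ⟶ L) (U : X.Opens) :
    restrictComplex K U ⟶ restrictComplex L U :=
  ((Scheme.Modules.restrictFunctor U.ι).mapHomologicalComplex _).map f

lemma quasiIso_restrict {K L : CochainComplex X.Modules ℤ} (f : K ⟶ L) [hf : QuasiIso f] :
    QuasiIso (restrictComplexMap f U) := by
  rw [quasiIso_iff_locCone] at hf ⊢
  intro i j k l hij hjk hkl V (x : Γ(K.X k, U.ι ''ᵁ V)) (y : Γ(L.X j, U.ι ''ᵁ V)) hx hxy p hp
  obtain ⟨W, hW, hpW, x', y', h1, h2⟩ := hf i j k l hij hjk hkl (U.ι ''ᵁ V) x y hx hxy p.1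
    ⟨p, hp, rfl⟩
  have hWe := image_preimage_of_le (hW.trans (image_ι_le V))
  have hWV : U.ι ⁻¹ᵁ W ≤ V := fun y hy ↦ by
    obtain ⟨z, hz, hzy⟩ := hW hy
    rwa [← U.ι.isOpenEmbedding.injective hzy]
  refine ⟨U.ι ⁻¹ᵁ W, hWV, hpW, rs _ hWe.le x', rs _ hWe.le y', ?_, ?_⟩
  · refine (app_rs (K.d j k) hWe.le x').trans ?_
    rw [h1, rs_rs]
    rfl
  · have e1 := app_rs (f.f j) hWe.le x'
    have e2 := app_rs (L.d i j) hWe.le y'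
    have := congrArg (rs _ hWe.le) h2
    rw [map_add, ← e1, ← e2, rs_rs] at this
    exact this

end Restriction

/-! ### Fibre products of complexes and contractible complexes -/

section Homological
variable {X : Scheme.{u}} {F G H : X.Modules} {A B C K L : CochainComplex X.Modules ℤ}

lemma IsZero.section_eq_zero (h : IsZero F) {U : X.Opens} (s : Γ(F, U)) : s = 0 :=
  congrArg (fun f : F ⟶ F ↦ f.app U s) ((IsZero.iff_id_eq_zero F).mp h)

lemma app_d_d (K : CochainComplex X.Modules ℤ) (i j k : ℤ) {U : X.Opens} (s : Γ(K.X i, U)) :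
    (K.d j k).app U ((K.d i j).app U s) = 0 :=
  congrArg (fun f : K.X i ⟶ K.X k ↦ f.app U s) (K.d_comp_d i j k)

lemma app_f_d (f : K ⟶ L) (i j : ℤ) {U : X.Opens} (s : Γ(K.X i, U)) :
    (L.d i j).app U ((f.f i).app U s) = (f.f j).app U ((K.d i j).app U s) :=
  congrArg (fun g : K.X i ⟶ L.X j ↦ g.app U s) (f.comm i j)

/-- The fibre product of two morphisms of sheaves of modules. -/
abbrev pbObj (f : F ⟶ H) (g : G ⟶ H) : X.Modules := kernel (biprod.desc f (-g))

/-- The first projection of a fibre product of sheaves. -/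
def pbObjFst (f : F ⟶ H) (g : G ⟶ H) : pbObj f g ⟶ F := kernel.ι _ ≫ biprod.fst

/-- The second projection of a fibre product of sheaves. -/
def pbObjSnd (f : F ⟶ H) (g : G ⟶ H) : pbObj f g ⟶ G := kernel.ι _ ≫ biprod.snd

lemma pbObj_condition (f : F ⟶ H) (g : G ⟶ H) : pbObjFst f g ≫ f = pbObjSnd f g ≫ g := by
  have e : biprod.desc f (-g) = biprod.fst ≫ f - biprod.snd ≫ g := by
    apply biprod.hom_ext' <;> simp
  rw [← sub_eq_zero, pbObjFst, pbObjSnd, Category.assoc, Category.assoc, ← Preadditive.comp_sub]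
  exact (congrArg (kernel.ι (biprod.desc f (-g)) ≫ ·) e.symm).trans (kernel.condition _)

lemma pbObj_hom_ext {f : F ⟶ H} {g : G ⟶ H} {T : X.Modules} {a b : T ⟶ pbObj f g}
    (h1 : a ≫ pbObjFst f g = b ≫ pbObjFst f g) (h2 : a ≫ pbObjSnd f g = b ≫ pbObjSnd f g) :
    a = b := by
  unfold pbObjFst at h1
  unfold pbObjSnd at h2
  refine (cancel_mono (kernel.ι (biprod.desc f (-g)))).mp ?_
  apply biprod.hom_ext
  · rwa [Category.assoc, Category.assoc]
  · rwa [Category.assoc, Category.assoc]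

/-- The morphism to a fibre product of sheaves with given components. -/
def pbObjLift (f : F ⟶ H) (g : G ⟶ H) {T : X.Modules} (a : T ⟶ F) (b : T ⟶ G)
    (h : a ≫ f = b ≫ g) : T ⟶ pbObj f g :=
  kernel.lift _ (biprod.lift a b) (by rw [biprod.lift_desc, h]; simp)

@[simp] lemma pbObjLift_fst (f : F ⟶ H) (g : G ⟶ H) {T : X.Modules} (a : T ⟶ F) (b : T ⟶ G)
    (h : a ≫ f = b ≫ g) : pbObjLift f g a b h ≫ pbObjFst f g = a := by
  unfold pbObjFst pbObjLift
  rw [← Category.assoc, kernel.lift_ι, biprod.lift_fst]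

@[simp] lemma pbObjLift_snd (f : F ⟶ H) (g : G ⟶ H) {T : X.Modules} (a : T ⟶ F) (b : T ⟶ G)
    (h : a ≫ f = b ≫ g) : pbObjLift f g a b h ≫ pbObjSnd f g = b := by
  unfold pbObjSnd pbObjLift
  rw [← Category.assoc, kernel.lift_ι, biprod.lift_snd]

/-- The differential of a fibre product of complexes. -/
def pbD (f : A ⟶ C) (g : B ⟶ C) (i j : ℤ) : pbObj (f.f i) (g.f i) ⟶ pbObj (f.f j) (g.f j) :=
  pbObjLift _ _ (pbObjFst _ _ ≫ A.d i j) (pbObjSnd _ _ ≫ B.d i j) (by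
    rw [Category.assoc, ← f.comm, ← Category.assoc, pbObj_condition, Category.assoc, g.comm,
      Category.assoc])

lemma pbD_fst (f : A ⟶ C) (g : B ⟶ C) (i j : ℤ) :
    pbD f g i j ≫ pbObjFst _ _ = pbObjFst _ _ ≫ A.d i j := pbObjLift_fst ..

lemma pbD_snd (f : A ⟶ C) (g : B ⟶ C) (i j : ℤ) :
    pbD f g i j ≫ pbObjSnd _ _ = pbObjSnd _ _ ≫ B.d i j := pbObjLift_snd ..

/-- The fibre product of two morphisms of complexes. -/
def pb (f : A ⟶ C) (g : B ⟶ C) : CochainComplex X.Modules ℤ where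
  X n := pbObj (f.f n) (g.f n)
  d i j := pbD f g i j
  shape i j h := by
    apply pbObj_hom_ext
    · rw [pbD_fst, A.shape _ _ h, comp_zero, zero_comp]
    · rw [pbD_snd, B.shape _ _ h, comp_zero, zero_comp]
  d_comp_d' i j k _ _ := by
    apply pbObj_hom_ext
    · rw [Category.assoc, pbD_fst, ← Category.assoc, pbD_fst, Category.assoc, A.d_comp_d,
        comp_zero, zero_comp]
    · rw [Category.assoc, pbD_snd, ← Category.assoc, pbD_snd, Category.assoc, B.d_comp_d,
        comp_zero, zero_comp]

/-- The first projection of a fibre product of complexes. -/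
def pbFst (f : A ⟶ C) (g : B ⟶ C) : pb f g ⟶ A where
  f _ := pbObjFst _ _
  comm' i j _ := (pbD_fst f g i j).symm

/-- The second projection of a fibre product of complexes. -/
def pbSnd (f : A ⟶ C) (g : B ⟶ C) : pb f g ⟶ B where
  f _ := pbObjSnd _ _
  comm' i j _ := (pbD_snd f g i j).symm

lemma pb_condition (f : A ⟶ C) (g : B ⟶ C) : pbFst f g ≫ f = pbSnd f g ≫ g := by
  ext n : 1
  exact pbObj_condition _ _

lemma pbLift_condition {f : A ⟶ C} {g : B ⟶ C} {a : K ⟶ A} {b : K ⟶ B} (h : a ≫ f = b ≫ g)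
    (n : ℤ) : a.f n ≫ f.f n = b.f n ≫ g.f n :=
  congrArg (fun φ : K ⟶ C ↦ φ.f n) h

/-- The morphism to a fibre product of complexes with given components. -/
def pbLift {f : A ⟶ C} {g : B ⟶ C} (a : K ⟶ A) (b : K ⟶ B) (h : a ≫ f = b ≫ g) : K ⟶ pb f g where
  f n := pbObjLift _ _ (a.f n) (b.f n) (pbLift_condition h n)
  comm' i j _ := by
    apply pbObj_hom_ext
    · change (_ ≫ pbD f g i j) ≫ _ =
        (K.d i j ≫ pbObjLift _ _ (a.f j) (b.f j) (pbLift_condition h j)) ≫ _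
      rw [Category.assoc, Category.assoc, pbD_fst, pbObjLift_fst, ← Category.assoc, pbObjLift_fst,
        a.comm]
    · change (_ ≫ pbD f g i j) ≫ _ =
        (K.d i j ≫ pbObjLift _ _ (a.f j) (b.f j) (pbLift_condition h j)) ≫ _
      rw [Category.assoc, Category.assoc, pbD_snd, pbObjLift_snd, ← Category.assoc, pbObjLift_snd,
        b.comm]

@[simp] lemma pbLift_fst {f : A ⟶ C} {g : B ⟶ C} (a : K ⟶ A) (b : K ⟶ B) (h : a ≫ f = b ≫ g) :
    pbLift a b h ≫ pbFst f g = a := by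
  ext n : 1
  exact pbObjLift_fst _ _ _ _ (pbLift_condition h n)

@[simp] lemma pbLift_snd {f : A ⟶ C} {g : B ⟶ C} (a : K ⟶ A) (b : K ⟶ B) (h : a ≫ f = b ≫ g) :
    pbLift a b h ≫ pbSnd f g = b := by
  ext n : 1
  exact pbObjLift_snd _ _ _ _ (pbLift_condition h n)

lemma pb_section_ext (f : A ⟶ C) (g : B ⟶ C) {n : ℤ} {U : X.Opens} {s t : Γ((pb f g).X n, U)}
    (h1 : ((pbFst f g).f n).app U s = ((pbFst f g).f n).app U t)
    (h2 : ((pbSnd f g).f n).app U s = ((pbSnd f g).f n).app U t) : s = t :=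
  app_injective (kernel.ι (biprod.desc (f.f n) (-g.f n))) U (biprod_app_ext h1 h2)

lemma exists_pb_section (f : A ⟶ C) (g : B ⟶ C) {n : ℤ} {U : X.Opens} (a : Γ(A.X n, U))
    (b : Γ(B.X n, U)) (h : (f.f n).app U a = (g.f n).app U b) :
    ∃ s : Γ((pb f g).X n, U), ((pbFst f g).f n).app U s = a ∧ ((pbSnd f g).f n).app U s = b := by
  obtain ⟨s, hs⟩ := exists_kernel_section (biprod.desc (f.f n) (-g.f n)) U (bpair a b) (by
    rw [desc_bpair, h]; simp)
  refine ⟨s, ?_, ?_⟩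
  · exact (congrArg ((biprod.fst : A.X n ⊞ B.X n ⟶ _).app U) hs).trans (fst_bpair _ _)
  · exact (congrArg ((biprod.snd : A.X n ⊞ B.X n ⟶ _).app U) hs).trans (snd_bpair _ _)

lemma pb_section_condition (f : A ⟶ C) (g : B ⟶ C) {n : ℤ} {U : X.Opens} (s : Γ((pb f g).X n, U)) :
    (f.f n).app U (((pbFst f g).f n).app U s) = (g.f n).app U (((pbSnd f g).f n).app U s) :=
  congrArg (fun φ : pb f g ⟶ C ↦ (φ.f n).app U s) (pb_condition f g)

/-- Quasi-isomorphisms are stable under base change along `f : A ⟶ C`, provided that the fibre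
product is transversal: `f` and `g` together are surjective onto `C`. -/
lemma quasiIso_pbFst (f : A ⟶ C) (g : B ⟶ C) [hg : QuasiIso g]
    (h : ∀ n, Epi (biprod.desc (f.f n) (g.f n))) : QuasiIso (pbFst f g) := by
  rw [quasiIso_iff_locCone] at hg ⊢
  intro i j k l hij hjk hkl U x y hx hxy p hp
  have hb : (B.d k l).app U (((pbSnd f g).f k).app U x) = 0 := by
    rw [app_f_d, hx, map_zero]
  have hgb : (g.f k).app U (((pbSnd f g).f k).app U x) = (C.d j k).app U ((f.f j).app U y) := by
    rw [← pb_section_condition, hxy, app_f_d]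
  obtain ⟨V, hV, hpV, b, c, h1, h2⟩ := hg i j k l hij hjk hkl U _ _ hb hgb p hp
  obtain ⟨W, hW, hpW, t, ht⟩ := (epi_iff_locSurj _).mp (h i) V c p hpV
  rw [desc_app_eq] at ht
  set a' : Γ(A.X i, W) := (biprod.fst : A.X i ⊞ B.X i ⟶ _).app W t
  set b' : Γ(B.X i, W) := (biprod.snd : A.X i ⊞ B.X i ⟶ _).app W t
  obtain ⟨s, hs1, hs2⟩ := exists_pb_section f g (n := j)
    (rs _ (hW.trans hV) y - (A.d i j).app W a') (rs _ hW b + (B.d i j).app W b') (by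
      have h3 := congrArg (rs _ hW) h2
      rw [map_add, ← app_rs (g.f j), ← app_rs (C.d i j), ← ht, rs_rs, ← app_rs (f.f j)] at h3
      rw [map_sub, map_add, ← h3, map_add, app_f_d, app_f_d]
      abel)
  refine ⟨W, hW.trans hV, hpW, s, a', pb_section_ext f g ?_ ?_, ?_⟩
  · rw [← app_f_d, hs1, map_sub, app_d_d, sub_zero, app_rs, app_rs, hxy]
  · rw [← app_f_d, hs2, map_add, app_d_d, add_zero, app_rs, h1, app_rs, rs_rs]
  · rw [hs1, sub_add_cancel]

lemma isIso_pbFst_f (f : A ⟶ C) (g : B ⟶ C) (n : ℤ) [IsIso (g.f n)] : IsIso ((pbFst f g).f n) := by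
  refine isIso_of_bijective _ fun U ↦ ⟨fun s t h ↦ pb_section_ext f g h ?_, fun a ↦ ?_⟩
  · apply (app_bijective (g.f n) U).1
    rw [← pb_section_condition, ← pb_section_condition, h]
  · obtain ⟨b, hb⟩ := (app_bijective (g.f n) U).2 ((f.f n).app U a)
    obtain ⟨s, hs, -⟩ := exists_pb_section f g a b hb.symm
    exact ⟨s, hs⟩

lemma isIso_pbSnd_f (f : A ⟶ C) (g : B ⟶ C) (n : ℤ) [IsIso (f.f n)] : IsIso ((pbSnd f g).f n) := by
  refine isIso_of_bijective _ fun U ↦ ⟨fun s t h ↦ pb_section_ext f g ?_ h, fun b ↦ ?_⟩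
  · apply (app_bijective (f.f n) U).1
    rw [pb_section_condition, pb_section_condition, h]
  · obtain ⟨a, ha⟩ := (app_bijective (f.f n) U).2 ((g.f n).app U b)
    obtain ⟨s, -, hs⟩ := exists_pb_section f g a b ha
    exact ⟨s, hs⟩

lemma isZero_pb_X {f : A ⟶ C} {g : B ⟶ C} {n : ℤ} (hA : IsZero (A.X n)) (hB : IsZero (B.X n)) :
    IsZero ((pb f g).X n) := by
  refine (IsZero.iff_id_eq_zero _).mpr (hom_ext_app fun U s ↦ pb_section_ext f g ?_ ?_)
  · exact (IsZero.section_eq_zero hA _).trans (IsZero.section_eq_zero hA _).symm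
  · exact (IsZero.section_eq_zero hB _).trans (IsZero.section_eq_zero hB _).symm

lemma epi_biprod_desc_left (f : F ⟶ H) (g : G ⟶ H) [Epi f] : Epi (biprod.desc f g) :=
  epi_of_epi_fac (biprod.inl_desc f g)

lemma epi_biprod_desc_right (f : F ⟶ H) (g : G ⟶ H) [Epi g] : Epi (biprod.desc f g) :=
  epi_of_epi_fac (biprod.inr_desc f g)

lemma IsBounded.pb (hA : IsBounded A) (hB : IsBounded B) (f : A ⟶ C) (g : B ⟶ C) :
    IsBounded (pb f g) := by
  obtain ⟨a, b, h⟩ := hA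
  obtain ⟨a', b', h'⟩ := hB
  exact ⟨min a a', max b b', fun n hn ↦ isZero_pb_X (h n (by omega)) (h' n (by omega))⟩

lemma boundedCoherent.pb [IsLocallyNoetherian X] (hA : boundedCoherent X A)
    (hB : boundedCoherent X B) (hC : ∀ n, IsCoherent (C.X n)) (f : A ⟶ C) (g : B ⟶ C) :
    boundedCoherent X (pb f g) :=
  ⟨hA.1.pb hB.1 f g, fun n ↦ ((hA.2 n).biprod (hB.2 n)).kernel (hC n) _⟩

lemma isVectorBundle_pb [IsLocallyNoetherian X] {f : A ⟶ C} {g : B ⟶ C} {n : ℤ}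
    (hA : IsVectorBundle (A.X n)) (hB : IsVectorBundle (B.X n)) (hC : IsVectorBundle (C.X n))
    (h : Epi (biprod.desc (f.f n) (g.f n))) : IsVectorBundle ((pb f g).X n) := by
  have : Epi (biprod.desc (f.f n) (-g.f n)) := by
    have e : biprod.desc (f.f n) (-g.f n) =
        biprod.map (𝟙 _) (-𝟙 _) ≫ biprod.desc (f.f n) (g.f n) := by
      apply biprod.hom_ext' <;> simp
    have : IsIso (-𝟙 (B.X n)) := ⟨-𝟙 _, by simp⟩
    rw [e]
    infer_instance
  exact (hA.biprod hB).kernel hC _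

/-- The contractible complex `F ⟶ F` in degrees `i` and `j = i + 1`. -/
def disk (F : X.Modules) (i j : ℤ) (h : i + 1 = j) : CochainComplex X.Modules ℤ :=
  HomologicalComplex.double (𝟙 F) (c := ComplexShape.up ℤ) (i₀ := i) (i₁ := j) h

section Disk
variable {i j : ℤ}

lemma disk_ne (hij : i + 1 = j) : i ≠ j := by omega

/-- The term of a disk in the lower of its two degrees. -/
def diskIsoLeft (F : X.Modules) (hij : i + 1 = j) : (disk F i j hij).X i ≅ F :=
  HomologicalComplex.doubleXIso₀ _ _

/-- The term of a disk in the upper of its two degrees. -/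
def diskIsoRight (F : X.Modules) (hij : i + 1 = j) : (disk F i j hij).X j ≅ F :=
  HomologicalComplex.doubleXIso₁ _ _ (disk_ne hij)

lemma disk_d (F : X.Modules) (hij : i + 1 = j) :
    (disk F i j hij).d i j = (diskIsoLeft F hij).hom ≫ (diskIsoRight F hij).inv := by
  refine (HomologicalComplex.double_d _ _ (disk_ne hij)).trans ?_
  rw [Category.id_comp]
  rfl

lemma disk_d_eq_zero (F : X.Modules) (hij : i + 1 = j) (k l : ℤ) (h : k ≠ i) :
    (disk F i j hij).d k l = 0 :=
  HomologicalComplex.double_d_eq_zero₀ (𝟙 F) (c := ComplexShape.up ℤ) hij _ _ h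

instance (F : X.Modules) (hij : i + 1 = j) : IsIso ((disk F i j hij).d i j) := by
  rw [disk_d]; infer_instance

lemma isZero_disk_X (F : X.Modules) (hij : i + 1 = j) (n : ℤ) (hi : n ≠ i) (hj : n ≠ j) :
    IsZero ((disk F i j hij).X n) := HomologicalComplex.isZero_double_X _ _ _ hi hj

lemma isBounded_disk (F : X.Modules) (hij : i + 1 = j) : IsBounded (disk F i j hij) :=
  ⟨i, j, fun n hn ↦ isZero_disk_X _ hij _ (by omega) (by omega)⟩

lemma isVectorBundle_disk (hF : IsVectorBundle F) (hij : i + 1 = j) (n : ℤ) :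
    IsVectorBundle ((disk F i j hij).X n) := by
  by_cases hi : n = i
  · subst hi; exact hF.of_iso (diskIsoLeft F hij).symm
  by_cases hj : n = j
  · subst hj; exact hF.of_iso (diskIsoRight F hij).symm
  exact SelfDualData.isVectorBundle_zero (isZero_disk_X _ _ _ hi hj)

lemma isCoherent_disk (hF : IsCoherent F) (hij : i + 1 = j) (n : ℤ) :
    IsCoherent ((disk F i j hij).X n) := by
  by_cases hi : n = i
  · subst hi; exact hF.of_iso (diskIsoLeft F hij).symm
  by_cases hj : n = j
  · subst hj; exact hF.of_iso (diskIsoRight F hij).symm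
  exact (SelfDualData.isVectorBundle_zero (isZero_disk_X _ _ _ hi hj)).isCoherent

lemma exactAt_disk (F : X.Modules) (hij : i + 1 = j) (n : ℤ) : (disk F i j hij).ExactAt n := by
  rw [exactAt_iff_locExact (n - 1) n (n + 1) (by omega) rfl]
  intro U s hs x hx
  refine ⟨U, le_rfl, hx, ?_⟩
  by_cases hj : n = j
  · subst hj
    obtain rfl : i = n - 1 := by omega
    obtain ⟨t, ht⟩ := (app_bijective ((disk F (n - 1) n hij).d (n - 1) n) U).2 s
    exact ⟨t, by rw [ht, rs_self]⟩
  · refine ⟨0, ?_⟩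
    rw [map_zero, rs_self]
    by_cases hi : n = i
    · subst hi
      have hj2 : n + 1 = j := hij
      subst hj2
      exact ((app_bijective ((disk F n (n + 1) rfl).d n (n + 1)) U).1
        (hs.trans (map_zero _).symm)).symm
    · exact (IsZero.section_eq_zero (isZero_disk_X F hij n hi hj) s).symm

/-- The morphism from `F ⟶ F` to `K` extending a morphism `F ⟶ K^i`. -/
def fromDisk (hij : i + 1 = j) (φ : F ⟶ K.X i) : disk F i j hij ⟶ K :=
  HomologicalComplex.mkHomFromDouble _ (disk_ne hij) φ (φ ≫ K.d i j) (by simp) (by simp)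

@[simp] lemma fromDisk_left (hij : i + 1 = j) (φ : F ⟶ K.X i) :
    (fromDisk hij φ).f i = (diskIsoLeft F hij).hom ≫ φ :=
  HomologicalComplex.mkHomFromDouble_f₀ ..

@[simp] lemma fromDisk_right (hij : i + 1 = j) (φ : F ⟶ K.X i) :
    (fromDisk hij φ).f j = (diskIsoRight F hij).hom ≫ φ ≫ K.d i j :=
  HomologicalComplex.mkHomFromDouble_f₁ ..

open scoped Classical in
/-- The morphism from `K` to `F ⟶ F` extending a morphism `K^j ⟶ F`. -/
def toDisk (hij : i + 1 = j) (φ : K.X j ⟶ F) : K ⟶ disk F i j hij where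
  f k := if hi : k = i then K.d k j ≫ φ ≫ (diskIsoLeft F hij).inv ≫ eqToHom (by rw [hi])
    else if hj : k = j then
      eqToHom (by rw [hj]) ≫ φ ≫ (diskIsoRight F hij).inv ≫ eqToHom (by rw [hj])
    else 0
  comm' k l hkl := by
    obtain rfl : k + 1 = l := hkl
    by_cases hi : k = i
    · subst hi
      obtain rfl : k + 1 = j := hij
      simp [disk_d]
    · rw [dif_neg hi, disk_d_eq_zero F hij _ _ hi, comp_zero]
      by_cases hi' : k + 1 = i
      · subst hi'
        simp
      · rw [dif_neg hi', dif_neg (by omega), comp_zero]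

@[simp] lemma toDisk_right (hij : i + 1 = j) (φ : K.X j ⟶ F) :
    (toDisk hij φ).f j = φ ≫ (diskIsoRight F hij).inv := by
  simp [toDisk, (disk_ne hij).symm]

@[simp] lemma toDisk_left (hij : i + 1 = j) (φ : K.X j ⟶ F) :
    (toDisk hij φ).f i = K.d i j ≫ φ ≫ (diskIsoLeft F hij).inv := by
  simp [toDisk]

lemma quasiIso_of_disk {hij : i + 1 = j} (f : disk F i j hij ⟶ K) (hK : ∀ n, K.ExactAt n) :
    QuasiIso f :=
  ⟨fun n ↦ (quasiIsoAt_iff_exactAt f n (exactAt_disk F hij n)).mpr (hK n)⟩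

lemma epi_fromDisk (hij : i + 1 = j) (φ : F ⟶ G) [Epi φ] (n : ℤ) :
    Epi ((fromDisk hij (K := disk G i j hij) (φ ≫ (diskIsoLeft G hij).inv)).f n) := by
  by_cases hi : n = i
  · subst hi; rw [fromDisk_left]; infer_instance
  by_cases hj : n = j
  · subst hj; rw [fromDisk_right]; infer_instance
  exact (isZero_disk_X _ _ _ hi hj).epi _

lemma epi_toDisk (hij : i + 1 = j) (φ : K.X j ⟶ F) [Epi φ] [Epi (K.d i j)] (n : ℤ) :
    Epi ((toDisk hij φ).f n) := by
  by_cases hi : n = i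
  · subst hi; rw [toDisk_left]; infer_instance
  by_cases hj : n = j
  · subst hj; rw [toDisk_right]; infer_instance
  exact (isZero_disk_X _ _ _ hi hj).epi _

end Disk
end Homological

/-! ### Complexes of modules and sections over affine opens -/

section ProjectiveTerms
variable {𝒜 : Type*} [Category* 𝒜] [Abelian 𝒜]

lemma projective_kernel_of_exact {A B C : 𝒜} (f : A ⟶ B) (g : B ⟶ C) (w : f ≫ g = 0)
    (h : (ShortComplex.mk f g w).Exact) (hA : Projective A) (hg : Projective (kernel g)) :
    Projective (kernel f) := by
  have : Epi (kernel.lift g f w) := (ShortComplex.exact_iff_epi_kernel_lift _).mp h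
  let σ : kernel g ⟶ A := Projective.factorThru (𝟙 _) (kernel.lift g f w)
  have hσ : σ ≫ kernel.lift g f w = 𝟙 _ := Projective.factorThru_comp _ _
  have hp : kernel.lift g f w ≫ kernel.ι g = f := kernel.lift_ι _ _ _
  have hι : kernel.ι f ≫ kernel.lift g f w = 0 := by
    rw [← cancel_mono (kernel.ι g), Category.assoc, hp, kernel.condition, zero_comp]
  have hr : (𝟙 A - kernel.lift g f w ≫ σ) ≫ f = 0 := by
    have h1 : (kernel.lift g f w ≫ σ) ≫ kernel.lift g f w = kernel.lift g f w := by
      rw [Category.assoc, hσ, Category.comp_id]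
    have h2 := congrArg (· ≫ kernel.ι g) h1
    simp only [Category.assoc, hp] at h2
    rw [Preadditive.sub_comp, Category.id_comp, Category.assoc, h2, sub_self]
  refine Retract.projective (Y := A)
    { i := kernel.ι f, r := kernel.lift f (𝟙 A - kernel.lift g f w ≫ σ) hr, retract := ?_ }
  rw [← cancel_mono (kernel.ι f), Category.assoc, kernel.lift_ι, Preadditive.comp_sub,
    reassoc_of% hι, zero_comp, sub_zero, Category.id_comp, Category.comp_id]

variable {P C : CochainComplex 𝒜 ℤ}

lemma coneTo_eq (f : P ⟶ C) (i j k : ℤ) :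
    biprod.map (𝟙 (P.X j)) (-𝟙 (C.X i)) ≫ coneFrom f i j k = coneTo f i j k := by
  unfold coneFrom coneTo
  apply biprod.hom_ext' <;> apply biprod.hom_ext <;> simp

lemma isIso_biprod_map_neg (A B : 𝒜) : IsIso (biprod.map (𝟙 A) (-𝟙 B)) :=
  ⟨biprod.map (𝟙 _) (-𝟙 _), by
    constructor <;> apply biprod.hom_ext' <;> apply biprod.hom_ext <;> simp⟩

lemma projective_kernel_coneTo (f : P ⟶ C) (i j k : ℤ)
    (h : Projective (kernel (coneFrom f i j k))) :
    Projective (kernel (coneTo f i j k)) := by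
  rw [← coneTo_eq]
  have := isIso_biprod_map_neg (P.X j) (C.X i)
  exact Projective.of_iso (kernelIsIsoComp _ _).symm h

/-- If a bounded complex `C` whose terms are projective, except possibly the lowest one `C^k`, is
quasi-isomorphic to a bounded complex of projectives in degrees above `k`, then `C^k` is projective
as well. -/
lemma projective_lowest_term (f : P ⟶ C) [hf : QuasiIso f] (k b : ℤ) (hP : ∀ n, Projective (P.X n))
    (hPk : IsZero (P.X k)) (hPb : ∀ n, b < n → IsZero (P.X n)) (hCk : IsZero (C.X (k - 1)))
    (hCb : ∀ n, b < n → IsZero (C.X n)) (hC : ∀ n, k < n → Projective (C.X n)) :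
    Projective (C.X k) := by
  rw [quasiIso_iff_cone_exact] at hf
  -- descending induction: the cocycles of the cone are projective in degrees above `k`
  have key : ∀ m : ℕ, ∀ n : ℤ, k < n → b - m < n →
      Projective (kernel (coneTo f n (n + 1) (n + 1 + 1))) := by
    intro m
    induction m with
    | zero =>
      intro n hn hbn
      have h0 : IsZero (P.X (n + 1) ⊞ C.X n) := by
        rw [biprod_isZero_iff]
        exact ⟨hPb _ (by push_cast at hbn; omega), hCb _ (by push_cast at hbn; omega)⟩
      have : IsZero (kernel (coneTo f n (n + 1) (n + 1 + 1))) := h0.of_mono (kernel.ι _)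
      exact this.projective
    | succ m ih =>
      intro n hn hbn
      have h1 := ih (n + 1) (by omega) (by push_cast at hbn; omega)
      have h2 : Projective (P.X (n + 1) ⊞ C.X n) := by
        have := hP (n + 1)
        have := hC n hn
        infer_instance
      have h3 := projective_kernel_of_exact _ _ _ (hf n (n + 1) _ _ rfl rfl rfl) h2 h1
      exact projective_kernel_coneTo _ _ _ _ h3
  have h1 := key (b - k).toNat (k + 1) (by omega) (by omega)
  -- the lowest term of the cone injects, so that it is isomorphic to the cocycles one degree above
  have hm : Mono (coneTo f k (k + 1) (k + 1 + 1)) := by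
    have h2 := hf (k - 1) k (k + 1) (k + 1 + 1) (by omega) rfl rfl
    refine h2.mono_g ?_
    have : IsZero (P.X k ⊞ C.X (k - 1)) := (biprod_isZero_iff _ _).mpr ⟨hPk, hCk⟩
    exact this.eq_of_src _ _
  have := isIso_biprod_map_neg (P.X (k + 1)) (C.X k)
  have hm' : Mono (coneFrom f k (k + 1) (k + 1 + 1)) := by
    rw [← coneTo_eq] at hm
    have : coneFrom f k (k + 1) (k + 1 + 1) = inv (biprod.map (𝟙 (P.X (k + 1))) (-𝟙 (C.X k))) ≫
      biprod.map (𝟙 (P.X (k + 1))) (-𝟙 (C.X k)) ≫ coneFrom f k (k + 1) (k + 1 + 1) := by simp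
    rw [this]
    infer_instance
  have w := coneFrom_coneTo f k (k + 1) (k + 1 + 1) (k + 1 + 1 + 1)
  have he : Epi (kernel.lift _ _ w) :=
    (ShortComplex.exact_iff_epi_kernel_lift _).mp (hf k (k + 1) _ _ rfl rfl rfl)
  have hm2 : Mono (kernel.lift _ _ w) := by
    have : Mono (kernel.lift _ _ w ≫ kernel.ι _) := by rw [kernel.lift_ι]; exact hm'
    exact mono_of_mono _ (kernel.ι _)
  have : IsIso (kernel.lift _ _ w) := isIso_of_mono_of_epi _
  have h2 : Projective (P.X (k + 1) ⊞ C.X k) :=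
    Projective.of_iso (asIso (kernel.lift _ _ w)).symm h1
  exact Retract.projective (Y := P.X (k + 1) ⊞ C.X k)
    { i := biprod.inr, r := biprod.snd, retract := biprod.inr_snd }

end ProjectiveTerms

section Lift
universe v w
variable {𝒜 : Type w} [Category.{v} 𝒜] [Abelian 𝒜] {P C K : CochainComplex 𝒜 ℤ}

/-- A quasi-isomorphism from a bounded above complex of projectives to the target of another
quasi-isomorphism `c` lifts along `c` up to homotopy, and the lift is a quasi-isomorphism. -/
lemma exists_quasiIso_lift (b : ℤ) (hP : ∀ n, Projective (P.X n))
    (hPb : ∀ n, b < n → IsZero (P.X n)) (p : P ⟶ K) (c : C ⟶ K) [QuasiIso p] [QuasiIso c] :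
    ∃ f : P ⟶ C, QuasiIso f := by
  let := HasDerivedCategory.standard 𝒜
  have : P.IsStrictlyLE b := (CochainComplex.isStrictlyLE_iff _ _).mpr hPb
  have := CochainComplex.isKProjective_of_projective P b
  obtain ⟨g, hg⟩ := (CochainComplex.IsKProjective.Qh_map_bijective P
    ((HomotopyCategory.quotient _ _).obj C)).surjective
    ((DerivedCategory.quotientCompQhIso 𝒜).hom.app P ≫ DerivedCategory.Q.map p ≫
      inv (DerivedCategory.Q.map c) ≫ (DerivedCategory.quotientCompQhIso 𝒜).inv.app C)
  obtain ⟨f, rfl⟩ := (HomotopyCategory.quotient _ _).map_surjective g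
  refine ⟨f, (DerivedCategory.isIso_Q_map_iff_quasiIso _ f).mp ?_⟩
  have h := DerivedCategory.quotientCompQhIso_hom_naturality f
  rw [hg] at h
  simp only [Category.assoc, Iso.inv_hom_id_app, Category.comp_id] at h
  rw [← (cancel_epi ((DerivedCategory.quotientCompQhIso 𝒜).hom.app P)).mp h]
  infer_instance

end Lift

section QuasiIsoModuleCat
variable {R : Type u} [CommRing R] {K L : CochainComplex (ModuleCat.{u} R) ℤ}

lemma quasiIso_moduleCat (f : K ⟶ L)
    (h : ∀ i j k l : ℤ, i + 1 = j → j + 1 = k → k + 1 = l → ∀ (x : K.X k) (y : L.X j),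
      K.d k l x = 0 → f.f k x = L.d j k y →
        ∃ (x' : K.X j) (y' : L.X i), K.d j k x' = x ∧ f.f j x' + L.d i j y' = y) : QuasiIso f := by
  rw [quasiIso_iff_cone_exact]
  intro i j k l hij hjk hkl
  rw [ShortComplex.moduleCat_exact_iff]
  intro (z : (K.X k ⊞ L.X j : ModuleCat R)) (hz : coneTo f j k l z = 0)
  have e : ∀ {M N : ModuleCat.{u} R} (z : (M ⊞ N : ModuleCat R)),
      z = (biprod.inl : M ⟶ M ⊞ N) ((biprod.fst : M ⊞ N ⟶ M) z) +
        (biprod.inr : N ⟶ M ⊞ N) ((biprod.snd : M ⊞ N ⟶ N) z) := fun {M N} z ↦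
    (congrArg (fun g : M ⊞ N ⟶ M ⊞ N ↦ g z) (biprod.total (X := M) (Y := N))).symm
  have c1 : coneTo f j k l ≫ biprod.fst = biprod.fst ≫ K.d k l := by
    unfold coneTo; apply biprod.hom_ext' <;> simp
  have c2 : coneTo f j k l ≫ biprod.snd = biprod.fst ≫ f.f k - biprod.snd ≫ L.d j k := by
    unfold coneTo; apply biprod.hom_ext' <;> simp
  have z1 := congrArg (fun g : K.X k ⊞ L.X j ⟶ K.X l ↦ g z) c1
  have z2 := congrArg (fun g : K.X k ⊞ L.X j ⟶ L.X k ↦ g z) c2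
  have z1' : K.d k l ((biprod.fst : K.X k ⊞ L.X j ⟶ _) z) = 0 :=
    z1.symm.trans ((congrArg (biprod.fst : K.X l ⊞ L.X k ⟶ _) hz).trans (map_zero _))
  have z2' : f.f k ((biprod.fst : K.X k ⊞ L.X j ⟶ _) z) -
      L.d j k ((biprod.snd : K.X k ⊞ L.X j ⟶ _) z) = 0 :=
    z2.symm.trans ((congrArg (biprod.snd : K.X l ⊞ L.X k ⟶ _) hz).trans (map_zero _))
  obtain ⟨x', y', h1, h2⟩ := h i j k l hij hjk hkl _ _ z1' (sub_eq_zero.mp z2')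
  have c3 : (biprod.inl : K.X j ⟶ K.X j ⊞ L.X i) ≫ coneFrom f i j k =
      K.d j k ≫ biprod.inl + f.f j ≫ biprod.inr := by
    unfold coneFrom; apply biprod.hom_ext <;> simp
  have c4 : (biprod.inr : L.X i ⟶ K.X j ⊞ L.X i) ≫ coneFrom f i j k = L.d i j ≫ biprod.inr := by
    unfold coneFrom; apply biprod.hom_ext <;> simp
  refine ⟨(biprod.inl : K.X j ⟶ K.X j ⊞ L.X i) x' + (biprod.inr : L.X i ⟶ K.X j ⊞ L.X i) y', ?_⟩
  have z3 : coneFrom f i j k ((biprod.inl : K.X j ⟶ K.X j ⊞ L.X i) x') =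
      (biprod.inl : K.X k ⟶ K.X k ⊞ L.X j) (K.d j k x') +
        (biprod.inr : L.X j ⟶ K.X k ⊞ L.X j) (f.f j x') := 
    congrArg (fun g : K.X j ⟶ K.X k ⊞ L.X j ↦ g x') c3
  have z4 : coneFrom f i j k ((biprod.inr : L.X i ⟶ K.X j ⊞ L.X i) y') =
      (biprod.inr : L.X j ⟶ K.X k ⊞ L.X j) (L.d i j y') := 
    congrArg (fun g : L.X i ⟶ K.X k ⊞ L.X j ↦ g y') c4
  change coneFrom f i j k (_ + _) = z
  rw [map_add, z3, z4, e z, ← h1, ← h2, map_add, add_assoc]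

end QuasiIsoModuleCat

section SectionsFunctor
variable {X : Scheme.{u}} (V : X.Opens) {F G : X.Modules} {K L : CochainComplex X.Modules ℤ}

/-- Sections over `V`, as a functor to modules over the functions on `V`. -/
def sectionsFunctor : X.Modules ⥤ ModuleCat.{u} Γ(X, V) where
  obj F := ModuleCat.of Γ(X, V) Γ(F, V)
  map f := ModuleCat.ofHom (appLin f V)
  map_id _ := rfl
  map_comp _ _ := rfl

instance : (sectionsFunctor V).Additive where
  map_add := rfl

/-- The complex of sections over `V`. -/
abbrev sectionsComplex (K : CochainComplex X.Modules ℤ) :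
    CochainComplex (ModuleCat.{u} Γ(X, V)) ℤ :=
  ((sectionsFunctor V).mapHomologicalComplex _).obj K

/-- On an affine open, a quasi-isomorphism of complexes of quasi-coherent sheaves induces a
quasi-isomorphism of the complexes of sections. -/
lemma quasiIso_sections (f : K ⟶ L) [hf : QuasiIso f] (hK : ∀ n, IsQC (K.X n))
    (hL : ∀ n, IsQC (L.X n)) (hV : IsAffineOpen V) :
    QuasiIso (((sectionsFunctor V).mapHomologicalComplex _).map f) := by
  rw [quasiIso_iff_cone_exact] at hf
  refine quasiIso_moduleCat _ fun i j k l hij hjk hkl (x : Γ(K.X k, V)) (y : Γ(L.X j, V))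
    (hx : (K.d k l).app V x = 0) (hxy : (f.f k).app V x = (L.d j k).app V y) ↦ ?_
  have h := (exact_iff_locExact _ _ (coneFrom_coneTo f i j k l)).mp (hf i j k l hij hjk hkl)
  obtain ⟨z, hz⟩ := h.exists_preimage ((hK j).biprod (hL i)) ((hK k).biprod (hL j))
    ((hK l).biprod (hL k)) (coneFrom_coneTo f i j k l) hV (bpair x y) (by
      unfold coneTo
      rw [desc_bpair, lift_app_eq, lift_app_eq, hx, hxy]
      apply biprod_app_ext <;> simp)
  unfold coneFrom at hz
  rw [bpair_ext_iff, desc_app_eq, lift_app_eq, lift_app_eq] at hz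
  obtain ⟨h1, h2⟩ := hz
  simp only [map_add, fst_bpair, snd_bpair, zero_app_apply, add_zero] at h1 h2
  exact ⟨(biprod.fst : K.X j ⊞ L.X i ⟶ _).app V z, (biprod.snd : K.X j ⊞ L.X i ⟶ _).app V z, h1, h2⟩

end SectionsFunctor

/-! ### Resolutions by complexes of vector bundles -/

section Resolution
variable {X : Scheme.{u}} {F G : X.Modules} {K L K₀ : CochainComplex X.Modules ℤ}

lemma exists_common_frames (E : ℤ → X.Modules) (a : ℤ)
    (hE : ∀ n, a ≤ n → IsVectorBundle (E n)) (x : X) :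
    ∀ m : ℕ, ∃ V : X.Opens, x ∈ V ∧ ∀ n, a ≤ n → n < a + m →
      ∃ (k : ℕ) (e : Fin k → Γ(E n, V)), IsFrame (E n) V e := by
  intro m
  induction m with
  | zero => exact ⟨⊤, trivial, fun n h1 h2 ↦ by push_cast at h2; omega⟩
  | succ m ih =>
    obtain ⟨V, hxV, hV⟩ := ih
    obtain ⟨W, hxW, k, e, he⟩ := hE (a + m) (by omega) x
    refine ⟨V ⊓ W, ⟨hxV, hxW⟩, fun n h1 h2 ↦ ?_⟩
    push_cast at h2
    by_cases hn : n = a + m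
    · subst hn
      exact ⟨k, _, he.mono inf_le_right⟩
    · obtain ⟨k', e', he'⟩ := hV n h1 (by omega)
      exact ⟨k', _, he'.mono inf_le_left⟩

lemma IsZero.projective_sections (h : IsZero F) (W : X.Opens) :
    Module.Projective Γ(X, W) Γ(F, W) := by
  have : Subsingleton Γ(F, W) := ⟨fun s t ↦
    (IsZero.section_eq_zero h s).trans (IsZero.section_eq_zero h t).symm⟩
  infer_instance

/-- Near every point, finitely many vector bundles have projective modules of sections over all
small open subsets. -/
lemma exists_projective_sections (E : ℤ → X.Modules) (a b : ℤ)
    (hE : ∀ n, a ≤ n → IsVectorBundle (E n)) (h0 : ∀ n, b < n → IsZero (E n)) (x : X) :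
    ∃ V : X.Opens, x ∈ V ∧ ∀ W ≤ V, ∀ n, a ≤ n → Module.Projective Γ(X, W) Γ(E n, W) := by
  obtain ⟨V, hxV, hV⟩ := exists_common_frames E a hE x (b + 1 - a).toNat
  refine ⟨V, hxV, fun W hWV n hn ↦ ?_⟩
  by_cases hb : b < n
  · exact IsZero.projective_sections (h0 n hb) W
  · obtain ⟨k, e, he⟩ := hV n (by omega) (by omega)
    have := (he.mono hWV).free
    infer_instance

/-- The complex `K` is locally quasi-isomorphic to bounded complexes of vector bundles, with a
uniform bound. -/
def IsLocallyPerfect (K : CochainComplex X.Modules ℤ) : Prop :=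
  ∃ a b : ℤ, ∀ x : X, ∃ U : X.Opens, x ∈ U ∧ ∃ P : CochainComplex U.toScheme.Modules ℤ,
    (∀ n, IsVectorBundle (P.X n)) ∧ (∀ n, (n < a ∨ b < n) → IsZero (P.X n)) ∧
    ∃ φ : P ⟶ restrictComplex K U, QuasiIso φ

lemma IsZero.restrict (h : IsZero F) (U : X.Opens) : IsZero (F.restrict U.ι) :=
  (Scheme.Modules.restrictFunctor U.ι).map_isZero h

lemma isLocallyPerfect_of_isVectorBundle (hb : IsBounded K) (hK : ∀ n, IsVectorBundle (K.X n)) :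
    IsLocallyPerfect K := by
  obtain ⟨a, b, h⟩ := hb
  exact ⟨a, b, fun x ↦ ⟨⊤, trivial, restrictComplex K ⊤, fun n ↦ (hK n).restrict,
    fun n hn ↦ IsZero.restrict (h n hn) _, 𝟙 _, inferInstance⟩⟩

variable [IsLocallyNoetherian X]

/-- In a bounded coherent complex `C` quasi-isomorphic to a perfect complex, the lowest term is a
vector bundle as soon as the others are and it lies far enough to the left. -/
lemma isVectorBundle_lowest_term (C : CochainComplex X.Modules ℤ) (hC : ∀ n, IsCoherent (C.X n))
    (hK₀ : ∀ n, IsCoherent (K₀.X n)) (t : C ⟶ K₀) [QuasiIso t] (k a b b' : ℤ)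
    (hk : k < a) (hCk : ∀ n < k, IsZero (C.X n)) (hCb : ∀ n, b' < n → IsZero (C.X n))
    (hCP : ∀ n, k < n → IsVectorBundle (C.X n))
    (hP : ∀ x : X, ∃ U : X.Opens, x ∈ U ∧ ∃ P : CochainComplex U.toScheme.Modules ℤ,
      (∀ n, IsVectorBundle (P.X n)) ∧ (∀ n, (n < a ∨ b < n) → IsZero (P.X n)) ∧
      ∃ φ : P ⟶ restrictComplex K₀ U, QuasiIso φ) :
    IsVectorBundle (C.X k) := by
  intro x
  obtain ⟨U, hxU, P, hPv, hP0, φ, hφ⟩ := hP x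
  suffices HasFrameNear ((C.X k).restrict U.ι) (⟨x, hxU⟩ : U) from this.of_restrict
  obtain ⟨V₁, hx₁, hV₁⟩ := exists_projective_sections P.X a b (fun n _ ↦ hPv n)
    (fun n hn ↦ hP0 n (Or.inr hn)) ⟨x, hxU⟩
  obtain ⟨V₂, hx₂, hV₂⟩ := exists_projective_sections (fun n ↦ (C.X n).restrict U.ι) (k + 1) b'
    (fun n hn ↦ (hCP n (by omega)).restrict) (fun n hn ↦ IsZero.restrict (hCb n hn) U) ⟨x, hxU⟩
  obtain ⟨V, hV, hxV, hVV⟩ := exists_affine_le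
    (show (⟨x, hxU⟩ : U.toScheme) ∈ V₁ ⊓ V₂ from ⟨hx₁, hx₂⟩)
  have hqi : QuasiIso (restrictComplexMap t U) := quasiIso_restrict t
  have hp := quasiIso_sections V φ (fun n ↦ (hPv n).isCoherent.isQC)
    (fun n ↦ ((hK₀ n).restrict (U := U)).isQC) hV
  have ht := quasiIso_sections V (restrictComplexMap t U) (fun n ↦ ((hC n).restrict (U := U)).isQC)
    (fun n ↦ ((hK₀ n).restrict (U := U)).isQC) hV
  have hPp : ∀ n, Projective ((sectionsComplex V P).X n) := fun n ↦
    (IsProjective.iff_projective _).mp (by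
      by_cases hn : n < a
      · exact IsZero.projective_sections (hP0 n (Or.inl hn)) V
      · exact hV₁ V (hVV.trans inf_le_left) n (by omega))
  have hPz : ∀ n, (n < a ∨ b < n) → IsZero ((sectionsComplex V P).X n) := fun n hn ↦
    (sectionsFunctor V).map_isZero (hP0 n hn)
  have hCz : ∀ n, (n < k ∨ b' < n) → IsZero ((sectionsComplex V (restrictComplex C U)).X n) :=
    fun n hn ↦ (sectionsFunctor V).map_isZero (IsZero.restrict (hn.elim (hCk n) (hCb n)) U)
  obtain ⟨f, hf⟩ := exists_quasiIso_lift b hPp (fun n hn ↦ hPz n (Or.inr hn))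
    (((sectionsFunctor V).mapHomologicalComplex _).map φ)
    (((sectionsFunctor V).mapHomologicalComplex _).map (restrictComplexMap t U))
  -- over a small affine open subset, the complex of sections of `C` receives a quasi-isomorphism
  -- from a complex of projective modules without term in degree `k`
  have := projective_lowest_term f k (max b b') hPp (hPz k (Or.inl hk))
    (fun n hn ↦ hPz n (by omega)) (hCz _ (by omega)) (fun n hn ↦ hCz n (by omega))
    (fun n hn ↦ (IsProjective.iff_projective _).mp (hV₂ V (hVV.trans inf_le_right) n (by omega)))
  exact hasFrameNear_of_projective (hC k).restrict hV ((IsProjective.iff_projective _).mpr this) hxV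

/-- Every coherent sheaf is a quotient of a vector bundle. -/
def HasEnoughBundles (X : Scheme.{u}) : Prop :=
  ∀ F : X.Modules, IsCoherent F → ∃ (B : X.Modules) (φ : B ⟶ F), IsVectorBundle B ∧ Epi φ

/-- A bounded coherent complex is quasi-isomorphic to one whose term in degree `n` is a vector
bundle; only the terms in degrees `n` and `n - 1` change. -/
lemma exists_quasiIso_isVectorBundle (hX : HasEnoughBundles X) (hK : boundedCoherent X K) (n : ℤ) :
    ∃ (K' : CochainComplex X.Modules ℤ) (t : K' ⟶ K), QuasiIso t ∧ boundedCoherent X K' ∧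
      IsVectorBundle (K'.X n) ∧ ∀ m, m ≠ n → m ≠ n - 1 → IsIso (t.f m) := by
  obtain ⟨B, φ, hB, hφ⟩ := hX _ (hK.2 n)
  have hn : n - 1 + 1 = n := by omega
  let g : disk B (n - 1) n hn ⟶ disk (K.X n) (n - 1) n hn :=
    fromDisk hn (φ ≫ (diskIsoLeft (K.X n) hn).inv)
  have hg : QuasiIso g := quasiIso_of_disk g (exactAt_disk _ _)
  have he : ∀ m, Epi (g.f m) := epi_fromDisk hn φ
  let f : K ⟶ disk (K.X n) (n - 1) n hn := toDisk hn (𝟙 _)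
  refine ⟨pb f g, pbFst f g, quasiIso_pbFst f g fun m ↦ epi_biprod_desc_right _ _,
    hK.pb ⟨isBounded_disk _ _, isCoherent_disk hB.isCoherent hn⟩ (isCoherent_disk (hK.2 n) hn) f g,
    ?_, fun m h1 h2 ↦ ?_⟩
  · have : IsIso (f.f n) := by
      rw [toDisk_right]; infer_instance
    have := isIso_pbSnd_f f g n
    exact hB.of_iso ((asIso ((pbSnd f g).f n)).trans (diskIsoRight B hn)).symm
  · have : IsIso (g.f m) := ⟨0, (isZero_disk_X _ _ _ h2 h1).eq_of_src _ _,
      (isZero_disk_X _ _ _ h2 h1).eq_of_src _ _⟩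
    exact isIso_pbFst_f f g m

/-- A bounded coherent complex quasi-isomorphic to a perfect one has a resolution by a bounded
complex of vector bundles. -/
theorem exists_bundle_resolution (hX : HasEnoughBundles X) (hK : boundedCoherent X K)
    (hK₀ : ∀ n, IsCoherent (K₀.X n)) (w : K ⟶ K₀) [QuasiIso w] (hP : IsLocallyPerfect K₀) :
    ∃ (C : CochainComplex X.Modules ℤ) (t : C ⟶ K), QuasiIso t ∧ boundedBundle X C := by
  obtain ⟨a, b, hP⟩ := hP
  obtain ⟨a', b', hK0⟩ := hK.1
  -- the terms are replaced by vector bundles one after the other, from the right to the left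
  have key : ∀ m : ℕ, ∃ (C : CochainComplex X.Modules ℤ) (t : C ⟶ K), QuasiIso t ∧
      boundedCoherent X C ∧ (∀ n, b' - m < n → IsVectorBundle (C.X n)) ∧
      ∀ n, (n < min a' (b' - m) ∨ b' < n) → IsZero (C.X n) := by
    intro m
    induction m with
    | zero =>
      refine ⟨K, 𝟙 _, inferInstance, hK, fun n hn ↦ ?_, fun n hn ↦ hK0 n (by omega)⟩
      exact SelfDualData.isVectorBundle_zero (hK0 n (Or.inr (by simpa using hn)))
    | succ m ih =>
      obtain ⟨C, t, ht, hC, hCv, hC0⟩ := ih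
      obtain ⟨C', t', ht', hC', hCn, hiso⟩ := exists_quasiIso_isVectorBundle hX hC (b' - m)
      refine ⟨C', t' ≫ t, inferInstance, hC', fun n hn ↦ ?_, fun n hn ↦ ?_⟩
      · push_cast at hn
        by_cases hn' : n = b' - m
        · subst hn'; exact hCn
        · have := hiso n hn' (by omega)
          exact (hCv n (by omega)).of_iso (asIso (t'.f n)).symm
      · push_cast at hn
        have := hiso n (by omega) (by omega)
        exact (hC0 n (by omega)).of_iso (asIso (t'.f n))
  -- after so many steps, the lowest term lies below both the perfect amplitude and the range of `K`
  obtain ⟨C, t, ht, hC, hCv, hC0⟩ := key (b' - min a' a + 1).toNat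
  refine ⟨C, t, ht, hC.1, fun n ↦ ?_⟩
  set k := b' - ((b' - min a' a + 1).toNat : ℤ) with hk
  rcases lt_trichotomy n k with h | rfl | h
  · exact SelfDualData.isVectorBundle_zero (hC0 n (by omega))
  · exact isVectorBundle_lowest_term C hC.2 hK₀ (t ≫ w) k a b b' (by omega)
      (fun n hn ↦ hC0 n (by omega)) (fun n hn ↦ hC0 n (Or.inr hn)) hCv hP
  · exact hCv n h

end Resolution

/-! ### Morphisms in the derived category -/

section Product
variable {X : Scheme.{u}} {F G : X.Modules} {K K' L N : CochainComplex X.Modules ℤ}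

lemma exactAt_of_isZero {n : ℤ} (h : IsZero (K.X n)) : K.ExactAt n :=
  (exactAt_iff_locExact (n - 1) n (n + 1) (by omega) rfl).mpr fun U s _ x hx ↦
    ⟨U, le_rfl, hx, 0, by rw [IsZero.section_eq_zero h s, map_zero, map_zero]⟩

open scoped ZeroObject in
/-- The direct sum of two complexes, as a fibre product over zero. -/
def prodCx (K L : CochainComplex X.Modules ℤ) : CochainComplex X.Modules ℤ :=
  pb (0 : K ⟶ 0) (0 : L ⟶ 0)

namespace prodCx

/-- The first projection of a direct sum of complexes. -/
def fst (K L : CochainComplex X.Modules ℤ) : prodCx K L ⟶ K := pbFst _ _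

/-- The second projection of a direct sum of complexes. -/
def snd (K L : CochainComplex X.Modules ℤ) : prodCx K L ⟶ L := pbSnd _ _

/-- The morphism to a direct sum of complexes with given components. -/
def lift (f : N ⟶ K) (g : N ⟶ L) : N ⟶ prodCx K L := pbLift f g (by simp)

@[simp] lemma lift_fst (f : N ⟶ K) (g : N ⟶ L) : lift f g ≫ fst K L = f := pbLift_fst ..
@[simp] lemma lift_snd (f : N ⟶ K) (g : N ⟶ L) : lift f g ≫ snd K L = g := pbLift_snd ..

lemma section_ext {n : ℤ} {U : X.Opens} {s t : Γ((prodCx K L).X n, U)}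
    (h1 : ((fst K L).f n).app U s = ((fst K L).f n).app U t)
    (h2 : ((snd K L).f n).app U s = ((snd K L).f n).app U t) : s = t := pb_section_ext _ _ h1 h2

lemma exists_section {n : ℤ} {U : X.Opens} (a : Γ(K.X n, U)) (b : Γ(L.X n, U)) :
    ∃ s : Γ((prodCx K L).X n, U), ((fst K L).f n).app U s = a ∧ ((snd K L).f n).app U s = b :=
  exists_pb_section _ _ a b rfl

lemma hom_ext {f g : N ⟶ prodCx K L} (h1 : f ≫ fst K L = g ≫ fst K L)
    (h2 : f ≫ snd K L = g ≫ snd K L) : f = g := by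
  ext n : 1
  refine hom_ext_app fun U s ↦ section_ext ?_ ?_
  · exact congrArg (fun φ : N ⟶ K ↦ (φ.f n).app U s) h1
  · exact congrArg (fun φ : N ⟶ L ↦ (φ.f n).app U s) h2

lemma isZero_X {n : ℤ} (hK : IsZero (K.X n)) (hL : IsZero (L.X n)) : IsZero ((prodCx K L).X n) :=
  isZero_pb_X hK hL

lemma quasiIso_fst (hL : ∀ n, L.ExactAt n) : QuasiIso (fst K L) := by
  open scoped ZeroObject in
  have hz : ∀ n, IsZero ((0 : CochainComplex X.Modules ℤ).X n) := fun n ↦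
    (HomologicalComplex.eval _ _ n).map_isZero (isZero_zero _)
  have : QuasiIso (0 : L ⟶ (0 : CochainComplex X.Modules ℤ)) := ⟨fun n ↦
    (quasiIsoAt_iff_exactAt _ _ (hL n)).mpr (exactAt_of_isZero (hz n))⟩
  exact quasiIso_pbFst _ _ fun n ↦ (hz n).epi _

variable [IsLocallyNoetherian X]

lemma boundedCoherent (hK : boundedCoherent X K) (hL : boundedCoherent X L) :
    boundedCoherent X (prodCx K L) :=
  hK.pb hL (fun n ↦ (SelfDualData.isVectorBundle_zero
    ((HomologicalComplex.eval _ _ n).map_isZero (isZero_zero _))).isCoherent) _ _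

lemma boundedBundle (hK : boundedBundle X K) (hL : boundedBundle X L) :
    boundedBundle X (prodCx K L) :=
  ⟨hK.1.pb hL.1 _ _, fun n ↦ isVectorBundle_pb (hK.2 n) (hL.2 n) (SelfDualData.isVectorBundle_zero
    ((HomologicalComplex.eval _ _ n).map_isZero (isZero_zero _)))
    (((HomologicalComplex.eval _ _ n).map_isZero (isZero_zero _)).epi _)⟩

end prodCx

/-- Adding a contractible complex `B ⟶ B` in degrees `n` and `n + 1` to the source makes a morphism
of complexes surjective in degree `n`. -/
lemma exists_epi_degree [IsLocallyNoetherian X] (w : N ⟶ K) (n : ℤ) {B : X.Modules} (β : B ⟶ K.X n)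
    [Epi β] : ∃ (N' : CochainComplex X.Modules ℤ) (i : N ⟶ N') (π : N' ⟶ N) (w' : N' ⟶ K),
      i ≫ π = 𝟙 N ∧ i ≫ w' = w ∧ QuasiIso π ∧ Epi (w'.f n) ∧
      (boundedCoherent X N → IsCoherent B → boundedCoherent X N') ∧
      (boundedBundle X N → IsVectorBundle B → boundedBundle X N') ∧
      ∀ m, m ≠ n → m ≠ n + 1 → IsZero (N.X m) → IsZero (N'.X m) := by
  let D := disk B n (n + 1) rfl
  let b : D ⟶ K := fromDisk rfl β
  let w' : prodCx N D ⟶ K := prodCx.fst N D ≫ w + prodCx.snd N D ≫ b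
  have hw : prodCx.lift (𝟙 N) 0 ≫ w' = w := by
    rw [Preadditive.comp_add, ← Category.assoc, ← Category.assoc, prodCx.lift_fst, prodCx.lift_snd]
    simp
  have hb : prodCx.lift 0 (𝟙 D) ≫ w' = b := by
    rw [Preadditive.comp_add, ← Category.assoc, ← Category.assoc, prodCx.lift_fst, prodCx.lift_snd]
    simp
  refine ⟨prodCx N D, prodCx.lift (𝟙 N) 0, prodCx.fst N D, w', prodCx.lift_fst _ _, hw,
    prodCx.quasiIso_fst (exactAt_disk B rfl), ?_, fun h hB ↦ prodCx.boundedCoherent h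
      ⟨isBounded_disk _ _, isCoherent_disk hB rfl⟩, fun h hB ↦ prodCx.boundedBundle h
      ⟨isBounded_disk _ _, isVectorBundle_disk hB rfl⟩,
      fun m h1 h2 h ↦ prodCx.isZero_X h (isZero_disk_X _ _ _ h1 h2)⟩
  have h1 : Epi (b.f n) := by
    rw [fromDisk_left]; infer_instance
  have h2 : (prodCx.lift 0 (𝟙 D)).f n ≫ w'.f n = b.f n :=
    congrArg (fun φ : D ⟶ K ↦ φ.f n) hb
  exact epi_of_epi_fac h2

/-- A morphism of bounded coherent complexes factors, up to a quasi-isomorphism, through a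
degreewise epimorphism. -/
lemma exists_epi_replacement [IsLocallyNoetherian X] (w : N ⟶ K) (hN : boundedCoherent X N)
    (hK : boundedCoherent X K) :
    ∃ (N' : CochainComplex X.Modules ℤ) (i : N ⟶ N') (π : N' ⟶ N) (w' : N' ⟶ K),
      i ≫ π = 𝟙 N ∧ i ≫ w' = w ∧ QuasiIso π ∧ boundedCoherent X N' ∧ ∀ n, Epi (w'.f n) := by
  obtain ⟨a, b, hab⟩ := hK.1
  have key : ∀ m : ℕ, ∃ (N' : CochainComplex X.Modules ℤ) (i : N ⟶ N') (π : N' ⟶ N) (w' : N' ⟶ K),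
      i ≫ π = 𝟙 N ∧ i ≫ w' = w ∧ QuasiIso π ∧ boundedCoherent X N' ∧
        ∀ n, a ≤ n → n < a + m → Epi (w'.f n) := by
    intro m
    induction m with
    | zero =>
      exact ⟨N, 𝟙 _, 𝟙 _, w, by simp, by simp, inferInstance, hN, fun n _ _ ↦ by omega⟩
    | succ m ih =>
      obtain ⟨N₁, i, π, w₁, h1, h2, h3, h4, h5⟩ := ih
      obtain ⟨N₂, j, ρ, w₂, e1, e2, e3, e4, e5, -, -⟩ := exists_epi_degree w₁ (a + m) (𝟙 _)
      refine ⟨N₂, i ≫ j, ρ ≫ π, w₂, ?_, ?_, inferInstance, e5 h4 (hK.2 _), fun n hn hn' ↦ ?_⟩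
      · rw [Category.assoc, reassoc_of% e1, h1]
      · rw [Category.assoc, e2, h2]
      · by_cases hnm : n = a + m
        · subst hnm; exact e4
        · have := h5 n hn (by push_cast at hn'; omega)
          have h6 : j.f n ≫ w₂.f n = w₁.f n := congrArg (fun φ : N₁ ⟶ K ↦ φ.f n) e2
          exact epi_of_epi_fac h6
  obtain ⟨N', i, π, w', h1, h2, h3, h4, h5⟩ := key (b + 1 - a).toNat
  refine ⟨N', i, π, w', h1, h2, h3, h4, fun n ↦ ?_⟩
  by_cases hn : n < a ∨ b < n
  · exact (hab n hn).epi _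
  · exact h5 n (by omega) (by omega)

end Product

section Localization
variable {X : Scheme.{u}}

lemma isIso_Q_map {K L : CohComplex X} (f : K ⟶ L) (hf : QuasiIso f.hom) : IsIso ((Q X).map f) :=
  Localization.inverts (Q X) (cohQuasiIso X) f hf

lemma isIso_QB_map {K L : BundleComplex X} (f : K ⟶ L) (hf : QuasiIso f.hom) :
    IsIso ((QB X).map f) :=
  Localization.inverts (Q X) (cohQuasiIso X) ((ObjectProperty.ιOfLE boundedBundle_le).map f) hf

lemma comp_eq_of_ore {D : Type*} [Category* D] {A B E F G H : D} {s' : A ⟶ B} {s : B ⟶ E}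
    {h : E ⟶ F} {t : B ⟶ F} (e : s ≫ h = t) {c : A ⟶ G} {p : G ⟶ B} (es : s' = c ≫ p)
    {r : G ⟶ H} {w : H ⟶ F} (hpr : p ≫ t = r ≫ w) {v : F ⟶ H} (hv : w ≫ v = 𝟙 H) :
    (s' ≫ s) ≫ h ≫ v = c ≫ r := by
  rw [es, Category.assoc, reassoc_of% e, Category.assoc, reassoc_of% hpr, hv, Category.comp_id]

lemma Q_obj_symm (A : DCoh X) :
    (Q X).obj ((Localization.Construction.objEquiv (cohQuasiIso X)).symm A) = A :=
  (Localization.Construction.objEquiv (cohQuasiIso X)).right_inv A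

variable [IsLocallyNoetherian X]

/-- Completing a cospan with a quasi-isomorphism to a square that commutes in the derived
category. -/
lemma exists_ore {C K N : CohComplex X} (t : C ⟶ K) (w : N ⟶ K) (hw : QuasiIso w.hom) :
    ∃ (W : CohComplex X) (p : W ⟶ C) (r : W ⟶ N), QuasiIso p.hom ∧
      (Q X).map p ≫ (Q X).map t = (Q X).map r ≫ (Q X).map w := by
  obtain ⟨N', i, π, w', h1, h2, h3, h4, h5⟩ := exists_epi_replacement w.hom N.property K.property
  have hi : QuasiIso i := by
    have : QuasiIso (i ≫ π) := by rw [h1]; infer_instance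
    exact quasiIso_of_comp_right i π
  have hw' : QuasiIso w' := by
    have : QuasiIso (i ≫ w') := by rw [h2]; exact hw
    exact quasiIso_of_comp_left i w'
  let N'' : CohComplex X := ⟨N', h4⟩
  let W : CohComplex X := ⟨pb t.hom w', C.property.pb h4 K.property.2 _ _⟩
  let π'' : N'' ⟶ N := ObjectProperty.homMk π
  let i'' : N ⟶ N'' := ObjectProperty.homMk i
  let w'' : N'' ⟶ K := ObjectProperty.homMk w'
  let p : W ⟶ C := ObjectProperty.homMk (pbFst t.hom w')
  let r : W ⟶ N'' := ObjectProperty.homMk (pbSnd t.hom w')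
  have hpr : p ≫ t = r ≫ w'' := by
    ext : 1
    exact pb_condition _ _
  have hQi : IsIso ((Q X).map i'') := isIso_Q_map i'' hi
  have e1 : (Q X).map i'' ≫ (Q X).map π'' = 𝟙 _ := by
    refine ((Q X).map_comp _ _).symm.trans (Eq.trans ?_ ((Q X).map_id N))
    congr 1
    ext : 1
    exact h1
  have e2 : (Q X).map i'' ≫ (Q X).map w'' = (Q X).map w := by
    rw [← Functor.map_comp]
    congr 1
    ext : 1
    exact h2
  have e3 : (Q X).map w'' = (Q X).map π'' ≫ (Q X).map w := by
    rw [← cancel_epi ((Q X).map i''), e2, reassoc_of% e1]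
  refine ⟨W, p, r ≫ π'', quasiIso_pbFst _ _ fun n ↦ epi_biprod_desc_right _ _, ?_⟩
  rw [← Functor.map_comp, hpr, Functor.map_comp, e3, Functor.map_comp, Category.assoc]

/-- A bundle complex as a complex of coherent sheaves. -/
abbrev toCoh (C : BundleComplex X) : CohComplex X := (ObjectProperty.ιOfLE boundedBundle_le).obj C

/-- Every morphism in the derived category from a complex of vector bundles is a fraction
`Q(s)⁻¹ Q(t)` with a quasi-isomorphism `s` of complexes of vector bundles. -/
theorem exists_roof (hX : HasEnoughBundles X) {C : BundleComplex X} {L : CohComplex X}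
    (h : (QB X).obj C ⟶ (Q X).obj L) :
    ∃ (C' : BundleComplex X) (s : C' ⟶ C) (t : toCoh C' ⟶ L), QuasiIso s.hom ∧
      (QB X).map s ≫ h = (Q X).map t := by
  let T : MorphismProperty (DCoh X) := fun A B g ↦ ∀ h : (QB X).obj C ⟶ A,
    (∃ (C' : BundleComplex X) (s : C' ⟶ C)
      (t : toCoh C' ⟶ (Localization.Construction.objEquiv (cohQuasiIso X)).symm A),
        QuasiIso s.hom ∧ (QB X).map s ≫ h = (Q X).map t ≫ eqToHom (Q_obj_symm _)) →
    ∃ (C' : BundleComplex X) (s : C' ⟶ C)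
      (t : toCoh C' ⟶ (Localization.Construction.objEquiv (cohQuasiIso X)).symm B),
        QuasiIso s.hom ∧
          (QB X).map s ≫ h ≫ g = (Q X).map t ≫ eqToHom (Q_obj_symm _)
  have hT : T = ⊤ := by
    have : T.IsStableUnderComposition := ⟨fun {A B D} f g hf hg h hh ↦ by
      have := hg (h ≫ f) (hf h hh)
      simpa only [Category.assoc] using this⟩
    refine Localization.Construction.morphismProperty_eq_top T ?_ ?_
    · rintro K L f h ⟨C', s, t, hs, e⟩
      refine ⟨C', s, (show toCoh C' ⟶ K from t) ≫ f, hs, ?_⟩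
      have e' : (QB X).map s ≫ h = (Q X).map (show toCoh C' ⟶ K from t) :=
        e.trans (Category.comp_id _)
      rw [← Category.assoc, e']
      exact ((Q X).map_comp _ _).symm.trans (Category.comp_id _).symm
    · rintro K L w hw h ⟨C', s, t, hs, e⟩
      obtain ⟨W, p, r, hp, hpr⟩ := exists_ore (show toCoh C' ⟶ L from t) w hw
      obtain ⟨C'', c, hc, hC''⟩ := exists_bundle_resolution hX W.property (toCoh C').property.2
        p.hom (isLocallyPerfect_of_isVectorBundle C'.property.1 C'.property.2)
      have e' : (QB X).map s ≫ h = (Q X).map (show toCoh C' ⟶ L from t) :=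
        e.trans (Category.comp_id _)
      let C₃ : BundleComplex X := ⟨C'', hC''⟩
      let c' : toCoh C₃ ⟶ W := ObjectProperty.homMk c
      let s' : C₃ ⟶ C' := ObjectProperty.homMk (c ≫ p.hom)
      have es : (QB X).map s' = (Q X).map c' ≫ (Q X).map p := (Q X).map_comp c' p
      refine ⟨C₃, s' ≫ s, c' ≫ r, ?_, ?_⟩
      · have : QuasiIso (c ≫ p.hom) := inferInstance
        exact inferInstanceAs (QuasiIso ((c ≫ p.hom) ≫ s.hom))
      · have hwi : (Q X).map w ≫ Localization.Construction.wInv w hw = 𝟙 _ :=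
          (Localization.Construction.wIso w hw).hom_inv_id
        have h1 := comp_eq_of_ore e' es hpr hwi
        have h2 : (QB X).map (s' ≫ s) ≫ h ≫ Localization.Construction.wInv w hw =
            (Q X).map c' ≫ (Q X).map r :=
          (congrArg (· ≫ h ≫ Localization.Construction.wInv w hw) ((QB X).map_comp s' s)).trans h1
        exact h2.trans (((Q X).map_comp c' r).symm.trans (Category.comp_id _).symm)
  have h1 : T h := by rw [hT]; trivial
  obtain ⟨C', s, t, hs, e⟩ := h1 (𝟙 _) ⟨C, 𝟙 C, 𝟙 (toCoh C),
    inferInstanceAs (QuasiIso (𝟙 C.obj)), rfl⟩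
  refine ⟨C', s, t, hs, ?_⟩
  rw [Category.id_comp] at e
  exact e.trans (Category.comp_id _)

end Localization

/-! ### Duality of complexes of vector bundles -/

section DualExact
variable {X : Scheme.{u}} {F G H B Z : X.Modules}

lemma dual_section_ext {U : X.Opens} {φ ψ : Γ(dual F, U)}
    (h : ∀ V (hV : V ≤ U) (s : Γ(F, V)), (show dualSections F U from φ).1.app V hV s =
      (show dualSections F U from ψ).1.app V hV s) : φ = ψ := dualSections_ext h

lemma dual_app_rs {U V W : X.Opens} (φ : Γ(dual F, U)) (hV : V ≤ U) (h : W ≤ V) (s : Γ(F, V)) :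
    (show dualSections F U from φ).1.app W (h.trans hV) (rs F h s) =
      rO h ((show dualSections F U from φ).1.app V hV s) := φ.2 V W hV h s

/-- A section of the dual over `V`, from a compatible family of linear maps. -/
def dualMk (F : X.Modules) (V : X.Opens) (ψ : ∀ W : X.Opens, W ≤ V → (Γ(F, W) →ₗ[Γ(X, W)] Γ(X, W)))
    (hψ : ∀ (W W' : X.Opens) (hW : W ≤ V) (h : W' ≤ W) (s : Γ(F, W)),
      ψ W' (h.trans hW) (rs F h s) = rO h (ψ W hW s)) : Γ(dual F, V) :=
  (⟨fun W ↦ ψ W.1 W.2, fun W W' hW h s ↦ hψ W W' hW h s⟩ : dualSections F V)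

lemma dualMap_add (f g : F ⟶ G) : dualMap (f + g) = dualMap f + dualMap g := by
  refine hom_ext_app fun U φ ↦ dual_section_ext fun V hV s ↦ ?_
  exact map_add ((show dualSections G U from φ).1.app V hV) _ _

lemma dualMap_neg (f : F ⟶ G) : dualMap (-f) = -dualMap f := by
  refine hom_ext_app fun U φ ↦ dual_section_ext fun V hV s ↦ ?_
  exact map_neg ((show dualSections G U from φ).1.app V hV) _

/-- Lifts of a frame along an epimorphism exist locally. -/
lemma exists_lift_frame (p : B ⟶ Z) [Epi p] (hZ : IsVectorBundle Z) {U : X.Opens} {x : X}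
    (hx : x ∈ U) : ∃ V ≤ U, x ∈ V ∧ ∃ (n : ℕ) (b : Fin n → Γ(B, V)),
      IsFrame Z V (fun i ↦ p.app V (b i)) := by
  obtain ⟨W, hxW, n, e, he⟩ := hZ x
  have key : ∀ m : ℕ, m ≤ n → ∃ V : X.Opens, ∃ hV : V ≤ U ⊓ W, x ∈ V ∧ ∀ i : Fin n, i.1 < m →
      ∃ b : Γ(B, V), p.app V b = rs Z (hV.trans inf_le_right) (e i) := by
    intro m
    induction m with
    | zero => exact fun _ ↦ ⟨U ⊓ W, le_rfl, ⟨hx, hxW⟩, fun i hi ↦ by omega⟩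
    | succ m ih =>
      intro hm
      obtain ⟨V, hV, hxV, hb⟩ := ih (by omega)
      obtain ⟨V', hV', hxV', b', hb'⟩ := (epi_iff_locSurj p).mp inferInstance V
        (rs Z (hV.trans inf_le_right) (e ⟨m, by omega⟩)) x hxV
      refine ⟨V', hV'.trans hV, hxV', fun i hi ↦ ?_⟩
      by_cases him : i.1 < m
      · obtain ⟨b, hb⟩ := hb i him
        exact ⟨rs B hV' b, by rw [app_rs, hb, rs_rs]⟩
      · have hi' : (⟨m, by omega⟩ : Fin n) = i := Fin.ext (by simp; omega)
        exact ⟨b', by rw [hb', rs_rs, hi']⟩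
  obtain ⟨V, hV, hxV, hb⟩ := key n le_rfl
  choose b hb using fun i ↦ hb i i.2
  exact ⟨V, hV.trans inf_le_left, hxV, n, b, by simp only [hb]; exact he.mono _⟩

/-- The section of `p` determined by a lift of a frame. -/
def frameLift {V : X.Opens} {n : ℕ} {p : B ⟶ Z} {b : Fin n → Γ(B, V)}
    (he : IsFrame Z V (fun i ↦ p.app V (b i))) (W : X.Opens) (hW : W ≤ V) :
    Γ(Z, W) →ₗ[Γ(X, W)] Γ(B, W) where
  toFun z := ∑ i, (he.basis W hW).repr z i • rs B hW (b i)
  map_add' z z' := by simp [add_smul, Finset.sum_add_distrib]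
  map_smul' r z := by simp [mul_smul, Finset.smul_sum]

lemma app_frameLift {V : X.Opens} {n : ℕ} {p : B ⟶ Z} {b : Fin n → Γ(B, V)}
    (he : IsFrame Z V (fun i ↦ p.app V (b i))) (W : X.Opens) (hW : W ≤ V) (z : Γ(Z, W)) :
    p.app W (frameLift he W hW z) = z := by
  conv_rhs => rw [← (he.basis W hW).sum_repr z]
  change p.app W (∑ i : Fin n, _) = _
  rw [map_sum]
  refine Finset.sum_congr rfl fun i _ ↦ ?_
  rw [app_smul, app_rs, he.basis_apply]
  rfl

lemma rs_frameLift {V : X.Opens} {n : ℕ} {p : B ⟶ Z} {b : Fin n → Γ(B, V)}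
    (he : IsFrame Z V (fun i ↦ p.app V (b i))) (W W' : X.Opens) (hW : W ≤ V) (h : W' ≤ W)
    (z : Γ(Z, W)) : rs B h (frameLift he W hW z) = frameLift he W' (h.trans hW) (rs Z h z) := by
  change rs B h (∑ i : Fin n, _) = ∑ i : Fin n, _
  rw [map_sum]
  refine Finset.sum_congr rfl fun i _ ↦ ?_
  rw [rs_smul, rs_rs]
  congr 1
  exact (he.repr_map hW h z i).symm

/-- If `a` and the epimorphism `p` onto a vector bundle are exact, so are their transposes. -/
lemma locExact_dualMap (a : F ⟶ B) (p : B ⟶ Z) [Epi p] (hZ : IsVectorBundle Z)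
    (h : LocExact a p) : LocExact (dualMap p) (dualMap a) := by
  intro U φ hφ x hx
  obtain ⟨V, hVU, hxV, n, b, he⟩ := exists_lift_frame p hZ hx
  have hφ0 : ∀ W (hW : W ≤ U) (s : Γ(B, W)), p.app W s = 0 →
      (show dualSections B U from φ).1.app W hW s = 0 := by
    intro W hW s hs
    refine function_ext_of_local _ _ fun y hy ↦ ?_
    obtain ⟨W', hW', hyW', t, ht⟩ := h W s hs y hy
    refine ⟨W', hW', hyW', ?_⟩
    rw [← dual_app_rs φ hW hW', ← ht, map_zero]
    exact congrArg (fun ψ : Γ(dual F, U) ↦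
      (show dualSections F U from ψ).1.app W' (hW'.trans hW) t) hφ
  refine ⟨V, hVU, hxV, dualMk Z V (fun W hW ↦
    ((show dualSections B U from φ).1.app W (hW.trans hVU)) ∘ₗ frameLift he W hW) ?_, ?_⟩
  · intro W W' hW h s
    change (show dualSections B U from φ).1.app W' _ (frameLift he W' _ _) =
      rO h ((show dualSections B U from φ).1.app W _ (frameLift he W _ _))
    rw [← rs_frameLift he W W' hW h, dual_app_rs φ (hW.trans hVU) h]
  · refine dual_section_ext fun W hW s ↦ ?_
    change (show dualSections B U from φ).1.app W _ (frameLift he W hW (p.app W s)) =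
      (show dualSections B U from φ).1.app W (hW.trans hVU) s
    rw [← sub_eq_zero, ← map_sub]
    exact hφ0 _ _ _ (by rw [map_sub, app_frameLift, sub_self])

/-- The transpose of the inclusion of a kernel is surjective if the image is a vector bundle. -/
lemma epi_dualMap_kernel (c : B ⟶ H) (p : B ⟶ Z) [Epi p] (hZ : IsVectorBundle Z)
    (hp : ∀ (U : X.Opens) (s : Γ(B, U)), p.app U s = 0 ↔ c.app U s = 0) :
    LocSurj (dualMap (kernel.ι c)) := by
  intro U φ x hx
  obtain ⟨V, hVU, hxV, n, b, he⟩ := exists_lift_frame p hZ hx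
  have hk : ∀ W (hW : W ≤ V) (s : Γ(B, W)), ∃ t : Γ(kernel c, W),
      (kernel.ι c).app W t = s - frameLift he W hW (p.app W s) := fun W hW s ↦
    exists_kernel_section c W _ ((hp W _).mp (by rw [map_sub, app_frameLift, sub_self]))
  choose κ hκ using hk
  have hinj := fun W ↦ app_injective (kernel.ι c) W
  let ρ (W : X.Opens) (hW : W ≤ V) : Γ(B, W) →ₗ[Γ(X, W)] Γ(kernel c, W) :=
    { toFun := κ W hW
      map_add' := fun s t ↦ hinj W (by simp only [map_add, hκ]; abel)
      map_smul' := fun r s ↦ hinj W (by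
        simp only [hκ, app_smul, map_smul, RingHom.id_apply, smul_sub]) }
  refine ⟨V, hVU, hxV, dualMk B V (fun W hW ↦
    ((show dualSections (kernel c) U from φ).1.app W (hW.trans hVU)) ∘ₗ ρ W hW) ?_, ?_⟩
  · intro W W' hW h s
    have e : κ W' (h.trans hW) (rs B h s) = rs _ h (κ W hW s) := hinj W' (by
      rw [hκ, app_rs, app_rs, hκ, map_sub, rs_frameLift])
    change (show dualSections (kernel c) U from φ).1.app W' _ (κ W' _ _) =
      rO h ((show dualSections (kernel c) U from φ).1.app W _ (κ W hW s))
    rw [e]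
    exact dual_app_rs φ (hW.trans hVU) h _
  · refine dual_section_ext fun W hW s ↦ ?_
    change (show dualSections (kernel c) U from φ).1.app W _ (κ W hW ((kernel.ι c).app W s)) =
      (show dualSections (kernel c) U from φ).1.app W (hW.trans hVU) s
    congr 1
    apply hinj W
    rw [hκ, (hp W _).mpr (kernel_section_condition c W s), map_zero, sub_zero]

lemma app_kernel_lift_eq_zero_iff {S T E : X.Modules} (g : S ⟶ T) (c : T ⟶ E) (w : g ≫ c = 0)
    {V : X.Opens} (s : Γ(S, V)) : (kernel.lift c g w).app V s = 0 ↔ g.app V s = 0 := by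
  have e : (kernel.ι c).app V ((kernel.lift c g w).app V s) = g.app V s :=
    congrArg (fun q : S ⟶ T ↦ q.app V s) (kernel.lift_ι c g w)
  rw [← e]
  exact ⟨fun h ↦ by rw [h, map_zero],
    fun h ↦ app_injective (kernel.ι c) V (h.trans (map_zero _).symm)⟩

/-- The dual of an exact sequence whose kernels are vector bundles is exact. -/
lemma LocExact.dualMap {S₀ S₁ S₂ S₃ S₄ : X.Modules} {a : S₀ ⟶ S₁} {b : S₁ ⟶ S₂} {c : S₂ ⟶ S₃}
    {d : S₃ ⟶ S₄} (w₂ : b ≫ c = 0) (w₃ : c ≫ d = 0) (h₁ : LocExact a b) (h₂ : LocExact b c)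
    (h₃ : LocExact c d) (hc : IsVectorBundle (kernel c)) (hd : IsVectorBundle (kernel d)) :
    LocExact (dualMap b) (dualMap a) := by
  have he : Epi (kernel.lift c b w₂) := (ShortComplex.exact_iff_epi_kernel_lift _).mp
    ((exact_iff_locExact _ _ w₂).mpr h₂)
  have he' : Epi (kernel.lift d c w₃) := (ShortComplex.exact_iff_epi_kernel_lift _).mp
    ((exact_iff_locExact _ _ w₃).mpr h₃)
  have hE := locExact_dualMap a (kernel.lift c b w₂) hc
    (fun V s hs ↦ h₁ V s ((app_kernel_lift_eq_zero_iff _ _ w₂ s).mp hs))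
  have hS := epi_dualMap_kernel c (kernel.lift d c w₃) hd
    (fun V s ↦ app_kernel_lift_eq_zero_iff _ _ w₃ s)
  intro U φ hφ p hp
  obtain ⟨V, hV, hpV, ψ, hψ⟩ := hE U φ hφ p hp
  obtain ⟨V', hV', hpV', χ, hχ⟩ := hS V ψ p hpV
  refine ⟨V', hV'.trans hV, hpV', χ, ?_⟩
  have h1 : (DT4.dualMap (kernel.lift c b w₂)).app V' ((DT4.dualMap (kernel.ι c)).app V' χ) =
      rs _ (hV'.trans hV) φ := by
    rw [hχ, app_rs, hψ, rs_rs]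
  rw [← h1]
  exact congrArg (fun g : S₁ ⟶ S₂ ↦ (DT4.dualMap g).app V' χ) (kernel.lift_ι c b w₂).symm

/-- A section of the dual of a direct sum, given by its two components. -/
lemma dualMap_inl_add {A B : X.Modules} {V : X.Opens} (y : Γ(dual A, V)) (x : Γ(dual B, V)) :
    (dualMap (biprod.inl : A ⟶ A ⊞ B)).app V
      ((dualMap biprod.fst).app V y + (dualMap biprod.snd).app V x) = y := by
  have h1 : (dualMap (biprod.inl : A ⟶ A ⊞ B)).app V ((dualMap biprod.fst).app V y) = y :=
    (congrArg (fun g : A ⟶ A ↦ (dualMap g).app V y) biprod.inl_fst).trans (by rw [dualMap_id]; rfl)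
  have h2 : (dualMap (biprod.inl : A ⟶ A ⊞ B)).app V ((dualMap biprod.snd).app V x) = 0 :=
    (congrArg (fun g : A ⟶ B ↦ (dualMap g).app V x) biprod.inl_snd).trans
      (by rw [dualMap_zero]; rfl)
  rw [map_add, h1, h2, add_zero]

lemma dualMap_inr_add {A B : X.Modules} {V : X.Opens} (y : Γ(dual A, V)) (x : Γ(dual B, V)) :
    (dualMap (biprod.inr : B ⟶ A ⊞ B)).app V
      ((dualMap biprod.fst).app V y + (dualMap biprod.snd).app V x) = x := by
  have h1 : (dualMap (biprod.inr : B ⟶ A ⊞ B)).app V ((dualMap biprod.fst).app V y) = 0 :=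
    (congrArg (fun g : B ⟶ A ↦ (dualMap g).app V y) biprod.inr_fst).trans
      (by rw [dualMap_zero]; rfl)
  have h2 : (dualMap (biprod.inr : B ⟶ A ⊞ B)).app V ((dualMap biprod.snd).app V x) = x :=
    (congrArg (fun g : B ⟶ B ↦ (dualMap g).app V x) biprod.inr_snd).trans (by rw [dualMap_id]; rfl)
  rw [map_add, h1, h2, zero_add]

end DualExact

section DualQuasiIso
variable {X : Scheme.{u}} {K L : CochainComplex X.Modules ℤ}

/-- The differential of the mapping cone of `f`. -/
def coneD (f : K ⟶ L) (i j k : ℤ) : K.X j ⊞ L.X i ⟶ K.X k ⊞ L.X j :=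
  biprod.desc (biprod.lift (-K.d j k) (f.f j)) (biprod.lift 0 (L.d i j))

lemma coneD_comp (f : K ⟶ L) (i j k l : ℤ) : coneD f i j k ≫ coneD f j k l = 0 := by
  unfold coneD
  apply biprod.hom_ext' <;> apply biprod.hom_ext <;> simp

lemma locExact_coneD (f : K ⟶ L) [hf : QuasiIso f] (i j k l : ℤ) (hij : i + 1 = j) (hjk : j + 1 = k)
    (hkl : k + 1 = l) : LocExact (coneD f i j k) (coneD f j k l) := by
  rw [quasiIso_iff_locCone] at hf
  intro U z hz p hp
  obtain ⟨x, y, rfl⟩ : ∃ x y, z = bpair x y := ⟨_, _, (bpair_ext_iff.mpr ⟨rfl, rfl⟩)⟩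
  unfold coneD at hz ⊢
  rw [desc_bpair, lift_app_eq, lift_app_eq] at hz
  have h1 := congrArg ((biprod.fst : K.X l ⊞ L.X k ⟶ _).app U) hz
  have h2 := congrArg ((biprod.snd : K.X l ⊞ L.X k ⟶ _).app U) hz
  simp only [map_add, fst_bpair, snd_bpair, map_zero, zero_app_apply, add_zero,
    neg_app_apply, neg_eq_zero] at h1 h2
  obtain ⟨V, hV, hpV, x', y', e1, e2⟩ := hf i j k l hij hjk hkl U x (-y) h1 (by
    rw [map_neg]; exact eq_neg_of_add_eq_zero_left h2) p hp
  refine ⟨V, hV, hpV, bpair (-x') (-y'), ?_⟩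
  rw [desc_bpair, lift_app_eq, lift_app_eq, rs_bpair]
  apply biprod_app_ext
  · simp [e1]
  · have e3 : rs _ hV y = -(f.f j).app V x' - (L.d i j).app V y' := by
      rw [map_neg] at e2
      rw [← neg_neg (rs _ hV y), ← e2]; abel
    simp [e3, sub_eq_add_neg]

lemma dualMap_coneD_app (f : K ⟶ L) (n₀ n₁ n₂ : ℤ) {U : X.Opens} (x : Γ(dual (L.X n₁), U))
    (y : Γ(dual (K.X n₂), U)) : (dualMap (coneD f n₀ n₁ n₂)).app U
      ((dualMap biprod.fst).app U y + (dualMap biprod.snd).app U x) =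
    (dualMap biprod.fst).app U (-(dualMap (K.d n₁ n₂)).app U y + (dualMap (f.f n₁)).app U x) +
      (dualMap biprod.snd).app U ((dualMap (L.d n₀ n₁)).app U x) := by
  have c1 : coneD f n₀ n₁ n₂ ≫ biprod.fst = -(biprod.fst ≫ K.d n₁ n₂) := by
    unfold coneD; apply biprod.hom_ext' <;> simp
  have c2 : coneD f n₀ n₁ n₂ ≫ biprod.snd = biprod.fst ≫ f.f n₁ + biprod.snd ≫ L.d n₀ n₁ := by
    unfold coneD; apply biprod.hom_ext' <;> simp
  have e1 : (dualMap (coneD f n₀ n₁ n₂)).app U ((dualMap biprod.fst).app U y) =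
      (dualMap (-(biprod.fst ≫ K.d n₁ n₂))).app U y :=
    congrArg (fun g : K.X n₁ ⊞ L.X n₀ ⟶ K.X n₂ ↦ (dualMap g).app U y) c1
  have e2 : (dualMap (coneD f n₀ n₁ n₂)).app U ((dualMap biprod.snd).app U x) =
      (dualMap (biprod.fst ≫ f.f n₁ + biprod.snd ≫ L.d n₀ n₁)).app U x :=
    congrArg (fun g : K.X n₁ ⊞ L.X n₀ ⟶ L.X n₁ ↦ (dualMap g).app U x) c2
  rw [map_add, e1, e2, dualMap_add, dualMap_neg, dualMap_comp, dualMap_comp, dualMap_comp,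
    add_app_apply, comp_app_apply, comp_app_apply, neg_app_apply, comp_app_apply, map_add, map_neg]
  abel

variable [IsLocallyNoetherian X]

lemma isVectorBundle_kernel_coneD (f : K ⟶ L) [QuasiIso f] (hK : boundedBundle X K)
    (hL : boundedBundle X L) (n : ℤ) : IsVectorBundle (kernel (coneD f n (n + 1) (n + 1 + 1))) := by
  obtain ⟨⟨a, b, hK0⟩, hK⟩ := hK
  obtain ⟨⟨a', b', hL0⟩, hL⟩ := hL
  have key : ∀ m : ℕ, ∀ n : ℤ, max b b' - m < n →
      IsVectorBundle (kernel (coneD f n (n + 1) (n + 1 + 1))) := by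
    intro m
    induction m with
    | zero =>
      intro n hbn
      have h0 : IsZero (K.X (n + 1) ⊞ L.X n) := by
        rw [biprod_isZero_iff]
        exact ⟨hK0 _ (by push_cast at hbn; omega), hL0 _ (by push_cast at hbn; omega)⟩
      exact SelfDualData.isVectorBundle_zero (h0.of_mono (kernel.ι _))
    | succ m ih =>
      intro n hbn
      have h1 := ih (n + 1) (by push_cast at hbn; omega)
      have w := coneD_comp f n (n + 1) (n + 1 + 1) (n + 1 + 1 + 1)
      have he : Epi (kernel.lift _ _ w) := (ShortComplex.exact_iff_epi_kernel_lift _).mp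
        ((exact_iff_locExact _ _ w).mpr (locExact_coneD f n (n + 1) _ _ rfl rfl rfl))
      have h2 := ((hK (n + 1)).biprod (hL n)).kernel h1 (kernel.lift _ _ w)
      refine h2.of_iso ((kernelCompMono (kernel.lift _ _ w) (kernel.ι _)).symm.trans
        (kernelIsoOfEq (kernel.lift_ι _ _ w)))
  exact key (max b b' + 1 - n).toNat n (by omega)

lemma locExact_dualMap_coneD (f : K ⟶ L) [QuasiIso f] (hK : boundedBundle X K)
    (hL : boundedBundle X L) (n₀ n₁ n₂ n₃ : ℤ) (h₁ : n₀ + 1 = n₁) (h₂ : n₁ + 1 = n₂)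
    (h₃ : n₂ + 1 = n₃) :
    LocExact (dualMap (coneD f n₁ n₂ n₃)) (dualMap (coneD f n₀ n₁ n₂)) := by
  subst h₂ h₃
  exact LocExact.dualMap (coneD_comp f n₁ (n₁ + 1) (n₁ + 1 + 1) (n₁ + 1 + 1 + 1))
    (coneD_comp f (n₁ + 1) (n₁ + 1 + 1) (n₁ + 1 + 1 + 1) (n₁ + 1 + 1 + 1 + 1))
    (locExact_coneD f n₀ n₁ _ _ h₁ rfl rfl) (locExact_coneD f n₁ (n₁ + 1) _ _ rfl rfl rfl)
    (locExact_coneD f (n₁ + 1) (n₁ + 1 + 1) _ _ rfl rfl rfl)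
    (isVectorBundle_kernel_coneD f hK hL _) (isVectorBundle_kernel_coneD f hK hL _)

lemma locCone_dualMap (f : K ⟶ L) [QuasiIso f] (hK : boundedBundle X K)
    (hL : boundedBundle X L) (n₀ n₁ n₂ n₃ : ℤ) (h₁ : n₀ + 1 = n₁) (h₂ : n₁ + 1 = n₂)
    (h₃ : n₂ + 1 = n₃) (U : X.Opens) (x : Γ(dual (L.X n₁), U)) (y : Γ(dual (K.X n₂), U))
    (hx : (dualMap (L.d n₀ n₁)).app U x = 0)
    (hxy : (dualMap (f.f n₁)).app U x = (dualMap (K.d n₁ n₂)).app U y) (p : X) (hp : p ∈ U) :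
    ∃ (V : X.Opens) (h : V ≤ U), p ∈ V ∧ ∃ (x' : Γ(dual (L.X n₂), V)) (y' : Γ(dual (K.X n₃), V)),
      (dualMap (L.d n₁ n₂)).app V x' = rs _ h x ∧
      (dualMap (f.f n₂)).app V x' + (dualMap (K.d n₂ n₃)).app V y' = rs _ h y := by
  have hφ : (dualMap (coneD f n₀ n₁ n₂)).app U
      ((dualMap biprod.fst).app U y + (dualMap biprod.snd).app U x) = 0 := by
    rw [dualMap_coneD_app, hx, hxy, neg_add_cancel, map_zero, map_zero, add_zero]
  obtain ⟨V, hV, hpV, χ, hχ⟩ :=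
    locExact_dualMap_coneD f hK hL n₀ n₁ n₂ n₃ h₁ h₂ h₃ U _ hφ p hp
  have hdec : χ = (dualMap biprod.fst).app V ((dualMap biprod.inl).app V χ) +
      (dualMap biprod.snd).app V ((dualMap biprod.inr).app V χ) := by
    have h1 : (dualMap (biprod.fst ≫ biprod.inl + biprod.snd ≫ biprod.inr :
        K.X n₃ ⊞ L.X n₂ ⟶ K.X n₃ ⊞ L.X n₂)).app V χ = χ := by
      rw [biprod.total, dualMap_id]; rfl
    rw [dualMap_add, dualMap_comp, dualMap_comp] at h1
    exact h1.symm
  rw [hdec, dualMap_coneD_app, map_add (rs _ hV), ← app_rs, ← app_rs] at hχ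
  refine ⟨V, hV, hpV, (dualMap biprod.inr).app V χ, -(dualMap biprod.inl).app V χ, ?_, ?_⟩
  · have h1 := congrArg ((dualMap biprod.inr).app V) hχ
    rwa [dualMap_inr_add, dualMap_inr_add] at h1
  · have h1 := congrArg ((dualMap biprod.inl).app V) hχ
    rw [dualMap_inl_add, dualMap_inl_add] at h1
    rw [map_neg, add_comm, h1]

/-- Quasi-isomorphisms of bounded complexes of vector bundles are preserved by duality. -/
theorem quasiIso_dualComplexMap (f : K ⟶ L) [QuasiIso f] (hK : boundedBundle X K)
    (hL : boundedBundle X L) : QuasiIso (dualComplexMap f) := by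
  rw [quasiIso_iff_locCone]
  intro i j k l hij hjk hkl U x y hx hxy p hp
  exact locCone_dualMap f hK hL (-l - 2) (-k - 2) (-j - 2) (-i - 2) (by omega) (by omega)
    (by omega) U x y hx hxy p hp

end DualQuasiIso

/-! ### Symmetric morphisms -/

section Scalars
variable {X : Scheme.{u}} {F G : X.Modules} {K L : CochainComplex X.Modules ℤ}

/-- Multiplication by a global function. -/
def scalarEnd (r : Γ(X, ⊤)) (F : X.Modules) : F ⟶ F :=
  homOfSections (fun U ↦ rO (le_top : U ≤ ⊤) r • LinearMap.id) (fun U V h s ↦ by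
    change rO (le_top : V ≤ ⊤) r • rs F h s = rs F h (rO (le_top : U ≤ ⊤) r • s)
    rw [rs_smul, rO_rO])

lemma scalarEnd_app (r : Γ(X, ⊤)) (U : X.Opens) (s : Γ(F, U)) :
    (scalarEnd r F).app U s = rO (le_top : U ≤ ⊤) r • s := rfl

lemma scalarEnd_comp (r : Γ(X, ⊤)) (f : F ⟶ G) : scalarEnd r F ≫ f = f ≫ scalarEnd r G :=
  hom_ext_app fun U s ↦ app_smul f (rO (le_top : U ≤ ⊤) r) s

lemma scalarEnd_add_self (r : Γ(X, ⊤)) (hr : r + r = 1) : scalarEnd r F + scalarEnd r F = 𝟙 F :=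
  hom_ext_app fun U s ↦ by
    rw [add_app_apply, scalarEnd_app, ← add_smul, ← map_add, hr, map_one, one_smul, id_app_apply]

lemma dualMap_scalarEnd (r : Γ(X, ⊤)) : dualMap (scalarEnd r F) = scalarEnd r (dual F) :=
  hom_ext_app fun U φ ↦ dual_section_ext fun V hV s ↦ by
    change (show dualSections F U from φ).1.app V hV (rO (le_top : V ≤ ⊤) r • s) =
      rO hV (rO (le_top : U ≤ ⊤) r) * (show dualSections F U from φ).1.app V hV s
    rw [map_smul, rO_rO, smul_eq_mul]

/-- Multiplication by a global function on a complex. -/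
def scalarEndCx (r : Γ(X, ⊤)) (K : CochainComplex X.Modules ℤ) : K ⟶ K where
  f n := scalarEnd r (K.X n)
  comm' i j _ := scalarEnd_comp r (K.d i j)

lemma scalarEndCx_comp (r : Γ(X, ⊤)) (f : K ⟶ L) : scalarEndCx r K ≫ f = f ≫ scalarEndCx r L := by
  ext n : 1
  exact scalarEnd_comp r (f.f n)

lemma scalarEndCx_add_self (r : Γ(X, ⊤)) (hr : r + r = 1) :
    scalarEndCx r K + scalarEndCx r K = 𝟙 K := by
  ext n : 1
  exact scalarEnd_add_self r hr

end Scalars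

section Averaging
variable {X : Scheme.{u}} {K L : CochainComplex X.Modules ℤ}

lemma quasiIso_of_prodCx (f : K ⟶ L) [hf : QuasiIso f] {D : CochainComplex X.Modules ℤ}
    (g : prodCx K D ⟶ prodCx L D) (h1 : g ≫ prodCx.fst L D = prodCx.fst K D ≫ f)
    (h2 : g ≫ prodCx.snd L D = prodCx.snd K D) : QuasiIso g := by
  rw [quasiIso_iff_locCone] at hf ⊢
  have g1 : ∀ n U (s : Γ((prodCx K D).X n, U)), ((prodCx.fst L D).f n).app U ((g.f n).app U s) =
      (f.f n).app U (((prodCx.fst K D).f n).app U s) := fun n U s ↦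
    congrArg (fun φ : prodCx K D ⟶ L ↦ (φ.f n).app U s) h1
  have g2 : ∀ n U (s : Γ((prodCx K D).X n, U)), ((prodCx.snd L D).f n).app U ((g.f n).app U s) =
      ((prodCx.snd K D).f n).app U s := fun n U s ↦
    congrArg (fun φ : prodCx K D ⟶ D ↦ (φ.f n).app U s) h2
  intro i j k l hij hjk hkl U x y hx hxy p hp
  obtain ⟨V, hV, hpV, x', y', h1, h2⟩ := hf i j k l hij hjk hkl U
    (((prodCx.fst K D).f k).app U x) (((prodCx.fst L D).f j).app U y)
    (by rw [app_f_d, hx, map_zero]) (by rw [← g1, hxy, app_f_d]) p hp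
  obtain ⟨a, ha1, ha2⟩ := prodCx.exists_section (K := K) (L := D) x'
    (rs _ hV (((prodCx.snd L D).f j).app U y))
  obtain ⟨b, hb1, hb2⟩ := prodCx.exists_section (K := L) (L := D) y' 0
  refine ⟨V, hV, hpV, a, b, prodCx.section_ext ?_ ?_, prodCx.section_ext ?_ ?_⟩
  · rw [← app_f_d, ha1, h1, app_rs]
  · rw [← app_f_d, ha2, app_rs, app_f_d, ← hxy, g2, app_rs]
  · rw [map_add, g1, ha1, ← app_f_d, hb1, h2, app_rs]
  · rw [map_add, g2, ha2, ← app_f_d, hb2, map_zero, add_zero, app_rs]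

variable [IsLocallyNoetherian X]

/-- The functor of direct sum with a fixed complex. -/
def prodFunctor (D : CohComplex X) : CohComplex X ⥤ CohComplex X where
  obj K := ⟨prodCx K.obj D.obj, prodCx.boundedCoherent K.property D.property⟩
  map f := ObjectProperty.homMk (prodCx.lift (prodCx.fst _ _ ≫ f.hom) (prodCx.snd _ _))
  map_id K := by
    ext : 1
    apply prodCx.hom_ext
    · exact (prodCx.lift_fst _ _).trans ((Category.comp_id _).trans (Category.id_comp _).symm)
    · exact (prodCx.lift_snd _ _).trans (Category.id_comp _).symm
  map_comp f g := by
    ext : 1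
    apply prodCx.hom_ext
    · refine (prodCx.lift_fst _ _).trans ?_
      refine ((Category.assoc _ _ _).trans ?_).symm
      refine (congrArg (fun φ ↦ _ ≫ φ) (prodCx.lift_fst _ _)).trans ?_
      refine (Category.assoc _ _ _).symm.trans ?_
      exact (congrArg (fun φ ↦ φ ≫ g.hom) (prodCx.lift_fst _ _)).trans (Category.assoc _ _ _)
    · refine (prodCx.lift_snd _ _).trans ?_
      refine ((Category.assoc _ _ _).trans ?_).symm
      exact (congrArg (fun φ ↦ _ ≫ φ) (prodCx.lift_snd _ _)).trans (prodCx.lift_snd _ _)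

lemma Q_map_prodFunctor (D : CohComplex X) {K L : CohComplex X} {a b : K ⟶ L}
    (h : (Q X).map a = (Q X).map b) :
    (Q X).map ((prodFunctor D).map a) = (Q X).map ((prodFunctor D).map b) := by
  have hinv : (cohQuasiIso X).IsInvertedBy (prodFunctor D ⋙ Q X) := fun K L f hf ↦ by
    have : QuasiIso f.hom := hf
    exact isIso_Q_map _ (quasiIso_of_prodCx f.hom _ (prodCx.lift_fst _ _)
      (prodCx.lift_snd _ _))
  let e := Localization.fac (prodFunctor D ⋙ Q X) hinv (Q X)
  have h1 := e.hom.naturality a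
  have h2 := e.hom.naturality b
  have h3 : (Q X ⋙ Localization.lift (prodFunctor D ⋙ Q X) hinv (Q X)).map a =
      (Q X ⋙ Localization.lift (prodFunctor D ⋙ Q X) hinv (Q X)).map b :=
    congrArg (Localization.lift (prodFunctor D ⋙ Q X) hinv (Q X)).map h
  rw [h3, h2] at h1
  exact ((cancel_epi (e.hom.app K)).mp h1).symm

/-- If `2` is invertible, two morphisms of complexes that agree in the derived category agree with
their average. -/
lemma Q_map_average (r : Γ(X, ⊤)) (hr : r + r = 1) {K L : CohComplex X} (a b c : K ⟶ L)
    (h : (Q X).map a = (Q X).map b) (hc : c.hom = (a.hom + b.hom) ≫ scalarEndCx r L.obj) :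
    (Q X).map c = (Q X).map a := by
  let P := (prodFunctor L).obj L
  let i : K ⟶ (prodFunctor L).obj K := ObjectProperty.homMk (prodCx.lift (𝟙 _) a.hom)
  let m : (prodFunctor L).obj L ⟶ L := ObjectProperty.homMk
    ((prodCx.fst L.obj L.obj + prodCx.snd L.obj L.obj) ≫ scalarEndCx r L.obj)
  -- the average is the composite of `(1, a)`, `b ⊕ 1` and the averaging map `m`; replacing `b` by `a`
  -- does not change the image of `b ⊕ 1` in the derived category, and turns the composite into `a`
  have key : ∀ g : K ⟶ L, (i ≫ (prodFunctor L).map g ≫ m).hom =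
      (g.hom + a.hom) ≫ scalarEndCx r L.obj := fun g ↦ by
    change prodCx.lift (𝟙 _) a.hom ≫ prodCx.lift (prodCx.fst _ _ ≫ g.hom) (prodCx.snd _ _) ≫
      (prodCx.fst L.obj L.obj + prodCx.snd L.obj L.obj) ≫ scalarEndCx r L.obj = _
    rw [← Category.assoc (prodCx.lift (prodCx.fst _ _ ≫ g.hom) (prodCx.snd _ _)),
      Preadditive.comp_add, prodCx.lift_fst, prodCx.lift_snd, ← Category.assoc,
      Preadditive.comp_add, ← Category.assoc, prodCx.lift_fst, prodCx.lift_snd, Category.id_comp]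
  have h1 : c = i ≫ (prodFunctor L).map b ≫ m := by
    ext : 1
    rw [key, hc, add_comm]
  have h2 : a = i ≫ (prodFunctor L).map a ≫ m := by
    ext : 1
    rw [key, Preadditive.add_comp, ← Preadditive.comp_add, scalarEndCx_add_self r hr,
      Category.comp_id]
  rw [h1, (Q X).map_comp, (Q X).map_comp, ← Q_map_prodFunctor L h, ← (Q X).map_comp,
    ← (Q X).map_comp, ← h2]

end Averaging

section Transposition
variable {X : Scheme.{u}} {F : X.Modules} {K L : CochainComplex X.Modules ℤ}

lemma evalDual_dualMap_evalDual (F : X.Modules) :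
    evalDual (dual F) ≫ dualMap (evalDual F) = 𝟙 (dual F) := by
  refine hom_ext_app fun U φ ↦ dual_section_ext fun V hV s ↦ ?_
  change (show dualSections F V from rs (dual F) hV φ).1.app V le_rfl (rs F le_rfl s) = _
  rw [rs_self]
  rfl

/-- The transpose `φ^∨[2]` of a morphism `φ : K ⟶ K^∨[2]`. -/
def transposeCx (φ : K ⟶ dualComplex K) : K ⟶ dualComplex K :=
  evalComplex K ≫ dualComplexMap φ

lemma XIsoOfEq_dualMap (φ : K ⟶ dualComplex K) (n m : ℤ) (h : n = m) (h' : -n - 2 = -m - 2) :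
    (K.XIsoOfEq h).hom ≫ φ.f m ≫ dualMap (K.XIsoOfEq h').hom = φ.f n := by
  subst h
  simp only [HomologicalComplex.XIsoOfEq_rfl, Iso.refl_hom, Category.id_comp, dualMap_id]
  exact Category.comp_id _

lemma evalDual_bidual {G : X.Modules} (φ : F ⟶ dual G) :
    evalDual F ≫ dualMap (evalDual G ≫ dualMap φ) = φ := by
  rw [dualMap_comp, ← Category.assoc, evalDual_naturality, Category.assoc,
    evalDual_dualMap_evalDual, Category.comp_id]

lemma transposeCx_transposeCx (φ : K ⟶ dualComplex K) : transposeCx (transposeCx φ) = φ := by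
  ext n : 1
  have e1 : n = -(-n - 2) - 2 := by ring
  have e2 : -n - 2 = -(-(-n - 2) - 2) - 2 := by ring
  refine Eq.trans ?_ (XIsoOfEq_dualMap φ n (-(-n - 2) - 2) e1 e2)
  change ((K.XIsoOfEq e1).hom ≫ evalDual _) ≫ dualMap (((K.XIsoOfEq e2).hom ≫ evalDual _) ≫
    dualMap (φ.f (-(-n - 2) - 2))) = _
  refine (Category.assoc _ _ _).trans (congrArg (fun ψ ↦ (K.XIsoOfEq e1).hom ≫ ψ) ?_)
  have key := evalDual_bidual (φ.f (-(-n - 2) - 2))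
  refine Eq.trans ?_ (congrArg (fun ψ : K.X (-(-n - 2) - 2) ⟶ dual (K.X (-(-(-n - 2) - 2) - 2)) ↦
    ψ ≫ dualMap (K.XIsoOfEq e2).hom) key)
  exact (Category.assoc (evalDual (K.X (-(-n - 2) - 2)))
    (dualMap (evalDual _ ≫ dualMap (φ.f (-(-n - 2) - 2)))) (dualMap (K.XIsoOfEq e2).hom)).symm

lemma dualComplexMap_add (f g : K ⟶ L) :
    dualComplexMap (f + g) = dualComplexMap f + dualComplexMap g := by
  ext n : 1
  exact dualMap_add _ _

lemma dualComplexMap_comp {N : CochainComplex X.Modules ℤ} (f : K ⟶ L) (g : L ⟶ N) :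
    dualComplexMap (f ≫ g) = dualComplexMap g ≫ dualComplexMap f := rfl

lemma dualComplexMap_scalarEndCx (r : Γ(X, ⊤)) :
    dualComplexMap (scalarEndCx r K) = scalarEndCx r (dualComplex K) := by
  ext n : 1
  exact dualMap_scalarEnd r

lemma transposeCx_average (r : Γ(X, ⊤)) (φ : K ⟶ dualComplex K) :
    transposeCx ((φ + transposeCx φ) ≫ scalarEndCx r _) =
      (φ + transposeCx φ) ≫ scalarEndCx r _ := by
  have h : transposeCx (φ + transposeCx φ) = φ + transposeCx φ := by
    unfold transposeCx
    rw [dualComplexMap_add, Preadditive.comp_add]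
    have := transposeCx_transposeCx φ
    unfold transposeCx at this
    rw [this, add_comm]
  unfold transposeCx at h ⊢
  rw [dualComplexMap_comp, dualComplexMap_scalarEndCx, ← Category.assoc, ← scalarEndCx_comp,
    Category.assoc, h, scalarEndCx_comp]

lemma evalComplex_naturality (f : K ⟶ L) :
    evalComplex K ≫ dualComplexMap (dualComplexMap f) = f ≫ evalComplex L := by
  ext n : 1
  change (_ ≫ evalDual _) ≫ dualMap (dualMap _) = f.f n ≫ _ ≫ evalDual _
  rw [Category.assoc, evalDual_naturality, ← Category.assoc, ← Category.assoc,
    HomologicalComplex.XIsoOfEq_hom_naturality]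

lemma transposeCx_conj (r : L ⟶ K) (φ : K ⟶ dualComplex K) (h : transposeCx φ = φ) :
    transposeCx (r ≫ φ ≫ dualComplexMap r) = r ≫ φ ≫ dualComplexMap r := by
  unfold transposeCx at h ⊢
  rw [dualComplexMap_comp, dualComplexMap_comp, ← Category.assoc, ← Category.assoc,
    evalComplex_naturality, Category.assoc r, h, Category.assoc]

end Transposition

section Detection
variable {X : Scheme.{u}}

/-- The cohomology functors of the derived category compute the homology of complexes. -/
def cohomologyFac (X : Scheme.{u}) (n : ℤ) : Q X ⋙ cohomology X n ≅
    (boundedCoherent X).ι ⋙ HomologicalComplex.homologyFunctor _ _ n :=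
  Localization.fac (W := cohQuasiIso X)
    ((boundedCoherent X).ι ⋙ HomologicalComplex.homologyFunctor _ _ n)
    (fun _ _ f hf ↦ HomologicalComplex.homologyFunctor_inverts_quasiIso X.Modules _ n f.hom hf)
    (Q X)

lemma quasiIso_of_isIso_Q_map {K L : CohComplex X} (f : K ⟶ L) [IsIso ((Q X).map f)] :
    QuasiIso f.hom := by
  rw [quasiIso_iff]
  intro n
  rw [quasiIsoAt_iff_isIso_homologyMap]
  exact (NatIso.isIso_map_iff (cohomologyFac X n) f).mp
    (inferInstanceAs (IsIso ((cohomology X n).map ((Q X).map f))))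

lemma quasiIso_of_isIso_QB_map {K L : BundleComplex X} (f : K ⟶ L) [h : IsIso ((QB X).map f)] :
    QuasiIso f.hom :=
  have : IsIso ((Q X).map ((ObjectProperty.ιOfLE boundedBundle_le).map f)) := h
  quasiIso_of_isIso_Q_map ((ObjectProperty.ιOfLE boundedBundle_le).map f)

/-- Vector bundles are reflexive. -/
lemma isIso_evalDual {F : X.Modules} (hF : IsVectorBundle F) :
    IsIso (evalDual F) := by
  have hmono : Mono (evalDual F) := by
    refine mono_of_injective _ fun W s s' hs ↦ section_ext_of_local _ _ fun p hp ↦ ?_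
    obtain ⟨U, hx, n, e, he⟩ := hF p
    refine ⟨W ⊓ U, inf_le_left, ⟨hp, hx⟩, (he.basis (W ⊓ U) inf_le_right).ext_elem fun i ↦ ?_⟩
    exact congrArg (fun φ : dualSections (dual F) W ↦ φ.1.app (W ⊓ U) inf_le_left
      (dualRestrict F inf_le_right (he.coordSection i))) hs
  have hepi : Epi (evalDual F) := by
    refine LocSurj.epi fun W (Φ : dualSections (dual F) W) p hp ↦ ?_
    obtain ⟨U, hx, n, e, he⟩ := hF p
    let b := he.basis (W ⊓ U) inf_le_right
    let c (i : Fin n) : dualSections F (W ⊓ U) := dualRestrict F inf_le_right (he.coordSection i)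
    let a (i : Fin n) : Γ(X, W ⊓ U) := Φ.1.app (W ⊓ U) inf_le_left (c i)
    refine ⟨W ⊓ U, inf_le_left, ⟨hp, hx⟩, ∑ i, a i • b i, ?_⟩
    refine dual_section_ext fun V hV φ ↦ ?_
    refine LinearMap.congr_fun (f := (evSection F (W ⊓ U) (∑ i, a i • b i)).1.app V hV)
      (g := Φ.1.app V (hV.trans inf_le_left))
      ((he.dual.basis V (hV.trans inf_le_right)).ext fun j ↦ ?_) φ
    rw [he.dual.basis_apply]
    have h1 : (he.basis V (hV.trans inf_le_right)).repr (rs F hV (∑ i, a i • b i)) j =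
        rO hV (a j) := (he.repr_map inf_le_right hV _ j).trans (by
      rw [b.repr_sum_self]; rfl)
    have h2 := Φ.2 (W ⊓ U) V inf_le_left hV (c j)
    exact h1.trans h2.symm
  exact isIso_of_mono_of_epi _

end Detection

/-! ### The orthogonal bundle of a symmetric complex -/

section Pairing
variable {X : Scheme.{u}} {A B D Z F G : X.Modules}

lemma dual_biprod_ext {f g : Z ⟶ dual (F ⊞ G)}
    (h1 : f ≫ dualMap biprod.inl = g ≫ dualMap biprod.inl)
    (h2 : f ≫ dualMap biprod.inr = g ≫ dualMap biprod.inr) : f = g := by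
  have key : ∀ f : Z ⟶ dual (F ⊞ G), f = (f ≫ dualMap biprod.inl) ≫ dualMap biprod.fst +
      (f ≫ dualMap biprod.inr) ≫ dualMap biprod.snd := fun f ↦ by
    rw [Category.assoc, Category.assoc, ← Preadditive.comp_add, ← dualMap_comp, ← dualMap_comp,
      ← dualMap_add, biprod.total, dualMap_id, Category.comp_id]
  rw [key f, h1, h2, ← key g]

lemma mono_dualMap (p : F ⟶ G) [Epi p] : Mono (dualMap p) := by
  refine mono_of_injective _ fun U φ ψ h ↦ dual_section_ext fun V hV s ↦
    function_ext_of_local _ _ fun x hx ↦ ?_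
  obtain ⟨W, hW, hxW, t, ht⟩ := (epi_iff_locSurj p).mp inferInstance V s x hx
  refine ⟨W, hW, hxW, ?_⟩
  rw [← dual_app_rs φ hV hW s, ← dual_app_rs ψ hV hW s, ← ht]
  exact congrArg (fun χ : dualSections F U ↦ χ.1.app W (hW.trans hV) t) h

/-- The pairing `((x, β), (b, δ)) ↦ β(b) - δ(x)` between `D ⊞ B^*` and `B ⊞ D^*`. -/
def pairing (B D : X.Modules) : D ⊞ dual B ⟶ dual (B ⊞ dual D) :=
  biprod.desc (-(evalDual D ≫ dualMap biprod.snd)) (dualMap biprod.fst)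

lemma pairing_inl : pairing B D ≫ dualMap biprod.inl = biprod.snd := by
  unfold pairing
  apply biprod.hom_ext'
  · rw [biprod.inl_desc_assoc, Preadditive.neg_comp, Category.assoc, ← dualMap_comp,
      biprod.inl_snd, dualMap_zero, comp_zero, neg_zero, biprod.inl_snd]
  · rw [biprod.inr_desc_assoc, ← dualMap_comp, biprod.inl_fst, dualMap_id, biprod.inr_snd]

lemma pairing_inr : pairing B D ≫ dualMap biprod.inr = -(biprod.fst ≫ evalDual D) := by
  unfold pairing
  apply biprod.hom_ext'
  · rw [biprod.inl_desc_assoc, Preadditive.neg_comp, Category.assoc, ← dualMap_comp,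
      biprod.inr_snd, dualMap_id, Category.comp_id, Preadditive.comp_neg, biprod.inl_fst_assoc]
  · rw [biprod.inr_desc_assoc, ← dualMap_comp, biprod.inr_fst, dualMap_zero, Preadditive.comp_neg,
      biprod.inr_fst_assoc, zero_comp, neg_zero]

lemma isIso_pairing (hD : IsVectorBundle D) : IsIso (pairing B D) := by
  have := isIso_evalDual hD
  refine ⟨biprod.lift (-(dualMap biprod.inr ≫ inv (evalDual D))) (dualMap biprod.inl), ?_, ?_⟩
  · apply biprod.hom_ext
    · rw [Category.assoc, biprod.lift_fst, Preadditive.comp_neg, ← Category.assoc, pairing_inr,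
        Preadditive.neg_comp, Category.assoc, IsIso.hom_inv_id, neg_neg]
      exact (Category.comp_id _).trans (Category.id_comp _).symm
    · rw [Category.assoc, biprod.lift_snd, pairing_inl, Category.id_comp]
  · apply dual_biprod_ext
    · rw [Category.assoc, pairing_inl, biprod.lift_snd, Category.id_comp]
    · rw [Category.assoc, pairing_inr, Preadditive.comp_neg, biprod.lift_fst_assoc,
        Preadditive.neg_comp, neg_neg, Category.assoc, IsIso.inv_hom_id, Category.id_comp]
      exact Category.comp_id _

end Pairing

/-- A complex `A ⟶ B ⟶ D` whose last term is a vector bundle, with the components `φ₂ : A ⟶ D^*` and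
`φ₁ : B ⟶ B^*` of a symmetric morphism to the dual complex. The remaining component `D ⟶ A^*` is
determined by symmetry. -/
structure SymmetricTriple (X : Scheme.{u}) where
  A : X.Modules
  B : X.Modules
  D : X.Modules
  dA : A ⟶ B
  dB : B ⟶ D
  φ₂ : A ⟶ dual D
  φ₁ : B ⟶ dual B
  isVectorBundle_D : IsVectorBundle D
  symm : evalDual B ≫ dualMap φ₁ = φ₁
  comp : dA ≫ dB = 0
  comm : dA ≫ φ₁ = φ₂ ≫ dualMap dB

namespace SymmetricTriple
variable {X : Scheme.{u}} (t : SymmetricTriple X)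

/-- The component of the symmetric morphism in degree `0`. -/
def φ₀ : t.D ⟶ dual t.A := evalDual t.D ≫ dualMap t.φ₂

lemma comm' : t.dB ≫ t.φ₀ = t.φ₁ ≫ dualMap t.dA := by
  have h := congrArg (fun f : t.A ⟶ dual t.B ↦ evalDual t.B ≫ dualMap f) t.comm
  beta_reduce at h
  rw [dualMap_comp, ← Category.assoc, t.symm, dualMap_comp, ← Category.assoc,
    evalDual_naturality, Category.assoc] at h
  exact h.symm

/-- The first differential of the cone. -/
def j : t.A ⟶ t.B ⊞ dual t.D := biprod.lift (-t.dA) t.φ₂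

/-- The second differential of the cone. -/
def c : t.B ⊞ dual t.D ⟶ t.D ⊞ dual t.B :=
  biprod.desc (biprod.lift (-t.dB) t.φ₁) (biprod.lift 0 (dualMap t.dB))

/-- The third differential of the cone. -/
def k : t.D ⊞ dual t.B ⟶ dual t.A := biprod.desc t.φ₀ (dualMap t.dA)

lemma j_c : t.j ≫ t.c = 0 := by
  unfold j c
  rw [biprod.lift_desc]
  apply biprod.hom_ext
  · simp [t.comp]
  · simp [t.comm]

lemma c_k : t.c ≫ t.k = 0 := by
  unfold c k
  apply biprod.hom_ext'
  · rw [biprod.inl_desc_assoc, biprod.lift_desc, Preadditive.neg_comp, t.comm', comp_zero,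
      neg_add_cancel]
  · rw [biprod.inr_desc_assoc, biprod.lift_desc, zero_comp, zero_add, ← dualMap_comp, t.comp,
      dualMap_zero, comp_zero]

/-- The sheaf of cocycles of the cone, the underlying bundle of the orthogonal bundle. -/
def E : X.Modules := kernel t.k

/-- The inclusion of the cocycles. -/
def ι : t.E ⟶ t.D ⊞ dual t.B := kernel.ι t.k

instance : Mono t.ι := inferInstanceAs (Mono (kernel.ι t.k))

/-- The projection of `B ⊞ D^*` onto the cocycles. -/
def p : t.B ⊞ dual t.D ⟶ t.E := kernel.lift t.k t.c t.c_k

lemma p_ι : t.p ≫ t.ι = t.c := kernel.lift_ι _ _ _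

lemma ι_k : t.ι ≫ t.k = 0 := kernel.condition _

lemma j_p : t.j ≫ t.p = 0 := by
  rw [← cancel_mono t.ι, Category.assoc, p_ι, j_c, zero_comp]

/-- The symmetric form on `B ⊞ D^*` that descends to `E`. -/
def form : t.B ⊞ dual t.D ⟶ dual (t.B ⊞ dual t.D) := t.c ≫ pairing t.B t.D

lemma form_inl : t.form ≫ dualMap biprod.inl = biprod.desc t.φ₁ (dualMap t.dB) := by
  unfold form c
  rw [Category.assoc, pairing_inl]
  apply biprod.hom_ext' <;> simp

lemma form_inr : t.form ≫ dualMap biprod.inr = biprod.fst ≫ t.dB ≫ evalDual t.D := by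
  unfold form c
  rw [Category.assoc, pairing_inr]
  apply biprod.hom_ext' <;> simp

lemma comp_transpose {W F G : X.Modules} (Φ : W ⟶ dual W) (x : F ⟶ W) (y : G ⟶ W) :
    x ≫ (evalDual W ≫ dualMap Φ) ≫ dualMap y = evalDual F ≫ dualMap (y ≫ Φ ≫ dualMap x) := by
  rw [dualMap_comp, dualMap_comp, ← Category.assoc, ← Category.assoc, ← evalDual_naturality,
    Category.assoc, Category.assoc, Category.assoc]

lemma form_symm : evalDual _ ≫ dualMap t.form = t.form := by
  apply biprod.hom_ext' <;> apply dual_biprod_ext <;> rw [Category.assoc, comp_transpose]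
  · rw [form_inl, biprod.inl_desc, t.symm, Category.assoc, form_inl, biprod.inl_desc]
  · rw [form_inl, biprod.inr_desc, evalDual_naturality, Category.assoc, form_inr,
      biprod.inl_fst_assoc]
  · rw [form_inr, biprod.inl_fst_assoc, dualMap_comp, ← Category.assoc,
      evalDual_dualMap_evalDual, Category.id_comp, Category.assoc, form_inl, biprod.inr_desc]
  · rw [form_inr, biprod.inr_fst_assoc, zero_comp, dualMap_zero, comp_zero, Category.assoc,
      form_inr, biprod.inr_fst_assoc, zero_comp]

lemma pairing_j : pairing t.B t.D ≫ dualMap t.j = -t.k := by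
  have h : t.j = -(t.dA ≫ biprod.inl) + t.φ₂ ≫ biprod.inr := by
    unfold j
    apply biprod.hom_ext <;> simp
  rw [h, dualMap_add, dualMap_neg, Preadditive.comp_add, Preadditive.comp_neg, dualMap_comp,
    dualMap_comp, ← Category.assoc, pairing_inl, ← Category.assoc, pairing_inr]
  unfold k φ₀
  apply biprod.hom_ext' <;> simp

/-- A symmetric triple whose cone is exact at its two middle terms, with a bundle of cocycles. -/
structure IsNondegenerate : Prop where
  exact_c : LocExact t.j t.c
  exact_k : LocExact t.c t.k
  isVectorBundle_E : IsVectorBundle t.E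

variable {t}

lemma IsNondegenerate.epi_p (ht : t.IsNondegenerate) : Epi t.p :=
  (ShortComplex.exact_iff_epi_kernel_lift _).mp ((exact_iff_locExact _ _ t.c_k).mpr ht.exact_k)

lemma IsNondegenerate.exact_p (ht : t.IsNondegenerate) : LocExact t.j t.p := fun U s hs x hx ↦
  ht.exact_c U s (by
    rw [← p_ι, comp_app_apply, hs, map_zero]) x hx

lemma IsNondegenerate.exact_dual (ht : t.IsNondegenerate) :
    (ShortComplex.mk (dualMap t.p) (dualMap t.j)
      (by rw [← dualMap_comp, j_p, dualMap_zero])).Exact :=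
  have := ht.epi_p
  (exact_iff_locExact _ _ _).mpr (locExact_dualMap t.j t.p ht.isVectorBundle_E ht.exact_p)

/-- The symmetric form on `B ⊞ D^*` descends to `E`. -/
lemma IsNondegenerate.exists_q (ht : t.IsNondegenerate) :
    ∃ q : t.E ⟶ dual t.E, q ≫ dualMap t.p = t.ι ≫ pairing t.B t.D := by
  have := ht.epi_p
  have := mono_dualMap t.p
  have h : (t.ι ≫ pairing t.B t.D) ≫ dualMap t.j = 0 := by
    rw [Category.assoc, pairing_j, Preadditive.comp_neg, ι_k, neg_zero]
  exact ⟨ht.exact_dual.lift _ h, ht.exact_dual.lift_f _ h⟩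

lemma IsNondegenerate.isIso_q (ht : t.IsNondegenerate) {q : t.E ⟶ dual t.E}
    (hq : q ≫ dualMap t.p = t.ι ≫ pairing t.B t.D) : IsIso q := by
  have := ht.epi_p
  have := mono_dualMap t.p
  have := isIso_pairing (B := t.B) t.isVectorBundle_D
  have hmono : Mono q := by
    have : Mono (q ≫ dualMap t.p) := by rw [hq]; infer_instance
    exact mono_of_mono q (dualMap t.p)
  -- the inverse is the factorization of `E^* ⟶ (B ⊞ D^*)^* ≅ D ⊞ B^*` through the cocycles
  let r : dual t.E ⟶ t.D ⊞ dual t.B := dualMap t.p ≫ inv (pairing t.B t.D)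
  have hr : r ≫ t.k = 0 := by
    rw [← neg_eq_zero, ← Preadditive.comp_neg, ← pairing_j, Category.assoc,
      IsIso.inv_hom_id_assoc, ← dualMap_comp, j_p, dualMap_zero]
  obtain ⟨e, he⟩ : ∃ e : dual t.E ⟶ t.E, e ≫ t.ι = r := ⟨kernel.lift t.k r hr, kernel.lift_ι _ _ _⟩
  have h : e ≫ q = 𝟙 _ := by
    rw [← cancel_mono (dualMap t.p), Category.assoc, hq, ← Category.assoc, he, Category.assoc,
      IsIso.inv_hom_id, Category.comp_id, Category.id_comp]
  have : IsSplitEpi q := IsSplitEpi.mk' ⟨_, h⟩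
  exact isIso_of_mono_of_isSplitEpi q

lemma IsNondegenerate.symm_q (ht : t.IsNondegenerate) {q : t.E ⟶ dual t.E}
    (hq : q ≫ dualMap t.p = t.ι ≫ pairing t.B t.D) : evalDual t.E ≫ dualMap q = q := by
  have := ht.epi_p
  have := mono_dualMap t.p
  have h : t.p ≫ q ≫ dualMap t.p = t.form := by
    rw [hq, ← Category.assoc, p_ι, form]
  rw [← cancel_epi t.p, ← cancel_mono (dualMap t.p), Category.assoc, comp_transpose, h,
    form_symm, Category.assoc, h]

/-- The self-dual complex `D^* ⟶ E ⟶ D^**` of a symmetric triple. -/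
def IsNondegenerate.selfDual (ht : t.IsNondegenerate) : SelfDualData X where
  T := dual t.D
  E := t.E
  isVectorBundle_T := t.isVectorBundle_D.dual
  isVectorBundle_E := ht.isVectorBundle_E
  q := ht.exists_q.choose
  isIso_q := ht.isIso_q ht.exists_q.choose_spec
  symm := ht.symm_q ht.exists_q.choose_spec
  a := biprod.inr ≫ t.p
  isotropic := by
    have h := ht.exists_q.choose_spec
    rw [dualMap_comp, Category.assoc, ← Category.assoc _ (dualMap t.p), h]
    have h2 : biprod.inr ≫ t.form ≫ dualMap biprod.inr = 0 := by
      rw [form_inr, biprod.inr_fst_assoc, zero_comp]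
    rw [form, ← p_ι, Category.assoc, Category.assoc] at h2
    rw [Category.assoc, h2]

lemma IsNondegenerate.selfDual_aStar (ht : t.IsNondegenerate) :
    ht.selfDual.aStar = -(t.ι ≫ biprod.fst ≫ evalDual t.D) := by
  have h := ht.exists_q.choose_spec
  change ht.exists_q.choose ≫ dualMap (biprod.inr ≫ t.p) = _
  rw [dualMap_comp, ← Category.assoc, h, Category.assoc, pairing_inr, Preadditive.comp_neg]

end SymmetricTriple

section ThreeTerm
variable {X : Scheme.{u}} {K : CochainComplex X.Modules ℤ} {A B C : X.Modules} {f : A ⟶ B}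
  {g : B ⟶ C} {w : f ≫ g = 0}

/-- A morphism to a three-term complex. -/
def toThreeTerm (a : K.X (-2) ⟶ A) (b : K.X (-1) ⟶ B) (c : K.X 0 ⟶ C) (h₃ : K.d (-3) (-2) ≫ a = 0)
    (h₂ : a ≫ f = K.d (-2) (-1) ≫ b) (h₁ : b ≫ g = K.d (-1) 0 ≫ c) : K ⟶ threeTerm f g w where
  f
    | .negSucc 1 => a
    | .negSucc 0 => b
    | .ofNat 0 => c
    | _ => 0
  comm' i j hij := by
    obtain rfl : i + 1 = j := hij
    match i with
    | .negSucc 1 => exact h₂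
    | .negSucc 0 => exact h₁
    | .negSucc 2 => exact comp_zero.trans h₃.symm
    | .negSucc (_ + 3) => exact zero_comp.trans comp_zero.symm
    | .ofNat 0 => exact comp_zero.trans comp_zero.symm
    | .ofNat (_ + 1) => exact zero_comp.trans comp_zero.symm

/-- A morphism from a three-term complex. -/
def fromThreeTerm (a : A ⟶ K.X (-2)) (b : B ⟶ K.X (-1)) (c : C ⟶ K.X 0)
    (h₂ : a ≫ K.d (-2) (-1) = f ≫ b) (h₁ : b ≫ K.d (-1) 0 = g ≫ c) (h₀ : c ≫ K.d 0 1 = 0) :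
    threeTerm f g w ⟶ K where
  f
    | .negSucc 1 => a
    | .negSucc 0 => b
    | .ofNat 0 => c
    | _ => 0
  comm' i j hij := by
    obtain rfl : i + 1 = j := hij
    match i with
    | .negSucc 1 => exact h₂
    | .negSucc 0 => exact h₁
    | .negSucc 2 => exact zero_comp.trans zero_comp.symm
    | .negSucc (_ + 3) => exact zero_comp.trans comp_zero.symm
    | .ofNat 0 => exact h₀.trans comp_zero.symm
    | .ofNat (_ + 1) => exact zero_comp.trans comp_zero.symm

end ThreeTerm

/-! ### Reduction of a symmetric complex to a self-dual complex -/

section Reduction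
variable {X : Scheme.{u}} {C : CochainComplex X.Modules ℤ}

lemma comp_evalDual_dualMap_evalDual {A D : X.Modules} (g : A ⟶ dual D) :
    g ≫ evalDual (dual D) ≫ dualMap (evalDual D) = g := by
  rw [evalDual_dualMap_evalDual, Category.comp_id]

lemma f_eq_of_symm {φ : C ⟶ dualComplex C} (hφ : transposeCx φ = φ) (n : ℤ)
    (e : n = -(-n - 2) - 2) :
    ((C.XIsoOfEq e).hom ≫ evalDual _) ≫ dualMap (φ.f (-n - 2)) = φ.f n :=
  congrArg (fun ψ : C ⟶ dualComplex C ↦ ψ.f n) hφ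

/-- The three middle terms of a symmetric morphism `C ⟶ C^∨[2]`. -/
def tripleOf (hC : boundedBundle X C) (φ : C ⟶ dualComplex C) (hφ : transposeCx φ = φ) :
    SymmetricTriple X where
  A := C.X (-2)
  B := C.X (-1)
  D := C.X 0
  dA := C.d (-2) (-1)
  dB := C.d (-1) 0
  φ₂ := φ.f (-2)
  φ₁ := φ.f (-1)
  isVectorBundle_D := hC.2 0
  symm := f_eq_of_symm hφ (-1) rfl
  comp := C.d_comp_d _ _ _
  comm := (φ.comm (-2) (-1)).symm

variable (hC : boundedBundle X C) {φ : C ⟶ dualComplex C} (hφ : transposeCx φ = φ)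

lemma tripleOf_φ₀ : (tripleOf hC φ hφ).φ₀ = φ.f 0 := f_eq_of_symm hφ 0 rfl

lemma coneD_eq_c : coneD φ (-2) (-1) 0 = (tripleOf hC φ hφ).c := rfl

lemma coneD_eq_j (h1 : IsZero (C.X 1)) :
    coneD φ (-3) (-2) (-1) = biprod.fst ≫ (tripleOf hC φ hφ).j :=
  biprod.hom_ext' _ _ ((biprod.inl_desc _ _).trans (biprod.inl_fst_assoc _).symm)
    ((isZero_dual h1 : IsZero ((dualComplex C).X (-3))).eq_of_src _ _)

lemma coneD_eq_k : coneD φ (-1) 0 1 ≫ biprod.snd = (tripleOf hC φ hφ).k := by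
  have h1 : coneD φ (-1) 0 1 ≫ biprod.snd =
      biprod.desc (φ.f 0) ((dualComplex C).d (-1) 0) := by
    unfold coneD
    apply biprod.hom_ext' <;> simp
  rw [h1, ← tripleOf_φ₀ hC hφ]
  rfl

lemma LocExact.of_eq_comp {F F' G H : X.Modules} {f : F ⟶ G} {g : G ⟶ H} (h : LocExact f g)
    {e : F ⟶ F'} {f' : F' ⟶ G} (w : f = e ≫ f') : LocExact f' g := by
  subst w
  intro U s hs p hp
  obtain ⟨V, hV, hpV, z, hz⟩ := h U s hs p hp
  exact ⟨V, hV, hpV, e.app V z, hz⟩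

lemma LocExact.of_comp_eq {F G H H' : X.Modules} {f : F ⟶ G} {g : G ⟶ H} (h : LocExact f g)
    {e : H ⟶ H'} (he : Mono e) {g' : G ⟶ H'} (w : g ≫ e = g') : LocExact f g' := by
  subst w
  exact fun U s hs p hp ↦ h U s (app_injective e U (hs.trans (map_zero _).symm)) p hp

/-- The cone of a quasi-isomorphism is acyclic, and its cocycles are vector bundles. -/
lemma tripleOf_isNondegenerate [IsLocallyNoetherian X] [QuasiIso φ]
    (h0 : ∀ n, 0 < n → IsZero (C.X n)) :
    (tripleOf hC φ hφ).IsNondegenerate := by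
  have hL : boundedBundle X (dualComplex C) := (BundleComplex.dualTwo ⟨C, hC⟩).property
  have hsnd : Mono (biprod.snd : C.X 1 ⊞ (dualComplex C).X 0 ⟶ (dualComplex C).X 0) :=
    Preadditive.mono_of_cancel_zero _ fun g hg ↦
      biprod.hom_ext _ _ ((h0 1 one_pos).eq_of_tgt _ _) (hg.trans zero_comp.symm)
  have h1 := locExact_coneD φ (-3) (-2) (-1) 0 rfl rfl rfl
  have h2 := locExact_coneD φ (-2) (-1) 0 1 rfl rfl rfl
  rw [coneD_eq_c hC hφ] at h1 h2
  exact ⟨h1.of_eq_comp (coneD_eq_j hC hφ (h0 1 one_pos)), h2.of_comp_eq hsnd (coneD_eq_k hC hφ),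
    (isVectorBundle_kernel_coneD φ hC hL (-1)).of_iso
      ((kernelCompMono (coneD φ (-1) 0 1) biprod.snd).symm.trans
        (kernelIsoOfEq (coneD_eq_k hC hφ)))⟩

end Reduction

namespace SymmetricTriple
variable {X : Scheme.{u}} {t : SymmetricTriple X}

lemma φ₂_inr_p (t : SymmetricTriple X) :
    t.φ₂ ≫ biprod.inr ≫ t.p = t.dA ≫ biprod.inl ≫ t.p := by
  have h := t.j_p
  have hj : t.j = t.φ₂ ≫ biprod.inr - t.dA ≫ biprod.inl := by
    unfold j
    apply biprod.hom_ext <;> simp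
  rw [hj, Preadditive.sub_comp, Category.assoc, Category.assoc] at h
  exact sub_eq_zero.mp h

lemma p_aStar (ht : t.IsNondegenerate) :
    t.p ≫ ht.selfDual.aStar = biprod.fst ≫ t.dB ≫ evalDual t.D := by
  have h : t.p ≫ t.ι ≫ biprod.fst = -(biprod.fst ≫ t.dB) := by
    rw [← Category.assoc, p_ι]
    unfold c
    apply biprod.hom_ext' <;> simp
  refine (congrArg (fun g : t.E ⟶ dual (dual t.D) ↦ t.p ≫ g) ht.selfDual_aStar).trans ?_
  rw [Preadditive.comp_neg, ← Category.assoc t.ι, ← Category.assoc t.p, h,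
    Preadditive.neg_comp, neg_neg, Category.assoc]

lemma inl_p_aStar (ht : t.IsNondegenerate) :
    (biprod.inl ≫ t.p) ≫ ht.selfDual.aStar = t.dB ≫ evalDual t.D :=
  (Category.assoc _ _ _).trans
    ((congrArg (fun g : t.B ⊞ dual t.D ⟶ dual (dual t.D) ↦ biprod.inl ≫ g) (p_aStar ht)).trans
      (biprod.inl_fst_assoc _))

lemma inl_p_q {q : t.E ⟶ dual t.E} (hq : q ≫ dualMap t.p = t.ι ≫ pairing t.B t.D) :
    (biprod.inl ≫ t.p) ≫ q ≫ dualMap (biprod.inl ≫ t.p) = t.φ₁ := by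
  have h2 : biprod.inl ≫ t.form ≫ dualMap biprod.inl = t.φ₁ := by
    rw [form_inl, biprod.inl_desc]
  rw [dualMap_comp, Category.assoc, ← Category.assoc _ (dualMap t.p), hq, Category.assoc,
    ← Category.assoc t.p, p_ι, ← h2, form, Category.assoc]

lemma p_bpair {U : X.Opens} (b : Γ(t.B, U)) (δ : Γ(dual t.D, U)) :
    t.p.app U (bpair b δ) = (biprod.inl ≫ t.p).app U b + (biprod.inr ≫ t.p).app U δ :=
  map_add (t.p.app U).hom _ _

lemma exists_section_of_aStar (ht : t.IsNondegenerate) {U : X.Opens} (x : Γ(t.D, U))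
    (y : Γ(t.E, U)) (h : (evalDual t.D).app U x = ht.selfDual.aStar.app U y) (q : X) (hq : q ∈ U) :
    ∃ (V : X.Opens) (h : V ≤ U), q ∈ V ∧ ∃ (b : Γ(t.B, V)) (δ : Γ(dual t.D, V)),
      t.dB.app V b = rs t.D h x ∧
      (biprod.inl ≫ t.p).app V b + (biprod.inr ≫ t.p).app V δ = rs t.E h y := by
  have hD := isIso_evalDual t.isVectorBundle_D
  obtain ⟨V, hV, hqV, z, hz⟩ := (epi_iff_locSurj t.p).mp ht.epi_p U y q hq
  obtain ⟨b, δ, rfl⟩ : ∃ b δ, z = bpair b δ := ⟨_, _, bpair_ext_iff.mpr ⟨rfl, rfl⟩⟩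
  refine ⟨V, hV, hqV, b, δ, ?_, ?_⟩
  · have h1 : ht.selfDual.aStar.app V (t.p.app V (bpair b δ)) =
        (evalDual t.D).app V (t.dB.app V b) := by
      have h2 := congrArg (fun g : t.B ⊞ dual t.D ⟶ dual (dual t.D) ↦ g.app V (bpair b δ))
        (p_aStar ht)
      refine h2.trans ?_
      change (evalDual t.D).app V
        (t.dB.app V ((biprod.fst : t.B ⊞ dual t.D ⟶ t.B).app V (bpair b δ))) = _
      rw [fst_bpair]
    refine app_injective (evalDual t.D) V ?_
    rw [← h1, hz, app_rs, h]
    exact app_rs ht.selfDual.aStar hV y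
  · rw [← p_bpair, hz]

lemma exists_section_of_inl_eq_inr (ht : t.IsNondegenerate) {U : X.Opens} (x : Γ(t.B, U))
    (y : Γ(dual t.D, U)) (h : (biprod.inl ≫ t.p).app U x = (biprod.inr ≫ t.p).app U y)
    (q : X) (hq : q ∈ U) : ∃ (V : X.Opens) (h : V ≤ U), q ∈ V ∧ ∃ a : Γ(t.A, V),
      t.dA.app V a = rs t.B h x ∧ t.φ₂.app V a = rs _ h y := by
  obtain ⟨V, hV, hqV, a, ha⟩ := ht.exact_p U (bpair x (-y)) (by
    rw [p_bpair, h, map_neg, add_neg_cancel]) q hq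
  refine ⟨V, hV, hqV, -a, ?_⟩
  unfold j at ha
  rw [lift_app_eq, rs_bpair, bpair_ext_iff, fst_bpair, snd_bpair, neg_app_apply, map_neg] at ha
  rw [map_neg, map_neg, ha.1, ha.2, neg_neg]
  exact ⟨rfl, rfl⟩

end SymmetricTriple

section Reduction
open SymmetricTriple
variable {X : Scheme.{u}} {C : CochainComplex X.Modules ℤ}
variable (hC : boundedBundle X C) {φ : C ⟶ dualComplex C} (hφ : transposeCx φ = φ)
  (h0 : ∀ n, 0 < n → IsZero (C.X n)) (ht : (tripleOf hC φ hφ).IsNondegenerate)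

include h0 in
lemma isZero_dualComplex (n : ℤ) (hn : n < -2) : IsZero ((dualComplex C).X n) :=
  isZero_dual (h0 _ (by omega))

include h0 in
lemma d_f_eq_zero : C.d (-3) (-2) ≫ φ.f (-2) = 0 := by
  rw [← φ.comm, (isZero_dualComplex h0 (-3) (by norm_num)).eq_of_tgt (φ.f (-3)) 0, zero_comp]

/-- The morphism from a symmetric complex to its associated self-dual complex. -/
def toSelfDual : C ⟶ ht.selfDual.complex :=
  toThreeTerm (φ.f (-2)) (biprod.inl ≫ (tripleOf hC φ hφ).p) (evalDual (C.X 0))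
    (d_f_eq_zero h0) (φ₂_inr_p (tripleOf hC φ hφ)) (inl_p_aStar ht)

lemma toSelfDual_duality : toSelfDual hC hφ h0 ht ≫ ht.selfDual.dualityMap ≫
    dualComplexMap (toSelfDual hC hφ h0 ht) = φ := by
  ext n : 1
  obtain rfl | rfl | rfl | hn | hn : n = -2 ∨ n = -1 ∨ n = 0 ∨ n < -2 ∨ 0 < n := by omega
  · refine Eq.trans ?_ (comp_evalDual_dualMap_evalDual (A := C.X (-2)) (D := C.X 0) (φ.f (-2)))
    rfl
  · exact inl_p_q ht.exists_q.choose_spec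
  · refine Eq.trans ?_ (tripleOf_φ₀ hC hφ)
    rfl
  · exact (isZero_dualComplex h0 n hn).eq_of_tgt _ _
  · exact (h0 n hn).eq_of_src _ _

lemma quasiIso_toSelfDual [hq : QuasiIso φ] : QuasiIso (toSelfDual hC hφ h0 ht) := by
  have hD := isIso_evalDual (hC.2 0)
  have hp := ht.epi_p
  rw [epi_iff_locSurj] at hp
  rw [quasiIso_iff_locCone] at hq ⊢
  intro i j k l hij hjk hkl
  have hS : ∀ n, n < -2 ∨ 0 < n → IsZero (ht.selfDual.complex.X n) :=
    SelfDualData.isZero_threeTerm _ _ _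
  obtain hk | rfl | rfl | rfl | hk : k ≤ -2 ∨ k = -1 ∨ k = 0 ∨ k = 1 ∨ 2 ≤ k := by omega
  · intro U x y hx hxy p hpU
    have hφx : (φ.f k).app U x = 0 := by
      obtain rfl | hk' : k = -2 ∨ k < -2 := by omega
      · refine Eq.trans hxy ?_
        rw [IsZero.section_eq_zero (hS j (by omega)) y]
        exact map_zero _
      · exact IsZero.section_eq_zero (isZero_dualComplex h0 k hk') _
    obtain ⟨V, hV, hpV, x', -, h1, -⟩ := hq i j k l hij hjk hkl U x 0 hx
      (hφx.trans (map_zero _).symm) p hpU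
    exact ⟨V, hV, hpV, x', 0, h1, (IsZero.section_eq_zero (hS j (by omega)) _).trans
      (IsZero.section_eq_zero (hS j (by omega)) _).symm⟩
  · obtain ⟨rfl, rfl, rfl⟩ : i = -3 ∧ j = -2 ∧ l = 0 := by omega
    intro U x y hx hxy p hpU
    obtain ⟨V, hV, hpV, a, h1, h2⟩ := exists_section_of_inl_eq_inr ht x y hxy p hpU
    refine ⟨V, hV, hpV, a, 0, h1, ?_⟩
    rw [map_zero, add_zero]
    exact h2
  · obtain ⟨rfl, rfl, rfl⟩ : i = -2 ∧ j = -1 ∧ l = 1 := by omega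
    intro U x y hx hxy p hpU
    obtain ⟨V, hV, hpV, b, δ, h1, h2⟩ := exists_section_of_aStar ht x y hxy p hpU
    exact ⟨V, hV, hpV, b, δ, h1, h2⟩
  · obtain ⟨rfl, rfl, rfl⟩ : i = -1 ∧ j = 0 ∧ l = 2 := by omega
    intro U x y hx hxy p hpU
    obtain ⟨x', hx'⟩ := (app_bijective (evalDual (C.X 0)) U).2 y
    refine ⟨U, le_rfl, hpU, x', 0, (IsZero.section_eq_zero (h0 1 one_pos) _).trans
      (IsZero.section_eq_zero (h0 1 one_pos) _).symm, ?_⟩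
    rw [map_zero, add_zero, rs_self]
    exact hx'
  · intro U x y hx hxy p hpU
    exact ⟨U, le_rfl, hpU, 0, 0, (IsZero.section_eq_zero (h0 k (by omega)) _).trans
      (IsZero.section_eq_zero (h0 k (by omega)) _).symm,
      (IsZero.section_eq_zero (hS j (by omega)) _).trans
      (IsZero.section_eq_zero (hS j (by omega)) _).symm⟩

end Reduction

/-! ### Symmetric representatives and the reduction theorem -/

section Trim
variable {X : Scheme.{u}} [IsLocallyNoetherian X]

/-- A bounded complex of vector bundles without cohomology in positive degrees is quasi-isomorphic
to one without terms in positive degrees. -/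
lemma exists_trim (C : CochainComplex X.Modules ℤ) (hC : boundedBundle X C)
    (hex : ∀ n, 0 < n → C.ExactAt n) :
    ∃ (C' : CochainComplex X.Modules ℤ) (r : C' ⟶ C), QuasiIso r ∧ boundedBundle X C' ∧
      ∀ n, 0 < n → IsZero (C'.X n) := by
  have key : ∀ (m : ℕ) (C : CochainComplex X.Modules ℤ), boundedBundle X C →
      (∀ n, 0 < n → C.ExactAt n) → (∀ n : ℤ, m < n → IsZero (C.X n)) →
      ∃ (C' : CochainComplex X.Modules ℤ) (r : C' ⟶ C), QuasiIso r ∧ boundedBundle X C' ∧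
        ∀ n, 0 < n → IsZero (C'.X n) := by
    intro m
    induction m with
    | zero => exact fun C hC _ h0 ↦ ⟨C, 𝟙 C, inferInstance, hC, fun n hn ↦ h0 n (by simpa using hn)⟩
    | succ m ih =>
      intro C hC hex h0
      have hij : (m : ℤ) + 1 = m + 1 := rfl
      let F := C.X (m + 1)
      open scoped ZeroObject in
      let Z : CochainComplex X.Modules ℤ := 0
      have hZ : ∀ n, IsZero (Z.X n) := fun n ↦
        (HomologicalComplex.eval _ _ n).map_isZero (isZero_zero _)
      let f : C ⟶ disk F m (m + 1) hij := toDisk hij (𝟙 F)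
      let g : Z ⟶ disk F m (m + 1) hij := 0
      have hg : QuasiIso g := ⟨fun n ↦
        (quasiIsoAt_iff_exactAt' g n (exactAt_disk F hij n)).mpr (exactAt_of_isZero (hZ n))⟩
      -- exactness in the top degree `m + 1` makes the last differential surjective, so that the
      -- terms of degrees `m` and `m + 1` can be replaced by its kernel, a vector bundle
      have hd : Epi (C.d m (m + 1)) := by
        refine LocSurj.epi fun U s x hx ↦ ?_
        refine (exactAt_iff_locExact (m : ℤ) (m + 1) (m + 1 + 1) rfl rfl).mp (hex _ (by omega))
          U s ?_ x hx
        exact IsZero.section_eq_zero (h0 _ (by push_cast; omega)) _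
      have hf : ∀ n, Epi (f.f n) := fun n ↦ epi_toDisk hij (𝟙 F) n
      have hepi : ∀ n, Epi (biprod.desc (f.f n) (g.f n)) := fun n ↦
        have := hf n
        epi_biprod_desc_left _ _
      have hq : QuasiIso (pbFst f g) := quasiIso_pbFst f g hepi
      have hb : boundedBundle X (pb f g) := ⟨hC.1.pb ⟨0, 0, fun n _ ↦ hZ n⟩ f g, fun n ↦
        isVectorBundle_pb (hC.2 n) (SelfDualData.isVectorBundle_zero (hZ n))
          (isVectorBundle_disk (hC.2 _) hij n) (hepi n)⟩
      obtain ⟨C', r, hr, hC', h0'⟩ := ih (pb f g) hb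
        (fun n hn ↦ (quasiIsoAt_iff_exactAt' (pbFst f g) n (hex n hn)).mp inferInstance)
        (fun n hn ↦ by
          obtain rfl | hn' : n = m + 1 ∨ m + 1 < n := by omega
          · have : IsIso (f.f (m + 1)) := by
              change IsIso ((toDisk hij (𝟙 F)).f (m + 1))
              rw [toDisk_right]
              infer_instance
            have := isIso_pbSnd_f f g (m + 1)
            exact (hZ _).of_iso (asIso ((pbSnd f g).f (m + 1)))
          · exact isZero_pb_X (h0 n (by push_cast; omega)) (hZ n))
      exact ⟨C', r ≫ pbFst f g, inferInstance, hC', h0'⟩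
  obtain ⟨a, b, h⟩ := hC.1
  exact key b.toNat C hC hex fun n hn ↦ h n (by omega)

end Trim

section Cohomology
variable {X : Scheme.{u}}

lemma exactAt_of_isZero_cohomology {K : CohComplex X} {n : ℤ}
    (h : IsZero ((cohomology X n).obj ((Q X).obj K))) : K.obj.ExactAt n :=
  (HomologicalComplex.exactAt_iff_isZero_homology _ _).mpr
    (h.of_iso ((cohomologyFac X n).app K).symm)

lemma isZero_cohomology {K : CohComplex X} {n : ℤ} (h : K.obj.ExactAt n) :
    IsZero ((cohomology X n).obj ((Q X).obj K)) :=
  ((HomologicalComplex.exactAt_iff_isZero_homology _ _).mp h).of_iso ((cohomologyFac X n).app K)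

/-- Exactness is local. -/
lemma exactAt_of_restrict {K : CochainComplex X.Modules ℤ} {n : ℤ}
    (h : ∀ x : X, ∃ U : X.Opens, x ∈ U ∧ (restrictComplex K U).ExactAt n) : K.ExactAt n := by
  rw [exactAt_iff_locExact (n - 1) n (n + 1) (by omega) rfl]
  intro V s hs x hx
  obtain ⟨U, hxU, hU⟩ := h x
  rw [exactAt_iff_locExact (n - 1) n (n + 1) (by omega) rfl] at hU
  have hle : U.ι ''ᵁ (U.ι ⁻¹ᵁ V) ≤ V := U.ι.image_preimage_le V
  obtain ⟨W, hW, hxW, (t : Γ(K.X (n - 1), U.ι ''ᵁ W)), ht⟩ := hU (U.ι ⁻¹ᵁ V)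
    (rs (K.X n) hle s : Γ(K.X n, U.ι ''ᵁ (U.ι ⁻¹ᵁ V))) (by
      change (K.d n (n + 1)).app (U.ι ''ᵁ (U.ι ⁻¹ᵁ V)) (rs (K.X n) hle s) = 0
      rw [app_rs, hs, map_zero]) ⟨x, hxU⟩ hx
  refine ⟨U.ι ''ᵁ W, (Scheme.Hom.image_mono U.ι hW).trans hle, ⟨⟨x, hxU⟩, hxW, rfl⟩, t, ?_⟩
  have h1 : (K.d (n - 1) n).app (U.ι ''ᵁ W) t =
      rs (K.X n) (Scheme.Hom.image_mono U.ι hW) (rs (K.X n) hle s) := ht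
  rw [h1, rs_rs]

lemma isZero_cohomology_of_perfect {𝔼 : DCoh X} (h𝔼 : IsPerfectOfAmplitude 𝔼) (n : ℤ) (hn : 0 < n) :
    IsZero ((cohomology X n).obj 𝔼) := by
  obtain ⟨K, ⟨e⟩, hK⟩ := h𝔼
  refine IsZero.of_iso ?_ ((cohomology X n).mapIso e.symm)
  refine isZero_cohomology (exactAt_of_restrict fun x ↦ ?_)
  obtain ⟨U, hxU, P, -, hP, φ, hφ⟩ := hK x
  exact ⟨U, hxU, (quasiIsoAt_iff_exactAt φ n (exactAt_of_isZero (hP n (Or.inr hn)))).mp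
    inferInstance⟩

lemma epi_homologyMap_of_cohomology {K L : CohComplex X} (t : K ⟶ L) (n : ℤ)
    (h : Epi ((cohomology X n).map ((Q X).map t))) :
    Epi (HomologicalComplex.homologyMap t.hom n) := by
  have e := (cohomologyFac X n).hom.naturality t
  have h1 : Epi ((cohomologyFac X n).hom.app K ≫
      ((boundedCoherent X).ι ⋙ HomologicalComplex.homologyFunctor _ _ n).map t) := by
    rw [← e]
    have : Epi ((Q X ⋙ cohomology X n).map t) := h
    infer_instance
  exact @epi_of_epi _ _ _ _ _ ((cohomologyFac X n).hom.app K)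
    (((boundedCoherent X).ι ⋙ HomologicalComplex.homologyFunctor _ _ n).map t) h1

/-- A morphism of complexes that is surjective in degree `-1` and on cohomology in degree `0` is
surjective in degree `0`, if the target has no terms in degree `1`. -/
lemma epi_f_of_epi_homologyMap {C : Type*} [Category* C] [Abelian C] {K L : CochainComplex C ℤ}
    (t : K ⟶ L) (h1 : IsZero (L.X 1)) [Epi (t.f (-1))]
    [Epi (HomologicalComplex.homologyMap t 0)] : Epi (t.f 0) := by
  refine Preadditive.epi_of_cancel_zero _ fun {Z} g hg ↦ ?_
  have hd : L.d (-1) 0 ≫ g = 0 := by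
    rw [← cancel_epi (t.f (-1)), ← Category.assoc, t.comm, Category.assoc, hg, comp_zero, comp_zero]
  let g' : L.opcycles 0 ⟶ Z := L.descOpcycles g (-1) (by simp) hd
  have hg' : L.pOpcycles 0 ≫ g' = g := L.p_descOpcycles _ _ _ _
  have hι : IsIso (L.homologyι 0) := by
    have : L.d 0 1 = 0 := h1.eq_of_tgt _ _
    exact L.isIso_homologyι 0 1 (by simp) this
  have h3 : HomologicalComplex.opcyclesMap t 0 ≫ g' = 0 := by
    rw [← cancel_epi (K.pOpcycles 0), ← Category.assoc, HomologicalComplex.p_opcyclesMap,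
      Category.assoc, hg', hg, comp_zero]
  have h4 : L.homologyι 0 ≫ g' = 0 := by
    rw [← cancel_epi (HomologicalComplex.homologyMap t 0), ← Category.assoc,
      HomologicalComplex.homologyι_naturality, Category.assoc, h3, comp_zero, comp_zero]
  have h5 : g' = 0 := by
    rw [← cancel_epi (L.homologyι 0), h4, comp_zero]
  rw [← hg', h5, comp_zero]

end Cohomology

section Representatives
open BundleComplex
variable {X : Scheme.{u}} {P : BundleComplex X}
  {τ : (QB X).obj P ⟶ (QB X).obj P.dualTwo}

/-- A symmetric morphism of complexes `ψ : C ⟶ C^∨[2]` that represents `τ : P ⟶ P^∨[2]` along the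
quasi-isomorphism `s : C ⟶ P`. -/
structure IsSymmRep (τ : (QB X).obj P ⟶ (QB X).obj P.dualTwo) {C : BundleComplex X} (s : C ⟶ P)
    (ψ : C ⟶ C.dualTwo) : Prop where
  quasiIso : QuasiIso s.hom
  symm : transposeCx (K := C.obj) ψ.hom = ψ.hom
  map_eq : (QB X).map ψ = (QB X).map s ≫ τ ≫ (QB X).map (dualTwoMap s)

lemma isIso_QB_map_dualTwoMap [IsLocallyNoetherian X] {C C' : BundleComplex X} (r : C' ⟶ C)
    (hr : QuasiIso r.hom) :
    IsIso ((QB X).map (dualTwoMap r)) :=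
  isIso_QB_map _ (quasiIso_dualComplexMap r.hom C'.property C.property)

lemma IsSymmRep.quasiIso_form [IsLocallyNoetherian X] [IsIso τ] {C : BundleComplex X}
    {s : C ⟶ P} {ψ : C ⟶ C.dualTwo} (h : IsSymmRep τ s ψ) : QuasiIso ψ.hom := by
  have h1 := isIso_QB_map s h.quasiIso
  have h2 := isIso_QB_map_dualTwoMap s h.quasiIso
  have : IsIso ((QB X).map ψ) := by
    rw [h.map_eq]
    infer_instance
  exact quasiIso_of_isIso_QB_map ψ

/-- Symmetric representatives can be pulled back along quasi-isomorphisms. -/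
lemma IsSymmRep.comp {C C' : BundleComplex X} {s : C ⟶ P} {ψ : C ⟶ C.dualTwo}
    (h : IsSymmRep τ s ψ) (r : C' ⟶ C) (hr : QuasiIso r.hom) :
    IsSymmRep τ (r ≫ s) (r ≫ ψ ≫ dualTwoMap r) where
  quasiIso := by
    have := h.quasiIso
    exact inferInstanceAs (QuasiIso (r.hom ≫ s.hom))
  symm := transposeCx_conj r.hom ψ.hom h.symm
  map_eq := by
    have h1 : dualTwoMap (r ≫ s) = dualTwoMap s ≫ dualTwoMap r := rfl
    rw [h1, Functor.map_comp, Functor.map_comp, h.map_eq, Functor.map_comp, Functor.map_comp]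
    simp only [Category.assoc]

lemma transposeCx_comp_dualComplexMap {K L : CochainComplex X.Modules ℤ} (s : K ⟶ L)
    (t : K ⟶ dualComplex L) : transposeCx (t ≫ dualComplexMap s) =
      s ≫ evalComplex L ≫ dualComplexMap t := by
  unfold transposeCx
  rw [dualComplexMap_comp, ← Category.assoc, evalComplex_naturality, Category.assoc]

/-- If `2` is invertible, then a morphism `τ = τ^∨[2]` is represented by a symmetric morphism of
complexes: the average of a representative and its transpose. -/
lemma exists_isSymmRep [IsLocallyNoetherian X] (r : Γ(X, ⊤)) (hr : r + r = 1)
    {τ' : (QB X).obj P.dualTwo.dualTwo ⟶ (QB X).obj P.dualTwo} (h : IsDualTwo τ τ')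
    (h3 : (QB X).map P.eval ≫ τ' = τ) :
    ∃ (C : BundleComplex X) (s : C ⟶ P) (ψ : C ⟶ C.dualTwo), IsSymmRep τ s ψ := by
  obtain ⟨C, s, t, hs, h1, h2⟩ := h
  let φ : C ⟶ C.dualTwo := t ≫ dualTwoMap s
  -- the transpose of `φ`, which represents the same morphism because `τ` is symmetric
  let φ' : C ⟶ C.dualTwo := s ≫ P.eval ≫ dualTwoMap t
  have hφ' : φ'.hom = transposeCx (K := C.obj) φ.hom :=
    (transposeCx_comp_dualComplexMap s.hom t.hom).symm
  have e1 : (QB X).map φ = (QB X).map s ≫ τ ≫ (QB X).map (dualTwoMap s) := by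
    rw [Functor.map_comp, ← h1, Category.assoc]
  have e2 : (QB X).map φ' = (QB X).map s ≫ τ ≫ (QB X).map (dualTwoMap s) := by
    rw [Functor.map_comp, Functor.map_comp, ← h2, ← h3, Category.assoc]
  let f : C.obj ⟶ dualComplex C.obj := φ.hom
  let f' : C.obj ⟶ dualComplex C.obj := (f + transposeCx f) ≫ scalarEndCx r (dualComplex C.obj)
  let ψ : C ⟶ C.dualTwo := ObjectProperty.homMk f'
  refine ⟨C, s, ψ, hs, transposeCx_average r f, ?_⟩
  rw [← e1]
  exact Q_map_average r hr ((ObjectProperty.ιOfLE boundedBundle_le).map φ)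
    ((ObjectProperty.ιOfLE boundedBundle_le).map φ')
    ((ObjectProperty.ιOfLE boundedBundle_le).map ψ) (e1.trans e2.symm)
    (congrArg (fun g : C.obj ⟶ dualComplex C.obj ↦ (f + g) ≫ scalarEndCx r (dualComplex C.obj))
      hφ'.symm)

end Representatives

namespace SymmetricTriple
variable {X : Scheme.{u}} {t : SymmetricTriple X}

lemma exists_desc (ht : t.IsNondegenerate) {Z : X.Modules} (g : t.B ⊞ dual t.D ⟶ Z)
    (hg : t.j ≫ g = 0) : ∃ u : t.E ⟶ Z, t.p ≫ u = g := by
  have := ht.epi_p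
  have hS : (ShortComplex.mk t.j t.p t.j_p).Exact := (exact_iff_locExact _ _ _).mpr ht.exact_p
  exact ⟨hS.desc g hg, hS.g_desc g hg⟩

lemma aStar_comp (ht : t.IsNondegenerate) {e : dual (dual t.D) ⟶ t.D} (he : evalDual t.D ≫ e = 𝟙 _)
    {Y Z : X.Modules} {u : t.E ⟶ Y} {b : t.B ⟶ Y} (hu : t.p ≫ u = biprod.desc b 0) {d : Y ⟶ Z}
    {c : t.D ⟶ Z} (h : b ≫ d = t.dB ≫ c) : u ≫ d = ht.selfDual.aStar ≫ e ≫ c := by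
  have := ht.epi_p
  refine (cancel_epi t.p).mp ?_
  have h1 : t.p ≫ u ≫ d = biprod.fst ≫ t.dB ≫ c := by
    rw [← Category.assoc, hu, ← h]
    apply biprod.hom_ext' <;> simp
  have h2 : ((biprod.fst : t.B ⊞ dual t.D ⟶ t.B) ≫ t.dB ≫ evalDual t.D) ≫ e ≫ c =
      biprod.fst ≫ t.dB ≫ c := by
    rw [Category.assoc, Category.assoc, ← Category.assoc (evalDual t.D), he, Category.id_comp]
  refine h1.trans (h2.symm.trans ?_)
  exact (congrArg (fun g : t.B ⊞ dual t.D ⟶ dual (dual t.D) ↦ g ≫ e ≫ c)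
    (p_aStar ht)).symm.trans (Category.assoc _ _ _)

/-- A morphism on `B` that vanishes on the image of `A` descends to `E`, by zero on `D^*`. -/
lemma exists_descend (ht : t.IsNondegenerate) {e : dual (dual t.D) ⟶ t.D}
    (he : evalDual t.D ≫ e = 𝟙 _) {Y Z : X.Modules} (b : t.B ⟶ Y) (hb : t.dA ≫ b = 0)
    (d : Y ⟶ Z) (c : t.D ⟶ Z) (h : b ≫ d = t.dB ≫ c) :
    ∃ u : t.E ⟶ Y, (biprod.inl ≫ t.p) ≫ u = b ∧ (biprod.inr ≫ t.p) ≫ u = 0 ∧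
      u ≫ d = ht.selfDual.aStar ≫ e ≫ c := by
  obtain ⟨u, hu⟩ := exists_desc ht (biprod.desc b 0) (by
    unfold j
    rw [biprod.lift_desc, comp_zero, add_zero, Preadditive.neg_comp, hb, neg_zero])
  refine ⟨u, ?_, ?_, aStar_comp ht he hu h⟩
  · rw [Category.assoc, hu, biprod.inl_desc]
  · rw [Category.assoc, hu, biprod.inr_desc]

end SymmetricTriple

section Descent
open SymmetricTriple
variable {X : Scheme.{u}} {C : CochainComplex X.Modules ℤ}
variable (hC : boundedBundle X C) {φ : C ⟶ dualComplex C} (hφ : transposeCx φ = φ)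
  (h0 : ∀ n, 0 < n → IsZero (C.X n)) (ht : (tripleOf hC φ hφ).IsNondegenerate)

/-- Morphisms to a complex in degrees `-1` and `0` factor through the associated self-dual
complex. -/
lemma exists_toSelfDual_comp {L : CochainComplex X.Modules ℤ}
    (hL : ∀ n, n < -1 ∨ 0 < n → IsZero (L.X n)) (t : C ⟶ L) :
    ∃ u : ht.selfDual.complex ⟶ L, toSelfDual hC hφ h0 ht ≫ u = t := by
  obtain ⟨e, he, -⟩ := (isIso_evalDual (hC.2 0)).out
  have ht2 : C.d (-2) (-1) ≫ t.f (-1) = 0 := by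
    rw [← t.comm, (hL (-2) (Or.inl (by norm_num))).eq_of_tgt (t.f (-2)) 0, zero_comp]
  obtain ⟨u, hu1, hu2, hu3⟩ := exists_descend ht he (t.f (-1))
    ht2 (L.d (-1) 0) (t.f 0) (t.comm (-1) 0)
  refine ⟨fromThreeTerm 0 u (e ≫ t.f 0) (zero_comp.trans hu2.symm) hu3
    ((hL 1 (Or.inr one_pos)).eq_of_tgt _ _), ?_⟩
  ext n : 1
  obtain rfl | rfl | hn | hn : n = -1 ∨ n = 0 ∨ n < -1 ∨ 0 < n := by omega
  · exact hu1
  · refine (Category.assoc (evalDual (C.X 0)) e (t.f 0)).symm.trans ?_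
    rw [he, Category.id_comp]
  · exact (hL n (Or.inl hn)).eq_of_tgt _ _
  · exact (hL n (Or.inr hn)).eq_of_tgt _ _

end Descent

section Reduction
open BundleComplex
variable {X : Scheme.{u}} [IsLocallyNoetherian X]

/-- A complex of vector bundles in nonpositive degrees with a symmetric quasi-isomorphism to its
dual is quasi-isomorphic to a self-dual complex, compatibly with the dualities. -/
lemma exists_selfDual_of_symm (C : BundleComplex X) (ψ : C ⟶ C.dualTwo)
    (hψ : transposeCx (K := C.obj) ψ.hom = ψ.hom) (hq : QuasiIso ψ.hom)
    (h0 : ∀ n, 0 < n → IsZero (C.obj.X n)) (L : CohComplex X)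
    (hL : ∀ n, n < -1 ∨ 0 < n → IsZero (L.obj.X n)) (t : toCoh C ⟶ L) :
    ∃ (S : SelfDualData X) (s : C ⟶ S.cx) (u : S.cx.obj ⟶ L.obj), QuasiIso s.hom ∧
      s ≫ S.duality ≫ dualTwoMap s = ψ ∧ s.hom ≫ u = t.hom := by
  let φ : C.obj ⟶ dualComplex C.obj := ψ.hom
  have hφ : QuasiIso φ := hq
  have ht := tripleOf_isNondegenerate C.property (φ := φ) hψ h0
  obtain ⟨u, hu⟩ := exists_toSelfDual_comp C.property (φ := φ) hψ h0 ht hL t.hom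
  refine ⟨ht.selfDual, ObjectProperty.homMk (toSelfDual C.property (φ := φ) hψ h0 ht), u,
    quasiIso_toSelfDual C.property (φ := φ) hψ h0 ht, ?_, hu⟩
  ext : 1
  exact toSelfDual_duality C.property (φ := φ) hψ h0 ht

/-- Symmetric representatives can be modified so that a given morphism to a complex in degrees
`-1` and `0`, surjective on `h^0`, is represented by a surjective map of complexes, and the terms
in positive degrees vanish. -/
lemma exists_good_isSymmRep (hX : HasEnoughBundles X) {P : BundleComplex X}
    {τ : (QB X).obj P ⟶ (QB X).obj P.dualTwo} {C : BundleComplex X} {s : C ⟶ P}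
    {ψ : C ⟶ C.dualTwo} (h : IsSymmRep τ s ψ)
    (hP : ∀ n, 0 < n → IsZero ((cohomology X n).obj ((QB X).obj P))) (L : CohComplex X)
    (hL : ∀ n, n < -1 ∨ 0 < n → IsZero (L.obj.X n)) (At : (QB X).obj P ⟶ (Q X).obj L)
    (hAt : Epi ((cohomology X 0).map At)) :
    ∃ (C : BundleComplex X) (s : C ⟶ P) (ψ : C ⟶ C.dualTwo) (t : toCoh C ⟶ L),
      IsSymmRep τ s ψ ∧ (QB X).map s ≫ At = (Q X).map t ∧
      (∀ n, 0 < n → IsZero (C.obj.X n)) ∧ ∀ n, Epi (t.hom.f n) := by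
  obtain ⟨C₁, s₁, t₁, hs₁, h₁⟩ := exists_roof hX ((QB X).map s ≫ At)
  have hrep₁ := h.comp s₁ hs₁
  -- the terms in positive degrees are removed
  have hex : ∀ n, 0 < n → C₁.obj.ExactAt n := fun n hn ↦ by
    have := isIso_QB_map (s₁ ≫ s) hrep₁.quasiIso
    let e : (QB X).obj C₁ ≅ (QB X).obj P := asIso ((QB X).map (s₁ ≫ s))
    exact exactAt_of_isZero_cohomology (K := toCoh C₁)
      ((hP n hn).of_iso ((cohomology X n).mapIso e))
  obtain ⟨C₂', r', hr', hC₂, h0⟩ := exists_trim C₁.obj C₁.property hex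
  let C₂ : BundleComplex X := ⟨C₂', hC₂⟩
  let r : C₂ ⟶ C₁ := ObjectProperty.homMk r'
  have hrep₂ := hrep₁.comp r hr'
  -- a contractible summand in degrees `-1` and `0` makes the morphism to `L` surjective in degree
  -- `-1`; surjectivity in degree `0` then follows from surjectivity on `h^0`
  obtain ⟨B, β, hB, hβ⟩ := hX (L.obj.X (-1)) (L.property.2 _)
  obtain ⟨N, i, π, w, hiπ, hiw, hπ, hw, -, hN, hN0⟩ := exists_epi_degree (r' ≫ t₁.hom) (-1) β
  let C₃ : BundleComplex X := ⟨N, hN hC₂ hB⟩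
  let π' : C₃ ⟶ C₂ := ObjectProperty.homMk π
  let i' : C₂ ⟶ C₃ := ObjectProperty.homMk i
  let t : toCoh C₃ ⟶ L := ObjectProperty.homMk w
  have hrep₃ := hrep₂.comp π' hπ
  have ht : (QB X).map (π' ≫ r ≫ s₁ ≫ s) ≫ At = (Q X).map t := by
    have e1 : (QB X).map i' ≫ (Q X).map t = (QB X).map r ≫ (Q X).map t₁ := by
      have h1 : (ObjectProperty.ιOfLE boundedBundle_le).map i' ≫ t =
          (ObjectProperty.ιOfLE boundedBundle_le).map r ≫ t₁ := by
        ext : 1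
        exact hiw
      exact ((Q X).map_comp _ _).symm.trans ((congrArg (Q X).map h1).trans ((Q X).map_comp _ _))
    have e2 : (QB X).map i' ≫ (QB X).map π' = 𝟙 _ := by
      have h1 : i' ≫ π' = 𝟙 _ := by
        ext : 1
        exact hiπ
      rw [← Functor.map_comp, h1, (QB X).map_id]
    have := isIso_QB_map π' hπ
    have e3 : (QB X).map π' ≫ (QB X).map i' = 𝟙 _ := by
      rw [IsIso.eq_inv_of_inv_hom_id e2, IsIso.hom_inv_id]
    rw [Functor.map_comp, Functor.map_comp, Functor.map_comp, Category.assoc, Category.assoc,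
      Category.assoc, h₁, ← e1]
    exact (Iso.mk ((QB X).map π') ((QB X).map i') e3 e2).hom_inv_id_assoc ((Q X).map t)
  refine ⟨C₃, _, _, t, hrep₃, ht, fun n hn ↦ hN0 n (by omega) (by omega) (h0 n hn), fun n ↦ ?_⟩
  obtain rfl | rfl | hn | hn : n = -1 ∨ n = 0 ∨ n < -1 ∨ 0 < n := by omega
  · exact hw
  · have h1 : Epi ((cohomology X 0).map ((Q X).map t)) := by
      let a : (QB X).obj C₃ ⟶ (QB X).obj P := (QB X).map (π' ≫ r ≫ s₁ ≫ s)
      have i1 : IsIso a := isIso_QB_map _ hrep₃.quasiIso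
      rw [← ht]
      change Epi ((cohomology X 0).map (a ≫ At))
      rw [Functor.map_comp]
      exact epi_comp ((cohomology X 0).map a) ((cohomology X 0).map At)
    have h2 := epi_homologyMap_of_cohomology t 0 h1
    have h3 : Epi (t.hom.f (-1)) := hw
    exact epi_f_of_epi_homologyMap t.hom (hL 1 (Or.inr one_pos))
  · exact (hL n (Or.inl hn)).epi _
  · exact (hL n (Or.inr hn)).epi _

lemma conj_eq_of_comp_eq {D : Type*} [Category* D] {A B E F G H : D} {σ : A ⟶ B} [IsIso σ]
    {s : A ⟶ E} {i : E ⟶ F} {θ : F ⟶ G} {s' : G ⟶ H} {B' : D} {σ' : B' ⟶ H} [IsIso σ'] {δ : B ⟶ B'}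
    (h : σ ≫ δ ≫ σ' = s ≫ (i ≫ θ) ≫ s') : (inv σ ≫ s ≫ i) ≫ θ ≫ s' ≫ inv σ' = δ := by
  rw [← cancel_epi σ, ← cancel_mono σ', Category.assoc σ δ, h]
  simp

/-- Existence of self-dual representatives, together with surjective representatives of a
morphism to a complex in degrees `-1` and `0`. -/
theorem exists_selfDual_representative (hX : HasEnoughBundles X) (r : Γ(X, ⊤)) (hr : r + r = 1)
    {𝔼 : DCoh X} (h𝔼 : IsPerfectOfAmplitude 𝔼) (R : BundleResolution 𝔼) (θ : 𝔼 ≅ R.dualTwo)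
    (hθ : R.IsSymmetric θ.hom) (L : CohComplex X)
    (hL : ∀ n, n < -1 ∨ 0 < n → IsZero (L.obj.X n)) (At : 𝔼 ⟶ (Q X).obj L)
    (hAt : Epi ((cohomology X 0).map At)) :
    ∃ (S : SelfDualData X) (α : (QB X).obj S.cx ≅ 𝔼), Intertwines R θ.hom S α ∧
      ∃ u : S.cx.obj ⟶ L.obj, α.hom ≫ At = ofMap u ∧ ∀ n, Epi (u.f n) := by
  let τ : (QB X).obj R.P ⟶ (QB X).obj R.P.dualTwo := R.iso.hom ≫ θ.hom
  have hτ : IsIso τ := inferInstanceAs (IsIso (R.iso.hom ≫ θ.hom))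
  obtain ⟨θ', hθ', hθ''⟩ := hθ
  obtain ⟨C₀, s₀, ψ₀, h₀⟩ := exists_isSymmRep (τ := τ) r hr hθ' hθ''
  obtain ⟨C, s, ψ, t, h, ht, h0, hepi⟩ := exists_good_isSymmRep hX h₀
    (fun n hn ↦ (isZero_cohomology_of_perfect h𝔼 n hn).of_iso ((cohomology X n).mapIso R.iso))
    L hL (R.iso.hom ≫ At) (by rw [Functor.map_comp]; exact epi_comp _ _)
  obtain ⟨S, σ, u, hσ, hσδ, hσu⟩ := exists_selfDual_of_symm C ψ h.symm h.quasiIso_form h0 L hL t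
  have i1 := isIso_QB_map s h.quasiIso
  have i2 := isIso_QB_map σ hσ
  have i3 := isIso_QB_map_dualTwoMap σ hσ
  let α : (QB X).obj S.cx ≅ 𝔼 := (asIso ((QB X).map σ)).symm ≪≫ asIso ((QB X).map s) ≪≫ R.iso
  let α' : (QB X).obj R.P.dualTwo ⟶ (QB X).obj S.cx.dualTwo :=
    (QB X).map (dualTwoMap s) ≫ inv ((QB X).map (dualTwoMap σ))
  refine ⟨S, α, ⟨α', ⟨C, σ, s, hσ, ?_, ?_⟩, ?_⟩, u, ?_, fun n ↦ ?_⟩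
  · simp [α]
  · simp [α']
  · have e1 : (QB X).map σ ≫ (QB X).map S.duality ≫ (QB X).map (dualTwoMap σ) =
        (QB X).map s ≫ τ ≫ (QB X).map (dualTwoMap s) := by
      rw [← h.map_eq, ← hσδ, Functor.map_comp, Functor.map_comp]
    exact conj_eq_of_comp_eq e1
  · have e1 : (QB X).map σ ≫ ofMap u = (Q X).map t := by
      have h1 : (ObjectProperty.ιOfLE boundedBundle_le).map σ ≫
          (ObjectProperty.homMk u : toCoh S.cx ⟶ L) = t := by
        ext : 1
        exact hσu
      exact ((Q X).map_comp _ _).symm.trans (congrArg (Q X).map h1)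
    refine (cancel_epi ((QB X).map σ)).mp ?_
    rw [e1, ← ht]
    simp [α]
  · have := hepi n
    rw [← hσu] at this
    exact @epi_of_epi _ _ _ _ _ (σ.hom.f n) (u.f n) this

end Reduction

/-! ### Coherent sheaves as quotients of vector bundles -/

/-- The trace of an ample line bundle `O(1)` on a scheme: finitely many sections `s_α` whose
nonvanishing loci `W α` form an affine cover, seen through their quotients
`g β α = s_β / s_α`. -/
structure AmpleData (X : Scheme.{u}) where
  /-- The index set of the sections. -/
  I : Type u
  fintype : Fintype I
  /-- The nonvanishing loci of the sections. -/
  W : I → X.Opens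
  isAffineOpen : ∀ α, IsAffineOpen (W α)
  cover : ∀ x : X, ∃ α, x ∈ W α
  /-- The quotients of the sections; the first index is that of the numerator. -/
  g : ∀ _ α : I, Γ(X, W α)
  g_self : ∀ α, g α α = 1
  g_mul : ∀ (γ β α : I) (V : X.Opens) (hα : V ≤ W α) (hβ : V ≤ W β),
    rO hβ (g γ β) * rO hα (g β α) = rO hα (g γ α)
  basicOpen_g : ∀ β α, X.basicOpen (g β α) = W α ⊓ W β

namespace AmpleData
variable {X : Scheme.{u}} (A : AmpleData X) {F : X.Modules}

attribute [local instance] AmpleData.fintype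

/-- A section of `F` over `W γ` becomes a global section after a twist by `O(N)`. -/
lemma exists_twisted_section (hF : IsQC F) (γ : A.I) (m : Γ(F, A.W γ)) :
    ∃ (N : ℕ) (m' : ∀ α, Γ(F, A.W α)), m' γ = m ∧
      ∀ (α β : A.I) (V : X.Opens) (hα : V ≤ A.W α) (hβ : V ≤ A.W β),
        rO hα (A.g β α) ^ N • rs F hβ (m' β) = rs F hα (m' α) := by
  have hD : ∀ α, X.basicOpen (A.g γ α) ≤ A.W γ := fun α ↦
    (A.basicOpen_g γ α).le.trans inf_le_right
  choose n t ht using fun α ↦ hF.exists_extend (A.W α) (A.isAffineOpen α) (A.g γ α)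
    (rs F (hD α) m)
  obtain ⟨n₀, t', ht'⟩ : ∃ (n₀ : ℕ) (t' : ∀ α, Γ(F, A.W α)), ∀ α,
      rs F (X.basicOpen_le (A.g γ α)) (t' α) =
        rO (X.basicOpen_le (A.g γ α)) (A.g γ α) ^ n₀ • rs F (hD α) m := by
    refine ⟨∑ α, n α, fun α ↦ A.g γ α ^ (∑ α, n α - n α) • t α, fun α ↦ ?_⟩
    rw [rs_smul, ht, smul_smul, map_pow, ← pow_add, Nat.sub_add_cancel]
    exact Finset.single_le_sum (f := n) (fun _ _ ↦ Nat.zero_le _) (Finset.mem_univ α)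
  have hle : ∀ β α, X.basicOpen (A.g β α) ≤ A.W β := fun β α ↦
    (A.basicOpen_g β α).le.trans inf_le_right
  -- the failure of `g_γα ^ n₀ • m` to be compatible on `W α ⊓ W β`; it vanishes on `W γ`, so that a
  -- power of `g_γα` kills it
  let δ (β α : A.I) : Γ(F, X.basicOpen (A.g β α)) :=
    rO (X.basicOpen_le (A.g β α)) (A.g β α) ^ n₀ • rs F (hle β α) (t' β) -
      rs F (X.basicOpen_le (A.g β α)) (t' α)
  have hk : ∀ β α, ∃ k : ℕ, rO (X.basicOpen_le (A.g β α)) (A.g γ α) ^ k • δ β α = 0 := by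
    intro β α
    refine hF.exists_pow_smul _ ((A.isAffineOpen α).basicOpen _) _ _ ?_
    set D := X.basicOpen (rO (X.basicOpen_le (A.g β α)) (A.g γ α)) with hDdef
    have h1 : D ≤ X.basicOpen (A.g β α) := X.basicOpen_le _
    have h2 : D ≤ X.basicOpen (A.g γ α) := by
      rw [hDdef]
      exact (Scheme.basicOpen_res X (A.g γ α) _).le.trans inf_le_right
    have h3 : D ≤ X.basicOpen (A.g γ β) := by
      rw [A.basicOpen_g]
      exact le_inf (h1.trans (hle β α)) (h2.trans (hD α))
    have e1 : rs F (h1.trans (hle β α)) (t' β) =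
        rO (h1.trans (hle β α)) (A.g γ β) ^ n₀ • rs F (h3.trans (hD β)) m := by
      have := congrArg (rs F h3) (ht' β)
      rwa [rs_smul, rs_rs, rs_rs, map_pow, rO_rO] at this
    have e2 : rs F (h1.trans (X.basicOpen_le _)) (t' α) =
        rO (h1.trans (X.basicOpen_le _)) (A.g γ α) ^ n₀ • rs F (h3.trans (hD β)) m := by
      have := congrArg (rs F h2) (ht' α)
      rwa [rs_smul, rs_rs, rs_rs, map_pow, rO_rO] at this
    rw [map_sub, rs_smul, rs_rs, rs_rs, map_pow, rO_rO, e1, e2, smul_smul, ← mul_pow, mul_comm,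
      A.g_mul, sub_self]
  choose k hk using hk
  let K := ∑ β, ∑ α, k β α
  have hK : ∀ β α, rO (X.basicOpen_le (A.g β α)) (A.g γ α) ^ K • δ β α = 0 := fun β α ↦ by
    have hle : k β α ≤ K :=
      (Finset.single_le_sum (f := k β) (fun _ _ ↦ Nat.zero_le _) (Finset.mem_univ α)).trans
        (Finset.single_le_sum (f := fun β ↦ ∑ α, k β α) (fun _ _ ↦ Nat.zero_le _)
          (Finset.mem_univ β))
    rw [← Nat.sub_add_cancel hle, pow_add, mul_smul, hk, smul_zero]
  refine ⟨n₀ + K, fun α ↦ A.g γ α ^ K • t' α, ?_, fun α β V hα hβ ↦ ?_⟩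
  · have h1 : A.W γ ≤ X.basicOpen (A.g γ γ) := by rw [A.basicOpen_g, inf_idem]
    have h2 := congrArg (rs F h1) (ht' γ)
    rw [rs_rs, rs_smul, rs_rs, rs_self, rs_self, map_pow, rO_rO, rO_self, A.g_self, one_pow,
      one_smul] at h2
    beta_reduce
    rw [A.g_self, one_pow, one_smul, h2]
  · have hV : V ≤ X.basicOpen (A.g β α) := by
      rw [A.basicOpen_g]
      exact le_inf hα hβ
    have h1 := congrArg (rs F hV) (hK β α)
    rw [rs_smul, map_sub, rs_smul, rs_rs, rs_rs, map_pow, map_pow, rO_rO, rO_rO, map_zero,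
      smul_sub, sub_eq_zero, smul_smul] at h1
    rw [rs_smul, rs_smul, smul_smul, map_pow, map_pow, ← h1, ← A.g_mul γ β α V hα hβ]
    congr 1
    ring

end AmpleData

section PowSheaf
variable (X : Scheme.{u}) (I : Type u)

/-- The presheaf `U ↦ O_X(U)^I`. -/
def powAb : X.Opensᵒᵖ ⥤ Ab.{u} where
  obj U := AddCommGrpCat.of (I → Γ(X, U.unop))
  map i := AddCommGrpCat.ofHom
    { toFun := fun a k ↦ rO (leOfHom i.unop) (a k)
      map_zero' := funext fun _ ↦ map_zero _
      map_add' := fun _ _ ↦ funext fun _ ↦ map_add _ _ _ }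
  map_id U := by
    ext a k
    exact rO_self _ _
  map_comp i j := by
    ext a k
    exact (rO_rO _ _ _).symm

instance (U : X.Opensᵒᵖ) : Module (X.ringCatSheaf.obj.obj U) ((powAb X I).obj U) :=
  inferInstanceAs (Module Γ(X, U.unop) (I → Γ(X, U.unop)))

lemma powAb_isSheaf : TopCat.Presheaf.IsSheaf (X := X.toTopCat) (powAb X I) := by
  refine (TopCat.Presheaf.isSheaf_iff_isSheafUniqueGluing (powAb X I)).mpr ?_
  intro ι U (φ : ∀ i, I → Γ(X, U i)) hφ
  have hc : ∀ k i j (V : X.Opens) (hi : V ≤ U i) (hj : V ≤ U j),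
      rO hi (φ i k) = rO hj (φ j k) := fun k i j V hi hj ↦ by
    have h := congrArg (fun a : I → Γ(X, U i ⊓ U j) ↦ rO (le_inf hi hj) (a k)) (hφ i j)
    refine (rO_rO _ _ _).symm.trans (h.trans (rO_rO _ _ _))
  choose t ht using fun k ↦ exists_glue_functions U (iSup U) (fun i ↦ le_iSup U i) le_rfl
    (fun i ↦ φ i k) (hc k)
  refine ⟨t, fun i ↦ funext fun k ↦ ht k i, fun (s : I → Γ(X, iSup U)) hs ↦ funext fun k ↦ ?_⟩
  refine function_ext_of_local _ _ fun x hx ↦ ?_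
  obtain ⟨i, hi⟩ := Opens.mem_iSup.mp hx
  refine ⟨U i, le_iSup U i, hi, ?_⟩
  rw [ht]
  exact congrArg (fun a : I → Γ(X, U i) ↦ a k) (hs i)

/-- The sheaf `O_X^I`, with sections `O_X(U)^I` over `U`. -/
def powSheaf : X.Modules where
  val := PresheafOfModules.ofPresheaf (powAb X I) (by
    intro U V i (r : Γ(X, U.unop)) (a : I → Γ(X, U.unop))
    exact funext fun k ↦ map_mul (X.presheaf.map i).hom _ _)
  isSheaf := powAb_isSheaf X I

variable {X I}

/-- The coordinate functions of a section of `O_X^I`. -/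
def powCoord {U : X.Opens} (k : I) : Γ(powSheaf X I, U) →ₗ[Γ(X, U)] Γ(X, U) where
  toFun a := (show I → Γ(X, U) from a) k
  map_add' _ _ := rfl
  map_smul' _ _ := rfl

lemma powCoord_rs {U V : X.Opens} (h : V ≤ U) (k : I) (a : Γ(powSheaf X I, U)) :
    powCoord k (rs (powSheaf X I) h a) = rO h (powCoord k a) := rfl

end PowSheaf

namespace AmpleData
variable {X : Scheme.{u}} (A : AmpleData X) (N : ℕ)

/-- The sections of `O(-N)`, as families of functions `a_α` that transform like `s_α^N`. -/
def negTwistSections (U : X.Opens) : Submodule Γ(X, U) Γ(powSheaf X A.I, U) where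
  carrier := {a | ∀ (α β : A.I) (V : X.Opens) (hU : V ≤ U) (hα : V ≤ A.W α),
    rO hU (powCoord β a) = rO hα (A.g β α) ^ N * rO hU (powCoord α a)}
  zero_mem' α β V hU hα := by rw [map_zero, map_zero, map_zero, map_zero, mul_zero]
  add_mem' {a b} ha hb α β V hU hα := by
    rw [map_add, map_add, map_add, map_add, ha α β V hU hα, hb α β V hU hα, mul_add]
  smul_mem' r a ha α β V hU hα := by
    rw [(powCoord β).map_smul, (powCoord α).map_smul, smul_eq_mul, smul_eq_mul, map_mul, map_mul,
      ha α β V hU hα]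
    ring

lemma rs_mem_negTwistSections (U V : X.Opens) (h : V ≤ U) (s : Γ(powSheaf X A.I, U))
    (hs : s ∈ A.negTwistSections N U) : rs (powSheaf X A.I) h s ∈ A.negTwistSections N V := by
  intro α β W hW hα
  rw [powCoord_rs, powCoord_rs, rO_rO, rO_rO]
  exact hs α β W (hW.trans h) hα

lemma mem_negTwistSections_of_local (U : X.Opens) (s : Γ(powSheaf X A.I, U))
    (hs : ∀ x ∈ U, ∃ (V : X.Opens) (h : V ≤ U), x ∈ V ∧
      rs (powSheaf X A.I) h s ∈ A.negTwistSections N V) : s ∈ A.negTwistSections N U := by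
  intro α β W hW hα
  refine function_ext_of_local _ _ fun x hx ↦ ?_
  obtain ⟨V, hV, hxV, h⟩ := hs x (hW hx)
  have h1 := h α β (W ⊓ V) inf_le_right (inf_le_left.trans hα)
  rw [powCoord_rs, powCoord_rs, rO_rO, rO_rO] at h1
  refine ⟨W ⊓ V, inf_le_left, ⟨hx, hxV⟩, ?_⟩
  rw [map_mul, map_pow, rO_rO, rO_rO, rO_rO]
  exact h1

/-- The line bundle `O(-N)`. -/
def negTwist : X.Modules :=
  subsheaf (powSheaf X A.I) (A.negTwistSections N) (A.rs_mem_negTwistSections N)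
    (A.mem_negTwistSections_of_local N)

variable {N}

/-- The trivialization of `O(-N)` over `W α` by `s_α^N`, extended to all opens. -/
def coord {U : X.Opens} (α : A.I) : Γ(A.negTwist N, U) →ₗ[Γ(X, U)] Γ(X, U) :=
  (powCoord α).comp (A.negTwistSections N U).subtype

lemma coord_rs {U V : X.Opens} (h : V ≤ U) (α : A.I) (s : Γ(A.negTwist N, U)) :
    A.coord α (rs (A.negTwist N) h s) = rO h (A.coord α s) := rfl

lemma coord_transform {U V : X.Opens} (s : Γ(A.negTwist N, U)) (α β : A.I) (hU : V ≤ U)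
    (hα : V ≤ A.W α) : rO hU (A.coord β s) = rO hα (A.g β α) ^ N * rO hU (A.coord α s) :=
  Subtype.property (p := fun a ↦ a ∈ A.negTwistSections N U) s α β V hU hα

lemma coord_ext {U : X.Opens} {s t : Γ(A.negTwist N, U)} (h : ∀ α, A.coord α s = A.coord α t) :
    s = t :=
  Subtype.ext (p := fun a ↦ a ∈ A.negTwistSections N U) (funext h)

variable (N) in
/-- The generator of `O(-N)` over `W α`. -/
def generator (α : A.I) : Γ(A.negTwist N, A.W α) :=
  (⟨show A.I → Γ(X, A.W α) from fun β ↦ A.g β α ^ N, fun γ β V hU hγ ↦ by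
    change rO hU (A.g β α ^ N) = rO hγ (A.g β γ) ^ N * rO hU (A.g γ α ^ N)
    rw [map_pow, map_pow, ← mul_pow, A.g_mul]⟩ : A.negTwistSections N (A.W α))

lemma coord_generator (α β : A.I) : A.coord β (A.generator N α) = A.g β α ^ N := rfl

lemma isVectorBundle_negTwist : IsVectorBundle (A.negTwist N) := by
  intro x
  obtain ⟨α, hα⟩ := A.cover x
  refine ⟨A.W α, hα, 1, fun _ ↦ A.generator N α, (isFrame_iff _).mpr fun V hV ↦ ⟨?_, ?_⟩⟩
  · intro a ha
    have h := congrArg (A.coord α) ha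
    rw [Fin.sum_univ_one, map_smul, coord_rs, coord_generator, A.g_self, one_pow, map_one,
      smul_eq_mul, mul_one, map_zero] at h
    funext i
    rw [Subsingleton.elim i 0, h]
    rfl
  · intro s
    refine ⟨fun _ ↦ A.coord α s, ?_⟩
    rw [Fin.sum_univ_one]
    refine A.coord_ext fun β ↦ ?_
    have h := A.coord_transform s α β le_rfl hV
    rw [rO_self, rO_self] at h
    rw [map_smul, coord_rs, coord_generator, h, map_pow, smul_eq_mul, mul_comm]

/-- A twisted global section, given by compatible local sections, is a morphism from `O(-N)`. -/
lemma exists_hom_of_twisted_section (m : ∀ α, Γ(F, A.W α))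
    (hm : ∀ (α β : A.I) (V : X.Opens) (hα : V ≤ A.W α) (hβ : V ≤ A.W β),
      rO hα (A.g β α) ^ N • rs F hβ (m β) = rs F hα (m α)) :
    ∃ φ : A.negTwist N ⟶ F, ∀ α, φ.app (A.W α) (A.generator N α) = m α := by
  have hcov : ∀ U : X.Opens, U ≤ ⨆ α, U ⊓ A.W α := fun U x hx ↦ by
    obtain ⟨α, hα⟩ := A.cover x
    exact Opens.mem_iSup.mpr ⟨α, hx, hα⟩
  have hglue : ∀ (U : X.Opens) (s : Γ(A.negTwist N, U)), ∃ t : Γ(F, U), ∀ α,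
      rs F (inf_le_left : U ⊓ A.W α ≤ U) t =
        rO (inf_le_left : U ⊓ A.W α ≤ U) (A.coord α s) • rs F inf_le_right (m α) := by
    intro U s
    refine exists_glue_sections F (fun α ↦ U ⊓ A.W α) U (fun _ ↦ inf_le_left) (hcov U) _ ?_
    intro α β V hα hβ
    rw [rs_smul, rs_smul, rO_rO, rO_rO, rs_rs, rs_rs, ← hm α β V (hα.trans inf_le_right)
      (hβ.trans inf_le_right), A.coord_transform s α β (hβ.trans inf_le_left)
      (hα.trans inf_le_right), smul_smul, mul_comm]
  have huniq : ∀ (U : X.Opens) (t t' : Γ(F, U)), (∀ α,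
      rs F (inf_le_left : U ⊓ A.W α ≤ U) t = rs F inf_le_left t') → t = t' := by
    intro U t t' h
    refine section_ext_of_local _ _ fun x hx ↦ ?_
    obtain ⟨α, hα⟩ := A.cover x
    exact ⟨_, inf_le_left, ⟨hx, hα⟩, h α⟩
  choose T hT using hglue
  refine ⟨homOfSections (fun U ↦
    { toFun := T U
      map_add' := fun s t ↦ huniq _ _ _ fun α ↦ by
        rw [map_add, hT, hT, hT, map_add, map_add, add_smul]
      map_smul' := fun r s ↦ huniq _ _ _ fun α ↦ by
        rw [RingHom.id_apply, rs_smul, hT, hT, map_smul, smul_eq_mul, map_mul, mul_smul] }) ?_, ?_⟩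
  · intro U V h s
    refine huniq _ _ _ fun α ↦ ?_
    have h1 := congrArg (rs F (inf_le_inf_right (A.W α) h)) (hT U s α)
    rw [rs_rs, rs_smul, rO_rO, rs_rs] at h1
    change rs F _ (T V _) = rs F _ (rs F _ (T U s))
    rw [hT, coord_rs, rO_rO, rs_rs, h1]
  · intro α
    refine huniq _ _ _ fun β ↦ ?_
    change rs F _ (T _ _) = _
    rw [hT, coord_generator, map_pow, hm]

lemma exists_bundle_of_finite [IsLocallyNoetherian X] {κ : Type*} [Finite κ] (P : κ → X.Modules)
    (hP : ∀ k, IsVectorBundle (P k)) (φ : ∀ k, P k ⟶ F) :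
    ∃ (B : X.Modules) (ψ : B ⟶ F), IsVectorBundle B ∧ ∀ k, ∃ i : P k ⟶ B, i ≫ ψ = φ k := by
  induction κ using Finite.induction_empty_option with
  | of_equiv e h =>
    obtain ⟨B, ψ, hB, h⟩ := h (fun k ↦ P (e k)) (fun k ↦ hP _) (fun k ↦ φ (e k))
    refine ⟨B, ψ, hB, fun k ↦ ?_⟩
    obtain ⟨k, rfl⟩ := e.surjective k
    exact h k
  | h_empty => exact ⟨_, 0, SelfDualData.isVectorBundle_zero (isZero_zero _), fun k ↦ k.elim⟩
  | h_option h =>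
    obtain ⟨B, ψ, hB, h⟩ := h (fun k ↦ P (some k)) (fun k ↦ hP _) (fun k ↦ φ (some k))
    refine ⟨B ⊞ P none, biprod.desc ψ (φ none), hB.biprod (hP none), fun k ↦ ?_⟩
    cases k with
    | none => exact ⟨biprod.inr, biprod.inr_desc _ _⟩
    | some k =>
      obtain ⟨i, hi⟩ := h k
      exact ⟨i ≫ biprod.inl, by rw [Category.assoc, biprod.inl_desc, hi]⟩

include A in
/-- A scheme with an ample line bundle has the resolution property. -/
theorem hasEnoughBundles [IsLocallyNoetherian X] : HasEnoughBundles X := by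
  intro F hF
  choose n e he using fun α ↦
    haveI := hF.finite (A.isAffineOpen α)
    Module.Finite.exists_fin (R := Γ(X, A.W α)) (M := Γ(F, A.W α))
  have := A.fintype
  choose N m hm hm' using fun k : Σ α, Fin (n α) ↦
    A.exists_twisted_section hF.isQC k.1 (e k.1 k.2)
  choose φ hφ using fun k ↦ A.exists_hom_of_twisted_section (m k) (hm' k)
  obtain ⟨B, ψ, hB, h⟩ := exists_bundle_of_finite (fun k ↦ A.negTwist (N k))
    (fun k ↦ A.isVectorBundle_negTwist) φ
  refine ⟨B, ψ, hB, LocSurj.epi fun U s x hx ↦ ?_⟩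
  -- the bundle contains enough copies of `O(-N)` to hit generators of `F` over each `W α`
  have himage : ∀ (α : A.I) (t : Γ(F, A.W α)), ∃ b : Γ(B, A.W α), ψ.app (A.W α) b = t := by
    intro α t
    have h1 : LinearMap.range (appLin ψ (A.W α)) = ⊤ := by
      rw [eq_top_iff, ← he α, Submodule.span_le]
      rintro _ ⟨k, rfl⟩
      obtain ⟨i, hi⟩ := h ⟨α, k⟩
      refine ⟨i.app _ (A.generator (N ⟨α, k⟩) α), ?_⟩
      change ψ.app _ (i.app _ _) = _
      rw [← comp_app_apply, hi, hφ, hm]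
    obtain ⟨b, hb⟩ := h1.ge (Submodule.mem_top (x := t))
    exact ⟨b, hb⟩
  obtain ⟨α, hα⟩ := A.cover x
  obtain ⟨f, hfU, hxf⟩ := exists_basicOpen_le (A.isAffineOpen α) hα hx
  obtain ⟨k, t, ht⟩ := hF.isQC.exists_extend _ (A.isAffineOpen α) f (rs F hfU s)
  obtain ⟨b, rfl⟩ := himage α t
  obtain ⟨v, hv⟩ := ((isUnit_rO_basicOpen f le_rfl).pow k).exists_left_inv
  refine ⟨X.basicOpen f, hfU, hxf, v • rs B (X.basicOpen_le f) b, ?_⟩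
  rw [app_smul, app_rs, ht, smul_smul, hv, one_smul]

end AmpleData

/-! ### Ample line bundles on quasi-projective schemes -/

section ProjFunctions
variable {A : Type u} [CommRing A] {σ : Type*} [SetLike σ A] [AddSubgroupClass σ A] {𝒜 : ℕ → σ}
  [GradedRing 𝒜]

/-- The value of a function on an open subset of `Proj 𝒜` in the local ring at a point. -/
def projValue {U : (Proj 𝒜).Opens} (x : ProjectiveSpectrum 𝒜) (hx : (show Proj 𝒜 from x) ∈ U) :
    Γ(Proj 𝒜, U) →+* HomogeneousLocalization.AtPrime 𝒜 x.asHomogeneousIdeal.toIdeal where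
  toFun s := s.1 ⟨x, hx⟩
  map_one' := rfl
  map_mul' _ _ := rfl
  map_zero' := rfl
  map_add' _ _ := rfl

lemma projValue_rO {U V : (Proj 𝒜).Opens} (h : V ≤ U) (x : ProjectiveSpectrum 𝒜)
    (hx : (show Proj 𝒜 from x) ∈ V) (s : Γ(Proj 𝒜, U)) :
    projValue x hx (rO h s) = projValue x (h hx) s := rfl

lemma proj_function_ext {U : (Proj 𝒜).Opens} {s t : Γ(Proj 𝒜, U)}
    (h : ∀ x : ProjectiveSpectrum 𝒜, ∀ hx, projValue x hx s = projValue x hx t) : s = t :=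
  Subtype.ext (funext fun x ↦ h x.1 x.2)

lemma mem_basicOpen_iff_isUnit_projValue {U : (Proj 𝒜).Opens} (x : ProjectiveSpectrum 𝒜)
    (hx : (show Proj 𝒜 from x) ∈ U) (s : Γ(Proj 𝒜, U)) :
    (show Proj 𝒜 from x) ∈ (Proj 𝒜).basicOpen s ↔ IsUnit (projValue x hx s) := by
  rw [Scheme.mem_basicOpen _ _ _ hx]
  have : projValue x hx s = Proj.stalkIso' 𝒜 x
      ((ProjectiveSpectrum.Proj.structureSheaf 𝒜).presheaf.germ _ x hx s) :=
    (Proj.stalkIso'_germ 𝒜 U x hx s).symm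
  rw [this]
  exact (MulEquiv.isUnit_map (Proj.stalkIso' 𝒜 x)).symm

/-- The function `t / s` on `D_+(s)`, for homogeneous elements `s` and `t` of the same degree. -/
def projQuotient {d : ℕ} {s t : A} (hs : s ∈ 𝒜 d) (ht : t ∈ 𝒜 d) : Γ(Proj 𝒜, Proj.basicOpen 𝒜 s) :=
  Proj.awayToSection 𝒜 s (HomogeneousLocalization.mk ⟨d, ⟨t, ht⟩, ⟨s, hs⟩, Submonoid.mem_powers s⟩)

variable {d : ℕ} {s t r : A} (hs : s ∈ 𝒜 d) (ht : t ∈ 𝒜 d) (hr : r ∈ 𝒜 d)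

lemma projValue_projQuotient (x : ProjectiveSpectrum 𝒜)
    (hx : (show Proj 𝒜 from x) ∈ Proj.basicOpen 𝒜 s) :
    (projValue x hx (projQuotient hs ht)).val =
      Localization.mk t (⟨s, hx⟩ : x.asHomogeneousIdeal.toIdeal.primeCompl) := rfl

lemma projQuotient_self : projQuotient hs hs = 1 := by
  refine proj_function_ext fun x hx ↦ HomogeneousLocalization.val_injective _ ?_
  rw [map_one, HomogeneousLocalization.val_one, projValue_projQuotient]
  exact Localization.mk_self (⟨s, hx⟩ : x.asHomogeneousIdeal.toIdeal.primeCompl)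

lemma projQuotient_mul (V : (Proj 𝒜).Opens) (hVs : V ≤ Proj.basicOpen 𝒜 s)
    (hVt : V ≤ Proj.basicOpen 𝒜 t) :
    rO hVt (projQuotient ht hr) * rO hVs (projQuotient hs ht) = rO hVs (projQuotient hs hr) := by
  refine proj_function_ext fun x hx ↦ HomogeneousLocalization.val_injective _ ?_
  rw [map_mul, HomogeneousLocalization.val_mul, projValue_rO, projValue_rO, projValue_rO,
    projValue_projQuotient, projValue_projQuotient, projValue_projQuotient, Localization.mk_mul,
    Localization.mk_eq_mk_iff, Localization.r_iff_exists]
  refine ⟨1, ?_⟩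
  change 1 * (s * (r * t)) = 1 * (t * s * r)
  ring

lemma basicOpen_projQuotient :
    (Proj 𝒜).basicOpen (projQuotient hs ht) = Proj.basicOpen 𝒜 s ⊓ Proj.basicOpen 𝒜 t := by
  have key : ∀ x : ProjectiveSpectrum 𝒜, ∀ hx : (show Proj 𝒜 from x) ∈ Proj.basicOpen 𝒜 s,
      (show Proj 𝒜 from x) ∈ (Proj 𝒜).basicOpen (projQuotient hs ht) ↔
        (show Proj 𝒜 from x) ∈ Proj.basicOpen 𝒜 t := by
    intro x hx
    rw [mem_basicOpen_iff_isUnit_projValue x hx, ← HomogeneousLocalization.isUnit_iff_isUnit_val,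
      projValue_projQuotient, Localization.mk_eq_mk']
    exact IsLocalization.AtPrime.isUnit_mk'_iff _ x.asHomogeneousIdeal.toIdeal t ⟨s, hx⟩
  ext x
  exact ⟨fun h ↦ ⟨(Proj 𝒜).basicOpen_le _ h, (key x ((Proj 𝒜).basicOpen_le _ h)).mp h⟩,
    fun h ↦ (key x h.1).mpr h.2⟩

/-- The sets `D_+(s)`, with `s` homogeneous of positive degree, form a basis of the topology. -/
lemma exists_homogeneous_basicOpen_le (O : (Proj 𝒜).Opens) (x : Proj 𝒜) (hx : x ∈ O) :
    ∃ (d : ℕ) (s : A), 0 < d ∧ s ∈ 𝒜 d ∧ x ∈ Proj.basicOpen 𝒜 s ∧ Proj.basicOpen 𝒜 s ≤ O := by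
  obtain ⟨_, ⟨r, rfl⟩, hxr, hrO⟩ :=
    (Opens.isBasis_iff_nbhd.mp (Proj.isBasis_basicOpen 𝒜)) hx
  have key : ∀ r : A, x ∈ Proj.basicOpen 𝒜 r →
      ∃ i : ℕ, x ∈ Proj.basicOpen 𝒜 (GradedRing.proj 𝒜 i r) := by
    intro r hr
    rw [Proj.basicOpen_eq_iSup_proj] at hr
    exact Opens.mem_iSup.mp hr
  obtain ⟨a, ha, hxa⟩ := SetLike.not_le_iff_exists.mp (ProjectiveSpectrum.not_irrelevant_le x)
  obtain ⟨i, hi⟩ := key r hxr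
  obtain ⟨k, hk⟩ := key a hxa
  refine ⟨i + k, GradedRing.proj 𝒜 i r * GradedRing.proj 𝒜 k a, ?_,
    SetLike.mul_mem_graded (SetLike.coe_mem _) (SetLike.coe_mem _), ?_, ?_⟩
  · have : k ≠ 0 := by
      rintro rfl
      rw [(HomogeneousIdeal.mem_irrelevant_iff 𝒜 a).mp ha, Proj.basicOpen_zero] at hk
      exact hk
    omega
  · rw [Proj.basicOpen_mul]
    exact ⟨hi, hk⟩
  · rw [Proj.basicOpen_mul]
    rw [Proj.basicOpen_eq_iSup_proj] at hrO
    exact inf_le_left.trans ((le_iSup (fun i ↦ Proj.basicOpen 𝒜 (GradedRing.proj 𝒜 i r)) i).trans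
      hrO)
end ProjFunctions

lemma rO_app_rO {X Y : Scheme.{u}} (f : X ⟶ Y) {U V : Y.Opens} (h : V ≤ U) {W : X.Opens}
    (hU : W ≤ f ⁻¹ᵁ U) (hV : W ≤ f ⁻¹ᵁ V) (s : Γ(Y, U)) :
    rO hV (f.app V (rO h s)) = rO hU (f.app U s) := by
  have : f.app V (rO h s) = rO (f.preimage_mono h) (f.app U s) :=
    CategoryTheory.congr_fun (f.naturality (homOfLE h).op) s
  rw [this, rO_rO]

lemma isAffineOpen_preimage_of_isImmersion {X Y : Scheme.{u}} (f : X ⟶ Y) [IsImmersion f]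
    (V : Y.Opens) (hV : IsAffineOpen V) (hVO : V ≤ f.coborderRange) : IsAffineOpen (f ⁻¹ᵁ V) := by
  have h := f.liftCoborder_preimage (f.coborderRange.ι ⁻¹ᵁ V)
  rw [Scheme.Hom.image_preimage_eq_opensRange_inf, Scheme.Opens.opensRange_ι,
    inf_eq_right.mpr hVO] at h
  rw [← h]
  exact (hV.preimage_of_isOpenImmersion _ (by simpa using hVO)).preimage _

/-- A quasi-compact locally closed subscheme of `Proj 𝒜` carries an ample line bundle. -/
lemma nonempty_ampleData {X : Scheme.{u}} [CompactSpace X] {A : Type u} [CommRing A] {σ : Type*}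
    [SetLike σ A] [AddSubgroupClass σ A] {𝒜 : ℕ → σ} [GradedRing 𝒜] (j : X ⟶ Proj 𝒜)
    [IsImmersion j] : Nonempty (AmpleData X) := by
  have hj : ∀ x : X, j x ∈ j.coborderRange := fun x ↦ subset_coborder ⟨x, rfl⟩
  choose d s hd hs hxs hsO using fun x : X ↦
    exists_homogeneous_basicOpen_le j.coborderRange (j x) (hj x)
  obtain ⟨t, ht⟩ := isCompact_univ.elim_finite_subcover
    (fun x : X ↦ ((j ⁻¹ᵁ Proj.basicOpen 𝒜 (s x) : X.Opens) : Set X))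
    (fun x ↦ (j ⁻¹ᵁ Proj.basicOpen 𝒜 (s x)).isOpen)
    (fun x _ ↦ Set.mem_iUnion.mpr ⟨x, hxs x⟩)
  classical
  -- powers of the finitely many sections have the common degree `D`
  obtain ⟨D, e, he, heD⟩ : ∃ (D : ℕ) (e : t → ℕ), (∀ x, 0 < e x) ∧ ∀ x, e x * d x = D := by
    refine ⟨∏ x : t, d x, fun x ↦ ∏ y ∈ Finset.univ.erase x, d y,
      fun x ↦ Finset.prod_pos fun y _ ↦ hd y, fun x ↦ ?_⟩
    exact Finset.prod_erase_mul _ (fun y : t ↦ d y) (Finset.mem_univ x)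
  have hS : ∀ x : t, s x ^ e x ∈ 𝒜 D := fun x ↦ by
    have := SetLike.pow_mem_graded (A := 𝒜) (e x) (hs x)
    rwa [smul_eq_mul, heD] at this
  have hB : ∀ x : t, Proj.basicOpen 𝒜 (s x ^ e x) = Proj.basicOpen 𝒜 (s x) := fun x ↦
    Proj.basicOpen_pow 𝒜 _ _ (he x)
  exact ⟨{
    I := t
    fintype := inferInstance
    W := fun x ↦ j ⁻¹ᵁ Proj.basicOpen 𝒜 (s x ^ e x)
    isAffineOpen := fun x ↦ by
      rw [hB]
      exact isAffineOpen_preimage_of_isImmersion j _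
        (Proj.isAffineOpen_basicOpen 𝒜 _ (hs x) (hd x)) (hsO x)
    cover := fun x ↦ by
      obtain ⟨y, hy, hxy⟩ := Set.mem_iUnion₂.mp (ht (Set.mem_univ x))
      refine ⟨⟨y, hy⟩, ?_⟩
      rw [hB]
      exact hxy
    g := fun y x ↦ j.app _ (projQuotient (hS x) (hS y))
    g_self := fun x ↦ by rw [projQuotient_self, map_one]
    g_mul := fun z y x V hx hy ↦ by
      have h : V ≤ j ⁻¹ᵁ (Proj.basicOpen 𝒜 (s x ^ e x) ⊓ Proj.basicOpen 𝒜 (s y ^ e y)) :=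
        le_inf hx hy
      rw [← rO_app_rO j inf_le_right hy h, ← rO_app_rO j inf_le_left hx h,
        ← rO_app_rO j inf_le_left hx h, ← map_mul, ← map_mul, projQuotient_mul]
    basicOpen_g := fun y x ↦ by
      rw [← Scheme.preimage_basicOpen, basicOpen_projQuotient]
      rfl }⟩

section
variable (n : ℕ)
attribute [local instance] MvPolynomial.gradedAlgebra

lemma finiteType_homogeneousSubmodule_zero :
    Algebra.FiniteType (MvPolynomial.homogeneousSubmodule (Fin (n + 1)) ℂ 0)
    (MvPolynomial (Fin (n + 1)) ℂ) := by
  have : IsScalarTower ℂ (MvPolynomial.homogeneousSubmodule (Fin (n + 1)) ℂ 0)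
    (MvPolynomial (Fin (n + 1)) ℂ) := ⟨fun a b c ↦ smul_assoc a b.1 c⟩
  exact Algebra.FiniteType.of_restrictScalars_finiteType ℂ _ _

lemma isNoetherianRing_homogeneousSubmodule_zero :
    IsNoetherianRing (MvPolynomial.homogeneousSubmodule (Fin (n + 1)) ℂ 0) := by
  refine isNoetherianRing_of_surjective ℂ _ (algebraMap ℂ _) ?_
  rintro ⟨p, hp⟩
  have := MvPolynomial.totalDegree_eq_zero_iff_eq_C.mp
    (Nat.le_zero.mp (MvPolynomial.IsHomogeneous.totalDegree_le hp))
  exact ⟨_, Subtype.ext this.symm⟩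

lemma isNoetherian_proj :
    IsNoetherian (Proj (MvPolynomial.homogeneousSubmodule (Fin (n + 1)) ℂ)) := by
  have := finiteType_homogeneousSubmodule_zero n
  have := isNoetherianRing_homogeneousSubmodule_zero n
  have h1 := LocallyOfFiniteType.isLocallyNoetherian
    (Proj.toSpecZero (MvPolynomial.homogeneousSubmodule (Fin (n + 1)) ℂ))
  have h2 : CompactSpace (Proj (MvPolynomial.homogeneousSubmodule (Fin (n + 1)) ℂ)) :=
    QuasiCompact.compactSpace_of_compactSpace
      (Proj.toSpecZero (MvPolynomial.homogeneousSubmodule (Fin (n + 1)) ℂ))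
  exact { }
end

attribute [local instance] MvPolynomial.gradedAlgebra in
lemma IsQuasiProjective.isLocallyNoetherian {M : Scheme.{0}} {f : M ⟶ Spec (.of ℂ)}
    (hf : IsQuasiProjective f) : IsLocallyNoetherian M := by
  obtain ⟨n, j, hj, -⟩ := hf
  have := isNoetherian_proj n
  exact LocallyOfFiniteType.isLocallyNoetherian j

attribute [local instance] MvPolynomial.gradedAlgebra in
/-- A quasi-projective scheme carries an ample line bundle. -/
lemma IsQuasiProjective.nonempty_ampleData {M : Scheme.{0}} {f : M ⟶ Spec (.of ℂ)}
    (hf : IsQuasiProjective f) : Nonempty (AmpleData M) := by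
  obtain ⟨n, j, hj, -⟩ := hf
  have := isNoetherian_proj n
  have := j.isEmbedding.isInducing.noetherianSpace
  exact DT4.nonempty_ampleData j

/-- `2` is invertible on a complex scheme. -/
lemma exists_add_self_eq_one {M : Scheme.{0}} (f : M ⟶ Spec (.of ℂ)) :
    ∃ r : Γ(M, ⊤), r + r = 1 := by
  let φ : ℂ →+* Γ(M, ⊤) := ((Scheme.ΓSpecIso (.of ℂ)).inv ≫ f.appTop).hom
  refine ⟨φ (1 / 2), ?_⟩
  rw [← map_add, add_halves, map_one]

/-! ### Coherence of pullbacks -/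

section Pullback
variable {X Y : Scheme.{u}}

/-- Pullbacks commute with the restriction to open subschemes. -/
def pullbackRestrictIso (f : X ⟶ Y) (F : Y.Modules) (U : Y.Opens) :
    (Scheme.Modules.pullback (f ∣_ U)).obj (F.restrict U.ι) ≅
      ((Scheme.Modules.pullback f).obj F).restrict (f ⁻¹ᵁ U).ι :=
  (Scheme.Modules.pullback (f ∣_ U)).mapIso
      ((Scheme.Modules.restrictFunctorIsoPullback U.ι).app F) ≪≫
    (Scheme.Modules.pullbackComp (f ∣_ U) U.ι).app F ≪≫
    (Scheme.Modules.pullbackCongr (morphismRestrict_ι f U)).app F ≪≫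
    ((Scheme.Modules.pullbackComp (f ⁻¹ᵁ U).ι f).app F).symm ≪≫
    ((Scheme.Modules.restrictFunctorIsoPullback (f ⁻¹ᵁ U).ι).app _).symm

/-- The finality of the preimage functor; it ensures that pullbacks preserve structure sheaves. -/
instance final_opensMap (f : X ⟶ Y) : (Opens.map f.base).Final where
  out U := by
    let T : StructuredArrow U (Opens.map f.base) :=
      StructuredArrow.mk (Y := (⊤ : Y.Opens)) (homOfLE fun _ _ ↦ trivial)
    have hT : IsTerminal T := IsTerminal.ofUniqueHom
      (fun Z ↦ StructuredArrow.homMk (homOfLE le_top) (Subsingleton.elim _ _))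
      (fun Z m ↦ StructuredArrow.ext _ _ (Subsingleton.elim _ _))
    exact isConnected_of_isTerminal _ hT

/-- The pullback of the structure sheaf is the structure sheaf. -/
lemma nonempty_pullback_unit_iso (f : X ⟶ Y) :
    Nonempty ((show X.Modules from SheafOfModules.unit X.ringCatSheaf) ≅
      (Scheme.Modules.pullback f).obj (SheafOfModules.unit Y.ringCatSheaf)) := by
  have h1 : (SheafOfModules.pushforward.{u} f.toRingCatSheafHom).IsRightAdjoint :=
    inferInstanceAs (Scheme.Modules.pushforward f).IsRightAdjoint
  have h2 : IsIso (SheafOfModules.pullbackObjUnitToUnit f.toRingCatSheafHom) :=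
    @SheafOfModules.instIsIsoPullbackObjUnitToUnitOfFinal _ _ _ _ _ _ _ _ _ _
      f.toRingCatSheafHom h1 (final_opensMap f)
  exact ⟨(asIso (SheafOfModules.pullbackObjUnitToUnit f.toRingCatSheafHom)).symm⟩

lemma exists_presentation_pullback (f : X ⟶ Y) (F : Y.Modules)
    (p : SheafOfModules.Presentation (R := Y.ringCatSheaf) F) (hp : p.IsFinite) :
    ∃ q : SheafOfModules.Presentation (R := X.ringCatSheaf) ((Scheme.Modules.pullback f).obj F),
      q.IsFinite := by
  let E : SheafOfModules.{u} Y.ringCatSheaf ⥤ SheafOfModules.{u} X.ringCatSheaf :=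
    Scheme.Modules.pullback f
  have : PreservesColimitsOfSize.{u, u} E :=
    (Scheme.Modules.pullbackPushforwardAdjunction f).leftAdjoint_preservesColimits
  obtain ⟨η⟩ := nonempty_pullback_unit_iso f
  exact ⟨SheafOfModules.Presentation.map.{u, u, u} p E η, SheafOfModules.Presentation.IsFinite.mk
    (isFiniteType_generators := ⟨hp.isFiniteType_generators.finite⟩)
    (isFiniteType_relations := ⟨hp.isFiniteType_relations.finite⟩)⟩

lemma IsCoherent.pullback {F : Y.Modules} (hF : IsCoherent F) (f : X ⟶ Y) :
    IsCoherent ((Scheme.Modules.pullback f).obj F) := by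
  refine isCoherent_of_presentations _ fun x ↦ ?_
  obtain ⟨U, hx, p, hp⟩ := hF.exists_presentation (f x)
  obtain ⟨q, hq⟩ := exists_presentation_pullback (f ∣_ U) _ p hp
  have hiso : @IsIso (SheafOfModules.{u} (f ⁻¹ᵁ U).toScheme.ringCatSheaf) _ _ _
    (pullbackRestrictIso f F U).hom := (pullbackRestrictIso f F U).isIso_hom
  exact ⟨f ⁻¹ᵁ U, hx, @SheafOfModules.Presentation.ofIsIso.{u, u, u} _ _ _ _ _ _ _ _
    (pullbackRestrictIso f F U).hom hiso q, SheafOfModules.Presentation.IsFinite.mk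
    (isFiniteType_generators := ⟨hq.isFiniteType_generators.finite⟩)
    (isFiniteType_relations := ⟨hq.isFiniteType_relations.finite⟩)⟩

end Pullback

/-! ### Coherence of ideal sheaves -/

section Ideal
variable {X Y : Scheme.{u}}

lemma IsQC.pushforward {F : X.Modules} (hF : IsQC F) (f : X ⟶ Y) [IsAffineHom f] :
    IsQC ((Scheme.Modules.pushforward f).obj F) := by
  have hb : ∀ (U : Y.Opens) (r : Γ(Y, U)), f ⁻¹ᵁ Y.basicOpen r = X.basicOpen (f.app U r) :=
    fun U r ↦ Scheme.preimage_basicOpen f r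
  constructor
  · intro U hU r s
    have key : ∀ s : Γ(F, f ⁻¹ᵁ Y.basicOpen r), ∃ (n : ℕ) (t : Γ(F, f ⁻¹ᵁ U)),
        rs F (f.preimage_mono (Y.basicOpen_le r)) t =
          f.app _ (rO (Y.basicOpen_le r) r ^ n) • s := by
      intro s
      obtain ⟨n, t, ht⟩ := hF.exists_extend (f ⁻¹ᵁ U) (hU.preimage f) (f.app U r)
        (rs F (hb U r).ge s)
      refine ⟨n, t, ?_⟩
      have h1 := congrArg (rs F (hb U r).le) ht
      rw [rs_rs, rs_smul, rs_rs, rs_self, map_pow, rO_rO] at h1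
      have h2 := rO_app_rO f (Y.basicOpen_le r) (f.preimage_mono (Y.basicOpen_le r)) le_rfl r
      rw [rO_self] at h2
      rw [h1, map_pow, h2]
    exact key s
  · intro U hU r t ht
    have key : ∀ t : Γ(F, f ⁻¹ᵁ U), rs F (f.preimage_mono (Y.basicOpen_le r)) t = 0 →
        ∃ n : ℕ, f.app U (r ^ n) • t = 0 := by
      intro t ht
      obtain ⟨n, hn⟩ := hF.exists_pow_smul (f ⁻¹ᵁ U) (hU.preimage f) (f.app U r) t (by
        have h1 := congrArg (rs F (hb U r).ge) ht
        rwa [rs_rs, map_zero] at h1)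
      exact ⟨n, by rw [map_pow, hn]⟩
    exact key t ht

end Ideal

lemma isQC_structureSheaf (A : Scheme.{0}) : IsQC (structureSheaf A) := by
  constructor
  · intro U hU f s
    obtain ⟨n, t, ht⟩ := exists_extend_functions hU f (fun _ : Unit ↦ s)
    exact ⟨n, t (), ht ()⟩
  · intro U hU f t ht
    have := hU.isLocalization_basicOpen f
    obtain ⟨⟨_, n, rfl⟩, hn⟩ := (IsLocalization.map_eq_zero_iff (Submonoid.powers f)
      Γ(A, A.basicOpen f) (show Γ(A, U) from t)).mp ht
    exact ⟨n, hn⟩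

lemma isCoherent_idealSheaf {M A : Scheme.{0}} [IsLocallyNoetherian A] (i : M ⟶ A) [IsAffineHom i] :
    IsCoherent (idealSheaf i) := by
  refine ((isQC_structureSheaf A).kernel ((isQC_structureSheaf M).pushforward i)
    (sharp i)).isCoherent
    fun U hU ↦ ?_
  have hR : IsNoetherianRing Γ(A, U) := IsLocallyNoetherian.component_noetherian ⟨U, hU⟩
  have : Module.Finite Γ(A, U) Γ(structureSheaf A, U) := Module.Finite.self Γ(A, U)
  exact Module.Finite.of_injective (appLin (kernel.ι (sharp i)) U) (app_injective _ U)

/-! ### Coherence of sheafifications -/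

section Sheafification
variable {X : Scheme.{u}}

/-- A presheaf `P` of modules whose sections over affine open subsets are finite modules compatible
with localization has a coherent associated sheaf `F`. The latter is encoded by a locally bijective
family of linear maps `η` from `P` to `F`. -/
lemma isCoherent_of_locally_bijective [IsLocallyNoetherian X] {F : X.Modules}
    (P : X.Opens → Type u) [∀ U, AddCommGroup (P U)] [∀ U, Module Γ(X, U) (P U)]
    (res : ∀ {U V : X.Opens}, V ≤ U → P U →+ P V)
    (res_smul : ∀ {U V : X.Opens} (h : V ≤ U) (r : Γ(X, U)) (s : P U),
      res h (r • s) = rO h r • res h s)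
    (res_res : ∀ {U V W : X.Opens} (h : V ≤ U) (h' : W ≤ V) (s : P U),
      res h' (res h s) = res (h'.trans h) s)
    (η : ∀ U, P U →ₗ[Γ(X, U)] Γ(F, U))
    (η_res : ∀ {U V : X.Opens} (h : V ≤ U) (s : P U), η V (res h s) = rs F h (η U s))
    (hsurj : ∀ (U : X.Opens) (s : Γ(F, U)), ∀ x ∈ U, ∃ (V : X.Opens) (h : V ≤ U), x ∈ V ∧
      ∃ t : P V, η V t = rs F h s)
    (hinj : ∀ (U : X.Opens) (t : P U), η U t = 0 → ∀ x ∈ U, ∃ (V : X.Opens) (h : V ≤ U), x ∈ V ∧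
      res h t = 0)
    (hfin : ∀ U : X.Opens, IsAffineOpen U → Module.Finite Γ(X, U) (P U))
    (hext : ∀ (U : X.Opens), IsAffineOpen U → ∀ (f : Γ(X, U)) (s : P (X.basicOpen f)),
      ∃ (n : ℕ) (t : P U), res (X.basicOpen_le f) t = rO (X.basicOpen_le f) f ^ n • s)
    (hpow : ∀ (U : X.Opens), IsAffineOpen U → ∀ (f : Γ(X, U)) (t : P U),
      res (X.basicOpen_le f) t = 0 → ∃ n : ℕ, f ^ n • t = 0) : IsCoherent F := by
  refine isCoherent_of_isConcretePresentation F fun x ↦ ?_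
  obtain ⟨U, hU, hxU, -⟩ := exists_affine_le (show x ∈ (⊤ : X.Opens) from trivial)
  have hR : IsNoetherianRing Γ(X, U) := IsLocallyNoetherian.component_noetherian ⟨U, hU⟩
  have hfinU := hfin U hU
  obtain ⟨n, e, he⟩ := Module.Finite.exists_fin (R := Γ(X, U)) (M := P U)
  let p : (Fin n → Γ(X, U)) →ₗ[Γ(X, U)] P U := Fintype.linearCombination Γ(X, U) e
  obtain ⟨m, r, hr⟩ := Submodule.fg_iff_exists_fin_generating_family.mp
    (IsNoetherian.noetherian (LinearMap.ker p))
  refine ⟨U, hxU, m, n, fun i ↦ η U (e i), r, ⟨?_, ?_, ?_⟩⟩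
  · intro V s hVU x hx
    obtain ⟨V', hV', hxV', t', ht'⟩ := hsurj V s x hx
    obtain ⟨f, hfV, hxf⟩ := exists_basicOpen_le hU (hVU hx) hxV'
    refine ⟨X.basicOpen f, hfV.trans hV', hxf, ?_⟩
    obtain ⟨k, t, ht⟩ := hext U hU f (res hfV t')
    have h1 : η U t ∈ Submodule.span Γ(X, U) (Set.range fun i ↦ rs F le_rfl (η U (e i))) := by
      simp only [rs_self]
      have h2 : t ∈ Submodule.span Γ(X, U) (Set.range e) := by
        rw [he]; trivial
      obtain ⟨c, rfl⟩ := (mem_span_range_iff _ _).mp h2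
      exact (mem_span_range_iff _ _).mpr ⟨c, by simp only [map_sum, map_smul]⟩
    have h2 := rs_mem_span (fun i ↦ η U (e i)) le_rfl (X.basicOpen_le f) h1
    rw [← η_res, ht, map_smul, η_res, ht', rs_rs] at h2
    have hu : IsUnit (rO (X.basicOpen_le f) f ^ k) := (isUnit_rO_basicOpen f le_rfl).pow k
    exact (Submodule.smul_mem_iff_of_isUnit _ hu).mp h2
  · intro j
    have h1 : r j ∈ LinearMap.ker p := hr ▸ Submodule.subset_span ⟨j, rfl⟩
    have h2 : ∑ i, r j i • e i = 0 := by
      simpa [p, Fintype.linearCombination_apply] using h1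
    have h3 := congrArg (η U) h2
    simpa only [map_sum, map_smul, map_zero] using h3
  · intro V hVU a ha x hx
    have h0 : η V (∑ i, a i • res hVU (e i)) = 0 := by
      simpa only [map_sum, map_smul, η_res] using ha
    obtain ⟨V', hV', hxV', h0'⟩ := hinj V _ h0 x hx
    obtain ⟨f, hfV', hxf⟩ := exists_basicOpen_le hU (hVU hx) hxV'
    have hfV := hfV'.trans hV'
    refine ⟨X.basicOpen f, hfV, hxf, ?_⟩
    obtain ⟨k, b, hb⟩ := exists_extend_functions hU f (fun i ↦ rO hfV (a i))
    obtain ⟨l, hl⟩ := hpow U hU f (∑ i, b i • e i) (by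
      have h1 := congrArg (res hfV') h0'
      simp only [map_sum, res_smul, res_res, map_zero, rO_rO] at h1
      simp only [map_sum, res_smul, hb, mul_smul, ← Finset.smul_sum, h1, smul_zero])
    -- after multiplication by `f ^ (l + k)`, the relation `a` comes from a relation over `U`
    have hk : (fun i ↦ f ^ l * b i) ∈ LinearMap.ker p := by
      simpa [p, Fintype.linearCombination_apply, Finset.smul_sum, mul_smul] using hl
    rw [← hr] at hk
    obtain ⟨c, hc⟩ := (mem_span_range_iff _ _).mp hk
    have hu : IsUnit (rO (X.basicOpen_le f) f ^ (l + k)) := (isUnit_rO_basicOpen f le_rfl).pow _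
    refine (Submodule.smul_mem_iff_of_isUnit _ hu).mp ((mem_span_range_iff _ _).mpr
      ⟨fun j ↦ rO (X.basicOpen_le f) (c j), ?_⟩)
    funext i
    have h1 := congrArg (rO (X.basicOpen_le f)) (congrFun hc i)
    simp only [Finset.sum_apply, Pi.smul_apply, smul_eq_mul, map_sum, map_mul, hb, map_pow] at h1 ⊢
    rw [h1, pow_add, mul_assoc]

end Sheafification

/-! ### Coherence of the sheaf of differentials -/

section Cotangent
variable {A : Scheme.{0}} (g : A ⟶ Spec (.of ℂ))

instance (U : A.Opens) : Module Γ(A, U) ((cotangentPresheaf g).obj (op U)) :=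
  inferInstanceAs (Module (A.ringCatSheaf.obj.obj (op U)) ((cotangentPresheaf g).obj (op U)))

/-- The restriction maps of `U ↦ Ω_{O_A(U)/ℂ}`. -/
def cotangentRes {U V : A.Opens} (h : V ≤ U) :
    (cotangentPresheaf g).obj (op U) →+ (cotangentPresheaf g).obj (op V) :=
  ((cotangentPresheaf g).presheaf.map (homOfLE h).op).hom

lemma cotangentRes_smul {U V : A.Opens} (h : V ≤ U) (r : Γ(A, U))
    (s : (cotangentPresheaf g).obj (op U)) :
    cotangentRes g h (r • s) = rO h r • cotangentRes g h s :=
  (cotangentPresheaf g).map_smul (homOfLE h).op r s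

lemma cotangentRes_cotangentRes {U V W : A.Opens} (h : V ≤ U) (h' : W ≤ V)
    (s : (cotangentPresheaf g).obj (op U)) :
    cotangentRes g h' (cotangentRes g h s) = cotangentRes g (h'.trans h) s :=
  (CategoryTheory.congr_fun ((cotangentPresheaf g).presheaf.map_comp
    (homOfLE h).op (homOfLE h').op) s).symm

/-- The sheafification map on sections. -/
def toCotangent (U : A.Opens) :
    (cotangentPresheaf g).obj (op U) →ₗ[Γ(A, U)] Γ(cotangentSheaf g, U) :=
  ((toCotangentSheaf g).app (op U)).hom

lemma toCotangent_res {U V : A.Opens} (h : V ≤ U) (s : (cotangentPresheaf g).obj (op U)) :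
    toCotangent g V (cotangentRes g h s) = rs (cotangentSheaf g) h (toCotangent g U s) :=
  PresheafOfModules.naturality_apply (toCotangentSheaf g) (homOfLE h).op s

lemma toCotangent_locSurj (U : A.Opens) (s : Γ(cotangentSheaf g, U)) (x : A) (hx : x ∈ U) :
    ∃ (V : A.Opens) (h : V ≤ U), x ∈ V ∧ ∃ t, toCotangent g V t = rs (cotangentSheaf g) h s := by
  have h1 : Presheaf.IsLocallySurjective (Opens.grothendieckTopology A)
      (CategoryTheory.toSheafify (Opens.grothendieckTopology A) (cotangentPresheaf g).presheaf) :=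
    inferInstance
  obtain ⟨V, i, ⟨t, ht⟩, hxV⟩ := h1.imageSieve_mem (U := U) s x hx
  exact ⟨V, leOfHom i, hxV, t, ht⟩

lemma toCotangent_locInj (U : A.Opens) (t : (cotangentPresheaf g).obj (op U))
    (ht : toCotangent g U t = 0) (x : A) (hx : x ∈ U) :
    ∃ (V : A.Opens) (h : V ≤ U), x ∈ V ∧ cotangentRes g h t = 0 := by
  have h1 : Presheaf.IsLocallyInjective (Opens.grothendieckTopology A)
      (CategoryTheory.toSheafify (Opens.grothendieckTopology A) (cotangentPresheaf g).presheaf) :=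
    inferInstance
  obtain ⟨V, i, hi, hxV⟩ := h1.equalizerSieve_mem (X := op U) t 0
    (ht.trans (map_zero (toCotangent g U)).symm) x hx
  exact ⟨V, leOfHom i, hxV, hi.trans (map_zero (cotangentRes g (leOfHom i)))⟩

/-- Kähler differentials commute with localization. -/
lemma isLocalizedModule_cotangentRes {U : A.Opens} (hU : IsAffineOpen U) (f : Γ(A, U)) :
    (∀ s : (cotangentPresheaf g).obj (op (A.basicOpen f)), ∃ (n : ℕ) (t : _),
      cotangentRes g (A.basicOpen_le f) t = rO (A.basicOpen_le f) f ^ n • s) ∧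
    ∀ t : (cotangentPresheaf g).obj (op U), cotangentRes g (A.basicOpen_le f) t = 0 →
      ∃ n : ℕ, f ^ n • t = 0 := by
  let B := Γ(A, U)
  let C := Γ(A, A.basicOpen f)
  let _ : Algebra ℂ B := ((constants g).app (op U)).hom.toAlgebra
  let _ : Algebra ℂ C := ((constants g).app (op (A.basicOpen f))).hom.toAlgebra
  let _ : Algebra B C := (rO (A.basicOpen_le f)).toAlgebra
  have : IsScalarTower ℂ B C := .of_algebraMap_eq fun z ↦
    CategoryTheory.congr_fun ((constants g).naturality (homOfLE (A.basicOpen_le f)).op) z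
  have hloc : IsLocalization.Away f C := hU.isLocalization_basicOpen f
  have h := KaehlerDifferential.isLocalizedModule_map (R := ℂ) (S := B) (T := C)
    (Submonoid.powers f)
  have hmap : ∀ t : Ω[B⁄ℂ], KaehlerDifferential.map ℂ ℂ B C t =
      cotangentRes g (A.basicOpen_le f) t :=
    fun t ↦ rfl
  constructor
  · intro s
    obtain ⟨⟨t, ⟨_, n, rfl⟩⟩, ht⟩ := h.surj (s : Ω[C⁄ℂ])
    refine ⟨n, t, ?_⟩
    rw [← map_pow]
    exact ht.symm
  · intro t ht
    obtain ⟨⟨_, n, rfl⟩, hn⟩ := h.exists_of_eq (x₁ := t) (x₂ := 0)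
      ((hmap t).trans (ht.trans (map_zero (KaehlerDifferential.map ℂ ℂ B C)).symm))
    exact ⟨n, hn.trans (smul_zero _)⟩

lemma finite_cotangent {U : A.Opens} (hU : IsAffineOpen U) [LocallyOfFiniteType g] :
    Module.Finite Γ(A, U) ((cotangentPresheaf g).obj (op U)) := by
  let _ : Algebra ℂ Γ(A, U) := ((constants g).app (op U)).hom.toAlgebra
  have : Algebra.FiniteType ℂ Γ(A, U) := by
    have h1 : ((Scheme.ΓSpecIso (.of ℂ)).inv ≫ g.appLE ⊤ U le_top).hom.FiniteType := by
      rw [CommRingCat.hom_comp]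
      exact (g.finiteType_appLE (isAffineOpen_top _) hU _).comp (RingHom.FiniteType.of_surjective _
        (ConcreteCategory.bijective_of_isIso (Scheme.ΓSpecIso (.of ℂ)).inv).2)
    exact h1
  have : Module.Finite Γ(A, U) (Ω[Γ(A, U)⁄ℂ]) := inferInstance
  exact this

lemma isCoherent_cotangentSheaf [IsLocallyNoetherian A] [LocallyOfFiniteType g] :
    IsCoherent (cotangentSheaf g) :=
  isCoherent_of_locally_bijective (fun U ↦ (cotangentPresheaf g).obj (op U)) (cotangentRes g)
    (cotangentRes_smul g) (cotangentRes_cotangentRes g) (toCotangent g) (toCotangent_res g)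
    (toCotangent_locSurj g) (toCotangent_locInj g) (fun _ hU ↦ finite_cotangent g hU)
    (fun _ hU f ↦ (isLocalizedModule_cotangentRes g hU f).1)
    (fun _ hU f ↦ (isLocalizedModule_cotangentRes g hU f).2)

end Cotangent

/-! ### The truncated cotangent complex and resolutions by vector bundles -/

lemma isZero_truncatedCotangent {M A : Scheme.{0}} (g : A ⟶ Spec (.of ℂ)) (i : M ⟶ A) (n : ℤ)
    (hn : n < -1 ∨ 0 < n) : IsZero ((truncatedCotangent g i).X n) :=
  HomologicalComplex.isZero_double_X _ _ _ (by omega) (by omega)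

lemma boundedCoherent_truncatedCotangent {M A : Scheme.{0}} (g : A ⟶ Spec (.of ℂ)) (i : M ⟶ A)
    [LocallyOfFiniteType g] [IsAffineHom i] : boundedCoherent M (truncatedCotangent g i) := by
  have : IsLocallyNoetherian A := LocallyOfFiniteType.isLocallyNoetherian g
  refine ⟨⟨-1, 0, isZero_truncatedCotangent g i⟩, fun n ↦ ?_⟩
  obtain rfl | rfl | hn : n = -1 ∨ n = 0 ∨ (n < -1 ∨ 0 < n) := by omega
  · exact ((isCoherent_idealSheaf i).pullback i).of_iso (HomologicalComplex.doubleXIso₀ _ _).symm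
  · exact ((isCoherent_cotangentSheaf g).pullback i).of_iso
      (HomologicalComplex.doubleXIso₁ _ _ (by decide)).symm
  · exact (SelfDualData.isVectorBundle_zero (isZero_truncatedCotangent g i n hn)).isCoherent

/-- If coherent sheaves are quotients of vector bundles, then perfect objects have bounded
resolutions by vector bundles. -/
lemma nonempty_bundleResolution {X : Scheme.{u}} [IsLocallyNoetherian X] (hX : HasEnoughBundles X)
    {𝔼 : DCoh X} (h𝔼 : IsPerfectOfAmplitude 𝔼) : Nonempty (BundleResolution 𝔼) := by
  obtain ⟨K, ⟨e⟩, hK⟩ := h𝔼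
  have hP : IsLocallyPerfect K.obj := ⟨-2, 0, hK⟩
  obtain ⟨C, t, ht, hC⟩ := exists_bundle_resolution hX K.property K.property.2 (𝟙 K.obj) hP
  let P : BundleComplex X := ⟨C, hC⟩
  let t' : toCoh P ⟶ K := ObjectProperty.homMk t
  exact ⟨P, @asIso _ _ _ _ ((Q X).map t') (isIso_Q_map t' ht) ≪≫ e⟩

lemma exists_zero_cohComplex (X : Scheme.{u}) : ∃ L : CohComplex X, ∀ n, IsZero (L.obj.X n) := by
  have h : ∀ n, IsZero ((HomologicalComplex.zero (V := X.Modules) (c := ComplexShape.up ℤ)).X n) :=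
    fun n ↦ isZero_zero _
  exact ⟨⟨_, ⟨0, 0, fun n _ ↦ h n⟩, fun n ↦ (SelfDualData.isVectorBundle_zero (h n)).isCoherent⟩, h⟩

end DT4

end

open CategoryTheory AlgebraicGeometry DT4
theorem mainTheorem12 (M : Scheme.{0})
    (f : M ⟶ Spec (.of ℂ)) (hf : IsQuasiProjective f)
    (𝔼 : DCoh M) (h𝔼 : IsPerfectOfAmplitude 𝔼) :
    Nonempty (BundleResolution 𝔼) ∧
    ∀ (R : BundleResolution 𝔼) (θ : 𝔼 ≅ R.dualTwo), R.IsSymmetric θ.hom →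
      (∃ (S : SelfDualData M) (α : (QB M).obj S.cx ≅ 𝔼),
        Intertwines R θ.hom S α) ∧
      ∀ (A : Scheme.{0}) (g : A ⟶ Spec (.of ℂ)) (i : M ⟶ A),
        Smooth g → IsClosedImmersion i → i ≫ g = f →
        ∃ hL : boundedCoherent M (truncatedCotangent g i),
        ∀ At : 𝔼 ⟶ (Q M).obj ⟨truncatedCotangent g i, hL⟩, IsObstructionTheory At →
          ∃ (S : SelfDualData M) (α : (QB M).obj S.cx ≅ 𝔼),
            Intertwines R θ.hom S α ∧
            ∃ u : S.cx.obj ⟶ truncatedCotangent g i,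
              α.hom ≫ At = ofMap (L := ⟨truncatedCotangent g i, hL⟩) u ∧ ∀ n : ℤ, Epi (u.f n) := by
  have hM : IsLocallyNoetherian M := hf.isLocallyNoetherian
  obtain ⟨D⟩ := hf.nonempty_ampleData
  have hX : HasEnoughBundles M := D.hasEnoughBundles
  obtain ⟨r, hr⟩ := exists_add_self_eq_one f
  refine ⟨nonempty_bundleResolution hX h𝔼, fun R θ hθ ↦ ⟨?_, fun A g i hg hi _ ↦ ?_⟩⟩
  · obtain ⟨L, hL⟩ := exists_zero_cohComplex M
    have h0 : Limits.IsZero ((cohomology M 0).obj ((Q M).obj L)) :=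
      isZero_cohomology (exactAt_of_isZero (hL 0))
    obtain ⟨S, α, hα, -⟩ := exists_selfDual_representative hX r hr h𝔼 R θ hθ L (fun n _ ↦ hL n)
      (R.iso.inv ≫ ofMap (0 : R.P.obj ⟶ L.obj)) (h0.epi _)
    exact ⟨S, α, hα⟩
  · refine ⟨boundedCoherent_truncatedCotangent g i, fun At hAt ↦ ?_⟩
    exact exists_selfDual_representative hX r hr h𝔼 R θ hθ ⟨_, _⟩
      (isZero_truncatedCotangent g i) At (@IsIso.epi_of_iso _ _ _ _ _ hAt.1)
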